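/- \textbf{Setting.} Let $\mathbb K$ be a field of characteristic $0$ and $N\ge 0$ an integer; write $\overline n$ for $n \bmod 2$ and $p(\cdot)$ for the parity in a linear superspace (formulas involving $p(x)$ are stated for homogeneous $x$ and extended linearly). A \emph{supervariable} is $\Lambda=(\lambda,\theta^1,\dots,\theta^N)$ with $\lambda$ even and the $\theta^i$ odd; $\mathbb K[\Lambda_a]_{a\in A}$ is the free commutative superalgebra on supervariables $\Lambda_a$, and $V[\Lambda_a]_{a\in A}=\mathbb K[\Lambda_a]_{a\in A}\otimes V$. Let $\mathcal H_W$ be the free commutative superalgebra generated by an even $T$ and odd $S^1,\dots,S^N$, and let $(V,\nabla)$, $\nabla=(T,S^1,\dots,S^N)$, be an $\mathcal H_W$-supermodule. The superspace $\Pi^{N+1}V$ is $V$ with the parity shifted by $\overline{N+1}$, with the same operators $T,S^i$. Put $V_\nabla[\Lambda_k]_{k=1}^n=\mathbb K[\Lambda_k]_{k=1}^n\otimes_{\mathcal H_W}V$, where $T$ and $S^i$ act on $\mathbb K[\Lambda_k]_{k=1}^n$ as multiplication by $-\sum_k\lambda_k$ and $-\sum_k\theta^i_k$. For $n\ge1$,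 eliminating $\Lambda_n=-\Lambda_1-\dots-\Lambda_{n-1}-\nabla$ identifies it with $V[\Lambda_k]_{k=1}^{n-1}$; for $n=2$ the image of $f$ in $V[\Lambda]$ is written $f_{\Lambda,-\Lambda-\nabla}$. \textbf{SUSY Poisson vertex algebras.} A \emph{non-unital $N_W=N$ SUSY Poisson vertex algebra structure} on $(V,\nabla)$ is a pair of a linear map $\{\cdot_\Lambda\cdot\}\colon V\otimes V\to V[\Lambda]$ of parity $\overline N$ and an even linear map $\mu\colon V\otimes V\to V$, $ab=\mu(a\otimes b)$, such that for all $a,b,c\in V$ and $1\le i\le N$: (1) $\{Ta_\Lambda b\}=-\lambda\{a_\Lambda b\}$, $\{a_\Lambda Tb\}=(\lambda+T)\{a_\Lambda b\}$, $\{S^ia_\Lambda b\}=-(-1)^N\theta^i\{a_\Lambda b\}$, $\{a_\Lambda S^ib\}=(-1)^{p(a)+\overline N}(\theta^i+S^i)\{a_\Lambda b\}$; (2) $\{b_\Lambda a\}=-(-1)^{p(a)p(b)+\overline N}\{a_{-\Lambda-\nabla}b\}$; (3) $\{a_{\Lambda_1}\{b_{\Lambda_2}c\}\}=(-1)^{(p(a)+\overline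 N)\overline N}\{\{a_{\Lambda_1}b\}_{\Lambda_1+\Lambda_2}c\}+(-1)^{(p(a)+\overline N)(p(b)+\overline N)}\{b_{\Lambda_2}\{a_{\Lambda_1}c\}\}$; (4) $T(ab)=(Ta)b+a(Tb)$ and $S^i(ab)=(S^ia)b+(-1)^{p(a)}a(S^ib)$; (5) $ba=(-1)^{p(a)p(b)}ab$ and $(ab)c=a(bc)$; (6) $\{a_\Lambda bc\}=\{a_\Lambda b\}c+(-1)^{(p(a)+\overline N)p(b)}b\{a_\Lambda c\}$. Here brackets are extended to coefficients in $\mathbb K[\Lambda_1,\Lambda_2]$ by the Koszul sign rule, the bracket having parity $\overline N$ and standing to the left of its arguments. \textbf{Quivers.} Let $\mathcal Q(n)$ be the set of quivers with vertex set $[n]=\{1,\dots,n\}$ and without loops. A cycle in the underlying graph is a closed walk of positive length that repeats no edge (two parallel or opposite edges form a cycle). For $\sigma\in\mathfrak S_n$, $\sigma Q$ is obtained from $Q$ by applying $\sigma$ to the sources and targets. For a decomposition $\nu$, $n=n_1+\dots+n_m$ with $n_j\ge1$, of $[n]$ into consecutive blocks of sizes $n_1,\dots,n_m$, let $\Delta^\nu_j(Q)$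 be the quiver of the edges of $Q$ inside the $j$-th block and $\Delta^\nu_0(Q)\in\mathcal Q(m)$ the quiver of the edges between different blocks, with each block contracted to a vertex. A block $i$ is \emph{externally connected} to $k\in[n]$ if the underlying graph of $\Delta_0^\nu(Q)$ has a walk from $i$ to the block of $k$ that repeats no edge and contains an edge which, as an edge of $Q$, has $k$ as an end point; $\mathcal E(k)$ denotes the set of these $i$. \textbf{The operad.} For an $\mathcal H_W$-supermodule $V$, $P^{\mathrm{cl}}_W(V)(n)$ is the superspace of linear maps $X\colon V^{\otimes n}\otimes\mathbb K\mathcal Q(n)\to V_\nabla[\Lambda_k]_{k=1}^n$, written $X^Q=X(-\otimes Q)$, such that for each $Q\in\mathcal Q(n)$: (a) $X^Q=0$ if the underlying graph of $Q$ contains a cycle; (b) $\sum_{q=1}^rX^{Q\setminus\alpha_q}=0$ for every directed cycle $(\alpha_1,\dots,\alpha_r)$ (with distinct edges) of $Q$; (c) for each connected component $I$ of $Q$ and $v\in V^{\otimes n}$, $(\partial_{\lambda_k}-\partial_{\lambda_l})X^Q(v)=0$ for $k,l\in I$, and $\sum_{k\in I}X^Q(T^{(k)}v)=-\sum_{k\in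 I}\lambda_kX^Q(v)$; (d) $X^Q((S^i)^{(k)}v)=-(-1)^{p(X)}\theta^i_kX^Q(v)$ for $k\in[n]$ and $1\le i\le N$. Here $\varphi^{(k)}$ is $\varphi$ acting on the $k$-th tensor factor, with Koszul signs. The group $\mathfrak S_n$ acts from the right by $X^\sigma(v_1\otimes\dots\otimes v_n\otimes Q)=\pm X^{\sigma Q}_{\Lambda_{\sigma^{-1}(1)},\dots,\Lambda_{\sigma^{-1}(n)}}(v_{\sigma^{-1}(1)}\otimes\dots\otimes v_{\sigma^{-1}(n)})$, $\pm$ being the Koszul sign of the permutation of the $v_k$. The composition $X\circ(Y_1\odot\dots\odot Y_m)$ of $X\in P^{\mathrm{cl}}_W(V)(m)$ with $Y_j\in P^{\mathrm{cl}}_W(V)(n_j)$ is computed on $v_1\otimes\dots\otimes v_n\otimes Q$ as follows. Let $w_j$ be the tensor product of the $v_k$ with $k$ in the $j$-th block. Write $Y_j^{\Delta^\nu_j(Q)}(w_j)$, in the variables of the $j$-th block with the last one eliminated as above, as a sum of terms $a_ju_j$ with $u_j\in V$ and $a_j$ a polynomial. In $a_1\cdots a_m$ replace each $\Lambda_k$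 by $\Lambda_k+\sum_{i\in\mathcal E(k)}(\Lambda_i'+\nabla^{(i)})$, where $\Lambda'_i$ is the sum of the $\Lambda_k$ with $k$ in the $i$-th block, with every $\nabla^{(i)}$ moved to the right, and let these $\nabla^{(i)}$ act on $u_1\otimes\dots\otimes u_m$. To the result, a sum of terms $b\,(u'_1\otimes\dots\otimes u'_m)$ with $b\in\mathbb K[\Lambda_k]_{k=1}^n$, apply $b\,(u'_1\otimes\dots\otimes u'_m)\mapsto(-1)^{p(X)p(b)}b\,X^{\Delta_0^\nu(Q)}_{\Lambda_1',\dots,\Lambda'_m}(u'_1\otimes\dots\otimes u'_m)$. The total sign in front is $\prod_{i<j}(-1)^{p(w_i)p(Y_j)}\prod_{i<j}(-1)^{p(u_i)p(a_j)}$. \textbf{Maurer--Cartan elements.} For $f\in P(n+1)$, $g\in P(m+1)$, where $P=P^{\mathrm{cl}}_W(V)$, put $f\,\square\,g=\sum_\sigma\bigl(f\circ(g\odot\mathrm{id}_V\odot\dots\odot\mathrm{id}_V)\bigr)^{\sigma^{-1}}$, the sum being over all $\sigma\in\mathfrak S_{n+m+1}$ that are increasing on $\{1,\dots,m+1\}$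 and on $\{m+2,\dots,m+n+1\}$; $\mathrm{id}_V\in P(1)$ is $v\mapsto 1\otimes v$. Let $$\mathrm{MC}(L(P))_{\overline 1}=\{X\in P(2)\ \text{odd}\mid X^\sigma=X\ \text{for all}\ \sigma\in\mathfrak S_2,\ X\,\square\,X=0\}.$$ \textbf{Theorem.} Let $(V,\nabla)$ be an $\mathcal H_W$-supermodule with parity $p$. (1) For $X\in\mathrm{MC}\bigl(L(P^{\mathrm{cl}}_W(\Pi^{N+1}V))\bigr)_{\overline 1}$ define, for $a,b\in V$, $$\{a_\Lambda b\}_X=(-1)^{p(a)(\overline N+\overline 1)}X^{\bullet\ \bullet}_{\Lambda,-\Lambda-\nabla}(a\otimes b),\qquad \mu_X(a\otimes b)=(-1)^{p(a)(\overline N+\overline 1)}\operatorname{Res}_\Lambda\bigl(\lambda^{-1}X^{\bullet\to\bullet}_{\Lambda,-\Lambda-\nabla}(a\otimes b)\bigr),$$ where $\bullet\ \bullet$ is the quiver with vertices $1,2$ and no edge, $\bullet\to\bullet$ is the quiver with one edge, from $1$ to $2$, and $\operatorname{Res}_\Lambda(\lambda^{-1}\lambda^m\theta^{i_1}\cdots\theta^{i_r}v)$,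 for $i_1<\dots<i_r$, is $v$ if $m=0$ and $r=N$, and $0$ otherwise. Then $(\{\cdot_\Lambda\cdot\}_X,\mu_X)$ is a non-unital $N_W=N$ SUSY Poisson vertex algebra structure on $(V,\nabla)$. (2) The map $X\mapsto(\{\cdot_\Lambda\cdot\}_X,\mu_X)$ is a bijection from $\mathrm{MC}\bigl(L(P^{\mathrm{cl}}_W(\Pi^{N+1}V))\bigr)_{\overline 1}$ onto the set of all non-unital $N_W=N$ SUSY Poisson vertex algebra structures on $(V,\nabla)$. -/

import Mathlib

open scoped TensorProduct

noncomputable section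

namespace SUSY

/-! ## Signs, superpolynomials -/

/-- The sign `(-1)^p` of a parity `p`. -/
def ksign (p : ZMod 2) : ℤ := if p = 0 then 1 else -1

/-- Families of even elements `l a` and odd elements `t a i` of a `K`-algebra which satisfy the
relations of a free commutative superalgebra. -/
structure SuperCommute {N : ℕ} {J B : Type*} [Ring B] (l : J → B) (t : J → Fin N → B) : Prop where
  ll : ∀ a b, l a * l b = l b * l a
  lt : ∀ a b i, l a * t b i = t b i * l a
  tt : ∀ a b i j, t a i * t b j = -(t b j * t a i)

/-- The defining relations of the polynomial superalgebra: the generator `Sum.inl a` is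
`λ_a`, the generator `Sum.inr (a, i)` is `θ_a^i`. -/
inductive PolyRel (K : Type*) [Field K] (N : ℕ) (ι : Type) :
    FreeAlgebra K (ι ⊕ ι × Fin N) → FreeAlgebra K (ι ⊕ ι × Fin N) → Prop
  | ll (a b : ι) : PolyRel K N ι
      (FreeAlgebra.ι K (Sum.inl a) * FreeAlgebra.ι K (Sum.inl b))
      (FreeAlgebra.ι K (Sum.inl b) * FreeAlgebra.ι K (Sum.inl a))
  | lt (a b : ι) (i : Fin N) : PolyRel K N ι
      (FreeAlgebra.ι K (Sum.inl a) * FreeAlgebra.ι K (Sum.inr (b, i)))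
      (FreeAlgebra.ι K (Sum.inr (b, i)) * FreeAlgebra.ι K (Sum.inl a))
  | tt (a b : ι) (i j : Fin N) : PolyRel K N ι
      (FreeAlgebra.ι K (Sum.inr (a, i)) * FreeAlgebra.ι K (Sum.inr (b, j)))
      (-(FreeAlgebra.ι K (Sum.inr (b, j)) * FreeAlgebra.ι K (Sum.inr (a, i))))

/-- The polynomial superalgebra `K[Λ_a]_{a ∈ ι}` in the `(1|N)`-supervariables
`Λ_a = (λ_a, θ_a^1, …, θ_a^N)`. -/
def SuperPoly (K : Type*) [Field K] (N : ℕ) (ι : Type) : Type _ := RingQuot (PolyRel K N ι)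

instance (K : Type*) [Field K] (N : ℕ) (ι : Type) : Ring (SuperPoly K N ι) :=
  inferInstanceAs (Ring (RingQuot (PolyRel K N ι)))

instance (K : Type*) [Field K] (N : ℕ) (ι : Type) : Algebra K (SuperPoly K N ι) :=
  inferInstanceAs (Algebra K (RingQuot (PolyRel K N ι)))

namespace SuperPoly

variable {K : Type*} [Field K] {N : ℕ} {ι κ : Type}

/-- The even generator `λ_a`. -/
def lam (a : ι) : SuperPoly K N ι :=
  RingQuot.mkAlgHom K (PolyRel K N ι) (FreeAlgebra.ι K (Sum.inl a))

/-- The odd generator `θ_a^i`. -/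
def th (a : ι) (i : Fin N) : SuperPoly K N ι :=
  RingQuot.mkAlgHom K (PolyRel K N ι) (FreeAlgebra.ι K (Sum.inr (a, i)))

theorem superCommute_gen :
    SuperCommute (lam : ι → SuperPoly K N ι) (th : ι → Fin N → SuperPoly K N ι) where
  ll a b := by
    have := RingQuot.mkAlgHom_rel K (PolyRel.ll (K := K) (N := N) a b)
    rwa [map_mul, map_mul] at this
  lt a b i := by
    have := RingQuot.mkAlgHom_rel K (PolyRel.lt (K := K) (N := N) a b i)
    rwa [map_mul, map_mul] at this
  tt a b i j := by
    have := RingQuot.mkAlgHom_rel K (PolyRel.tt (K := K) (N := N) a b i j)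
    rwa [map_neg, map_mul, map_mul] at this

/-- The algebra morphism that substitutes `l a` for `λ_a` and `t a i` for `θ_a^i`. -/
def lift {B : Type*} [Ring B] [Algebra K B] (l : ι → B) (t : ι → Fin N → B)
    (h : SuperCommute l t) : SuperPoly K N ι →ₐ[K] B :=
  RingQuot.liftAlgHom K
    ⟨FreeAlgebra.lift K (Sum.elim l (fun x => t x.1 x.2)), by
      rintro _ _ (⟨a, b⟩ | ⟨a, b, i⟩ | ⟨a, b, i, j⟩)
      · simpa using h.ll a b
      · simpa using h.lt a b i
      · simpa using h.tt a b i j⟩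

@[simp] theorem lift_lam {B : Type*} [Ring B] [Algebra K B] (l : ι → B) (t : ι → Fin N → B)
    (h : SuperCommute l t) (a : ι) : lift (K := K) l t h (lam a) = l a := by
  unfold lift lam
  erw [RingQuot.liftAlgHom_mkAlgHom_apply]
  simp

@[simp] theorem lift_th {B : Type*} [Ring B] [Algebra K B] (l : ι → B) (t : ι → Fin N → B)
    (h : SuperCommute l t) (a : ι) (i : Fin N) : lift (K := K) l t h (th a i) = t a i := by
  unfold lift th
  erw [RingQuot.liftAlgHom_mkAlgHom_apply]
  simp

theorem superCommute_sum [Fintype κ] {B : Type*} [Ring B] {l : κ → B} {t : κ → Fin N → B}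
    (h : SuperCommute l t) (c : ι → κ → ℤ) :
    SuperCommute (fun a => ∑ k, c a k • l k) (fun a i => ∑ k, c a k • t k i) where
  ll a b := by
    simp only [Finset.sum_mul_sum, smul_mul_smul_comm]
    rw [Finset.sum_comm]
    simp only [h.ll, mul_comm]
  lt a b i := by
    simp only [Finset.sum_mul_sum, smul_mul_smul_comm]
    rw [Finset.sum_comm]
    simp only [h.lt, mul_comm]
  tt a b i j := by
    simp only [Finset.sum_mul_sum, smul_mul_smul_comm]
    rw [Finset.sum_comm, ← Finset.sum_neg_distrib]
    refine Finset.sum_congr rfl fun x _ => ?_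
    rw [← Finset.sum_neg_distrib]
    refine Finset.sum_congr rfl fun y _ => ?_
    rw [h.tt, smul_neg, mul_comm]

/-- The substitution `Λ_a ↦ ∑_k c a k Λ_k` (in all `1|N` components) with integer coefficients. -/
def linSubst [Fintype κ] (c : ι → κ → ℤ) : SuperPoly K N ι →ₐ[K] SuperPoly K N κ :=
  lift _ _ (superCommute_sum superCommute_gen c)

/-- The parity involution: `λ_a ↦ λ_a`, `θ_a^i ↦ -θ_a^i`. On an element `a` of parity `p(a)` it is
multiplication by `(-1)^{p(a)}`. -/
def involute : SuperPoly K N ι →ₐ[K] SuperPoly K N ι :=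
  lift lam (fun a i => -th a i)
    { ll := superCommute_gen.ll
      lt := fun a b i => by rw [mul_neg, neg_mul, superCommute_gen.lt]
      tt := fun a b i j => by rw [neg_mul_neg, neg_mul_neg, superCommute_gen.tt] }

/-- `a ↦ (-1)^{p · p(a)} a`. -/
def signBy (p : ZMod 2) : SuperPoly K N ι →ₗ[K] SuperPoly K N ι :=
  if p = 0 then LinearMap.id else involute.toLinearMap

/-- The homogeneous part of parity `p` of the polynomial superalgebra. -/
def parity (p : ZMod 2) : Submodule K (SuperPoly K N ι) where
  carrier := {a | involute a = ksign p • a}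
  add_mem' := by
    intro a b ha hb
    simp only [Set.mem_ofPred_eq] at *
    rw [map_add, ha, hb, smul_add]
  zero_mem' := by simp
  smul_mem' := by
    intro c a ha
    simp only [Set.mem_ofPred_eq] at *
    rw [map_smul, ha, smul_comm]

/-- The projection to the homogeneous part of parity `p`. -/
def projParity (p : ZMod 2) : SuperPoly K N ι →ₗ[K] SuperPoly K N ι :=
  (2 : K)⁻¹ • (LinearMap.id + ksign p • involute.toLinearMap)

/-- The algebra morphism `a ↦ a + ε ∂a/∂λ_k` to the dual numbers. -/
def dlamHom [DecidableEq ι] (k : ι) : SuperPoly K N ι →ₐ[K] DualNumber (SuperPoly K N ι) :=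
  lift (fun a => TrivSqZeroExt.inl (lam a) + TrivSqZeroExt.inr (if a = k then 1 else 0))
    (fun a i => TrivSqZeroExt.inl (th a i))
    { ll := fun a b => by
        ext
        · simp only [TrivSqZeroExt.fst_mul, TrivSqZeroExt.fst_add, TrivSqZeroExt.fst_inl,
            TrivSqZeroExt.fst_inr, add_zero, superCommute_gen.ll]
        · simp only [TrivSqZeroExt.snd_mul, TrivSqZeroExt.fst_add, TrivSqZeroExt.snd_add,
            TrivSqZeroExt.fst_inl, TrivSqZeroExt.fst_inr, TrivSqZeroExt.snd_inl,
            TrivSqZeroExt.snd_inr]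
          split_ifs <;> simp [add_comm]
      lt := fun a b i => by
        ext
        · simp only [TrivSqZeroExt.fst_mul, TrivSqZeroExt.fst_add, TrivSqZeroExt.fst_inl,
            TrivSqZeroExt.fst_inr, add_zero, superCommute_gen.lt]
        · simp only [TrivSqZeroExt.snd_mul, TrivSqZeroExt.fst_add, TrivSqZeroExt.snd_add,
            TrivSqZeroExt.fst_inl, TrivSqZeroExt.fst_inr, TrivSqZeroExt.snd_inl,
            TrivSqZeroExt.snd_inr]
          split_ifs <;> simp
      tt := fun a b i j => by
        ext
        · simpa using superCommute_gen.tt a b i j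
        · simp }

/-- The partial derivative `∂/∂λ_k`. -/
def dlam [DecidableEq ι] (k : ι) : SuperPoly K N ι →ₗ[K] SuperPoly K N ι where
  toFun a := (dlamHom k a).snd
  map_add' a b := by simp
  map_smul' c a := by simp

theorem hom_ext {B : Type*} [Ring B] [Algebra K B] {f g : SuperPoly K N ι →ₐ[K] B}
    (hl : ∀ a, f (lam a) = g (lam a)) (ht : ∀ a i, f (th a i) = g (th a i)) : f = g := by
  refine RingQuot.ringQuot_ext' K f g (FreeAlgebra.hom_ext (funext fun x => ?_))
  rcases x with a | ⟨a, i⟩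
  · exact hl a
  · exact ht a i

theorem fst_dlamHom [DecidableEq ι] (k : ι) (x : SuperPoly K N ι) : (dlamHom k x).fst = x := by
  have : (TrivSqZeroExt.fstHom K (SuperPoly K N ι) (SuperPoly K N ι)).comp (dlamHom k) =
      AlgHom.id K _ := by
    refine hom_ext (fun a => ?_) (fun a i => ?_)
    · simp only [dlamHom, AlgHom.comp_apply, lift_lam, TrivSqZeroExt.fstHom_apply,
        TrivSqZeroExt.fst_add, TrivSqZeroExt.fst_inl, TrivSqZeroExt.fst_inr, add_zero,
        AlgHom.coe_id, id]
    · simp only [dlamHom, AlgHom.comp_apply, lift_th, TrivSqZeroExt.fstHom_apply,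
        TrivSqZeroExt.fst_inl, AlgHom.coe_id, id]
  exact DFunLike.congr_fun this x

theorem dlam_mul [DecidableEq ι] (k : ι) (a b : SuperPoly K N ι) :
    dlam k (a * b) = dlam k a * b + a * dlam k b := by
  simp only [dlam, LinearMap.coe_mk, AddHom.coe_mk, map_mul, TrivSqZeroExt.snd_mul, fst_dlamHom]
  simp [add_comm]

theorem dlam_one [DecidableEq ι] (k : ι) : dlam k (1 : SuperPoly K N ι) = 0 := by
  simp only [dlam, LinearMap.coe_mk, AddHom.coe_mk, map_one, TrivSqZeroExt.snd_one]

theorem dlam_lam [DecidableEq ι] (k a : ι) :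
    dlam k (lam a : SuperPoly K N ι) = if a = k then 1 else 0 := by
  simp only [dlam, LinearMap.coe_mk, AddHom.coe_mk, dlamHom, lift_lam, TrivSqZeroExt.snd_add,
    TrivSqZeroExt.snd_inl, TrivSqZeroExt.snd_inr, zero_add]

theorem dlam_th [DecidableEq ι] (k a : ι) (i : Fin N) :
    dlam k (th a i : SuperPoly K N ι) = 0 := by
  simp only [dlam, LinearMap.coe_mk, AddHom.coe_mk, dlamHom, lift_th, TrivSqZeroExt.snd_inl]

/-- The image of `a` under `K[Λ] → K[θ^1, …, θ^N]`, `λ ↦ 0`, as an element of the exterior algebra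
of the standard `N`-dimensional space. -/
def toExterior : SuperPoly K N Unit →ₐ[K] ExteriorAlgebra K (Fin N → K) :=
  lift (fun _ => 0) (fun _ i => ExteriorAlgebra.ι K (Pi.single i 1))
    { ll := by simp
      lt := by simp
      tt := fun _ _ i j => by
        rw [eq_neg_iff_add_eq_zero]
        exact ExteriorAlgebra.ι_add_mul_swap _ _ }

/-- The functional `a ↦ Res_Λ(λ⁻¹ a)` on `K[Λ]`, i.e. `λ^m θ^I ↦ δ_{m,0} δ_{I,[N]}`: the coefficient
of `θ^1 ⋯ θ^N` in the part of `a` that is free of `λ`. -/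
def resCoeff : SuperPoly K N Unit →ₗ[K] K :=
  (ExteriorAlgebra.liftAlternating
    (Pi.single N (Pi.basisFun K (Fin N)).det :
      ∀ i : ℕ, AlternatingMap K (Fin N → K) K (Fin i))) ∘ₗ toExterior.toLinearMap

end SuperPoly

/-! ## Superspaces with a supermodule structure -/

/-- A structure of linear superspace on `V` (a `ℤ/2`-grading) with a supermodule structure
`∇ = (T, S^1, …, S^N)` over the free commutative superalgebra in even `T` and odd `S^1, …, S^N`. -/
structure HWSupermodule (K : Type*) [Field K] (N : ℕ) (V : Type*) [AddCommGroup V] [Module K V] where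
  parity : ZMod 2 → Submodule K V
  isInternal : DirectSum.IsInternal parity
  T : Module.End K V
  S : Fin N → Module.End K V
  T_mem : ∀ p v, v ∈ parity p → T v ∈ parity p
  S_mem : ∀ i p v, v ∈ parity p → S i v ∈ parity (p + 1)
  T_S : ∀ i, T * S i = S i * T
  S_S : ∀ i j, S i * S j + S j * S i = 0

section Module

variable {K : Type*} [Field K] {N : ℕ} {V : Type*} [AddCommGroup V] [Module K V]

namespace HWSupermodule

/-- Shift of the parity by `r`: for `r = n mod 2` this is `Π^n V`. The underlying linear space and
the operators `T`, `S^i` do not change. -/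
def shift (H : HWSupermodule K N V) (r : ZMod 2) : HWSupermodule K N V where
  parity p := H.parity (p + r)
  isInternal := by
    have h := (DirectSum.isInternal_submodule_iff_iSupIndep_and_iSup_eq_top _).1 H.isInternal
    rw [DirectSum.isInternal_submodule_iff_iSupIndep_and_iSup_eq_top]
    exact ⟨h.1.comp (Equiv.addRight r).injective, ((Equiv.addRight r).iSup_comp).trans h.2⟩
  T := H.T
  S := H.S
  T_mem p v hv := H.T_mem _ v hv
  S_mem i p v hv := by
    have := H.S_mem i _ v hv
    rwa [add_right_comm] at this
  T_S := H.T_S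
  S_S := H.S_S

/-- The projection of `V` to its part of parity `p`. -/
def proj (H : HWSupermodule K N V) (p : ZMod 2) : V →ₗ[K] V :=
  (H.parity p).subtype ∘ₗ DirectSum.component K (ZMod 2) (fun q => H.parity q) p ∘ₗ
    (LinearEquiv.ofBijective (DirectSum.coeLinearMap H.parity) H.isInternal).symm.toLinearMap

theorem proj_of_mem (H : HWSupermodule K N V) (p q : ZMod 2) (v : V) (hv : v ∈ H.parity q) :
    H.proj p v = if p = q then v else 0 := by
  have : (LinearEquiv.ofBijective (DirectSum.coeLinearMap H.parity) H.isInternal).symm v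
      = DirectSum.lof K (ZMod 2) (fun q => H.parity q) q ⟨v, hv⟩ := by
    rw [LinearEquiv.symm_apply_eq]
    exact (DirectSum.coeLinearMap_lof H.parity q ⟨v, hv⟩).symm
  simp only [proj, LinearMap.comp_apply, LinearEquiv.coe_coe, this]
  split_ifs with h
  · subst h
    simp [DirectSum.component.lof_self]
  · rw [DirectSum.component.of, dif_neg (fun e => h e.symm)]
    simp

/-- `v ↦ (-1)^{p · p(v)} v`. -/
def signBy (H : HWSupermodule K N V) (p : ZMod 2) : V →ₗ[K] V :=
  if p = 0 then LinearMap.id else H.proj 0 - H.proj 1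

theorem signBy_of_mem (H : HWSupermodule K N V) (p q : ZMod 2) (v : V) (hv : v ∈ H.parity q) :
    H.signBy p v = ksign (p * q) • v := by
  unfold signBy
  split_ifs with h
  · simp [h, ksign]
  · have hp : p = 1 := by revert p; decide
    subst hp
    simp only [LinearMap.sub_apply, proj_of_mem _ _ _ _ hv, ksign, one_mul]
    revert hv
    rcases (by revert q; decide : q = 0 ∨ q = 1) with rfl | rfl <;> simp

theorem ext_homogeneous (H : HWSupermodule K N V) {W : Type*} [AddCommGroup W] [Module K W]
    {f g : V →ₗ[K] W} (h : ∀ q v, v ∈ H.parity q → f v = g v) : f = g := by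
  have htop := ((DirectSum.isInternal_submodule_iff_iSupIndep_and_iSup_eq_top _).1
    H.isInternal).2
  ext v
  have hv : v ∈ ⨆ q, H.parity q := htop ▸ Submodule.mem_top
  induction hv using Submodule.iSup_induction' with
  | mem q x hx => exact h q x hx
  | zero => simp
  | add x y _ _ hx hy => rw [map_add, map_add, hx, hy]

theorem signBy_T (H : HWSupermodule K N V) (p : ZMod 2) :
    H.signBy p * H.T = H.T * H.signBy p := by
  refine H.ext_homogeneous fun q v hv => ?_
  simp only [Module.End.mul_apply]
  rw [H.signBy_of_mem p q v hv, H.signBy_of_mem p q _ (H.T_mem q v hv), map_zsmul]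

theorem signBy_one_S (H : HWSupermodule K N V) (i : Fin N) :
    H.signBy 1 * H.S i = -(H.S i * H.signBy 1) := by
  refine H.ext_homogeneous fun q v hv => ?_
  simp only [Module.End.mul_apply, LinearMap.neg_apply]
  rw [H.signBy_of_mem 1 q v hv, H.signBy_of_mem 1 (q + 1) _ (H.S_mem i q v hv), map_zsmul,
    ← neg_smul]
  congr 1
  clear hv
  revert q
  decide

/-- The tensor power `V^{⊗ m}`. -/
abbrev TPow (K : Type*) [Field K] (V : Type*) [AddCommGroup V] [Module K V] (m : ℕ) : Type _ :=
  PiTensorProduct K (fun _ : Fin m => V)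

/-- The components of `T^{(k)} = id ⊗ ⋯ ⊗ T ⊗ ⋯ ⊗ id`. -/
def Tcomp (H : HWSupermodule K N V) {ι : Type} [LinearOrder ι] (k l : ι) : Module.End K V :=
  if l = k then H.T else 1

/-- The components of `(S^i)^{(k)} = id ⊗ ⋯ ⊗ S^i ⊗ ⋯ ⊗ id`; since `S^i` is odd, this maps
`v_1 ⊗ ⋯ ⊗ v_n` to `(-1)^{p(v_1) + ⋯ + p(v_{k-1})} v_1 ⊗ ⋯ ⊗ S^i v_k ⊗ ⋯ ⊗ v_n`. -/
def Scomp (H : HWSupermodule K N V) {ι : Type} [LinearOrder ι] (k : ι) (i : Fin N) (l : ι) :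
    Module.End K V :=
  if l < k then H.signBy 1 else if l = k then H.S i else 1

/-- `T^{(k)}` on `V^{⊗ m}`. -/
def TT (H : HWSupermodule K N V) (m : ℕ) (k : Fin m) : Module.End K (TPow K V m) :=
  PiTensorProduct.map (H.Tcomp k)

/-- `(S^i)^{(k)}` on `V^{⊗ m}`. -/
def SS (H : HWSupermodule K N V) (m : ℕ) (k : Fin m) (i : Fin N) : Module.End K (TPow K V m) :=
  PiTensorProduct.map (H.Scomp k i)

theorem superCommute (H : HWSupermodule K N V) :
    SuperCommute (fun _ : Unit => H.T) (fun (_ : Unit) i => H.S i) where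
  ll _ _ := rfl
  lt _ _ i := H.T_S i
  tt _ _ i j := eq_neg_of_add_eq_zero_left (H.S_S i j)

theorem map_eq_neg {m : ℕ} (f g : Fin m → Module.End K V) (k : Fin m) (hk : f k = -g k)
    (h : ∀ l, l ≠ k → f l = g l) :
    (PiTensorProduct.map f : Module.End K (TPow K V m)) = -PiTensorProduct.map g := by
  have hf : f = Function.update g k (-g k) := by
    ext1 l
    by_cases hl : l = k
    · subst hl; simpa using hk
    · simpa [hl] using h l hl
  have := (PiTensorProduct.mapMultilinear K (fun _ : Fin m => V) (fun _ => V)).map_update_neg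
    g k (g k)
  rw [Function.update_eq_self] at this
  rw [hf]
  exact this

theorem superCommute_tensor (H : HWSupermodule K N V) (m : ℕ) :
    SuperCommute (H.TT m) (H.SS m) where
  ll a b := by
    simp only [TT, ← PiTensorProduct.map_mul]
    congr 1
    ext1 l
    simp only [Tcomp]
    split_ifs <;> simp
  lt a b i := by
    simp only [TT, SS, ← PiTensorProduct.map_mul]
    congr 1
    ext1 l
    simp only [Tcomp, Scomp]
    split_ifs <;> simp [H.signBy_T, H.T_S]
  tt a b i j := by
    simp only [SS, ← PiTensorProduct.map_mul]
    have hS : ∀ i j, H.S i * H.S j = -(H.S j * H.S i) :=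
      fun i j => eq_neg_of_add_eq_zero_left (H.S_S i j)
    refine map_eq_neg _ _ (min a b) ?_ ?_
    · rcases lt_trichotomy a b with h | h | h
      · simp [Scomp, h, h.le, H.signBy_one_S]
      · subst h
        simp [Scomp, hS i j]
      · simp [Scomp, h, h.le, H.signBy_one_S]
    · intro l hl
      simp only [Scomp]
      rcases lt_trichotomy a b with h | h | h
      · rw [min_eq_left h.le] at hl
        split_ifs <;> first | (exfalso; order) | simp_all
      · subst h
        rw [min_self] at hl
        split_ifs <;> first | (exfalso; order) | simp_all
      · rw [min_eq_right h.le] at hl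
        split_ifs <;> first | (exfalso; order) | simp_all

end HWSupermodule

/-! ## Superpolynomials with coefficients and substitution of `∇` -/

/-- The space `V[Λ_a]_{a ∈ ι} = K[Λ_a]_{a ∈ ι} ⊗ V`. -/
abbrev PolyV (K : Type*) [Field K] (N : ℕ) (ι : Type) (V : Type*) [AddCommGroup V] [Module K V] :
    Type _ := SuperPoly K N ι ⊗[K] V

namespace PolyV

variable {ι κ J : Type} {W : Type*} [AddCommGroup W] [Module K W]

/-- The even operator `a ⊗ w ↦ a ⊗ f w` on `W[Λ]` for even `f`. -/
def evenOp (f : Module.End K W) : Module.End K (PolyV K N κ W) :=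
  TensorProduct.map LinearMap.id f

/-- The odd operator `a ⊗ w ↦ (-1)^{p(a)} a ⊗ f w` on `W[Λ]` for odd `f`. -/
def oddOp (f : Module.End K W) : Module.End K (PolyV K N κ W) :=
  TensorProduct.map SuperPoly.involute.toLinearMap f

/-- Multiplication by `b` from the left, `a ⊗ w ↦ b a ⊗ w`. -/
def mulOp (b : SuperPoly K N κ) : Module.End K (PolyV K N κ W) :=
  TensorProduct.map (LinearMap.mulLeft K b) LinearMap.id

theorem superCommute_ops {l : J → Module.End K W} {t : J → Fin N → Module.End K W}
    (h : SuperCommute l t) :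
    SuperCommute (B := Module.End K (PolyV K N κ W))
      (Sum.elim (fun k => mulOp (SuperPoly.lam k)) (fun j => evenOp (l j)))
      (Sum.elim (fun k i => mulOp (SuperPoly.th k i)) (fun j i => oddOp (t j i))) where
  ll := by
    have hl : ∀ a b w, l a (l b w) = l b (l a w) := fun a b w => LinearMap.congr_fun (h.ll a b) w
    rintro (a | a) (b | b) <;> refine TensorProduct.ext' fun x w => ?_
    · simp [mulOp, ← mul_assoc, SuperPoly.superCommute_gen.ll a b]
    · simp [mulOp, evenOp]
    · simp [mulOp, evenOp]
    · simp [evenOp, hl a b]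
  lt := by
    have hl : ∀ a b i w, l a (t b i w) = t b i (l a w) :=
      fun a b i w => LinearMap.congr_fun (h.lt a b i) w
    rintro (a | a) (b | b) i <;> refine TensorProduct.ext' fun x w => ?_
    · simp [mulOp, ← mul_assoc, SuperPoly.superCommute_gen.lt a b]
    · simp [mulOp, oddOp, SuperPoly.involute]
    · simp [mulOp, evenOp]
    · simp [evenOp, oddOp, hl a b]
  tt := by
    have hl : ∀ a b i j w, t a i (t b j w) = -t b j (t a i w) :=
      fun a b i j w => LinearMap.congr_fun (h.tt a b i j) w
    rintro (a | a) (b | b) i j <;> refine TensorProduct.ext' fun x w => ?_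
    · simp [mulOp, ← mul_assoc, SuperPoly.superCommute_gen.tt a b, TensorProduct.neg_tmul]
    · simp [mulOp, oddOp, SuperPoly.involute, TensorProduct.neg_tmul]
    · simp [mulOp, oddOp, SuperPoly.involute, TensorProduct.neg_tmul]
    · simp [oddOp, hl a b, TensorProduct.tmul_neg]

/-- For a supercommuting family `∇_j = (l j, t j)` of even and odd operators on `W`, the action of
polynomials in the supervariables `Λ_k`, `k ∈ κ`, and `∇_j`, `j ∈ J`, on `W[Λ_k]_{k ∈ κ}`. -/
def act {l : J → Module.End K W} {t : J → Fin N → Module.End K W} (h : SuperCommute l t) :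
    SuperPoly K N (κ ⊕ J) →ₐ[K] Module.End K (PolyV K N κ W) :=
  SuperPoly.lift _ _ (superCommute_ops h)

/-- The substitution `a ⊗ w ↦ a(Λ, ∇) w` from `W[Λ_k, Ξ_j]` to `W[Λ_k]`. -/
def evalNabla {l : J → Module.End K W} {t : J → Fin N → Module.End K W} (h : SuperCommute l t) :
    PolyV K N (κ ⊕ J) W →ₗ[K] PolyV K N κ W :=
  TensorProduct.lift ((act h).toLinearMap.compl₂ (TensorProduct.mk K (SuperPoly K N κ) W 1))

/-- The substitution `Λ_a ↦ ∑_k c a k Λ_k` in the coefficients. -/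
def subst [Fintype κ] (c : ι → κ → ℤ) : PolyV K N ι W →ₗ[K] PolyV K N κ W :=
  TensorProduct.map (SuperPoly.linSubst c).toLinearMap LinearMap.id

/-- The part of `V[Λ]` of parity `p`. -/
def parity (H : HWSupermodule K N V) (ι : Type) (p : ZMod 2) : Submodule K (PolyV K N ι V) :=
  Submodule.span K {x | ∃ q r : ZMod 2, q + r = p ∧
    ∃ a ∈ SuperPoly.parity (K := K) (N := N) (ι := ι) q, ∃ v ∈ H.parity r, x = a ⊗ₜ[K] v}

end PolyV

/-! ## The spaces `V_∇[Λ]` -/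

variable (H : HWSupermodule K N V)

/-- The left submodule of `K[Λ_a]_{a ∈ ι} ⊗ V` that is spanned by the relations of the tensor product
over the algebra of `T, S^1, …, S^N`, which acts on `K[Λ_a]` from the right by
`a · T = a (-∑ λ_a)` and `a · S^i = a (-∑ θ_a^i)`. -/
def relSub (ι : Type) [Fintype ι] : Submodule (SuperPoly K N ι) (PolyV K N ι V) :=
  Submodule.span (SuperPoly K N ι)
    ({x | ∃ v : V, x = (-∑ a, SuperPoly.lam a) ⊗ₜ[K] v - 1 ⊗ₜ[K] H.T v} ∪
      {x | ∃ (i : Fin N) (v : V), x = (-∑ a, SuperPoly.th a i) ⊗ₜ[K] v - 1 ⊗ₜ[K] H.S i v})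

/-- The space `V_∇[Λ_a]_{a ∈ ι}`: the tensor product of `K[Λ_a]_{a ∈ ι}` and `V` over the algebra
of `T, S^1, …, S^N`. -/
abbrev Vnabla (ι : Type) [Fintype ι] : Type _ := PolyV K N ι V ⧸ relSub H ι

namespace Vnabla

variable {ι κ : Type} [Fintype ι] [Fintype κ]

/-- The class of an element of `V[Λ]`. -/
def mk : PolyV K N ι V →ₗ[K] Vnabla H ι := (relSub H ι).mkQ.restrictScalars K

/-- The part of parity `p`. -/
def parity (p : ZMod 2) : Submodule K (Vnabla H ι) := (PolyV.parity H ι p).map (mk H)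

/-- A `K`-linear map out of `V[Λ]` that kills the relations, as a map out of `V_∇[Λ]`. -/
def desc {W : Type*} [AddCommGroup W] [Module K W] (f : PolyV K N ι V →ₗ[K] W)
    (hf : ∀ x ∈ relSub H ι, f x = 0) : Vnabla H ι →ₗ[K] W :=
  (((relSub H ι).restrictScalars K).liftQ f (fun x hx => hf x hx)) ∘ₗ
    (Submodule.Quotient.restrictScalarsEquiv K (relSub H ι)).symm.toLinearMap

@[simp] theorem desc_mk {W : Type*} [AddCommGroup W] [Module K W] (f : PolyV K N ι V →ₗ[K] W)
    (hf : ∀ x ∈ relSub H ι, f x = 0) (x : PolyV K N ι V) : desc H f hf (mk H x) = f x := rfl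

/-- A map `a ⊗ v ↦ Φ(a) (j v)`, with `Φ` an algebra morphism, that is compatible with the
relations of the tensor product. -/
def descAct {W : Type*} [AddCommGroup W] [Module K W] (Φ : SuperPoly K N ι →ₐ[K] Module.End K W)
    (j : V →ₗ[K] W) (hT : ∀ v, Φ (-∑ a, SuperPoly.lam a) (j v) = j (H.T v))
    (hS : ∀ i v, Φ (-∑ a, SuperPoly.th a i) (j v) = j (H.S i v)) : Vnabla H ι →ₗ[K] W :=
  desc H (TensorProduct.lift (Φ.toLinearMap.compl₂ j)) (by
    have hsmul : ∀ (a : SuperPoly K N ι) (x : PolyV K N ι V),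
        TensorProduct.lift (Φ.toLinearMap.compl₂ j) (a • x) =
          Φ a (TensorProduct.lift (Φ.toLinearMap.compl₂ j) x) := by
      intro a x
      induction x using TensorProduct.induction_on with
      | zero => simp
      | tmul b v => simp [TensorProduct.smul_tmul']
      | add x y hx hy => rw [smul_add, map_add, map_add, hx, hy, map_add]
    intro x hx
    induction hx using Submodule.span_induction with
    | mem x hx =>
      rcases hx with ⟨v, rfl⟩ | ⟨i, v, rfl⟩
      · rw [map_sub, sub_eq_zero]
        simpa using hT v
      · rw [map_sub, sub_eq_zero]
        simpa using hS i v
    | zero => simp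
    | add x y _ _ hx hy => rw [map_add, hx, hy, add_zero]
    | smul a x _ hx => rw [hsmul, hx, map_zero])

theorem neg_sum_linSubst [DecidableEq κ] (c : ι → κ → ℤ) (d : κ → ℤ)
    (h : ∀ k, ∑ a, c a k = -d k) :
    SuperPoly.linSubst (K := K) (N := N) c (-∑ a, SuperPoly.lam a) = ∑ k, d k • SuperPoly.lam k ∧
      ∀ i, SuperPoly.linSubst (K := K) (N := N) c (-∑ a, SuperPoly.th a i) =
        ∑ k, d k • SuperPoly.th k i := by
  constructor
  · simp only [SuperPoly.linSubst, map_neg, map_sum, SuperPoly.lift_lam]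
    rw [Finset.sum_comm, ← Finset.sum_neg_distrib]
    refine Finset.sum_congr rfl fun k _ => ?_
    rw [← Finset.sum_smul, h, neg_smul, neg_neg]
  · intro i
    simp only [SuperPoly.linSubst, map_neg, map_sum, SuperPoly.lift_th]
    rw [Finset.sum_comm, ← Finset.sum_neg_distrib]
    refine Finset.sum_congr rfl fun k _ => ?_
    rw [← Finset.sum_smul, h, neg_smul, neg_neg]

/-- The coefficients of the substitution `Λ_a ↦ Λ_{r a}` for `a ≠ ℓ` and
`Λ_ℓ ↦ -∑_{a ≠ ℓ} Λ_{r a} - ∇`, where `∇` is the variable `Sum.inr ()`. -/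
def elimCoeff [DecidableEq ι] [DecidableEq κ] (l : ι) (r : ι → κ) (a : ι) (x : κ ⊕ Unit) : ℤ :=
  if a = l then
    -(∑ b ∈ Finset.univ.erase l, if x = Sum.inl (r b) then 1 else 0) -
      (if x = Sum.inr () then 1 else 0)
  else if x = Sum.inl (r a) then 1 else 0

theorem sum_elimCoeff [DecidableEq ι] [DecidableEq κ] (l : ι) (r : ι → κ) (x : κ ⊕ Unit) :
    ∑ a, elimCoeff l r a x = -(if x = Sum.inr () then 1 else 0) := by
  rw [← Finset.add_sum_erase _ _ (Finset.mem_univ l)]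
  have : ∑ a ∈ Finset.univ.erase l, elimCoeff l r a x =
      ∑ b ∈ Finset.univ.erase l, if x = Sum.inl (r b) then 1 else 0 := by
    refine Finset.sum_congr rfl fun a ha => ?_
    simp [elimCoeff, Finset.ne_of_mem_erase ha]
  rw [this]
  simp only [elimCoeff, if_true]
  ring

/-- The map `V_∇[Λ_a]_{a ∈ ι} → V[Λ_k]_{k ∈ κ}` that eliminates one supervariable `Λ_l`:
`a ⊗ v` is sent to `a v` with `Λ_a` replaced by `Λ_{r a}` for `a ≠ l` and `Λ_l` replaced by
`-∑_{a ≠ l} Λ_{r a} - ∇`. -/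
def elim [DecidableEq ι] [DecidableEq κ] (l : ι) (r : ι → κ) : Vnabla H ι →ₗ[K] PolyV K N κ V :=
  descAct H ((PolyV.act (κ := κ) H.superCommute).comp (SuperPoly.linSubst (elimCoeff l r)))
    (TensorProduct.mk K (SuperPoly K N κ) V 1)
    (fun v => by
      rw [AlgHom.comp_apply, (neg_sum_linSubst _ _ (sum_elimCoeff l r)).1]
      simp [PolyV.act, PolyV.evenOp])
    (fun i v => by
      rw [AlgHom.comp_apply, (neg_sum_linSubst _ _ (sum_elimCoeff l r)).2]
      simp [PolyV.act, PolyV.oddOp])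

theorem smul_mk (a : SuperPoly K N ι) (x : PolyV K N ι V) : a • mk H x = mk H (a • x) := rfl

theorem mk_lam (v : V) :
    mk H ((-∑ a : ι, SuperPoly.lam (K := K) (N := N) a) ⊗ₜ[K] v) = mk H (1 ⊗ₜ[K] H.T v) := by
  rw [← sub_eq_zero, ← map_sub]
  exact (Submodule.Quotient.mk_eq_zero _).2 (Submodule.subset_span (Or.inl ⟨v, rfl⟩))

theorem mk_th (i : Fin N) (v : V) :
    mk H ((-∑ a : ι, SuperPoly.th (K := K) (N := N) a i) ⊗ₜ[K] v) = mk H (1 ⊗ₜ[K] H.S i v) := by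
  rw [← sub_eq_zero, ← map_sub]
  exact (Submodule.Quotient.mk_eq_zero _).2 (Submodule.subset_span (Or.inr ⟨i, v, rfl⟩))

/-- For a map `b : κ → ι`, the substitution `Λ_a ↦ ∑_{k : b k = a} Λ_k`, as a map
`V_∇[Λ_a]_{a ∈ ι} → V_∇[Λ_k]_{k ∈ κ}`. -/
def blockSubst [DecidableEq ι] [DecidableEq κ] (b : κ → ι) : Vnabla H ι →ₗ[K] Vnabla H κ :=
  descAct H
    ((Algebra.lsmul K K (Vnabla H κ)).comp
      (SuperPoly.linSubst (fun a k => if b k = a then 1 else 0)))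
    (mk H ∘ₗ TensorProduct.mk K (SuperPoly K N κ) V 1)
    (fun v => by
      rw [AlgHom.comp_apply, (neg_sum_linSubst _ (fun _ => -1) (by simp)).1]
      simp only [LinearMap.comp_apply, TensorProduct.mk_apply, Algebra.lsmul_coe, smul_mk,
        TensorProduct.smul_tmul', smul_eq_mul, mul_one, neg_smul, one_smul,
        Finset.sum_neg_distrib]
      exact mk_lam H v)
    (fun i v => by
      rw [AlgHom.comp_apply, (neg_sum_linSubst _ (fun _ => -1) (by simp)).2]
      simp only [LinearMap.comp_apply, TensorProduct.mk_apply, Algebra.lsmul_coe, smul_mk,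
        TensorProduct.smul_tmul', smul_eq_mul, mul_one, neg_smul, one_smul,
        Finset.sum_neg_distrib]
      exact mk_th H i v)

/-- The operator `∂/∂λ_k - ∂/∂λ_l` on `V[Λ]`. -/
def dlamSubPoly [DecidableEq ι] (k l : ι) : PolyV K N ι V →ₗ[K] PolyV K N ι V :=
  TensorProduct.map (SuperPoly.dlam k - SuperPoly.dlam l) LinearMap.id

/-- The operator `∂/∂λ_k - ∂/∂λ_l` on `V_∇[Λ]`. -/
def dlamSub [DecidableEq ι] (k l : ι) : Vnabla H ι →ₗ[K] Vnabla H ι :=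
  desc H (mk H ∘ₗ dlamSubPoly k l) (by
    have hsmul : ∀ (a : SuperPoly K N ι) (x : PolyV K N ι V), dlamSubPoly k l (a • x) =
        (SuperPoly.dlam k a - SuperPoly.dlam l a) • x + a • dlamSubPoly k l x := by
      intro a x
      induction x using TensorProduct.induction_on with
      | zero => simp
      | tmul b v =>
        simp only [dlamSubPoly, TensorProduct.smul_tmul', TensorProduct.map_tmul,
          LinearMap.sub_apply, smul_eq_mul, SuperPoly.dlam_mul, LinearMap.id_apply]
        rw [← TensorProduct.add_tmul]
        congr 1
        noncomm_ring
      | add x y hx hy => rw [smul_add, map_add, hx, hy, map_add, smul_add, smul_add]; abel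
    have key : ∀ x ∈ relSub H ι, dlamSubPoly k l x ∈ relSub H ι := by
      intro x hx
      induction hx using Submodule.span_induction with
      | mem x hx =>
        have : dlamSubPoly k l x = 0 := by
          rcases hx with ⟨v, rfl⟩ | ⟨i, v, rfl⟩ <;>
            simp [dlamSubPoly, SuperPoly.dlam_lam, SuperPoly.dlam_th, SuperPoly.dlam_one]
        rw [this]
        exact zero_mem _
      | zero => simp
      | add x y _ _ hx hy => rw [map_add]; exact add_mem hx hy
      | smul a x hx' hx =>
        rw [hsmul]
        exact add_mem (Submodule.smul_mem _ _ hx') (Submodule.smul_mem _ _ hx)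
    intro x hx
    exact (Submodule.Quotient.mk_eq_zero _).2 (key x hx))

end Vnabla
/-! ## Quivers -/

end Module

/-- A quiver without loops with vertex set `ι`, up to renaming of the edges: the multiset of its
edges, an edge being recorded as the pair (source, target). -/
@[ext] structure NQuiver (ι : Type) where
  edges : Multiset (ι × ι)
  no_loop : ∀ e ∈ edges, e.1 ≠ e.2

namespace NQuiver

variable {ι κ : Type}

/-- For a map `f` of the vertices, `IsWalk f p x y` says that the images under `f` of the edges in
the list `p`, each run through in one of its two directions, form a walk from `x` to `y`. -/
def IsWalk (f : ι → κ) : List (ι × ι) → κ → κ → Prop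
  | [], x, y => x = y
  | e :: p, x, y => (f e.1 = x ∧ IsWalk f p (f e.2) y) ∨ (f e.2 = x ∧ IsWalk f p (f e.1) y)

/-- `IsDirectedPath p x y` says that the edges in the list `p` form a directed path from `x` to
`y`. -/
def IsDirectedPath : List (ι × ι) → ι → ι → Prop
  | [], x, y => x = y
  | e :: p, x, y => e.1 = x ∧ IsDirectedPath p e.2 y

/-- The underlying graph has no cycle, i.e. no nonempty closed walk that uses every edge at most
once. -/
def IsAcyclic (Q : NQuiver ι) : Prop :=
  ∀ (p : List (ι × ι)) (x : ι), (p : Multiset (ι × ι)) ≤ Q.edges → IsWalk id p x x → p = []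

/-- The list `p` of edges of `Q` is a directed cycle. -/
def IsDirectedCycle (Q : NQuiver ι) (p : List (ι × ι)) : Prop :=
  p ≠ [] ∧ (p : Multiset (ι × ι)) ≤ Q.edges ∧ ∃ x, IsDirectedPath p x x

/-- The vertices `x` and `y` are connected in the underlying graph. -/
def Connected (Q : NQuiver ι) (x y : ι) : Prop :=
  ∃ p : List (ι × ι), (∀ e ∈ p, e ∈ Q.edges) ∧ IsWalk id p x y

/-- The quiver with an edge `e` removed. -/
def erase [DecidableEq ι] (Q : NQuiver ι) (e : ι × ι) : NQuiver ι where
  edges := Q.edges.erase e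
  no_loop _ h := Q.no_loop _ (Multiset.mem_of_mem_erase h)

/-- The quiver whose vertices are renamed by a bijection `s`; for a permutation this is `s Q`. -/
def rename (s : ι ≃ κ) (Q : NQuiver ι) : NQuiver κ where
  edges := Q.edges.map (Prod.map s s)
  no_loop e h := by
    obtain ⟨d, hd, rfl⟩ := Multiset.mem_map.1 h
    exact fun h => Q.no_loop d hd (s.injective h)

/-- For a decomposition of the vertices into blocks `b⁻¹(j)`, the quiver of the edges inside the
block `j`. -/
def inner [DecidableEq κ] (b : ι → κ) (Q : NQuiver ι) (j : κ) : NQuiver {k : ι // b k = j} where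
  edges := Q.edges.filterMap fun e =>
    if h : b e.1 = j ∧ b e.2 = j then some (⟨e.1, h.1⟩, ⟨e.2, h.2⟩) else none
  no_loop e h := by
    obtain ⟨d, hd, h⟩ := (Multiset.mem_filterMap _ _).1 h
    split_ifs at h with h'
    cases h
    exact fun h => Q.no_loop d hd (congrArg Subtype.val h)

/-- The quiver on the set of blocks whose edges are the edges between different blocks. -/
def outer [DecidableEq κ] (b : ι → κ) (Q : NQuiver ι) : NQuiver κ where
  edges := (Q.edges.filter fun e => b e.1 ≠ b e.2).map (Prod.map b b)
  no_loop e h := by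
    obtain ⟨d, hd, rfl⟩ := Multiset.mem_map.1 h
    exact (Multiset.mem_filter.1 hd).2

/-- The block `i` is externally connected to the vertex `k`: in the quiver on the blocks there is
a walk from `i` to the block of `k` that uses every edge at most once and at least one of whose
edges, as an edge of `Q`, has `k` as an end point. -/
def ExtConnected [DecidableEq κ] (b : ι → κ) (Q : NQuiver ι) (i : κ) (k : ι) : Prop :=
  ∃ p : List (ι × ι), (p : Multiset (ι × ι)) ≤ (Q.edges.filter fun e => b e.1 ≠ b e.2) ∧
    IsWalk b p i (b k) ∧ ∃ e ∈ p, e.1 = k ∨ e.2 = k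

/-- The quiver with two vertices and no edge. -/
def discrete : NQuiver (Fin 2) := ⟨0, by simp⟩

/-- The quiver with two vertices and one edge, from the first to the second vertex. -/
def arrow : NQuiver (Fin 2) := ⟨{(0, 1)}, by simp⟩

end NQuiver

/-! ## The operad -/

section Operad

variable {K : Type*} [Field K] {N : ℕ} {V : Type*} [AddCommGroup V] [Module K V]
  (H : HWSupermodule K N V)

/-- Linear maps from `V^{⊗ n}` tensored with the span of the quivers to `V_∇[Λ_1, …, Λ_n]`, for the
index set `ι = {1, …, n}`, or any finite linearly ordered set `ι`. -/
abbrev Op (ι : Type) [Fintype ι] : Type _ :=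
  NQuiver ι → MultilinearMap K (fun _ : ι => V) (Vnabla H ι)

variable {H}

/-- The homogeneous part of parity `p` of the space of `n`-ary operations of the
SUSY coisson operad of `V`. -/
structure IsPcl {ι : Type} [Fintype ι] [LinearOrder ι] (p : ZMod 2) (X : Op H ι) : Prop where
  /-- `X` has parity `p`. -/
  parity : ∀ (Q : NQuiver ι) (q : ι → ZMod 2) (v : ι → V), (∀ k, v k ∈ H.parity (q k)) →
    X Q v ∈ Vnabla.parity H (∑ k, q k + p)
  /-- First cycle relation. -/
  not_acyclic : ∀ Q : NQuiver ι, ¬ Q.IsAcyclic → X Q = 0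
  /-- Second cycle relation. -/
  directed_cycle : ∀ (Q : NQuiver ι) (c : List (ι × ι)), Q.IsDirectedCycle c →
    (c.map fun e => X (Q.erase e)).sum = 0
  /-- First sesquilinearity condition. -/
  sesq_d : ∀ (Q : NQuiver ι) (k l : ι), Q.Connected k l → ∀ v, Vnabla.dlamSub H k l (X Q v) = 0
  /-- Second sesquilinearity condition, for the connected component of `k`. -/
  sesq_T : ∀ (Q : NQuiver ι) (k : ι) (I : Finset ι), (∀ l, l ∈ I ↔ Q.Connected k l) → ∀ v,
    ∑ l ∈ I, X Q (fun m => H.Tcomp l m (v m)) =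
      -((∑ l ∈ I, SuperPoly.lam l : SuperPoly K N ι) • X Q v)
  /-- Third sesquilinearity condition. -/
  sesq_S : ∀ (Q : NQuiver ι) (k : ι) (i : Fin N) (v : ι → V),
    X Q (fun m => H.Scomp k i m (v m)) = -(ksign p • ((SuperPoly.th k i : SuperPoly K N ι) • X Q v))

namespace Op

/-- The operation `X` with the index set renamed by a bijection. -/
def reindex {ι κ : Type} [Fintype ι] [Fintype κ] [DecidableEq ι] [DecidableEq κ] (e : ι ≃ κ)
    (X : Op H ι) : Op H κ := fun Q =>
  (Vnabla.blockSubst H e.symm).compMultilinearMap ((X (Q.rename e.symm)).domDomCongr e)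

/-- The Koszul sign of the permutation `s` on factors with the parities `q`. -/
def koszulSign {ι : Type} [Fintype ι] [LinearOrder ι] (s : Equiv.Perm ι) (q : ι → ZMod 2) : ℤ :=
  ∏ k, ∏ l, if k < l ∧ s l < s k then ksign (q k * q l) else 1

/-- The right action of the symmetric group, `X^s(v ⊗ Q) = X^{sQ}_{s(Λ)}(s v)`. -/
def perm {ι : Type} [Fintype ι] [LinearOrder ι] (X : Op H ι) (s : Equiv.Perm ι) : Op H ι := fun Q =>
  ∑ q : ι → ZMod 2, koszulSign s q •
    ((Vnabla.blockSubst H s).compMultilinearMap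
      ((X (Q.rename s)).domDomCongr s.symm)).compLinearMap (fun k => H.proj (q k))

/-- The unit `id_V`, with a one-element index set. -/
def unit {ι : Type} [Fintype ι] [Subsingleton ι] (k : ι) : Op H ι := fun _ =>
  MultilinearMap.ofSubsingleton K V (Vnabla H ι) k
    (Vnabla.mk H ∘ₗ TensorProduct.mk K (SuperPoly K N ι) V 1)

/-- The map `w ⊗ v ↦ w ⊗ v` from `V^{⊗ m} ⊗ V` to `V^{⊗ (m + 1)}`. -/
def snocTensor (m : ℕ) :
    HWSupermodule.TPow K V m →ₗ[K] V →ₗ[K] HWSupermodule.TPow K V (m + 1) :=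
  PiTensorProduct.lift
    (PiTensorProduct.tprod K : MultilinearMap K (fun _ : Fin (m + 1) => V) _).curryRight

variable (H) in
/-- The map `(b ⊗ w, a ⊗ v) ↦ (-1)^{p(w) p(a)} b a ⊗ (w ⊗ v)`. -/
def snocPoly (m : ℕ) (ι : Type) : PolyV K N ι (HWSupermodule.TPow K V m) →ₗ[K] PolyV K N ι V →ₗ[K]
    PolyV K N ι (HWSupermodule.TPow K V (m + 1)) :=
  TensorProduct.curry <| ∑ q : ZMod 2,
    TensorProduct.map (LinearMap.mul' K (SuperPoly K N ι)) (TensorProduct.lift (snocTensor m)) ∘ₗ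
      (TensorProduct.tensorTensorTensorComm K _ _ _ _).toLinearMap ∘ₗ
      TensorProduct.map
        (TensorProduct.map LinearMap.id (PiTensorProduct.map fun _ => H.signBy q))
        (TensorProduct.map (SuperPoly.projParity q) LinearMap.id)

variable (H) in
/-- The map from `(V[Λ])^{⊗ m}` to `V^{⊗ m}[Λ]` that sends `a_1 v_1 ⊗ ⋯ ⊗ a_m v_m` to
`∏_{i < j} (-1)^{p(v_i) p(a_j)} (a_1 ⋯ a_m) (v_1 ⊗ ⋯ ⊗ v_m)`. -/
def collect (ι : Type) : (m : ℕ) →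
    MultilinearMap K (fun _ : Fin m => PolyV K N ι V) (PolyV K N ι (HWSupermodule.TPow K V m))
  | 0 => MultilinearMap.constOfIsEmpty K _ (1 ⊗ₜ[K] PiTensorProduct.tprod K Fin.elim0)
  | m + 1 => ((snocPoly H m ι).compMultilinearMap (collect ι m)).uncurryRight

/-- The coefficients of the substitution `Λ_k ↦ Λ_k + ∑_i Ξ_i` for `k` in the block `j`, where `i`
runs over the blocks that are externally connected to `k`. The variables `Λ_1, …, Λ_n` are indexed by
`Sum.inl`, the variables `Ξ_1, …, Ξ_m` by `Sum.inr`. -/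
def shiftCoeff {n m : ℕ} (b : Fin n → Fin m) (Q : NQuiver (Fin n)) (j : Fin m) :
    {k : Fin n // b k = j} → Fin n ⊕ Fin m → ℤ := by
  classical exact fun k x => match x with
    | Sum.inl k' => if k' = k then 1 else 0
    | Sum.inr i => if Q.ExtConnected b i k then 1 else 0

/-- The coefficients of the substitution `Λ_k ↦ Λ_k`, `Ξ_j ↦ Λ'_j + ∇^{(j)}`, where
`Λ'_j = ∑_{k : b k = j} Λ_k` and `∇^{(j)}` is the variable `Sum.inr j` on the right. -/
def nablaCoeff {n m : ℕ} (b : Fin n → Fin m) : Fin n ⊕ Fin m → Fin n ⊕ Fin m → ℤ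
  | Sum.inl k, x => if x = Sum.inl k then 1 else 0
  | Sum.inr j, Sum.inl k => if b k = j then 1 else 0
  | Sum.inr j, Sum.inr i => if i = j then 1 else 0

/-- The last element of a block. -/
def lastOf {n m : ℕ} (b : Fin n → Fin m) (hb : Function.Surjective b) (j : Fin m) :
    {k : Fin n // b k = j} :=
  Finset.univ.max' ⟨⟨(hb j).choose, (hb j).choose_spec⟩, Finset.mem_univ _⟩

variable (H) in
/-- The map `⨂_j V_∇[Λ_k]_{b k = j} → V^{⊗ m}[Λ_1, …, Λ_n]` in the composition for the quiver `Q`: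
for each block `j`, write an element of `V_∇[Λ_k]_{b k = j}` as a polynomial `a_j v_j` in the `Λ_k`
for `k` not the last element of the block, then send `a_1 v_1 ⊗ ⋯ ⊗ a_m v_m` to
`∏_{i < j} (-1)^{p(v_i) p(a_j)} a (v_1 ⊗ ⋯ ⊗ v_m)`, where `a` is obtained from `a_1 ⋯ a_m` by the
substitution `Λ_k ↦ Λ_k + ∑_i Ξ_i`, with `i` running over the blocks externally connected to `k`,
followed by `Ξ_i ↦ Λ'_i + ∇^{(i)}`. -/
def insertion {n m : ℕ} (b : Fin n → Fin m) (hb : Function.Surjective b) (Q : NQuiver (Fin n)) :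
    MultilinearMap K (fun j : Fin m => Vnabla H {k : Fin n // b k = j})
      (PolyV K N (Fin n) (HWSupermodule.TPow K V m)) :=
  (PolyV.evalNabla (H.superCommute_tensor m) ∘ₗ PolyV.subst (nablaCoeff b)).compMultilinearMap
    ((collect H (Fin n ⊕ Fin m) m).compLinearMap fun j =>
      PolyV.subst (shiftCoeff b Q j) ∘ₗ Vnabla.elim H (lastOf b hb j) id)

/-- The map `a ⊗ w ↦ (-1)^{p(X) p(a)} a X_{Λ'_1, …, Λ'_m}(w ⊗ Q)` from `V^{⊗ m}[Λ_1, …, Λ_n]` to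
`V_∇[Λ_1, …, Λ_n]`, for `X` of parity `p`. -/
def extend {n m : ℕ} (b : Fin n → Fin m) (p : ZMod 2) (X : Op H (Fin m)) (Q : NQuiver (Fin m)) :
    PolyV K N (Fin n) (HWSupermodule.TPow K V m) →ₗ[K] Vnabla H (Fin n) :=
  TensorProduct.lift
    (((Algebra.lsmul K K (Vnabla H (Fin n))).toLinearMap ∘ₗ SuperPoly.signBy p).compl₂
      (Vnabla.blockSubst H b ∘ₗ PiTensorProduct.lift (X Q)))

/-- The composition `X ∘ (Y_1 ⊙ ⋯ ⊙ Y_m)` for `X` of parity `pX` and `Y_j` of parity `pY j`. The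
decomposition `n = n_1 + ⋯ + n_m` into positive integers is given by the monotone surjection `b` that
maps the `j`-th block of `n_j` consecutive numbers to `j`. -/
def comp {n m : ℕ} (b : Fin n →o Fin m) (hb : Function.Surjective b) (pX : ZMod 2)
    (pY : Fin m → ZMod 2) (X : Op H (Fin m)) (Y : ∀ j : Fin m, Op H {k : Fin n // b k = j}) :
    Op H (Fin n) := fun Q =>
  (((extend b pX X (Q.outer b) ).compMultilinearMap (insertion H b hb Q)).compMultilinearMap
    (fun j => Y j (Q.inner b j))).domDomCongr (Equiv.sigmaFiberEquiv b) |>.compLinearMap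
      (fun k => H.signBy (∑ j with b k < j, pY j))

/-- The decomposition `n + m + 1 = (m + 1) + 1 + ⋯ + 1` into `n + 1` summands. -/
def firstBlock (n m : ℕ) : Fin (n + m + 1) →o Fin (n + 1) where
  toFun k := ⟨k - m, by omega⟩
  monotone' k l h := by
    simp only [Fin.mk_le_mk]
    have : (k : ℕ) ≤ l := h
    omega

theorem firstBlock_surjective (n m : ℕ) : Function.Surjective (firstBlock n m) := fun j =>
  ⟨⟨j + m, by omega⟩, Fin.ext (Nat.add_sub_cancel _ _)⟩

theorem firstBlock_eq_iff (n m : ℕ) (k : Fin (n + m + 1)) (j : Fin (n + 1)) :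
    firstBlock n m k = j ↔ (k : ℕ) - m = j := Fin.ext_iff

/-- The first block is `{1, …, m + 1}`. -/
def firstBlockEquiv (n m : ℕ) : Fin (m + 1) ≃ {k : Fin (n + m + 1) // firstBlock n m k = 0} where
  toFun k := ⟨⟨k, by omega⟩, (firstBlock_eq_iff _ _ _ _).2 (by simp only [Fin.val_zero]; omega)⟩
  invFun k := ⟨k.1, by
    have := (firstBlock_eq_iff _ _ _ _).1 k.2
    simp only [Fin.val_zero] at this
    omega⟩
  left_inv _ := rfl
  right_inv _ := rfl

instance firstBlock_subsingleton (n m : ℕ) (j : Fin n) :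
    Subsingleton {k : Fin (n + m + 1) // firstBlock n m k = j.succ} where
  allEq k l := by
    have hk := (firstBlock_eq_iff _ _ _ _).1 k.2
    have hl := (firstBlock_eq_iff _ _ _ _).1 l.2
    simp only [Fin.val_succ] at hk hl
    ext
    omega

/-- The infinitesimal composition `f ∘_1 g = f ∘ (g ⊙ 1 ⊙ ⋯ ⊙ 1)`, for `f` of parity `pf` and `g` of
parity `pg`. -/
def circOne {n m : ℕ} (pf pg : ZMod 2) (f : Op H (Fin (n + 1))) (g : Op H (Fin (m + 1))) :
    Op H (Fin (n + m + 1)) :=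
  comp (firstBlock n m) (firstBlock_surjective n m) pf (Fin.cons pg fun _ => 0) f
    (Fin.cases (g.reindex (firstBlockEquiv n m)) fun j =>
      unit ⟨⟨m + 1 + j, by omega⟩,
        (firstBlock_eq_iff _ _ _ _).2 (by simp only [Fin.val_succ]; omega)⟩)

/-- `s` is an `(m + 1, n)`-shuffle: it is increasing on the first `m + 1` numbers and on the last `n`
numbers. -/
def IsShuffle {n m : ℕ} (s : Equiv.Perm (Fin (n + m + 1))) : Prop :=
  (∀ k l : Fin (n + m + 1), k < l → (l : ℕ) ≤ m → s k < s l) ∧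
    (∀ k l : Fin (n + m + 1), k < l → m < (k : ℕ) → s k < s l)

open Classical in
/-- The product `f □ g = ∑_s (f ∘_1 g)^{s⁻¹}` over the `(m + 1, n)`-shuffles `s`. -/
def square {n m : ℕ} (pf pg : ZMod 2) (f : Op H (Fin (n + 1))) (g : Op H (Fin (m + 1))) :
    Op H (Fin (n + m + 1)) :=
  ∑ s : Equiv.Perm (Fin (n + m + 1)) with IsShuffle s, (circOne pf pg f g).perm s⁻¹

end Op

variable (H) in
/-- The odd Maurer-Cartan elements: the binary operations `X` of the coisson operad of `V` of odd
parity that are invariant under the symmetric group and satisfy `X □ X = 0`. -/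
def oddMC : Set (Op H (Fin 2)) :=
  {X | IsPcl 1 X ∧ (∀ s : Equiv.Perm (Fin 2), X.perm s = X) ∧
    Op.square (n := 1) (m := 1) 1 1 X X = 0}

end Operad

/-! ## SUSY Poisson vertex algebras -/

section PVA

variable {K : Type*} [Field K] {N : ℕ} {V : Type*} [AddCommGroup V] [Module K V]

namespace PolyV

/-- The map `a ⊗ v ↦ (-1)^{p · p(a)} a g(v)` that extends `g`. -/
def extend {κ : Type} (p : ZMod 2) (g : V →ₗ[K] PolyV K N κ V) : PolyV K N κ V →ₗ[K] PolyV K N κ V :=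
  TensorProduct.lift
    (((Algebra.lsmul K K (PolyV K N κ V)).toLinearMap ∘ₗ SuperPoly.signBy p).compl₂ g)

/-- The map `f ↦ Res_Λ(λ⁻¹ f)`, i.e. `λ^m θ^I v ↦ δ_{m,0} δ_{I,[N]} v`. -/
def res : PolyV K N Unit V →ₗ[K] V :=
  (TensorProduct.lid K V).toLinearMap ∘ₗ TensorProduct.map SuperPoly.resCoeff LinearMap.id

end PolyV

/-- Linear maps `V ⊗ V → V[Λ]`. -/
abbrev LamBracket (K : Type*) [Field K] (N : ℕ) (V : Type*) [AddCommGroup V] [Module K V] : Type _ :=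
  V →ₗ[K] V →ₗ[K] PolyV K N Unit V

namespace LamBracket

/-- The bracket `{a_Γ b}`, where `Γ = ∑_{k ∈ s} Λ_k`. -/
def eval {κ : Type} [Fintype κ] [DecidableEq κ] (B : LamBracket K N V) (s : Finset κ) :
    V →ₗ[K] V →ₗ[K] PolyV K N κ V :=
  B.compr₂ (PolyV.subst fun _ k => if k ∈ s then 1 else 0)

/-- `{a_{-Λ-∇} b}`. -/
def evalNeg (H : HWSupermodule K N V) (B : LamBracket K N V) :
    V →ₗ[K] V →ₗ[K] PolyV K N Unit V :=
  B.compr₂ (PolyV.evalNabla H.superCommute ∘ₗ PolyV.subst fun _ _ => -1)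

/-- `B` is the `Λ`-bracket of an `N_W = N` SUSY Lie conformal algebra structure on `(V, ∇)`. In the
Jacobi identity the supervariables `Λ_1`, `Λ_2` have the indices `0`, `1`, and the bracket, a map of
parity `N`, is extended to polynomials by the sign rule. -/
structure IsLieConformal (H : HWSupermodule K N V) (B : LamBracket K N V) : Prop where
  parity : ∀ (p q : ZMod 2) (a b : V), a ∈ H.parity p → b ∈ H.parity q →
    B a b ∈ PolyV.parity H Unit (p + q + N)
  T_left : ∀ a b : V, B (H.T a) b = -((SuperPoly.lam () : SuperPoly K N Unit) • B a b)
  T_right : ∀ a b : V, B a (H.T b) =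
    (SuperPoly.lam () : SuperPoly K N Unit) • B a b + PolyV.evenOp H.T (B a b)
  S_left : ∀ (i : Fin N) (a b : V), B (H.S i a) b =
    -(ksign N • ((SuperPoly.th () i : SuperPoly K N Unit) • B a b))
  S_right : ∀ (i : Fin N) (p : ZMod 2) (a b : V), a ∈ H.parity p → B a (H.S i b) =
    ksign (p + N) • ((SuperPoly.th () i : SuperPoly K N Unit) • B a b + PolyV.oddOp (H.S i) (B a b))
  skew : ∀ (p q : ZMod 2) (a b : V), a ∈ H.parity p → b ∈ H.parity q →
    B b a = -(ksign (p * q + N) • B.evalNeg H a b)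
  jacobi : ∀ (p q : ZMod 2) (a b c : V), a ∈ H.parity p → b ∈ H.parity q →
    PolyV.extend (p + N) (B.eval {0} a) (B.eval {(1 : Fin 2)} b c) =
      ksign ((p + N) * N) • PolyV.extend N ((B.eval Finset.univ).flip c) (B.eval {0} a b) +
      ksign ((p + N) * (q + N)) • PolyV.extend (q + N) (B.eval {1} b) (B.eval {0} a c)

end LamBracket

/-- The pair of the `Λ`-bracket `B` and the product `μ` is a structure of a non-unital `N_W = N` SUSY
Poisson vertex algebra on `(V, ∇)`. -/
structure IsSUSYPVA (H : HWSupermodule K N V) (B : LamBracket K N V) (μ : V →ₗ[K] V →ₗ[K] V) :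
    Prop where
  lieConformal : B.IsLieConformal H
  mul_even : ∀ (p q : ZMod 2) (a b : V), a ∈ H.parity p → b ∈ H.parity q → μ a b ∈ H.parity (p + q)
  T_mul : ∀ a b : V, H.T (μ a b) = μ (H.T a) b + μ a (H.T b)
  S_mul : ∀ (i : Fin N) (p : ZMod 2) (a b : V), a ∈ H.parity p →
    H.S i (μ a b) = μ (H.S i a) b + ksign p • μ a (H.S i b)
  mul_comm : ∀ (p q : ZMod 2) (a b : V), a ∈ H.parity p → b ∈ H.parity q →
    μ b a = ksign (p * q) • μ a b
  mul_assoc : ∀ a b c : V, μ (μ a b) c = μ a (μ b c)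
  leibniz : ∀ (p q : ZMod 2) (a b c : V), a ∈ H.parity p → b ∈ H.parity q →
    B a (μ b c) = TensorProduct.map LinearMap.id (μ.flip c) (B a b) +
      ksign ((p + N) * q) • TensorProduct.map (SuperPoly.signBy q) (μ b) (B a c)

/-- A multilinear map in two variables as a bilinear map. -/
def bilin {W : Type*} [AddCommGroup W] [Module K W] (f : MultilinearMap K (fun _ : Fin 2 => V) W) :
    V →ₗ[K] V →ₗ[K] W :=
  (MultilinearMap.ofSubsingletonₗ K K V W (0 : Fin 1)).symm.toLinearMap ∘ₗ f.curryLeft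

theorem bilin_apply {W : Type*} [AddCommGroup W] [Module K W]
    (f : MultilinearMap K (fun _ : Fin 2 => V) W) (a b : V) : bilin f a b = f ![a, b] := by
  simp only [bilin, LinearMap.comp_apply]
  change f _ = f _
  congr 1
  ext k
  fin_cases k <;> rfl

/-- The `Λ`-bracket `{a_Λ b}_X = (-1)^{p(a) (N + 1)} X_{Λ, -Λ-∇}(a ⊗ b)` for the quiver without
edges, where `p` is the parity of `V`. -/
def bracketOf (H : HWSupermodule K N V) (X : Op (H.shift (N + 1)) (Fin 2)) : LamBracket K N V :=
  ((bilin (X NQuiver.discrete)).compr₂ (Vnabla.elim (H.shift (N + 1)) 1 fun _ => ())) ∘ₗ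
    H.signBy (N + 1)

/-- The product `μ_X(a ⊗ b) = (-1)^{p(a) (N + 1)} Res_Λ(λ⁻¹ X_{Λ, -Λ-∇}(a ⊗ b))` for the quiver with
one edge from `1` to `2`, where `p` is the parity of `V`. -/
def mulOf (H : HWSupermodule K N V) (X : Op (H.shift (N + 1)) (Fin 2)) : V →ₗ[K] V →ₗ[K] V :=
  ((bilin (X NQuiver.arrow)).compr₂
    (PolyV.res ∘ₗ Vnabla.elim (H.shift (N + 1)) 1 fun _ => ())) ∘ₗ H.signBy (N + 1)

end PVA

end SUSY

end

/-!
An odd symmetric operation `X` with two arguments is determined by its values on the two quivers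
`• •` and `• → •`: by the cycle relations it changes sign when the edge is reversed, and it vanishes
on all other quivers. After elimination of the second supervariable the two values become brackets
`D` and `A` with values in `V[Λ]`, and the conditions on `X` become conditions on the pair `(D, A)`
(`isOddPair_val`, `isPcl_ofPair`, `perm_ofPair`, `ext_val`): both brackets are sesquilinear with
respect to the `S^i` and skew-symmetric, `D` is sesquilinear with respect to `T`, while `A` does not
contain `λ` and `T` acts on it as a derivation. Such a bracket `A` is determined by its product
`Res_Λ(λ⁻¹ A)` (`eq_zero_of_res_family`): the Berezin integral is nondegenerate, and multiplication
of `A(a, b)` by `θ^i` amounts to the application of `S^i` to `a`. Conversely, a commutative product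
on which `T` and the `S^i` act as derivations comes from the bracket
`(a, b) ↦ (θ^1 + S^1) ⋯ (θ^N + S^N) a · b`, with `S^i` acting on `a` only (`ofProduct`).

The operation `X □ X` is symmetric and changes sign when an edge is reversed, so it vanishes as soon
as it vanishes on three quivers with three vertices: the one without edges, the one with the edge
`1 → 2`, and `1 → 2 → 3` (`selfSquare_eq_zero`). On any other quiver, up to these symmetries, every
term of the square involves a quiver with two vertices and at least two edges. On the first quiver
the equation `X □ X = 0` is the Jacobi identity for `D` (`elimLast_square_empty`). On the other two,
residues suffice again, and they give the Leibniz rule (`resMid_selfSquare_edge`) and the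
associativity of the product (`res_resMid_selfSquare_path`).

All this holds for any supermodule. The sign `(-1)^{p(a) (N + 1)}` turns the identities for
`Π^{N+1} V` into those for `V`; this is the content of the equivalences for `LamBracket.twisted`.
-/

noncomputable section

namespace SUSY

/-! ### Signs -/

@[simp] theorem ksign_zero : ksign 0 = 1 := rfl

@[simp] theorem ksign_one : ksign 1 = -1 := rfl

theorem ksign_add (p q : ZMod 2) : ksign (p + q) = ksign p * ksign q := by
  revert p q; decide

theorem ksign_mul_self (p : ZMod 2) : ksign p * ksign p = 1 := by
  revert p; decide

theorem zmod_two_cases (p : ZMod 2) : p = 0 ∨ p = 1 := by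
  revert p; decide

theorem ksign_smul_smul {M : Type*} [AddCommGroup M] (p : ZMod 2) (x : M) :
    ksign p • ksign p • x = x := by
  rw [smul_smul, ksign_mul_self, one_smul]

namespace SuperPoly

variable {K : Type*} [Field K] {N : ℕ} {ι κ : Type}

/-! ### Superpolynomials -/

theorem induction_on {C : SuperPoly K N ι → Prop} (a : SuperPoly K N ι)
    (hr : ∀ r : K, C (algebraMap K _ r)) (hl : ∀ i, C (lam i)) (ht : ∀ i j, C (th i j))
    (hmul : ∀ a b, C a → C b → C (a * b)) (hadd : ∀ a b, C a → C b → C (a + b)) : C a := by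
  obtain ⟨x, rfl⟩ := RingQuot.mkAlgHom_surjective K (PolyRel K N ι) a
  induction x using FreeAlgebra.induction with
  | grade0 r => rw [AlgHom.commutes]; exact hr r
  | grade1 x =>
    rcases x with i | ⟨i, j⟩
    · exact hl i
    · exact ht i j
  | mul a b ha hb => rw [map_mul]; exact hmul _ _ ha hb
  | add a b ha hb => rw [map_add]; exact hadd _ _ ha hb

/-- A linear map that intertwines the actions of the generators intertwines the actions of all
superpolynomials. -/
theorem intertwine {M M' : Type*} [AddCommGroup M] [Module K M] [AddCommGroup M'] [Module K M']
    (Φ : SuperPoly K N ι →ₐ[K] Module.End K M) (Φ' : SuperPoly K N ι →ₐ[K] Module.End K M')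
    (ω : M →ₗ[K] M') (hl : ∀ i z, ω (Φ (lam i) z) = Φ' (lam i) (ω z))
    (ht : ∀ i j z, ω (Φ (th i j) z) = Φ' (th i j) (ω z)) (a : SuperPoly K N ι) :
    ∀ z, ω (Φ a z) = Φ' a (ω z) := by
  induction a using induction_on with
  | hr r => intro z; simp [Module.algebraMap_end_apply]
  | hl i => exact hl i
  | ht i j => exact ht i j
  | hmul a b ha hb => intro z; simp only [map_mul, Module.End.mul_apply, ha, hb]
  | hadd a b ha hb => intro z; simp only [map_add, LinearMap.add_apply, ha, hb]

/-- The renaming `Λ_a ↦ Λ_{b a}` of the supervariables. -/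
def ren (b : ι → κ) : SuperPoly K N ι →ₐ[K] SuperPoly K N κ :=
  lift (fun a => lam (b a)) (fun a i => th (b a) i)
    { ll := fun _ _ => superCommute_gen.ll _ _
      lt := fun _ _ _ => superCommute_gen.lt _ _ _
      tt := fun _ _ _ _ => superCommute_gen.tt _ _ _ _ }

@[simp] theorem ren_lam (b : ι → κ) (a : ι) : ren b (lam a : SuperPoly K N ι) = lam (b a) :=
  lift_lam _ _ _ _

@[simp] theorem ren_th (b : ι → κ) (a : ι) (i : Fin N) :
    ren b (th a i : SuperPoly K N ι) = th (b a) i :=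
  lift_th _ _ _ _ _

@[simp] theorem involute_lam (a : ι) : involute (lam a : SuperPoly K N ι) = lam a :=
  lift_lam _ _ _ _

@[simp] theorem involute_th (a : ι) (i : Fin N) :
    involute (th a i : SuperPoly K N ι) = -th a i :=
  lift_th _ _ _ _ _

@[simp] theorem linSubst_lam [Fintype κ] (c : ι → κ → ℤ) (a : ι) :
    linSubst c (lam a : SuperPoly K N ι) = ∑ k, c a k • lam k :=
  lift_lam _ _ _ _

@[simp] theorem linSubst_th [Fintype κ] (c : ι → κ → ℤ) (a : ι) (i : Fin N) :
    linSubst c (th a i : SuperPoly K N ι) = ∑ k, c a k • th k i :=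
  lift_th _ _ _ _ _

theorem linSubst_eq_ren [Fintype κ] [DecidableEq κ] (c : ι → κ → ℤ) (b : ι → κ)
    (h : ∀ a k, c a k = if k = b a then 1 else 0) :
    (linSubst c : SuperPoly K N ι →ₐ[K] SuperPoly K N κ) = ren b :=
  hom_ext (fun a => by simp [h]) (fun a i => by simp [h])

theorem involute_comp_involute :
    (involute : SuperPoly K N ι →ₐ[K] SuperPoly K N ι).comp involute = AlgHom.id K _ :=
  hom_ext (fun a => by simp) (fun a i => by simp)

@[simp] theorem involute_involute (a : SuperPoly K N ι) : involute (involute a) = a :=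
  DFunLike.congr_fun involute_comp_involute a

theorem involute_ren (b : ι → κ) (a : SuperPoly K N ι) : involute (ren b a) = ren b (involute a) :=
  DFunLike.congr_fun (hom_ext (f := involute.comp (ren b)) (g := (ren b).comp involute)
    (fun a => by simp) (fun a i => by simp)) a

theorem involute_linSubst [Fintype κ] (c : ι → κ → ℤ) (a : SuperPoly K N ι) :
    involute (linSubst c a) = linSubst c (involute a) :=
  DFunLike.congr_fun (hom_ext (f := involute.comp (linSubst c)) (g := (linSubst c).comp involute)
    (fun a => by simp) (fun a i => by simp)) a

theorem lam_comm (k : ι) (a : SuperPoly K N ι) : a * lam k = lam k * a := by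
  induction a using induction_on with
  | hr r => exact Algebra.commutes r _
  | hl i => exact superCommute_gen.ll _ _
  | ht i j => exact (superCommute_gen.lt _ _ _).symm
  | hmul a b ha hb => rw [mul_assoc, hb, ← mul_assoc, ha, mul_assoc]
  | hadd a b ha hb => rw [add_mul, mul_add, ha, hb]

theorem th_comm (k : ι) (j : Fin N) (a : SuperPoly K N ι) : a * th k j = th k j * involute a := by
  induction a using induction_on with
  | hr r => rw [AlgHom.commutes]; exact Algebra.commutes r _
  | hl i => rw [involute_lam]; exact superCommute_gen.lt _ _ _
  | ht i j => rw [involute_th, mul_neg]; exact superCommute_gen.tt _ _ _ _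
  | hmul a b ha hb => rw [mul_assoc, hb, ← mul_assoc, ha, mul_assoc, map_mul]
  | hadd a b ha hb => rw [add_mul, ha, hb, map_add, mul_add]

theorem signBy_zero : (signBy 0 : SuperPoly K N ι →ₗ[K] SuperPoly K N ι) = LinearMap.id := rfl

theorem signBy_one :
    (signBy 1 : SuperPoly K N ι →ₗ[K] SuperPoly K N ι) = involute.toLinearMap := rfl

theorem signBy_mul (p : ZMod 2) (a b : SuperPoly K N ι) :
    signBy p (a * b) = signBy p a * signBy p b := by
  rcases zmod_two_cases p with rfl | rfl <;> simp [signBy_zero, signBy_one]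

@[simp] theorem signBy_apply_one (p : ZMod 2) : signBy p (1 : SuperPoly K N ι) = 1 := by
  rcases zmod_two_cases p with rfl | rfl <;> simp [signBy_zero, signBy_one]

@[simp] theorem signBy_th (p : ZMod 2) (k : ι) (i : Fin N) :
    signBy p (th k i : SuperPoly K N ι) = ksign p • th k i := by
  rcases zmod_two_cases p with rfl | rfl <;> simp [signBy_zero, signBy_one]

theorem signBy_ren (p : ZMod 2) (b : ι → κ) (a : SuperPoly K N ι) :
    signBy p (ren b a) = ren b (signBy p a) := by
  rcases zmod_two_cases p with rfl | rfl <;> simp [signBy_zero, signBy_one, involute_ren]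

theorem mem_parity {p : ZMod 2} {a : SuperPoly K N ι} :
    a ∈ parity p ↔ involute a = ksign p • a := Iff.rfl

theorem signBy_of_mem (p q : ZMod 2) {a : SuperPoly K N ι} (ha : a ∈ parity q) :
    signBy p a = ksign (p * q) • a := by
  rcases zmod_two_cases p with rfl | rfl
  · simp [signBy_zero]
  · rw [one_mul]; exact ha

theorem ren_mem_parity {p : ZMod 2} (b : ι → κ) {a : SuperPoly K N ι} (ha : a ∈ parity p) :
    ren b a ∈ parity p := by
  rw [mem_parity, involute_ren, mem_parity.1 ha, map_zsmul]

/-- Every superpolynomial is the sum of an even one and an odd one. -/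
theorem exists_parity_decomposition [CharZero K] (a : SuperPoly K N ι) :
    ∃ a₀ ∈ parity (K := K) (N := N) (ι := ι) 0, ∃ a₁ ∈ parity (K := K) (N := N) (ι := ι) 1,
      a = a₀ + a₁ := by
  refine ⟨(2 : K)⁻¹ • (a + involute a), ?_, (2 : K)⁻¹ • (a - involute a), ?_, ?_⟩
  · rw [mem_parity]
    simp [add_comm]
  · rw [mem_parity]
    simp [← smul_neg]
  · rw [← smul_add, add_add_sub_cancel, ← two_smul K a, smul_smul, inv_mul_cancel₀ two_ne_zero,
      one_smul]

/-- The defining relations only give `2 (θ^i)^2 = 0`. -/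
theorem th_mul_self [CharZero K] (k : ι) (i : Fin N) :
    (th k i * th k i : SuperPoly K N ι) = 0 := by
  have h : (th k i * th k i : SuperPoly K N ι) = -(th k i * th k i) :=
    superCommute_gen.tt k k i i
  have h2 : (2 : K) • (th k i * th k i : SuperPoly K N ι) = 0 := by
    rw [two_smul]; exact add_eq_zero_iff_eq_neg.2 h
  exact (smul_eq_zero.1 h2).resolve_left two_ne_zero

/-! ### Monomials and the Berezin integral -/

/-- The product `θ^{i_1} ⋯ θ^{i_r}` in one supervariable. -/
def thWord (l : List (Fin N)) : SuperPoly K N Unit := (l.map (th ())).prod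

@[simp] theorem thWord_nil : thWord (K := K) ([] : List (Fin N)) = 1 := rfl

@[simp] theorem thWord_cons (i : Fin N) (l : List (Fin N)) :
    thWord (K := K) (i :: l) = th () i * thWord l := by simp [thWord]

theorem thWord_append (l l' : List (Fin N)) :
    thWord (K := K) (l ++ l') = thWord l * thWord l' := by simp [thWord]

theorem thWord_perm {l l' : List (Fin N)} (h : l.Perm l') :
    thWord (K := K) l = thWord l' ∨ thWord (K := K) l = -thWord l' := by
  induction h with
  | nil => exact Or.inl rfl
  | cons x _ ih => rcases ih with h | h <;> simp [h]
  | swap x y l =>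
    right
    rw [thWord_cons, thWord_cons, thWord_cons, thWord_cons, ← mul_assoc, superCommute_gen.tt,
      neg_mul, mul_assoc]
  | trans _ _ h1 h2 =>
    rcases h1 with h1 | h1 <;> rcases h2 with h2 | h2 <;> simp [h1, h2]

theorem th_mul_thWord_of_mem [CharZero K] {i : Fin N} {l : List (Fin N)} (h : i ∈ l) :
    th () i * thWord (K := K) l = 0 := by
  rcases thWord_perm (K := K) (List.perm_cons_erase h) with h | h <;>
    simp [h, ← mul_assoc, th_mul_self]

theorem thWord_of_not_nodup [CharZero K] {l : List (Fin N)} (h : ¬ l.Nodup) :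
    thWord (K := K) l = 0 := by
  induction l with
  | nil => simp at h
  | cons i l ih =>
    rw [thWord_cons]
    by_cases hi : i ∈ l
    · exact th_mul_thWord_of_mem hi
    · rw [ih (fun hl => h (List.nodup_cons.2 ⟨hi, hl⟩)), mul_zero]

theorem involute_thWord (l : List (Fin N)) :
    involute (thWord (K := K) l) = ksign l.length • thWord l := by
  induction l with
  | nil => simp
  | cons i l ih =>
    rw [thWord_cons, map_mul, ih, involute_th, List.length_cons, Nat.cast_add, Nat.cast_one,
      ksign_add, ksign_one, mul_neg_one, neg_smul, mul_smul_comm, neg_mul, smul_neg]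

theorem dlam_thWord (l : List (Fin N)) : dlam () (thWord (K := K) l) = 0 := by
  induction l with
  | nil => exact dlam_one _
  | cons i l ih => rw [thWord_cons, dlam_mul, dlam_th, ih]; simp

theorem resCoeff_thWord_ofFn {n : ℕ} (v : Fin n → Fin N) :
    resCoeff (thWord (K := K) (List.ofFn v)) =
      (Pi.single N (Pi.basisFun K (Fin N)).det :
        ∀ i : ℕ, AlternatingMap K (Fin N → K) K (Fin i)) n (fun k => Pi.single (v k) 1) := by
  have : toExterior (thWord (K := K) (List.ofFn v)) =
      ExteriorAlgebra.ιMulti K n (fun k => (Pi.single (v k) 1 : Fin N → K)) := by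
    rw [ExteriorAlgebra.ιMulti_apply, thWord, List.map_ofFn, map_list_prod, List.map_ofFn]
    congr 2
    funext k
    simp [toExterior]
  rw [resCoeff, LinearMap.comp_apply]
  erw [this]
  exact ExteriorAlgebra.liftAlternating_apply_ιMulti _ _

theorem resCoeff_thWord_of_length_ne {l : List (Fin N)} (h : l.length ≠ N) :
    resCoeff (thWord (K := K) l) = 0 := by
  conv_lhs => rw [← List.ofFn_get l]
  rw [resCoeff_thWord_ofFn, Pi.single_eq_of_ne h]
  rfl

theorem resCoeff_thWord_ne_zero {l : List (Fin N)} (h : l.length = N) (hl : l.Nodup) :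
    resCoeff (thWord (K := K) l) ≠ 0 := by
  have key : ∀ (n : ℕ) (_ : n = N) (v : Fin n → Fin N), Function.Injective v →
      resCoeff (thWord (K := K) (List.ofFn v)) ≠ 0 := by
    rintro n rfl v hv
    rw [resCoeff_thWord_ofFn, Pi.single_eq_same]
    have := (Pi.basisFun K (Fin n)).det.map_perm (Pi.basisFun K (Fin n))
      (Equiv.ofBijective v (Finite.injective_iff_bijective.1 hv))
    rw [Module.Basis.det_self] at this
    have h2 : (Pi.basisFun K (Fin n)).det (fun k => Pi.single (v k) 1) =
        (Pi.basisFun K (Fin n)).det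
          (⇑(Pi.basisFun K (Fin n)) ∘ (Equiv.ofBijective v
            (Finite.injective_iff_bijective.1 hv))) := by
      congr 1
      funext k
      simp
    rw [h2, this]
    rcases Int.units_eq_one_or (Equiv.Perm.sign
      (Equiv.ofBijective v (Finite.injective_iff_bijective.1 hv))) with h | h <;> simp [h]
  have := key l.length h l.get (List.nodup_iff_injective_get.1 hl)
  rwa [List.ofFn_get] at this

theorem resCoeff_thWord_finRange : resCoeff (thWord (K := K) (List.finRange N)) = 1 := by
  rw [← List.ofFn_id, resCoeff_thWord_ofFn, Pi.single_eq_same]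
  have := Module.Basis.det_self (Pi.basisFun K (Fin N))
  refine Eq.trans ?_ this
  congr 1
  funext k
  simp

theorem resCoeff_lam_mul (a : SuperPoly K N Unit) : resCoeff (lam () * a) = 0 := by
  simp [resCoeff, toExterior]

/-- The monomial `λ^m θ^I`, with the `θ^i`, `i ∈ I`, in increasing order. -/
def mon (x : ℕ × Finset (Fin N)) : SuperPoly K N Unit := lam () ^ x.1 * thWord x.2.sort

theorem th_mul_thWord_sort [CharZero K] (i : Fin N) (I : Finset (Fin N)) :
    th () i * thWord (K := K) I.sort = 0 ∨
      th () i * thWord (K := K) I.sort = thWord (insert i I).sort ∨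
        th () i * thWord (K := K) I.sort = -thWord (insert i I).sort := by
  by_cases hi : i ∈ I
  · exact Or.inl (th_mul_thWord_of_mem ((Finset.mem_sort _).2 hi))
  · right
    rw [← thWord_cons]
    refine thWord_perm ((List.perm_ext_iff_of_nodup ?_ (Finset.sort_nodup _ _)).2 ?_)
    · rw [List.nodup_cons]
      exact ⟨fun h => hi ((Finset.mem_sort _).1 h), Finset.sort_nodup _ _⟩
    · intro j
      simp

theorem mon_span [CharZero K] :
    ⊤ ≤ Submodule.span K (Set.range (mon (K := K) (N := N))) := by
  have hlam : ∀ x ∈ Submodule.span K (Set.range (mon (K := K) (N := N))),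
      lam () * x ∈ Submodule.span K (Set.range (mon (K := K) (N := N))) := by
    intro x hx
    induction hx using Submodule.span_induction with
    | mem x hx =>
      obtain ⟨⟨m, I⟩, rfl⟩ := hx
      refine Submodule.subset_span ⟨(m + 1, I), ?_⟩
      simp only [mon]
      rw [pow_succ', mul_assoc]
    | zero => simp
    | add x y _ _ hx hy => rw [mul_add]; exact add_mem hx hy
    | smul c x _ hx => rw [mul_smul_comm]; exact Submodule.smul_mem _ _ hx
  have hth : ∀ i, ∀ x ∈ Submodule.span K (Set.range (mon (K := K) (N := N))),
      th () i * x ∈ Submodule.span K (Set.range (mon (K := K) (N := N))) := by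
    intro i x hx
    induction hx using Submodule.span_induction with
    | mem x hx =>
      obtain ⟨⟨m, I⟩, rfl⟩ := hx
      have hc : th () i * mon (K := K) (m, I) = lam () ^ m * (th () i * thWord I.sort) := by
        simp only [mon]
        rw [← mul_assoc, ← mul_assoc, th_comm, map_pow, involute_lam]
      rw [hc]
      rcases th_mul_thWord_sort (K := K) i I with h | h | h
      · rw [h, mul_zero]; exact zero_mem _
      · rw [h]; exact Submodule.subset_span ⟨(m, insert i I), rfl⟩
      · rw [h, mul_neg]; exact neg_mem (Submodule.subset_span ⟨(m, insert i I), rfl⟩)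
    | zero => simp
    | add x y _ _ hx hy => rw [mul_add]; exact add_mem hx hy
    | smul c x _ hx => rw [mul_smul_comm]; exact Submodule.smul_mem _ _ hx
  have key : ∀ a : SuperPoly K N Unit, ∀ x ∈ Submodule.span K (Set.range (mon (K := K) (N := N))),
      a * x ∈ Submodule.span K (Set.range (mon (K := K) (N := N))) := by
    intro a
    induction a using induction_on with
    | hr r => intro x hx; rw [← Algebra.smul_def]; exact Submodule.smul_mem _ _ hx
    | hl i => exact hlam
    | ht i j => exact hth j
    | hmul a b ha hb => intro x hx; rw [mul_assoc]; exact ha _ (hb _ hx)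
    | hadd a b ha hb => intro x hx; rw [add_mul]; exact add_mem (ha _ hx) (hb _ hx)
  intro a _
  have := key a 1 (Submodule.subset_span ⟨(0, ∅), by simp [mon]⟩)
  rwa [mul_one] at this

theorem dlam_mon (m : ℕ) (I : Finset (Fin N)) :
    dlam () (mon (K := K) (m, I)) = (m : K) • mon (m - 1, I) := by
  have hp : ∀ m : ℕ, dlam () (lam () ^ m : SuperPoly K N Unit) = (m : K) • lam () ^ (m - 1) := by
    intro m
    induction m with
    | zero => simp [dlam_one]
    | succ m ih =>
      rw [pow_succ, dlam_mul, ih, dlam_lam]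
      rcases m with _ | m
      · simp
      · simp only [if_true, mul_one, Nat.add_sub_cancel, smul_mul_assoc, ← pow_succ]
        rw [Nat.cast_add (m + 1) 1, Nat.cast_one, add_smul, one_smul]
  simp only [mon]
  rw [dlam_mul, dlam_thWord, mul_zero, add_zero, hp, smul_mul_assoc]

theorem dlam_pow_mon (n m : ℕ) (I : Finset (Fin N)) :
    (dlam () ^ n : Module.End K (SuperPoly K N Unit)) (mon (K := K) (m, I)) =
      (m.descFactorial n : K) • mon (m - n, I) := by
  induction n with
  | zero => simp
  | succ n ih =>
    rw [pow_succ', Module.End.mul_apply, ih, map_smul, dlam_mon, smul_smul, Nat.descFactorial_succ,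
      Nat.sub_sub]
    push_cast
    rw [mul_comm]

theorem resCoeff_thWord_mul_mon_succ (l : List (Fin N)) (m : ℕ) (I : Finset (Fin N)) :
    resCoeff (thWord (K := K) l * mon (m + 1, I)) = 0 := by
  simp only [mon]
  rw [pow_succ', mul_assoc (lam ()), ← mul_assoc, lam_comm, mul_assoc, resCoeff_lam_mul]

theorem resCoeff_thWord_mul_mon_of_ne [CharZero K] {I J : Finset (Fin N)} (h : I ≠ J) :
    resCoeff (thWord (K := K) (Iᶜ).sort * mon (0, J)) = 0 := by
  simp only [mon, pow_zero, one_mul]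
  rw [← thWord_append]
  by_cases hn : ((Iᶜ).sort ++ J.sort).Nodup
  · refine resCoeff_thWord_of_length_ne fun hlen => h ?_
    have hd := (List.nodup_append.1 hn).2.2
    have hJI : J ⊆ I := by
      intro j hj
      by_contra hjI
      exact hd j (by simpa using hjI) j (by simpa using hj) rfl
    refine (Finset.eq_of_subset_of_card_le hJI ?_).symm
    simp only [List.length_append, Finset.length_sort, Finset.card_compl, Fintype.card_fin] at hlen
    have := I.card_le_univ
    simp only [Fintype.card_fin] at this
    omega
  · rw [thWord_of_not_nodup hn, map_zero]

theorem resCoeff_thWord_mul_mon_ne_zero (I : Finset (Fin N)) :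
    resCoeff (thWord (K := K) (Iᶜ).sort * mon (0, I)) ≠ 0 := by
  simp only [mon, pow_zero, one_mul]
  rw [← thWord_append]
  refine resCoeff_thWord_ne_zero ?_ ?_
  · have := I.card_le_univ
    simp only [Fintype.card_fin] at this
    simp only [List.length_append, Finset.length_sort, Finset.card_compl, Fintype.card_fin]
    omega
  · refine List.nodup_append.2 ⟨Finset.sort_nodup _ _, Finset.sort_nodup _ _, ?_⟩
    rintro a ha b hb rfl
    simp only [Finset.mem_sort, Finset.mem_compl] at ha hb
    exact ha hb

/-- Up to a nonzero factor, `Res_Λ(λ⁻¹ θ^J (∂/∂λ)^m ·)`, for `J` the complement of `I`, picks out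
the coefficient of `λ^m θ^I`. -/
theorem mon_linearIndependent [CharZero K] : LinearIndependent K (mon (K := K) (N := N)) := by
  refine LinearIndependent.of_pairwise_dual_eq_zero_one _ (fun x =>
    ((x.1.factorial : K) * resCoeff (thWord (K := K) (x.2ᶜ).sort * mon (0, x.2)))⁻¹ •
      (resCoeff ∘ₗ LinearMap.mulLeft K (thWord (x.2ᶜ).sort) ∘ₗ
        (dlam () ^ x.1 : Module.End K (SuperPoly K N Unit)))) ?_ ?_
  · rintro ⟨m, I⟩ ⟨n, J⟩ hne
    simp only [LinearMap.smul_apply, LinearMap.comp_apply, dlam_pow_mon, map_smul,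
      LinearMap.mulLeft_apply]
    refine smul_eq_zero_of_right _ ?_
    rcases lt_trichotomy n m with h | rfl | h
    · rw [Nat.descFactorial_eq_zero_iff_lt.2 h, Nat.cast_zero, zero_smul]
    · rw [Nat.sub_self, resCoeff_thWord_mul_mon_of_ne (fun h => hne (by rw [h])), smul_zero]
    · obtain ⟨d, hd⟩ : ∃ d, n - m = d + 1 := ⟨n - m - 1, by omega⟩
      rw [hd, resCoeff_thWord_mul_mon_succ, smul_zero]
  · rintro ⟨m, I⟩
    simp only [LinearMap.smul_apply, LinearMap.comp_apply, dlam_pow_mon, map_smul,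
      LinearMap.mulLeft_apply, Nat.sub_self, Nat.descFactorial_self, smul_eq_mul]
    exact inv_mul_cancel₀ (mul_ne_zero (Nat.cast_ne_zero.2 (Nat.factorial_ne_zero _))
      (resCoeff_thWord_mul_mon_ne_zero I))

/-- The monomials `λ^m θ^I` form a basis of the superpolynomials in one supervariable. -/
def monBasis [CharZero K] : Module.Basis (ℕ × Finset (Fin N)) K (SuperPoly K N Unit) :=
  Module.Basis.mk mon_linearIndependent mon_span

@[simp] theorem monBasis_apply [CharZero K] (x : ℕ × Finset (Fin N)) :
    monBasis (K := K) x = mon x := by simp [monBasis]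

theorem resCoeff_involute [CharZero K] (a : SuperPoly K N Unit) :
    resCoeff (involute a) = ksign N • resCoeff a := by
  have : resCoeff ∘ₗ (involute (K := K) (N := N) (ι := Unit)).toLinearMap =
      ksign N • resCoeff := by
    refine monBasis.ext fun ⟨m, I⟩ => ?_
    rw [monBasis_apply]
    rcases m with _ | m
    · simp only [mon, pow_zero, one_mul, LinearMap.comp_apply, AlgHom.toLinearMap_apply,
        LinearMap.smul_apply]
      rw [involute_thWord, map_zsmul]
      by_cases h : I.sort.length = N
      · rw [h]
      · rw [resCoeff_thWord_of_length_ne h, smul_zero, smul_zero]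
    · simp only [mon, LinearMap.comp_apply, AlgHom.toLinearMap_apply, LinearMap.smul_apply, map_mul,
        map_pow, involute_lam]
      rw [pow_succ', mul_assoc, mul_assoc, resCoeff_lam_mul, resCoeff_lam_mul, smul_zero]
  exact LinearMap.congr_fun this a

theorem resCoeff_signBy [CharZero K] (p : ZMod 2) (a : SuperPoly K N Unit) :
    resCoeff (signBy p a) = ksign (p * N) • resCoeff a := by
  rcases zmod_two_cases p with rfl | rfl
  · simp [signBy_zero]
  · simpa [signBy_one] using resCoeff_involute a

end SuperPoly

section Module

variable {K : Type*} [Field K] {N : ℕ} {V : Type*} [AddCommGroup V] [Module K V]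

namespace PolyV

variable {ι κ J : Type} {W : Type*} [AddCommGroup W] [Module K W]

/-! ### Operators on superpolynomials with coefficients -/

@[simp] theorem mulOp_apply (b : SuperPoly K N κ) (x : PolyV K N κ W) : mulOp b x = b • x := by
  induction x using TensorProduct.induction_on with
  | zero => simp
  | tmul a v => simp [mulOp, TensorProduct.smul_tmul']
  | add x y hx hy => rw [map_add, hx, hy, smul_add]

@[simp] theorem evenOp_tmul (f : Module.End K W) (a : SuperPoly K N κ) (w : W) :
    evenOp f (a ⊗ₜ[K] w) = a ⊗ₜ f w := rfl

@[simp] theorem oddOp_tmul (f : Module.End K W) (a : SuperPoly K N κ) (w : W) :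
    oddOp f (a ⊗ₜ[K] w) = SuperPoly.involute a ⊗ₜ f w := rfl

theorem evenOp_smul (f : Module.End K W) (a : SuperPoly K N κ) (x : PolyV K N κ W) :
    evenOp f (a • x) = a • evenOp f x := by
  induction x using TensorProduct.induction_on with
  | zero => simp
  | tmul b v => simp [TensorProduct.smul_tmul']
  | add x y hx hy => rw [smul_add, map_add, hx, hy, map_add, smul_add]

theorem oddOp_smul (f : Module.End K W) (a : SuperPoly K N κ) (x : PolyV K N κ W) :
    oddOp f (a • x) = SuperPoly.involute a • oddOp f x := by
  induction x using TensorProduct.induction_on with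
  | zero => simp
  | tmul b v => simp [TensorProduct.smul_tmul']
  | add x y hx hy => rw [smul_add, map_add, hx, hy, map_add, smul_add]

/-- The derivation `∂/∂λ` of the coefficients. -/
def dlamOp : Module.End K (PolyV K N Unit W) :=
  TensorProduct.map (SuperPoly.dlam ()) LinearMap.id

@[simp] theorem dlamOp_tmul (a : SuperPoly K N Unit) (w : W) :
    dlamOp (a ⊗ₜ[K] w) = SuperPoly.dlam () a ⊗ₜ w := rfl

theorem dlamOp_smul (a : SuperPoly K N Unit) (x : PolyV K N Unit W) :
    dlamOp (a • x) = SuperPoly.dlam () a • x + a • dlamOp x := by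
  induction x using TensorProduct.induction_on with
  | zero => simp
  | tmul b v => simp [TensorProduct.smul_tmul', SuperPoly.dlam_mul, TensorProduct.add_tmul]
  | add x y hx hy => rw [smul_add, map_add, hx, hy, map_add, smul_add, smul_add]; abel

@[simp] theorem res_tmul (a : SuperPoly K N Unit) (w : V) :
    res (a ⊗ₜ[K] w) = SuperPoly.resCoeff a • w := by
  simp [res]

/-- An element of `W[Λ]` that is annihilated by `∂/∂λ` does not contain `λ`. -/
theorem mem_span_of_dlamOp_eq_zero [CharZero K] {F : PolyV K N Unit W} (h : dlamOp F = 0) :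
    F ∈ Submodule.span K {x : PolyV K N Unit W | ∃ (I : Finset (Fin N)) (w : W),
      x = SuperPoly.thWord I.sort ⊗ₜ[K] w} := by
  classical
  have key : ∀ (G : PolyV K N Unit W) (m : ℕ) (I : Finset (Fin N)),
      TensorProduct.equivFinsuppOfBasisLeft SuperPoly.monBasis (dlamOp G) (m, I) =
        ((m : K) + 1) •
          TensorProduct.equivFinsuppOfBasisLeft SuperPoly.monBasis G (m + 1, I) := by
    intro G m I
    have hc : ∀ a : SuperPoly K N Unit, SuperPoly.monBasis.repr (SuperPoly.dlam () a) (m, I) =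
        ((m : K) + 1) * SuperPoly.monBasis.repr a (m + 1, I) := by
      intro a
      have : (Finsupp.lapply (m, I)) ∘ₗ SuperPoly.monBasis.repr.toLinearMap ∘ₗ
          SuperPoly.dlam () = ((m : K) + 1) • ((Finsupp.lapply (m + 1, I)) ∘ₗ
            (SuperPoly.monBasis (K := K) (N := N)).repr.toLinearMap) := by
        refine SuperPoly.monBasis.ext fun ⟨n, I'⟩ => ?_
        simp only [SuperPoly.monBasis_apply, LinearMap.comp_apply, LinearMap.smul_apply,
          SuperPoly.dlam_mon, map_smul]
        rw [← SuperPoly.monBasis_apply, ← SuperPoly.monBasis_apply]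
        simp only [LinearEquiv.coe_coe, Module.Basis.repr_self, Finsupp.lapply_apply,
          Finsupp.single_apply, Prod.mk.injEq, smul_eq_mul]
        rcases n with _ | n
        · simp
        · by_cases hnm : n = m
          · subst hnm; by_cases hI : I' = I <;> simp [hI]
          · simp [hnm]
      exact LinearMap.congr_fun this a
    induction G using TensorProduct.induction_on with
    | zero => simp
    | tmul a w => simp [TensorProduct.equivFinsuppOfBasisLeft_apply_tmul, hc, mul_smul]
    | add x y hx hy =>
      rw [map_add, map_add, Finsupp.add_apply, hx, hy, map_add, Finsupp.add_apply, smul_add]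
  rw [← (TensorProduct.equivFinsuppOfBasisLeft SuperPoly.monBasis).symm_apply_apply F,
    TensorProduct.equivFinsuppOfBasisLeft_symm_apply]
  refine Submodule.sum_mem _ fun x hx => ?_
  obtain ⟨m, I⟩ := x
  rcases m with _ | m
  · refine Submodule.subset_span
      ⟨I, TensorProduct.equivFinsuppOfBasisLeft SuperPoly.monBasis F (0, I), ?_⟩
    simp only [SuperPoly.monBasis_apply, SuperPoly.mon, pow_zero, one_mul]
  · have := key F m I
    rw [h, map_zero, Finsupp.zero_apply] at this
    have h2 := (smul_eq_zero.1 this.symm).resolve_left (by exact_mod_cast Nat.succ_ne_zero m)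
    exact absurd h2 (Finsupp.mem_support_iff.1 hx)

/-- The Berezin integral is nondegenerate on the elements of `W[Λ]` that do not contain `λ`. -/
theorem eq_zero_of_res [CharZero K] {F : PolyV K N Unit W} (h : dlamOp F = 0)
    (hres : ∀ l : List (Fin N), res (SuperPoly.thWord (K := K) l • F) = 0) : F = 0 := by
  have hspan : ∃ g : Finset (Fin N) → W, F = ∑ I, SuperPoly.thWord I.sort ⊗ₜ[K] g I := by
    have hF := mem_span_of_dlamOp_eq_zero h
    clear h hres
    induction hF using Submodule.span_induction with
    | mem x hx =>
      obtain ⟨I, w, rfl⟩ := hx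
      refine ⟨Pi.single I w, ?_⟩
      rw [Finset.sum_eq_single I]
      · simp
      · intro J _ hJ; simp [Pi.single_eq_of_ne hJ]
      · simp
    | zero => exact ⟨0, by simp⟩
    | add x y _ _ hx hy =>
      obtain ⟨g, rfl⟩ := hx
      obtain ⟨g', rfl⟩ := hy
      exact ⟨g + g', by simp [TensorProduct.tmul_add, Finset.sum_add_distrib]⟩
    | smul c x _ hx =>
      obtain ⟨g, rfl⟩ := hx
      exact ⟨c • g, by simp [Finset.smul_sum]⟩
  obtain ⟨g, rfl⟩ := hspan
  refine Finset.sum_eq_zero fun I _ => ?_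
  -- the coefficient of `θ^I` is recovered by the integral against the complementary monomial
  have key := hres (Iᶜ).sort
  have hm : ∀ J : Finset (Fin N), SuperPoly.thWord J.sort = SuperPoly.mon (K := K) (0, J) :=
    fun J => by rw [SuperPoly.mon, pow_zero, one_mul]
  rw [Finset.smul_sum, map_sum, Finset.sum_eq_single I] at key
  · rw [TensorProduct.smul_tmul', smul_eq_mul, res_tmul, hm I] at key
    rw [(smul_eq_zero.1 key).resolve_left (SuperPoly.resCoeff_thWord_mul_mon_ne_zero I),
      TensorProduct.tmul_zero]
  · intro J _ hJ
    rw [TensorProduct.smul_tmul', smul_eq_mul, res_tmul, hm J,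
      SuperPoly.resCoeff_thWord_mul_mon_of_ne hJ.symm, zero_smul]
  · simp

/-- The Berezin integral of an element of `W[Λ]` that does not contain `λ` is multiplied by `c ^ N`
under a substitution `θ^i ↦ c θ^i + t^i`. -/
theorem res_translate_thWord [CharZero K]
    (Φ : SuperPoly K N Unit →ₐ[K] Module.End K (PolyV K N Unit W))
    (c : ℤ) (t : Fin N → Module.End K W)
    (hΦ : ∀ i, Φ (SuperPoly.th () i) = c • mulOp (SuperPoly.th () i) + oddOp (t i))
    {l : List (Fin N)} (hl : l.length ≤ N) (w : W) :
    res (Φ (SuperPoly.thWord l) (1 ⊗ₜ[K] w)) =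
      c ^ N • SuperPoly.resCoeff (SuperPoly.thWord (K := K) l) • w := by
  -- `Fil n` is spanned by the words in fewer than `n` odd variables, which are killed by the
  -- integral if `n ≤ N`. Modulo `Fil n`, the substitution multiplies a word of length `n` by
  -- `c ^ n`.
  let Fil : ℕ → Submodule K (PolyV K N Unit W) := fun n => Submodule.span K
    {x | ∃ (l : List (Fin N)) (w : W), l.length < n ∧ x = SuperPoly.thWord l ⊗ₜ[K] w}
  have hA : ∀ i (l : List (Fin N)) w, Φ (SuperPoly.th () i) (SuperPoly.thWord l ⊗ₜ[K] w) =
      c • (SuperPoly.thWord (i :: l) ⊗ₜ[K] w) +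
        ksign l.length • (SuperPoly.thWord l ⊗ₜ[K] t i w) := by
    intro i l w
    rw [hΦ, LinearMap.add_apply, LinearMap.smul_apply, mulOp_apply, TensorProduct.smul_tmul',
      oddOp_tmul, SuperPoly.involute_thWord, smul_eq_mul, SuperPoly.thWord_cons,
      TensorProduct.smul_tmul']
    rfl
  have hmem : ∀ n l w, l.length < n → (SuperPoly.thWord l ⊗ₜ[K] w : PolyV K N Unit W) ∈ Fil n :=
    fun n l w hl => Submodule.subset_span ⟨l, w, hl, rfl⟩
  have hΦmem : ∀ i n x, x ∈ Fil n → Φ (SuperPoly.th () i) x ∈ Fil (n + 1) := by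
    intro i n x hx
    induction hx using Submodule.span_induction with
    | mem x hx =>
      obtain ⟨l, w, hl, rfl⟩ := hx
      rw [hA]
      exact add_mem (zsmul_mem (hmem _ _ _ (by simpa using hl)) _)
        (zsmul_mem (hmem _ _ _ (by omega)) _)
    | zero => simp
    | add x y _ _ hx hy => rw [map_add]; exact add_mem hx hy
    | smul c x _ hx => rw [map_smul]; exact Submodule.smul_mem _ _ hx
  have hword : ∀ (l : List (Fin N)) (w : W), Φ (SuperPoly.thWord l) (1 ⊗ₜ[K] w) -
      c ^ l.length • (SuperPoly.thWord l ⊗ₜ[K] w) ∈ Fil l.length := by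
    intro l w
    induction l with
    | nil => simp
    | cons i l ih =>
      have h1 := hΦmem i _ _ ih
      rw [map_sub, map_zsmul, hA] at h1
      rw [SuperPoly.thWord_cons, map_mul, Module.End.mul_apply, List.length_cons]
      have h2 : c ^ l.length • ksign l.length • (SuperPoly.thWord l ⊗ₜ[K] t i w) ∈
          Fil (l.length + 1) := zsmul_mem (zsmul_mem (hmem _ _ _ (by omega)) _) _
      have h3 := add_mem h1 h2
      rw [smul_add, smul_smul, ← pow_succ,
        SuperPoly.thWord_cons] at h3
      convert h3 using 1
      abel
  have hres : ∀ n ≤ N, ∀ x ∈ Fil n, res x = 0 := by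
    intro n hn x hx
    induction hx using Submodule.span_induction with
    | mem x hx =>
      obtain ⟨l, w, hl, rfl⟩ := hx
      rw [res_tmul, SuperPoly.resCoeff_thWord_of_length_ne (by omega), zero_smul]
    | zero => simp
    | add x y _ _ hx hy => rw [map_add, hx, hy, add_zero]
    | smul c x _ hx => rw [map_smul, hx, smul_zero]
  have h := hres _ hl _ (hword l w)
  rw [map_sub, sub_eq_zero, map_zsmul, res_tmul] at h
  rw [h]
  rcases hl.eq_or_lt with h' | h'
  · rw [h']
  · rw [SuperPoly.resCoeff_thWord_of_length_ne h'.ne, zero_smul, smul_zero, smul_zero]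

theorem res_translate [CharZero K] (Φ : SuperPoly K N Unit →ₐ[K] Module.End K (PolyV K N Unit W))
    (c : ℤ) (t : Fin N → Module.End K W)
    (hΦ : ∀ i, Φ (SuperPoly.th () i) = c • mulOp (SuperPoly.th () i) + oddOp (t i))
    {F : PolyV K N Unit W} (hF : dlamOp F = 0) :
    res (TensorProduct.lift (Φ.toLinearMap.compl₂ (TensorProduct.mk K (SuperPoly K N Unit) W 1)) F)
      = c ^ N • res F := by
  have hspan := mem_span_of_dlamOp_eq_zero hF
  clear hF
  induction hspan using Submodule.span_induction with
  | mem x hx =>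
    obtain ⟨I, w, rfl⟩ := hx
    have hI : I.sort.length ≤ N := by
      rw [Finset.length_sort]; simpa using I.card_le_univ
    rw [TensorProduct.lift.tmul, LinearMap.compl₂_apply, TensorProduct.mk_apply,
      AlgHom.toLinearMap_apply, res_translate_thWord Φ c t hΦ hI, res_tmul]
  | zero => rw [map_zero, map_zero, smul_zero]
  | add x y _ _ hx hy => rw [map_add, map_add, hx, hy, map_add, smul_add]
  | smul d x _ hx => rw [map_smul, map_smul, hx, map_smul, smul_comm]

theorem res_evenOp (f : Module.End K W) (x : PolyV K N Unit W) :
    res (evenOp f x) = f (res x) := by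
  induction x using TensorProduct.induction_on with
  | zero => simp
  | tmul b v => simp
  | add x y hx hy => rw [map_add, map_add, hx, hy, map_add, map_add]

theorem res_oddOp [CharZero K] (f : Module.End K W) (x : PolyV K N Unit W) :
    res (oddOp f x) = ksign N • f (res x) := by
  induction x using TensorProduct.induction_on with
  | zero => simp
  | tmul b v => rw [oddOp_tmul, res_tmul, res_tmul, SuperPoly.resCoeff_involute, map_smul,
    smul_assoc]
  | add x y hx hy => rw [map_add, map_add, hx, hy, map_add, map_add, smul_add]

/-! ### Parity -/

/-- The parity involution of `V[Λ]`. -/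
def inv (H : HWSupermodule K N V) : Module.End K (PolyV K N ι V) :=
  TensorProduct.map SuperPoly.involute.toLinearMap (H.signBy 1)

@[simp] theorem inv_tmul (H : HWSupermodule K N V) (a : SuperPoly K N ι) (v : V) :
    inv H (a ⊗ₜ[K] v) = SuperPoly.involute a ⊗ₜ H.signBy 1 v := rfl

end PolyV

namespace HWSupermodule

theorem exists_parity_decomposition (H : HWSupermodule K N V) (v : V) :
    ∃ v₀ ∈ H.parity 0, ∃ v₁ ∈ H.parity 1, v = v₀ + v₁ := by
  have htop := ((DirectSum.isInternal_submodule_iff_iSupIndep_and_iSup_eq_top _).1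
    H.isInternal).2
  have hv : v ∈ ⨆ q, H.parity q := htop ▸ Submodule.mem_top
  induction hv using Submodule.iSup_induction' with
  | mem q x hx =>
    rcases zmod_two_cases q with rfl | rfl
    · exact ⟨x, hx, 0, zero_mem _, by simp⟩
    · exact ⟨0, zero_mem _, x, hx, by simp⟩
  | zero => exact ⟨0, zero_mem _, 0, zero_mem _, by simp⟩
  | add x y _ _ hx hy =>
    obtain ⟨a, ha, b, hb, rfl⟩ := hx
    obtain ⟨c, hc, d, hd, rfl⟩ := hy
    exact ⟨a + c, add_mem ha hc, b + d, add_mem hb hd, by abel⟩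

theorem signBy_signBy (H : HWSupermodule K N V) (p : ZMod 2) (v : V) :
    H.signBy p (H.signBy p v) = v := by
  have : H.signBy p ∘ₗ H.signBy p = LinearMap.id := by
    refine H.ext_homogeneous fun q v hv => ?_
    rw [LinearMap.comp_apply, H.signBy_of_mem p q v hv, map_zsmul, H.signBy_of_mem p q v hv,
      ksign_smul_smul, LinearMap.id_apply]
  exact LinearMap.congr_fun this v

theorem signBy_zero (H : HWSupermodule K N V) : H.signBy 0 = LinearMap.id := rfl

/-- A parity-homogeneous element has sign `(-1)^p` under the parity involution, and conversely. -/
theorem mem_parity_iff [CharZero K] (H : HWSupermodule K N V) (p : ZMod 2) (v : V) :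
    v ∈ H.parity p ↔ H.signBy 1 v = ksign p • v := by
  refine ⟨fun h => by simpa using H.signBy_of_mem 1 p v h, fun h => ?_⟩
  obtain ⟨v₀, h₀, v₁, h₁, rfl⟩ := H.exists_parity_decomposition v
  have h2 : ∀ x : V, x + x = 0 → x = 0 := fun x hx => by
    rw [← two_smul K] at hx
    exact (smul_eq_zero.1 hx).resolve_left two_ne_zero
  rw [map_add, H.signBy_of_mem 1 0 v₀ h₀, H.signBy_of_mem 1 1 v₁ h₁] at h
  rcases zmod_two_cases p with rfl | rfl
  · simp only [mul_zero, ksign_zero, one_smul, mul_one, ksign_one, neg_smul] at h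
    have : v₁ = 0 := h2 _ (by
      have := congrArg (fun x => v₀ + v₁ - x) h
      simpa using this)
    rw [this, add_zero]; exact h₀
  · simp only [mul_zero, ksign_zero, one_smul, mul_one, ksign_one, neg_smul] at h
    have : v₀ = 0 := h2 _ (by
      have := congrArg (fun x => x + v₀ + v₁) h
      simp only [neg_add_rev] at this
      rw [← sub_eq_zero] at this
      rw [← this]; abel)
    rw [this, zero_add]; exact h₁

end HWSupermodule

namespace PolyV

variable {ι κ J : Type}

theorem tmul_mem_parity (H : HWSupermodule K N V) {q r p : ZMod 2} {a : SuperPoly K N ι} {v : V}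
    (ha : a ∈ SuperPoly.parity q) (hv : v ∈ H.parity r) (h : q + r = p) :
    a ⊗ₜ[K] v ∈ parity H ι p :=
  Submodule.subset_span ⟨q, r, h, a, ha, v, hv, rfl⟩

theorem parity_induction {H : HWSupermodule K N V} {p : ZMod 2} {C : PolyV K N ι V → Prop}
    (h0 : C 0) (hadd : ∀ x y, C x → C y → C (x + y))
    (ht : ∀ q r, q + r = p → ∀ a ∈ SuperPoly.parity (K := K) (N := N) (ι := ι) q,
      ∀ v ∈ H.parity r, C (a ⊗ₜ[K] v))
    {x : PolyV K N ι V} (hx : x ∈ parity H ι p) : C x := by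
  have key : ∀ c : K, C (c • x) := by
    induction hx using Submodule.span_induction with
    | mem x hx =>
      intro c
      obtain ⟨q, r, h, a, ha, v, hv, rfl⟩ := hx
      rw [← TensorProduct.tmul_smul]
      exact ht q r h a ha _ (Submodule.smul_mem _ _ hv)
    | zero => intro c; rw [smul_zero]; exact h0
    | add x y _ _ hx hy => intro c; rw [smul_add]; exact hadd _ _ (hx c) (hy c)
    | smul d x _ hx => intro c; rw [smul_smul]; exact hx _
  simpa using key 1

theorem mem_parity_iff [CharZero K] (H : HWSupermodule K N V) (p : ZMod 2) (x : PolyV K N ι V) :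
    x ∈ parity H ι p ↔ inv H x = ksign p • x := by
  constructor
  · intro hx
    refine parity_induction (C := fun x => inv H x = ksign p • x) (by simp) ?_ ?_ hx
    · intro x y hx hy
      rw [map_add, hx, hy, smul_add]
    · rintro q r rfl a ha v hv
      rw [inv_tmul, SuperPoly.mem_parity.1 ha, (H.mem_parity_iff _ _).1 hv, ksign_add]
      simp only [← Int.cast_smul_eq_zsmul K, TensorProduct.smul_tmul_smul, Int.cast_mul]
  · intro hx
    have key : ∀ y : PolyV K N ι V, y + ksign p • inv H y ∈ parity H ι p := by
      intro y
      induction y using TensorProduct.induction_on with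
      | zero => simp
      | tmul a v =>
        obtain ⟨a₀, ha₀, a₁, ha₁, rfl⟩ := SuperPoly.exists_parity_decomposition a
        obtain ⟨v₀, hv₀, v₁, hv₁, rfl⟩ := H.exists_parity_decomposition v
        have hpure : ∀ q r (a : SuperPoly K N ι) v, a ∈ SuperPoly.parity q → v ∈ H.parity r →
            a ⊗ₜ[K] v + ksign p • inv H (a ⊗ₜ[K] v) ∈ parity H ι p := by
          intro q r a v ha hv
          rw [inv_tmul, SuperPoly.mem_parity.1 ha, (H.mem_parity_iff _ _).1 hv]
          simp only [← Int.cast_smul_eq_zsmul K, TensorProduct.smul_tmul_smul, smul_smul]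
          by_cases h : q + r = p
          · exact add_mem (tmul_mem_parity H ha hv h)
              (Submodule.smul_mem _ _ (tmul_mem_parity H ha hv h))
          · have hs : ksign p * (ksign q * ksign r) = -1 := by
              clear ha hv hx; revert h; revert p q r; decide
            have : (ksign p : K) * ((ksign q : K) * (ksign r : K)) = -1 := by exact_mod_cast hs
            rw [this, neg_one_smul, add_neg_cancel]
            exact zero_mem _
        have h00 := hpure 0 0 a₀ v₀ ha₀ hv₀
        have h01 := hpure 0 1 a₀ v₁ ha₀ hv₁
        have h10 := hpure 1 0 a₁ v₀ ha₁ hv₀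
        have h11 := hpure 1 1 a₁ v₁ ha₁ hv₁
        have := add_mem (add_mem h00 h01) (add_mem h10 h11)
        convert this using 1
        simp only [TensorProduct.tmul_add, TensorProduct.add_tmul, map_add, smul_add]
        abel
      | add x y hx hy =>
        have := add_mem hx hy
        convert this using 1
        rw [map_add, smul_add]; abel
    have h2 := key x
    rw [hx, ksign_smul_smul, ← two_smul K] at h2
    exact (Submodule.smul_mem_iff _ (two_ne_zero (α := K))).1 h2

/-- The Berezin integral has parity `N`. -/
theorem res_mem_parity [CharZero K] (H : HWSupermodule K N V) {p : ZMod 2} {x : PolyV K N Unit V}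
    (hx : x ∈ parity H Unit p) : res x ∈ H.parity (p + N) := by
  rw [HWSupermodule.mem_parity_iff]
  have h1 : ∀ y : PolyV K N Unit V, res (inv H y) = ksign N • H.signBy 1 (res y) := by
    intro y
    induction y using TensorProduct.induction_on with
    | zero => simp
    | tmul b v =>
      rw [inv_tmul, res_tmul, res_tmul, SuperPoly.resCoeff_involute, map_smul, smul_assoc]
    | add x y hx hy => rw [map_add, map_add, hx, hy, map_add, map_add, smul_add]
  have h2 := h1 x
  rw [(mem_parity_iff H p x).1 hx, map_zsmul] at h2
  rw [add_comm, ksign_add, mul_smul, h2, ksign_smul_smul]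

/-! ### Sign-twisted extensions to polynomials -/

section Twist

variable {M : Type*} [AddCommGroup M] [Module K M] [Module (SuperPoly K N κ) M]
  [IsScalarTower K (SuperPoly K N κ) M]

/-- The map `a ⊗ v ↦ (-1)^{p · p(a)} ρ(a) g(v)` for a substitution `ρ` into a module over
the superpolynomials. -/
def twist (ρ : SuperPoly K N ι →ₐ[K] SuperPoly K N κ) (p : ZMod 2) (g : V →ₗ[K] M) :
    PolyV K N ι V →ₗ[K] M :=
  TensorProduct.lift (((Algebra.lsmul K K M).toLinearMap ∘ₗ ρ.toLinearMap ∘ₗ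
    SuperPoly.signBy p).compl₂ g)

@[simp] theorem twist_tmul (ρ : SuperPoly K N ι →ₐ[K] SuperPoly K N κ) (p : ZMod 2)
    (g : V →ₗ[K] M) (a : SuperPoly K N ι) (v : V) :
    twist ρ p g (a ⊗ₜ v) = ρ (SuperPoly.signBy p a) • g v := rfl

theorem twist_smul (ρ : SuperPoly K N ι →ₐ[K] SuperPoly K N κ) (p : ZMod 2)
    (g : V →ₗ[K] M) (a : SuperPoly K N ι) (x : PolyV K N ι V) :
    twist ρ p g (a • x) = ρ (SuperPoly.signBy p a) • twist ρ p g x := by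
  induction x using TensorProduct.induction_on with
  | zero => simp
  | tmul b v => simp [TensorProduct.smul_tmul', SuperPoly.signBy_mul, mul_smul]
  | add x y hx hy => rw [smul_add, map_add, hx, hy, map_add, smul_add]

/-- On elements of parity `P` a sign depending on the coefficient in `V` can be traded for a sign
depending on the polynomial. -/
theorem twist_comp_signBy (H : HWSupermodule K N V) (ρ : SuperPoly K N ι →ₐ[K] SuperPoly K N κ)
    (s r : ZMod 2) (g : V →ₗ[K] M) {P : ZMod 2} {x : PolyV K N ι V} (hx : x ∈ parity H ι P) :
    twist ρ s (g ∘ₗ H.signBy r) x = ksign (r * P) • twist ρ (s + r) g x := by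
  refine parity_induction
    (C := fun x => twist ρ s (g ∘ₗ H.signBy r) x = ksign (r * P) • twist ρ (s + r) g x)
    (by simp) ?_ ?_ hx
  · intro x y hx hy
    rw [map_add, hx, hy, map_add, smul_add]
  · rintro q r' rfl a ha v hv
    rw [twist_tmul, twist_tmul, LinearMap.comp_apply, H.signBy_of_mem r r' v hv,
      SuperPoly.signBy_of_mem s q ha, SuperPoly.signBy_of_mem (s + r) q ha]
    simp only [map_zsmul, smul_assoc]
    rw [smul_comm (ρ a), smul_smul, smul_smul]
    congr 1
    clear ha hv hx
    revert q r s r'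
    decide

theorem twist_smul_map (ρ : SuperPoly K N ι →ₐ[K] SuperPoly K N κ) (p : ZMod 2)
    (c : ℤ) (g : V →ₗ[K] M) (x : PolyV K N ι V) : twist ρ p (c • g) x = c • twist ρ p g x := by
  induction x using TensorProduct.induction_on with
  | zero => simp
  | tmul b v => rw [twist_tmul, twist_tmul, LinearMap.smul_apply, smul_comm]
  | add x y hx hy => rw [map_add, hx, hy, map_add, smul_add]

end Twist

theorem extend_eq_twist (p : ZMod 2) (g : V →ₗ[K] PolyV K N κ V) :
    extend p g = twist (AlgHom.id K _) p g := rfl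

end PolyV

namespace PolyV

variable {ι κ J : Type} {W : Type*} [AddCommGroup W] [Module K W]

/-! ### Substitution of operators -/

@[simp] theorem act_inl_lam {l : J → Module.End K W} {t : J → Fin N → Module.End K W}
    (h : SuperCommute l t) (k : κ) :
    act h (SuperPoly.lam (Sum.inl k)) = mulOp (SuperPoly.lam k) :=
  SuperPoly.lift_lam _ _ _ _

@[simp] theorem act_inr_lam {l : J → Module.End K W} {t : J → Fin N → Module.End K W}
    (h : SuperCommute l t) (j : J) :
    act (κ := κ) h (SuperPoly.lam (Sum.inr j)) = evenOp (l j) :=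
  SuperPoly.lift_lam _ _ _ _

@[simp] theorem act_inl_th {l : J → Module.End K W} {t : J → Fin N → Module.End K W}
    (h : SuperCommute l t) (k : κ) (i : Fin N) :
    act h (SuperPoly.th (Sum.inl k) i) = mulOp (SuperPoly.th k i) :=
  SuperPoly.lift_th _ _ _ _ _

@[simp] theorem act_inr_th {l : J → Module.End K W} {t : J → Fin N → Module.End K W}
    (h : SuperCommute l t) (j : J) (i : Fin N) :
    act (κ := κ) h (SuperPoly.th (Sum.inr j) i) = oddOp (t j i) :=
  SuperPoly.lift_th _ _ _ _ _

@[simp] theorem evalNabla_tmul {l : J → Module.End K W} {t : J → Fin N → Module.End K W}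
    (h : SuperCommute l t) (a : SuperPoly K N (κ ⊕ J)) (w : W) :
    evalNabla h (a ⊗ₜ[K] w) = act h a (1 ⊗ₜ w) := rfl

@[simp] theorem subst_tmul [Fintype κ] (c : ι → κ → ℤ) (a : SuperPoly K N ι) (w : W) :
    subst c (a ⊗ₜ[K] w) = SuperPoly.linSubst c a ⊗ₜ w := rfl

/-- The substitution of polynomials without `∇` is multiplication. -/
theorem act_ren_inl {l : J → Module.End K W} {t : J → Fin N → Module.End K W}
    (h : SuperCommute l t) (b : ι → κ) (a : SuperPoly K N ι) (x : PolyV K N κ W) :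
    act h (SuperPoly.ren (fun k => Sum.inl (b k)) a) x = SuperPoly.ren b a • x :=
  SuperPoly.intertwine ((act h).comp (SuperPoly.ren fun k => Sum.inl (b k)))
    ((Algebra.lsmul K K (PolyV K N κ W)).comp (SuperPoly.ren b)) LinearMap.id
    (fun i z => by simp) (fun i j z => by simp) a x

theorem inv_smul (H : HWSupermodule K N V) (a : SuperPoly K N κ) (x : PolyV K N κ V) :
    inv H (a • x) = SuperPoly.involute a • inv H x := by
  induction x using TensorProduct.induction_on with
  | zero => simp
  | tmul b v => simp [TensorProduct.smul_tmul']
  | add x y hx hy => rw [smul_add, map_add, hx, hy, map_add, smul_add]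

/-- Substitution of `∇` is compatible with the parity involution. -/
theorem inv_act (H : HWSupermodule K N V) (a : SuperPoly K N (κ ⊕ Unit)) (x : PolyV K N κ V) :
    inv H (act H.superCommute a x) = act H.superCommute (SuperPoly.involute a) (inv H x) := by
  refine SuperPoly.intertwine (act H.superCommute)
    ((act H.superCommute).comp SuperPoly.involute) (inv H) ?_ ?_ a x
  · rintro (i | i) z
    · simp [inv_smul]
    · simp only [act_inr_lam, AlgHom.comp_apply, SuperPoly.involute_lam]
      induction z using TensorProduct.induction_on with
      | zero => simp
      | tmul b v =>
        have := LinearMap.congr_fun (H.signBy_T 1) v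
        simp only [Module.End.mul_apply] at this
        simp [this]
      | add x y hx hy => simp only [map_add, hx, hy]
  · rintro (i | i) j z
    · simp only [act_inl_th, mulOp_apply, inv_smul, AlgHom.comp_apply, SuperPoly.involute_th,
      map_neg,
        LinearMap.neg_apply]
      exact neg_smul (SuperPoly.th i j) (inv H z)
    · simp only [act_inr_th, AlgHom.comp_apply, SuperPoly.involute_th, map_neg, LinearMap.neg_apply]
      induction z using TensorProduct.induction_on with
      | zero => simp
      | tmul b v =>
        have := LinearMap.congr_fun (H.signBy_one_S j) v
        simp only [Module.End.mul_apply, LinearMap.neg_apply] at this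
        simp [this, TensorProduct.tmul_neg]
      | add x y hx hy => simp only [map_add, hx, hy, neg_add]

end PolyV

namespace Vnabla

open PolyV

variable {H : HWSupermodule K N V} {ι κ : Type}

section

variable [Fintype ι]

/-! ### Coordinates on `V_∇[Λ]` -/

theorem mk_surjective : Function.Surjective (mk H (ι := ι)) := (relSub H ι).mkQ_surjective

theorem mk_evenOp (x : PolyV K N ι V) :
    mk H (evenOp H.T x) = -((∑ a : ι, SuperPoly.lam (K := K) (N := N) a) • mk H x) := by
  induction x using TensorProduct.induction_on with
  | zero => simp
  | tmul a v =>
    have h := mk_lam (ι := ι) H v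
    have h2 : mk H (a ⊗ₜ[K] H.T v) = a • mk H (1 ⊗ₜ[K] H.T v) := by
      rw [smul_mk, TensorProduct.smul_tmul', smul_eq_mul, mul_one]
    rw [evenOp_tmul, h2, ← h, smul_mk, smul_mk, ← map_neg, TensorProduct.smul_tmul',
      TensorProduct.smul_tmul', ← TensorProduct.neg_tmul, smul_eq_mul, smul_eq_mul, mul_neg,
      Finset.mul_sum, Finset.sum_mul]
    simp only [SuperPoly.lam_comm]
  | add x y hx hy => rw [map_add, map_add, hx, hy, map_add, smul_add, neg_add]

theorem mk_oddOp (i : Fin N) (x : PolyV K N ι V) :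
    mk H (oddOp (H.S i) x) = -((∑ a : ι, SuperPoly.th (K := K) (N := N) a i) • mk H x) := by
  induction x using TensorProduct.induction_on with
  | zero => simp
  | tmul a v =>
    have h := mk_th (ι := ι) H i v
    have h2 : mk H (SuperPoly.involute a ⊗ₜ[K] H.S i v) =
        SuperPoly.involute a • mk H (1 ⊗ₜ[K] H.S i v) := by
      rw [smul_mk, TensorProduct.smul_tmul', smul_eq_mul, mul_one]
    rw [oddOp_tmul, h2, ← h, smul_mk, smul_mk, ← map_neg, TensorProduct.smul_tmul',
      TensorProduct.smul_tmul', ← TensorProduct.neg_tmul, smul_eq_mul, smul_eq_mul, mul_neg,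
      Finset.mul_sum, Finset.sum_mul]
    simp only [SuperPoly.th_comm, SuperPoly.involute_involute]
  | add x y hx hy => rw [map_add, map_add, hx, hy, map_add, smul_add, neg_add]

variable (H) in
/-- The map `V[Λ_k]_{k ∈ κ} → V_∇[Λ_a]_{a ∈ ι}` that renames `Λ_k` to `Λ_{b k}`. -/
def embed (b : κ → ι) : PolyV K N κ V →ₗ[K] Vnabla H ι :=
  mk H ∘ₗ TensorProduct.map (SuperPoly.ren b).toLinearMap LinearMap.id

theorem embed_tmul (b : κ → ι) (a : SuperPoly K N κ) (v : V) :
    embed H b (a ⊗ₜ[K] v) = mk H (SuperPoly.ren b a ⊗ₜ v) := rfl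

theorem embed_smul (b : κ → ι) (a : SuperPoly K N κ) (x : PolyV K N κ V) :
    embed H b (a • x) = SuperPoly.ren b a • embed H b x := by
  induction x using TensorProduct.induction_on with
  | zero => simp
  | tmul c v =>
    rw [TensorProduct.smul_tmul', embed_tmul, embed_tmul, smul_mk, TensorProduct.smul_tmul',
      smul_eq_mul, smul_eq_mul, map_mul]
  | add x y hx hy => rw [smul_add, map_add, hx, hy, map_add, smul_add]

theorem embed_evenOp (b : κ → ι) (x : PolyV K N κ V) :
    embed H b (evenOp H.T x) =
      -((∑ a : ι, SuperPoly.lam (K := K) (N := N) a) • embed H b x) := by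
  have : embed H b (evenOp H.T x) =
      mk H (evenOp H.T (TensorProduct.map (SuperPoly.ren b).toLinearMap LinearMap.id x)) := by
    induction x using TensorProduct.induction_on with
    | zero => simp
    | tmul c v => rfl
    | add x y hx hy => simp only [map_add, hx, hy]
  rw [this, mk_evenOp]; rfl

theorem embed_oddOp (b : κ → ι) (i : Fin N) (x : PolyV K N κ V) :
    embed H b (oddOp (H.S i) x) =
      -((∑ a : ι, SuperPoly.th (K := K) (N := N) a i) • embed H b x) := by
  have : embed H b (oddOp (H.S i) x) =
      mk H (oddOp (H.S i) (TensorProduct.map (SuperPoly.ren b).toLinearMap LinearMap.id x)) := by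
    induction x using TensorProduct.induction_on with
    | zero => simp
    | tmul c v => simp [embed_tmul, SuperPoly.involute_ren]
    | add x y hx hy => simp only [map_add, hx, hy]
  rw [this, mk_oddOp]; rfl

theorem embed_mem_parity (b : κ → ι) {p : ZMod 2} {x : PolyV K N κ V}
    (hx : x ∈ PolyV.parity H κ p) : embed H b x ∈ Vnabla.parity H (ι := ι) p := by
  refine parity_induction (C := fun x => embed H b x ∈ Vnabla.parity H (ι := ι) p)
    (by simp) ?_ ?_ hx
  · intro x y hx hy
    rw [map_add]; exact add_mem hx hy
  · rintro q r h a ha v hv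
    exact ⟨_, tmul_mem_parity H (SuperPoly.ren_mem_parity b ha) hv h, rfl⟩

section Elim

variable [Fintype κ] [DecidableEq ι] [DecidableEq κ]

theorem elim_mk_tmul (l : ι) (r : ι → κ) (a : SuperPoly K N ι) (v : V) :
    elim H l r (mk H (a ⊗ₜ[K] v)) =
      act H.superCommute (SuperPoly.linSubst (elimCoeff l r) a) (1 ⊗ₜ[K] v) := rfl

theorem elim_smul (l : ι) (r : ι → κ) (a : SuperPoly K N ι) (x : Vnabla H ι) :
    elim H l r (a • x) =
      act H.superCommute (SuperPoly.linSubst (elimCoeff l r) a) (elim H l r x) := by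
  obtain ⟨x, rfl⟩ := mk_surjective x
  induction x using TensorProduct.induction_on with
  | zero => simp
  | tmul c v =>
    rw [smul_mk, TensorProduct.smul_tmul', elim_mk_tmul, elim_mk_tmul, smul_eq_mul, map_mul,
      map_mul]
    rfl
  | add x y hx hy => rw [map_add, smul_add, map_add, hx, hy, map_add, map_add]

theorem elim_embed (l : ι) (r : ι → κ) (b : κ → ι) (hb : ∀ k, b k ≠ l) (hr : ∀ k, r (b k) = k)
    (x : PolyV K N κ V) : elim H l r (embed H b x) = x := by
  have hc : (SuperPoly.linSubst (elimCoeff l r)).comp (SuperPoly.ren b) =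
      (SuperPoly.ren Sum.inl : SuperPoly K N κ →ₐ[K] SuperPoly K N (κ ⊕ Unit)) := by
    refine SuperPoly.hom_ext (fun a => ?_) (fun a i => ?_) <;>
      simp [elimCoeff, hb, hr]
  induction x using TensorProduct.induction_on with
  | zero => simp
  | tmul c v =>
    rw [embed_tmul, elim_mk_tmul, ← AlgHom.comp_apply (SuperPoly.linSubst _), hc]
    have := act_ren_inl H.superCommute (id : κ → κ) c (1 ⊗ₜ[K] v)
    refine this.trans ?_
    have hid : (SuperPoly.ren id : SuperPoly K N κ →ₐ[K] SuperPoly K N κ) = AlgHom.id K _ :=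
      SuperPoly.hom_ext (fun a => by simp) (fun a i => by simp)
    rw [hid, TensorProduct.smul_tmul']
    simp
  | add x y hx hy => rw [map_add, map_add, hx, hy]

/-- Elimination preserves parity. -/
theorem elim_mem_parity [CharZero K] (l : ι) (r : ι → κ) {p : ZMod 2} {x : Vnabla H ι}
    (hx : x ∈ Vnabla.parity H p) : elim H l r x ∈ PolyV.parity H κ p := by
  obtain ⟨x, hx, rfl⟩ := hx
  refine parity_induction (C := fun x => elim H l r (mk H x) ∈ PolyV.parity H κ p)
    (by simp) ?_ ?_ hx
  · intro x y hx hy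
    rw [map_add, map_add]; exact add_mem hx hy
  · rintro q s h a ha v hv
    rw [PolyV.mem_parity_iff, elim_mk_tmul, inv_act, SuperPoly.involute_linSubst,
      SuperPoly.mem_parity.1 ha, inv_tmul, (H.mem_parity_iff _ _).1 hv, map_one, ← h, ksign_add]
    simp only [map_zsmul, LinearMap.smul_apply]
    rw [← Int.cast_smul_eq_zsmul K (ksign s), TensorProduct.tmul_smul, map_smul, mul_smul,
      ← Int.cast_smul_eq_zsmul K (ksign s)]

end Elim

/-! ### Two supervariables -/

section Two

variable {l k : Fin 2}

theorem elim_smul_lam_self (x : Vnabla H (Fin 2)) :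
    elim H l (fun _ => ()) ((SuperPoly.lam l : SuperPoly K N (Fin 2)) • x) =
      -((SuperPoly.lam () : SuperPoly K N Unit) • elim H l (fun _ => ()) x) -
        evenOp H.T (elim H l (fun _ => ()) x) := by
  rw [elim_smul]
  have h : (Finset.univ.erase l).card = 1 := by simp
  simp [elimCoeff, sub_eq_add_neg]

theorem elim_smul_th_self (i : Fin N) (x : Vnabla H (Fin 2)) :
    elim H l (fun _ => ()) ((SuperPoly.th l i : SuperPoly K N (Fin 2)) • x) =
      -((SuperPoly.th () i : SuperPoly K N Unit) • elim H l (fun _ => ()) x) -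
        oddOp (H.S i) (elim H l (fun _ => ()) x) := by
  rw [elim_smul]
  simp [elimCoeff, sub_eq_add_neg]

theorem elim_smul_lam_of_ne (hkl : k ≠ l) (x : Vnabla H (Fin 2)) :
    elim H l (fun _ => ()) ((SuperPoly.lam k : SuperPoly K N (Fin 2)) • x) =
      (SuperPoly.lam () : SuperPoly K N Unit) • elim H l (fun _ => ()) x := by
  rw [elim_smul]
  simp [elimCoeff, hkl]

theorem elim_smul_th_of_ne (hkl : k ≠ l) (i : Fin N) (x : Vnabla H (Fin 2)) :
    elim H l (fun _ => ()) ((SuperPoly.th k i : SuperPoly K N (Fin 2)) • x) =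
      (SuperPoly.th () i : SuperPoly K N Unit) • elim H l (fun _ => ()) x := by
  rw [elim_smul]
  simp [elimCoeff, hkl]

theorem sum_eq_pair {M : Type*} [AddCommMonoid M] (hkl : k ≠ l) (f : Fin 2 → M) :
    ∑ a, f a = f k + f l := by
  rw [← Finset.sum_pair hkl]
  congr 1
  revert k l; decide

/-- Elimination of one of two supervariables is inverse to the embedding of `V[Λ]`. -/
theorem embed_elim (hkl : k ≠ l) (x : Vnabla H (Fin 2)) :
    embed H (fun _ => k) (elim H l (fun _ => ()) x) = x := by
  obtain ⟨x, rfl⟩ := mk_surjective x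
  induction x using TensorProduct.induction_on with
  | zero => simp
  | tmul a v =>
    have key := SuperPoly.intertwine
      ((PolyV.act (κ := Unit) H.superCommute).comp
        (SuperPoly.linSubst (elimCoeff l fun _ : Fin 2 => ())))
      (Algebra.lsmul K K (Vnabla H (Fin 2))) (embed H fun _ => k) ?_ ?_ a (1 ⊗ₜ[K] v)
    · refine key.trans ?_
      rw [embed_tmul, map_one, Algebra.lsmul_apply, smul_mk, TensorProduct.smul_tmul', smul_eq_mul,
        mul_one]
    · intro j z
      by_cases hj : j = l
      · subst hj
        simp [elimCoeff, embed_smul, embed_evenOp, sum_eq_pair hkl, add_smul]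
      · have hjk : j = k := by revert k l j; decide
        subst hjk
        simp [elimCoeff, hj, embed_smul]
    · intro j i z
      by_cases hj : j = l
      · subst hj
        simp [elimCoeff, embed_smul, embed_oddOp, sum_eq_pair hkl, add_smul]
      · have hjk : j = k := by revert k l j; decide
        subst hjk
        simp [elimCoeff, hj, embed_smul]
  | add x y hx hy => rw [map_add, map_add, map_add, hx, hy]

theorem elim_embed_of_ne (hkl : k ≠ l) (x : PolyV K N Unit V) :
    elim H l (fun _ => ()) (embed H (fun _ => k) x) = x :=
  elim_embed _ _ _ (fun _ => hkl) (fun _ => rfl) x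

/-- The elimination of the variable in which an element of `V[Λ]` is written is the substitution of
`-Λ - ∇` for `Λ`. -/
theorem elim_embed_self (l : Fin 2) (x : PolyV K N Unit V) :
    elim H l (fun _ => ()) (embed H (fun _ => l) x) =
      evalNabla H.superCommute (PolyV.subst (fun _ _ => -1) x) := by
  induction x using TensorProduct.induction_on with
  | zero => simp
  | tmul a v =>
    rw [embed_tmul, elim_mk_tmul, subst_tmul, evalNabla_tmul,
      ← AlgHom.comp_apply (SuperPoly.linSubst _)]
    congr 2
    refine DFunLike.congr_fun (F := SuperPoly K N Unit →ₐ[K] SuperPoly K N (Unit ⊕ Unit))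
      (SuperPoly.hom_ext (fun a => ?_) (fun a i => ?_)) a <;>
      simp [elimCoeff, add_comm]
  | add x y hx hy => simp only [map_add, hx, hy]

end Two

/-! ### Renaming and merging of supervariables -/

end

theorem linSubst_comp_ren {J : Type} [Fintype κ] [DecidableEq ι] (b : κ → ι) (c : J → ι)
    (d : J → κ) (h : ∀ j k, b k = c j ↔ k = d j) (a : SuperPoly K N J) :
    SuperPoly.linSubst (fun a k => if b k = a then 1 else 0) (SuperPoly.ren c a) =
      SuperPoly.ren d a := by
  classical
  rw [← AlgHom.comp_apply]
  refine DFunLike.congr_fun (SuperPoly.hom_ext (fun a => ?_) (fun a i => ?_)) a <;>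
    simp [h]

section Block

variable [Fintype ι] [Fintype κ] [DecidableEq ι] [DecidableEq κ]

theorem blockSubst_mk_tmul (b : κ → ι) (a : SuperPoly K N ι) (v : V) :
    blockSubst H b (mk H (a ⊗ₜ[K] v)) =
      mk H (SuperPoly.linSubst (fun a k => if b k = a then 1 else 0) a ⊗ₜ[K] v) := by
  refine Eq.trans (b := SuperPoly.linSubst (fun a k => if b k = a then 1 else 0) a •
    mk H (1 ⊗ₜ[K] v)) rfl ?_
  rw [smul_mk, TensorProduct.smul_tmul', smul_eq_mul, mul_one]

theorem blockSubst_smul (b : κ → ι) (a : SuperPoly K N ι) (x : Vnabla H ι) :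
    blockSubst H b (a • x) =
      SuperPoly.linSubst (fun a k => if b k = a then 1 else 0) a • blockSubst H b x := by
  obtain ⟨x, rfl⟩ := mk_surjective x
  induction x using TensorProduct.induction_on with
  | zero => simp
  | tmul c v =>
    rw [smul_mk, TensorProduct.smul_tmul', blockSubst_mk_tmul, blockSubst_mk_tmul, smul_eq_mul,
      map_mul, smul_mk, TensorProduct.smul_tmul', smul_eq_mul]
  | add x y hx hy => rw [map_add, smul_add, map_add, hx, hy, map_add, smul_add]

theorem blockSubst_embed {J : Type} (b : κ → ι) (c : J → ι) (d : J → κ)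
    (h : ∀ j k, b k = c j ↔ k = d j) (x : PolyV K N J V) :
    blockSubst H b (embed H c x) = embed H d x := by
  induction x using TensorProduct.induction_on with
  | zero => simp
  | tmul a v => rw [embed_tmul, blockSubst_mk_tmul, linSubst_comp_ren b c d h, embed_tmul]
  | add x y hx hy => simp only [map_add, hx, hy]

theorem blockSubst_comp {J : Type} [Fintype J] [DecidableEq J] (b : κ → ι) (c : J → κ)
    (x : Vnabla H ι) : blockSubst H c (blockSubst H b x) = blockSubst H (b ∘ c) x := by
  obtain ⟨x, rfl⟩ := mk_surjective x
  induction x using TensorProduct.induction_on with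
  | zero => simp
  | tmul a v =>
    rw [blockSubst_mk_tmul, blockSubst_mk_tmul, blockSubst_mk_tmul, ← AlgHom.comp_apply]
    congr 2
    refine DFunLike.congr_fun (SuperPoly.hom_ext (fun a => ?_) (fun a i => ?_)) a <;>
    · simp only [AlgHom.comp_apply, SuperPoly.linSubst_lam, SuperPoly.linSubst_th, map_sum,
      map_zsmul,
        Finset.smul_sum, Function.comp_apply]
      rw [Finset.sum_comm]
      refine Finset.sum_congr rfl fun j _ => ?_
      simp
  | add x y hx hy => simp only [map_add, hx, hy]

theorem blockSubst_id (x : Vnabla H ι) : blockSubst H (id : ι → ι) x = x := by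
  obtain ⟨x, rfl⟩ := mk_surjective x
  induction x using TensorProduct.induction_on with
  | zero => simp
  | tmul a v =>
    rw [blockSubst_mk_tmul]
    congr 2
    refine DFunLike.congr_fun (g := AlgHom.id K _)
      (SuperPoly.hom_ext (fun a => ?_) (fun a i => ?_)) a <;> simp
  | add x y hx hy => simp only [map_add, hx, hy]

/-- Substitutions act on sign-twisted extensions through the variables and the coefficients. -/
theorem blockSubst_twist {J : Type} (b : κ → ι) (c : J → ι) (d : J → κ)
    (h : ∀ j k, b k = c j ↔ k = d j) (p : ZMod 2) (g : V →ₗ[K] Vnabla H ι) (x : PolyV K N J V) :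
    blockSubst H b (twist (SuperPoly.ren c) p g x) =
      twist (SuperPoly.ren d) p (blockSubst H b ∘ₗ g) x := by
  induction x using TensorProduct.induction_on with
  | zero => simp
  | tmul a v =>
    rw [twist_tmul, twist_tmul, blockSubst_smul, linSubst_comp_ren b c d h, LinearMap.comp_apply]
  | add x y hx hy => simp only [map_add, hx, hy]

end Block

theorem dlam_ren_self [DecidableEq ι] (k : ι) (a : SuperPoly K N Unit) :
    SuperPoly.dlam k (SuperPoly.ren (fun _ => k) a) =
      SuperPoly.ren (fun _ => k) (SuperPoly.dlam () a) := by
  induction a using SuperPoly.induction_on with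
  | hr r => simp [Algebra.algebraMap_eq_smul_one, SuperPoly.dlam_one]
  | hl i => simp [SuperPoly.dlam_lam]
  | ht i j => simp [SuperPoly.dlam_th]
  | hmul a b ha hb => simp [SuperPoly.dlam_mul, ha, hb]
  | hadd a b ha hb => simp [ha, hb]

theorem dlam_ren_of_ne [DecidableEq ι] {k l : ι} (hkl : k ≠ l) (a : SuperPoly K N Unit) :
    SuperPoly.dlam l (SuperPoly.ren (fun _ => k) a) = 0 := by
  induction a using SuperPoly.induction_on with
  | hr r => simp [Algebra.algebraMap_eq_smul_one, SuperPoly.dlam_one]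
  | hl i => simp [SuperPoly.dlam_lam, hkl]
  | ht i j => simp [SuperPoly.dlam_th]
  | hmul a b ha hb => simp [SuperPoly.dlam_mul, ha, hb]
  | hadd a b ha hb => simp [ha, hb]

variable [Fintype ι]

theorem dlamSub_mk [DecidableEq ι] (k l : ι) (x : PolyV K N ι V) :
    dlamSub H k l (mk H x) = mk H (dlamSubPoly k l x) := rfl

theorem dlamSub_embed [DecidableEq ι] {k l : ι} (hkl : k ≠ l) (x : PolyV K N Unit V) :
    dlamSub H k l (embed H (fun _ => k) x) = embed H (fun _ => k) (dlamOp x) := by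
  induction x using TensorProduct.induction_on with
  | zero => simp
  | tmul a v =>
    rw [embed_tmul, dlamSub_mk, dlamSubPoly, TensorProduct.map_tmul, LinearMap.sub_apply,
      dlam_ren_self, dlam_ren_of_ne hkl, sub_zero]
    rfl
  | add x y hx hy => simp only [map_add, hx, hy]

/-- An element of `V_∇[Λ_1, Λ_2]` is annihilated by `∂/∂λ_1 - ∂/∂λ_2` if and only if it does not
contain `λ_1` after elimination of `Λ_2`. -/
theorem dlamSub_eq_zero_iff {k l : Fin 2} (hkl : k ≠ l) (x : Vnabla H (Fin 2)) :
    dlamSub H k l x = 0 ↔ dlamOp (elim H l (fun _ => ()) x) = 0 := by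
  conv_lhs => rw [← embed_elim hkl x, dlamSub_embed hkl]
  constructor
  · intro h
    have := congrArg (elim H l fun _ => ()) h
    rwa [elim_embed_of_ne hkl, map_zero] at this
  · intro h; rw [h, map_zero]

theorem dlamSub_self [DecidableEq ι] (k : ι) (x : Vnabla H ι) : dlamSub H k k x = 0 := by
  obtain ⟨x, rfl⟩ := mk_surjective x
  rw [dlamSub_mk]
  simp [dlamSubPoly]

theorem dlamSub_symm [DecidableEq ι] (k l : ι) (x : Vnabla H ι) :
    dlamSub H k l x = -dlamSub H l k x := by
  obtain ⟨x, rfl⟩ := mk_surjective x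
  rw [dlamSub_mk, dlamSub_mk, ← map_neg]
  congr 1
  rw [← LinearMap.neg_apply]
  congr 1
  rw [dlamSubPoly, dlamSubPoly, ← neg_sub]
  refine TensorProduct.ext' fun a v => ?_
  rw [LinearMap.neg_apply, TensorProduct.map_tmul, TensorProduct.map_tmul, ← TensorProduct.neg_tmul]
  rfl

/-- If `λ` does not occur, exchanging the roles of the two supervariables multiplies the Berezin
integral by `(-1)^N`. -/
theorem res_elim_embed_self [CharZero K] (l : Fin 2) {x : PolyV K N Unit V} (hx : dlamOp x = 0) :
    res (elim H l (fun _ => ()) (embed H (fun _ => l) x)) = ksign N • res x := by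
  have := res_translate ((PolyV.act (κ := Unit) H.superCommute).comp
    (SuperPoly.linSubst (elimCoeff l fun _ : Fin 2 => ()) |>.comp (SuperPoly.ren fun _ => l)))
    (-1) (fun i => -H.S i) (fun i => ?_) hx
  · have h2 : (-1 : ℤ) ^ N = ksign N := by
      rcases Nat.even_or_odd N with h | h
      · rw [h.neg_one_pow, (ZMod.natCast_eq_zero_iff_even).2 h, ksign_zero]
      · rw [h.neg_one_pow, (ZMod.natCast_eq_one_iff_odd).2 h, ksign_one]
    rw [← h2, ← this]
    congr 1
    clear this hx
    induction x using TensorProduct.induction_on with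
    | zero => simp
    | tmul a v => rfl
    | add x y hx hy => simp only [map_add, hx, hy]
  · refine LinearMap.ext fun x => ?_
    have h : oddOp (-H.S i) x = -oddOp (H.S i) x := by
      induction x using TensorProduct.induction_on with
      | zero => simp
      | tmul a v => rw [oddOp_tmul, oddOp_tmul, LinearMap.neg_apply, TensorProduct.tmul_neg]
      | add x y hx hy => rw [map_add, map_add, hx, hy, neg_add]
    simp [elimCoeff, h]

end Vnabla
end Module

section Operad

variable {K : Type*} [Field K] {N : ℕ} {V : Type*} [AddCommGroup V] [Module K V]
  {H : HWSupermodule K N V}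

open PolyV Vnabla

/-- The map from the vertices `1, 2, 3` to the blocks of the decomposition `3 = 2 + 1`. -/
def merge : Fin 3 → Fin 2 := Op.firstBlock 1 1

/-- The inclusion of the block `{1, 2}`, inverted. -/
def unmerge : {k : Fin 3 // merge k = 0} → Fin 2 := (Op.firstBlockEquiv 1 1).symm

namespace NQuiver

/-- The quiver of the edges inside the block `{1, 2}` of `{1, 2, 3}`. -/
def firstInner (Q : NQuiver (Fin 3)) : NQuiver (Fin 2) :=
  (Q.inner (Op.firstBlock 1 1) 0).rename (Op.firstBlockEquiv 1 1).symm

/-- The quiver of the edges between the blocks `{1, 2}` and `{3}`. -/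
def firstOuter (Q : NQuiver (Fin 3)) : NQuiver (Fin 2) := Q.outer merge

end NQuiver

namespace Op

/-! ### The composition of two binary operations -/

theorem extend_smul {n m : ℕ} (b : Fin n → Fin m) (p : ZMod 2) (X : Op H (Fin m))
    (Q : NQuiver (Fin m)) (a : SuperPoly K N (Fin n))
    (y : PolyV K N (Fin n) (HWSupermodule.TPow K V m)) :
    extend b p X Q (a • y) = SuperPoly.signBy p a • extend b p X Q y := by
  induction y using TensorProduct.induction_on with
  | zero => simp
  | tmul c w =>
    rw [TensorProduct.smul_tmul']
    simp [extend, SuperPoly.signBy_mul]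
  | add x y hx hy => rw [smul_add, map_add, hx, hy, map_add, smul_add]

theorem extend_tmul {n m : ℕ} (b : Fin n → Fin m) (p : ZMod 2) (X : Op H (Fin m))
    (Q : NQuiver (Fin m)) (a : SuperPoly K N (Fin n)) (w : HWSupermodule.TPow K V m) :
    extend b p X Q (a ⊗ₜ[K] w) =
      SuperPoly.signBy p a • Vnabla.blockSubst H b (PiTensorProduct.lift (X Q) w) := rfl

/-- For an odd operation, the operators `S^i` on its arguments become multiplications. -/
theorem extend_oddOp {n m : ℕ} (b : Fin n → Fin m) {X : Op H (Fin m)} (hX : IsPcl 1 X)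
    (Q : NQuiver (Fin m)) (k : Fin m) (i : Fin N)
    (y : PolyV K N (Fin n) (HWSupermodule.TPow K V m)) :
    extend b 1 X Q (oddOp (H.SS m k i) y) =
      (∑ j, (if b j = k then 1 else 0 : ℤ) • SuperPoly.th j i : SuperPoly K N (Fin n)) •
        extend b 1 X Q y := by
  have hw : ∀ w, PiTensorProduct.lift (X Q) (H.SS m k i w) =
      (SuperPoly.th k i : SuperPoly K N (Fin m)) • PiTensorProduct.lift (X Q) w := by
    intro w
    induction w using PiTensorProduct.induction_on with
    | smul_tprod r v =>
      rw [map_smul, map_smul, map_smul, HWSupermodule.SS, PiTensorProduct.map_tprod,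
        PiTensorProduct.lift.tprod, PiTensorProduct.lift.tprod, hX.sesq_S, ksign_one, neg_one_smul,
        neg_neg, smul_comm]
    | add x y hx hy => rw [map_add, map_add, hx, hy, map_add, smul_add]
  induction y using TensorProduct.induction_on with
  | zero => simp
  | tmul c w =>
    rw [oddOp_tmul, extend_tmul, extend_tmul, hw, blockSubst_smul, SuperPoly.linSubst_th,
      SuperPoly.signBy_one, AlgHom.toLinearMap_apply, AlgHom.toLinearMap_apply,
      SuperPoly.involute_involute, smul_smul, smul_smul]
    congr 1
    rw [Finset.mul_sum, Finset.sum_mul]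
    refine Finset.sum_congr rfl fun j _ => ?_
    rw [mul_smul_comm, smul_mul_assoc, SuperPoly.th_comm]
  | add x y hx hy => rw [map_add, map_add, hx, hy, map_add, smul_add]

/-- If the operators `T` on the two arguments of an operation add up to multiplication by minus the
sum of the even variables, as on a connected quiver, then so they do after extension. -/
theorem extend_evenOp {n : ℕ} (b : Fin n → Fin 2) {X : Op H (Fin 2)}
    (Q : NQuiver (Fin 2)) (hT : ∀ v, ∑ l, X Q (fun m => H.Tcomp l m (v m)) =
      -((∑ l, SuperPoly.lam l : SuperPoly K N (Fin 2)) • X Q v))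
    (y : PolyV K N (Fin n) (HWSupermodule.TPow K V 2)) :
    extend b 1 X Q (evenOp (H.TT 2 0) y) + extend b 1 X Q (evenOp (H.TT 2 1) y) =
      -((∑ j, SuperPoly.lam j : SuperPoly K N (Fin n)) • extend b 1 X Q y) := by
  have hw : ∀ w, PiTensorProduct.lift (X Q) (H.TT 2 0 w) + PiTensorProduct.lift (X Q) (H.TT 2 1 w) =
      -((∑ l, SuperPoly.lam l : SuperPoly K N (Fin 2)) • PiTensorProduct.lift (X Q) w) := by
    intro w
    induction w using PiTensorProduct.induction_on with
    | smul_tprod r v =>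
      rw [map_smul, map_smul, map_smul, map_smul, map_smul, ← smul_add, HWSupermodule.TT,
        HWSupermodule.TT, PiTensorProduct.map_tprod, PiTensorProduct.map_tprod,
        PiTensorProduct.lift.tprod, PiTensorProduct.lift.tprod, PiTensorProduct.lift.tprod,
        smul_comm, ← smul_neg]
      congr 1
      rw [← hT, Fin.sum_univ_two]
    | add x y hx hy =>
      simp only [map_add, smul_add, neg_add] at *
      rw [← hx, ← hy]; abel
  induction y using TensorProduct.induction_on with
  | zero => simp
  | tmul c w =>
    rw [evenOp_tmul, evenOp_tmul, extend_tmul, extend_tmul, extend_tmul, ← smul_add, ← map_add, hw,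
      map_neg, blockSubst_smul, map_sum, smul_neg, smul_smul, smul_smul]
    congr 2
    simp only [SuperPoly.linSubst_lam]
    rw [Finset.sum_comm]
    simp only [← Finset.sum_smul, Finset.sum_ite_eq, Finset.mem_univ, if_true, one_smul]
    rw [Finset.mul_sum, Finset.sum_mul]
    simp only [SuperPoly.lam_comm]
  | add x y hx hy =>
    simp only [map_add, smul_add, neg_add] at *
    rw [← hx, ← hy]; abel

theorem collect_two [CharZero K] {ι : Type} (w : Fin 2 → PolyV K N ι V) (a : SuperPoly K N ι)
    (u c : V)
    (h0 : w 0 = a ⊗ₜ u) (h1 : w 1 = 1 ⊗ₜ c) :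
    collect H ι 2 w = a ⊗ₜ PiTensorProduct.tprod K ![u, c] := by
  have : collect H ι 2 w = snocPoly H 1 ι
      (snocPoly H 0 ι (1 ⊗ₜ[K] PiTensorProduct.tprod K Fin.elim0) (w 0)) (w 1) := rfl
  have hsum : ∀ {M : Type _} [AddCommMonoid M] (f : ZMod 2 → M), ∑ q, f q = f 0 + f 1 :=
    fun f => Fin.sum_univ_two f
  have h2 : (2 : K)⁻¹ + 2⁻¹ = 1 := by rw [← two_mul, mul_inv_cancel₀ two_ne_zero]
  have hp0 : SuperPoly.projParity 0 (1 : SuperPoly K N ι) = 1 := by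
    simp [SuperPoly.projParity, ← add_smul, h2]
  have hp1 : SuperPoly.projParity 1 (1 : SuperPoly K N ι) = 0 := by
    simp [SuperPoly.projParity]
  have hpa : SuperPoly.projParity 0 a + SuperPoly.projParity 1 a = a := by
    simp only [SuperPoly.projParity, LinearMap.smul_apply, LinearMap.add_apply, ksign_zero,
      one_smul,
      ksign_one, neg_smul, LinearMap.neg_apply, LinearMap.id_apply, ← smul_add]
    rw [add_add_add_comm, add_neg_cancel, add_zero, smul_add, ← add_smul, h2, one_smul]
  have hv : ∀ q : ZMod 2, (Fin.snoc (fun i => H.signBy 0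
      ((Fin.snoc (fun i : Fin 0 => H.signBy q i.elim0) u : Fin 1 → V) i)) c : Fin 2 → V) =
        ![u, c] := by
    intro q
    ext i
    fin_cases i <;> rfl
  rw [this, h0, h1]
  simp only [snocPoly, snocTensor, TensorProduct.curry_apply, LinearMap.sum_apply,
    LinearMap.comp_apply, TensorProduct.map_tmul, LinearEquiv.coe_coe,
    TensorProduct.tensorTensorTensorComm_tmul, PiTensorProduct.map_tprod, LinearMap.id_apply,
    LinearMap.mul'_apply, TensorProduct.lift.tmul, PiTensorProduct.lift.tprod,
    MultilinearMap.curryRight_apply, one_mul, map_sum]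
  rw [hsum, hsum, hsum, hp0, hp1]
  simp only [mul_zero, TensorProduct.zero_tmul, add_zero, mul_one, hv]
  rw [← TensorProduct.add_tmul, hpa]

/-- The first element of the block `{1, 2}`. -/
def blk0 : {k : Fin 3 // merge k = 0} := ⟨0, rfl⟩

/-- The second element of the block `{1, 2}`. -/
def blk1 : {k : Fin 3 // merge k = 0} := ⟨1, rfl⟩

theorem lastOf_eq : lastOf (firstBlock 1 1) (firstBlock_surjective 1 1) 0 = blk1 := by
  refine le_antisymm ?_ ?_
  · refine Finset.max'_le _ _ _ fun k _ => ?_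
    revert k; decide
  · exact Finset.le_max' _ _ (Finset.mem_univ _)

variable (H) in
/-- The substitution, in the composition of two binary operations, of shifted variables and
operators in the polynomials that come from the inner operation. -/
def insHom (Q : NQuiver (Fin 3)) : SuperPoly K N {k : Fin 3 // merge k = 0} →ₐ[K]
    Module.End K (PolyV K N (Fin 3) (HWSupermodule.TPow K V 2)) :=
  (act (H.superCommute_tensor 2)).comp ((SuperPoly.linSubst (nablaCoeff merge)).comp
    (SuperPoly.linSubst (shiftCoeff merge Q 0)))

variable (H) in
/-- The insertion of the values of the inner operation next to a last argument `c`. -/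
def ins (Q : NQuiver (Fin 3)) (c : V) : PolyV K N {k : Fin 3 // merge k = 0} V →ₗ[K]
    PolyV K N (Fin 3) (HWSupermodule.TPow K V 2) :=
  TensorProduct.lift ((insHom H Q).toLinearMap.compl₂
    (TensorProduct.mk K (SuperPoly K N (Fin 3)) _ 1 ∘ₗ
      ((bilin (PiTensorProduct.tprod K : MultilinearMap K (fun _ : Fin 2 => V) _)).flip c)))

theorem ins_tmul (Q : NQuiver (Fin 3)) (c u : V)
    (a : SuperPoly K N {k : Fin 3 // merge k = 0}) :
    ins H Q c (a ⊗ₜ[K] u) = insHom H Q a (1 ⊗ₜ[K] PiTensorProduct.tprod K ![u, c]) := by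
  simp [ins, bilin_apply]

theorem evalNabla_collect [CharZero K] (Q : NQuiver (Fin 3)) (c : V)
    (P : PolyV K N {k : Fin 3 // merge k = 0} V) :
    evalNabla (H.superCommute_tensor 2) (PolyV.subst (nablaCoeff merge)
      (collect H (Fin 3 ⊕ Fin 2) 2
        ![PolyV.subst (shiftCoeff merge Q 0) P, 1 ⊗ₜ c])) = ins H Q c P := by
  have hu : ∀ x y : PolyV K N (Fin 3 ⊕ Fin 2) V, Function.update ![0, y] 0 x = ![x, y] := by
    intro x y
    ext j
    fin_cases j <;> rfl
  have hlin : (evalNabla (H.superCommute_tensor 2) ∘ₗ PolyV.subst (nablaCoeff merge)) ∘ₗ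
      (collect H (Fin 3 ⊕ Fin 2) 2).toLinearMap ![0, 1 ⊗ₜ c] 0 ∘ₗ
        PolyV.subst (shiftCoeff merge Q 0) = ins H Q c := by
    refine TensorProduct.ext' fun a u => ?_
    change evalNabla (H.superCommute_tensor 2) (PolyV.subst (nablaCoeff merge)
      (collect H (Fin 3 ⊕ Fin 2) 2 (Function.update ![0, 1 ⊗ₜ c] 0
        (PolyV.subst (shiftCoeff merge Q 0) (a ⊗ₜ[K] u))))) = _
    rw [hu, collect_two _ (SuperPoly.linSubst (shiftCoeff merge Q 0) a) u c rfl rfl,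
      ins_tmul]
    rfl
  rw [← hlin, ← hu]
  rfl

/-- The composition `X ∘_1 X` as the extension of the outer operation, applied to the values of the
inner operation after insertion of the shifted variables. -/
theorem circOne_eq_ins [CharZero K] (X : Op H (Fin 2)) (Q : NQuiver (Fin 3)) (v : Fin 3 → V) :
    circOne (n := 1) (m := 1) 1 1 X X Q v = extend merge 1 X Q.firstOuter
      (ins H Q (v 2) (Vnabla.elim H blk1 id
        (Vnabla.blockSubst H unmerge (X Q.firstInner ![v 0, v 1])))) := by
  have h0 : ∀ k : Fin 3,
      H.signBy (∑ x with firstBlock 1 1 k < x, (Fin.cons 1 (fun _ => 0) : Fin 2 → ZMod 2) x) =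
        LinearMap.id := by
    intro k
    rw [Finset.sum_eq_zero, HWSupermodule.signBy_zero]
    intro x hx
    have : x = 1 := by
      have := (Finset.mem_filter.1 hx).2
      revert this; revert x k; decide
    subst this
    rfl
  rw [← evalNabla_collect]
  refine congrArg (extend _ _ _ _) (congrArg (evalNabla _) (congrArg (PolyV.subst _)
    (congrArg (collect H _ 2) (funext fun j => ?_))))
  fin_cases j
  · refine congrArg (PolyV.subst _) ?_
    rw [← lastOf_eq]
    refine congrArg (Vnabla.elim H _ id) ?_
    refine congrArg (Vnabla.blockSubst H _) ?_
    refine congrArg (X Q.firstInner) ?_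
    ext k
    fin_cases k
    · exact LinearMap.congr_fun (h0 0) (v 0)
    · exact LinearMap.congr_fun (h0 1) (v 1)
  · refine Eq.trans (congrArg (PolyV.subst _) (a₂ := 1 ⊗ₜ v 2) ?_) ?_
    · refine Eq.trans (congrArg (Vnabla.elim H _ id) (a₂ := Vnabla.mk H (1 ⊗ₜ v 2)) ?_) ?_
      · refine congrArg (fun x => Vnabla.mk H (1 ⊗ₜ[K] x)) ?_
        exact LinearMap.congr_fun (h0 2) (v 2)
      · rw [elim_mk_tmul, map_one, map_one]; rfl
    · rw [subst_tmul, map_one]; rfl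

end Op

namespace Op

theorem insHom_lam (Q : NQuiver (Fin 3))
    (k : {k : Fin 3 // merge k = 0}) (e : Fin 2 → ℤ)
    (he : ∀ i, e i = shiftCoeff merge Q 0 k (Sum.inr i)) :
    insHom H Q (SuperPoly.lam k) = mulOp (SuperPoly.lam k.1) +
      ∑ i, e i • (∑ j, (if merge j = i then 1 else 0 : ℤ) • mulOp (SuperPoly.lam j) +
        evenOp (H.TT 2 i)) := by
  have h1 : ∀ j, shiftCoeff merge Q 0 k (Sum.inl j) = if j = k.1 then 1 else 0 :=
    fun _ => rfl
  simp only [insHom, AlgHom.comp_apply, SuperPoly.linSubst_lam, Fintype.sum_sum_type, h1, ← he,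
    nablaCoeff, map_add, map_sum, map_zsmul, act_inl_lam, act_inr_lam]
  simp

theorem insHom_th (Q : NQuiver (Fin 3))
    (k : {k : Fin 3 // merge k = 0}) (s : Fin N) (e : Fin 2 → ℤ)
    (he : ∀ i, e i = shiftCoeff merge Q 0 k (Sum.inr i)) :
    insHom H Q (SuperPoly.th k s) = mulOp (SuperPoly.th k.1 s) +
      ∑ i, e i • (∑ j, (if merge j = i then 1 else 0 : ℤ) • mulOp (SuperPoly.th j s) +
        oddOp (H.SS 2 i s)) := by
  have h1 : ∀ j, shiftCoeff merge Q 0 k (Sum.inl j) = if j = k.1 then 1 else 0 :=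
    fun _ => rfl
  simp only [insHom, AlgHom.comp_apply, SuperPoly.linSubst_th, Fintype.sum_sum_type, h1, ← he,
    nablaCoeff, map_add, map_sum, map_zsmul, act_inl_th, act_inr_th]
  simp

theorem shiftCoeff_inr_of_not {Q : NQuiver (Fin 3)} {k : {k : Fin 3 // merge k = 0}}
    {i : Fin 2} (h : ¬ Q.ExtConnected merge i k) :
    shiftCoeff merge Q 0 k (Sum.inr i) = 0 := by
  simp [shiftCoeff, h]

theorem shiftCoeff_inr_of {Q : NQuiver (Fin 3)} {k : {k : Fin 3 // merge k = 0}}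
    {i : Fin 2} (h : Q.ExtConnected merge i k) :
    shiftCoeff merge Q 0 k (Sum.inr i) = 1 := by
  simp [shiftCoeff, h]

/-- The map `u ↦ X_{Λ_1 + Λ_2, Λ_3}(u ⊗ c)` for the outer operation. -/
def outerVal (X : Op H (Fin 2)) (Q : NQuiver (Fin 2)) (c : V) : V →ₗ[K] Vnabla H (Fin 3) :=
  Vnabla.blockSubst H merge ∘ₗ (bilin (X Q)).flip c

theorem outerVal_apply (X : Op H (Fin 2)) (Q : NQuiver (Fin 2)) (c u : V) :
    outerVal X Q c u = Vnabla.blockSubst H merge (X Q ![u, c]) := by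
  simp [outerVal, bilin_apply]

theorem elim_blk_embed (k : {k : Fin 3 // merge k = 0}) (hk : k ≠ blk1)
    (x : PolyV K N Unit V) :
    Vnabla.elim H blk1 id (embed H (fun _ => k) x) =
      TensorProduct.map (SuperPoly.ren fun _ => k).toLinearMap LinearMap.id x := by
  have hc : (SuperPoly.linSubst (elimCoeff blk1 id)).comp (SuperPoly.ren fun _ : Unit => k) =
      (SuperPoly.ren fun _ => Sum.inl k : SuperPoly K N Unit →ₐ[K] _) := by
    refine SuperPoly.hom_ext (fun a => ?_) (fun a i => ?_) <;>
      simp [elimCoeff, hk]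
  induction x using TensorProduct.induction_on with
  | zero => simp
  | tmul a u =>
    rw [embed_tmul, elim_mk_tmul, ← AlgHom.comp_apply (SuperPoly.linSubst _), hc]
    refine (act_ren_inl H.superCommute (fun _ : Unit => k) a (1 ⊗ₜ[K] u)).trans ?_
    rw [TensorProduct.smul_tmul', smul_eq_mul, mul_one]
    rfl
  | add x y hx hy => simp only [map_add, hx, hy]

/-- If no edge between the blocks ends in the first vertex, its variable is not shifted in the
composition. -/
theorem circOne_of_fst [CharZero K] (X : Op H (Fin 2)) (Q : NQuiver (Fin 3)) (v : Fin 3 → V)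
    (hQ : ∀ i, ¬ Q.ExtConnected merge i 0) (F : PolyV K N Unit V)
    (hF : X Q.firstInner ![v 0, v 1] = embed H (fun _ => 0) F) :
    circOne (n := 1) (m := 1) 1 1 X X Q v =
      twist (SuperPoly.ren fun _ => (0 : Fin 3)) 1 (outerVal X Q.firstOuter (v 2)) F := by
  rw [circOne_eq_ins, hF, blockSubst_embed (H := H) unmerge (fun _ : Unit => (0 : Fin 2))
    (fun _ => blk0)
    (by intro _ k; revert k; decide), elim_blk_embed _ (by decide)]
  clear hF
  induction F using TensorProduct.induction_on with
  | zero => simp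
  | tmul a u =>
    have hins : (insHom H Q).comp (SuperPoly.ren fun _ : Unit => blk0) =
        (act (κ := Fin 3) (H.superCommute_tensor 2)).comp
          (SuperPoly.ren fun _ : Unit => Sum.inl 0) := by
      refine SuperPoly.hom_ext
        (B := Module.End K (PolyV K N (Fin 3) (HWSupermodule.TPow K V 2))) (fun a => ?_)
          (fun a i => ?_)
      · rw [AlgHom.comp_apply (insHom H Q), SuperPoly.ren_lam,
          insHom_lam Q blk0 (fun _ => 0) (fun i => (shiftCoeff_inr_of_not (hQ i)).symm)]
        simp [blk0]
      · rw [AlgHom.comp_apply (insHom H Q), SuperPoly.ren_th,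
          insHom_th Q blk0 i (fun _ => 0)
            (fun i => (shiftCoeff_inr_of_not (hQ i)).symm)]
        simp [blk0]
    rw [TensorProduct.map_tmul, AlgHom.toLinearMap_apply, LinearMap.id_apply, ins_tmul,
      ← AlgHom.comp_apply (insHom H Q), hins, AlgHom.comp_apply (act (H.superCommute_tensor 2)),
      act_ren_inl (H.superCommute_tensor 2) (fun _ : Unit => (0 : Fin 3)), extend_smul, twist_tmul,
      extend_tmul, SuperPoly.signBy_ren, SuperPoly.signBy_apply_one, one_smul,
      PiTensorProduct.lift.tprod, outerVal_apply]
  | add x y hx hy => simp only [map_add, hx, hy]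

theorem ins_evenOp (Q : NQuiver (Fin 3)) (c : V)
    (z : PolyV K N {k : Fin 3 // merge k = 0} V) :
    ins H Q c (evenOp H.T z) = evenOp (H.TT 2 0) (ins H Q c z) := by
  induction z using TensorProduct.induction_on with
  | zero => simp
  | tmul a u =>
    have h1 : (1 ⊗ₜ[K] PiTensorProduct.tprod K ![H.T u, c] :
        PolyV K N (Fin 3) (HWSupermodule.TPow K V 2)) =
        act (H.superCommute_tensor 2) (SuperPoly.lam (Sum.inr 0))
          (1 ⊗ₜ[K] PiTensorProduct.tprod K ![u, c]) := by
      rw [act_inr_lam, evenOp_tmul, HWSupermodule.TT, PiTensorProduct.map_tprod]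
      congr 2
      ext k
      fin_cases k <;> rfl
    rw [evenOp_tmul, ins_tmul, ins_tmul, h1, ← act_inr_lam (H.superCommute_tensor 2)]
    simp only [insHom, AlgHom.comp_apply]
    rw [← Module.End.mul_apply, ← map_mul, SuperPoly.lam_comm, map_mul, Module.End.mul_apply]
  | add x y hx hy => simp only [map_add, hx, hy]

theorem ins_oddOp (Q : NQuiver (Fin 3)) (c : V) (i : Fin N)
    (z : PolyV K N {k : Fin 3 // merge k = 0} V) :
    ins H Q c (oddOp (H.S i) z) = oddOp (H.SS 2 0 i) (ins H Q c z) := by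
  induction z using TensorProduct.induction_on with
  | zero => simp
  | tmul a u =>
    have h1 : (1 ⊗ₜ[K] PiTensorProduct.tprod K ![H.S i u, c] :
        PolyV K N (Fin 3) (HWSupermodule.TPow K V 2)) =
        act (H.superCommute_tensor 2) (SuperPoly.th (Sum.inr 0) i)
          (1 ⊗ₜ[K] PiTensorProduct.tprod K ![u, c]) := by
      rw [act_inr_th, oddOp_tmul, HWSupermodule.SS, PiTensorProduct.map_tprod, map_one]
      congr 2
      ext k
      fin_cases k <;> rfl
    rw [oddOp_tmul, ins_tmul, ins_tmul, h1, ← act_inr_th (H.superCommute_tensor 2)]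
    simp only [insHom, AlgHom.comp_apply]
    rw [← Module.End.mul_apply, ← map_mul, SuperPoly.th_comm, map_mul, Module.End.mul_apply,
      SuperPoly.involute_linSubst, SuperPoly.involute_linSubst, SuperPoly.involute_involute]
  | add x y hx hy => simp only [map_add, hx, hy]

theorem ins_smul (Q : NQuiver (Fin 3)) (c : V)
    (a : SuperPoly K N {k : Fin 3 // merge k = 0})
    (z : PolyV K N {k : Fin 3 // merge k = 0} V) :
    ins H Q c (a • z) = insHom H Q a (ins H Q c z) := by
  induction z using TensorProduct.induction_on with
  | zero => simp
  | tmul b u =>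
    rw [TensorProduct.smul_tmul', ins_tmul, ins_tmul, smul_eq_mul, map_mul, Module.End.mul_apply]
  | add x y hx hy => simp only [smul_add, map_add, hx, hy]

/-- If the block `{3}` is externally connected to the first vertex but no edge between the blocks
ends in the second vertex, then the variable of the second vertex is not shifted in the
composition. -/
theorem circOne_of_snd [CharZero K] {X : Op H (Fin 2)} (hX : IsPcl 1 X) (Q : NQuiver (Fin 3))
    (v : Fin 3 → V) (hT : ∀ v, ∑ l, X Q.firstOuter (fun m => H.Tcomp l m (v m)) =
      -((∑ l, SuperPoly.lam l : SuperPoly K N (Fin 2)) • X Q.firstOuter v))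
    (h0 : ¬ Q.ExtConnected merge 0 0) (h1 : Q.ExtConnected merge 1 0)
    (F : PolyV K N Unit V) (hF : X Q.firstInner ![v 0, v 1] = embed H (fun _ => 1) F) :
    circOne (n := 1) (m := 1) 1 1 X X Q v =
      twist (SuperPoly.ren fun _ => (1 : Fin 3)) 1 (outerVal X Q.firstOuter (v 2)) F := by
  rw [circOne_eq_ins, hF, blockSubst_embed (H := H) unmerge (fun _ : Unit => (1 : Fin 2))
    (fun _ => blk1)
    (by intro _ k; revert k; decide)]
  clear hF
  have he : ∀ i : Fin 2, (if i = 1 then 1 else 0 : ℤ) =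
      shiftCoeff merge Q 0 blk0 (Sum.inr i) := by
    intro i
    fin_cases i
    · exact (shiftCoeff_inr_of_not h0).symm
    · exact (shiftCoeff_inr_of h1).symm
  have hec : ∀ x : {k : Fin 3 // merge k = 0} ⊕ Unit, elimCoeff blk1 id blk1 x =
      if x = Sum.inl blk1 then 0 else -1 := by
    decide
  have hun : (Finset.univ : Finset {k : Fin 3 // merge k = 0}) = {blk0, blk1} := by decide
  have hfin : ∀ f : Fin 3 → SuperPoly K N (Fin 3), ∑ j, (if merge j = 0 then 1 else 0 : ℤ) • f j
      = f 0 + f 1 := by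
    intro f
    rw [Fin.sum_univ_three, show merge 0 = 0 from rfl, show merge 1 = 0 from rfl,
      show merge 2 = 1 from rfl]
    simp
  have hfin1 : ∀ f : Fin 3 → SuperPoly K N (Fin 3), ∑ j, (if merge j = 1 then 1 else 0 : ℤ) • f j
      = f 2 := by
    intro f
    rw [Fin.sum_univ_three, show merge 0 = 0 from rfl, show merge 1 = 0 from rfl,
      show merge 2 = 1 from rfl]
    simp
  induction F using TensorProduct.induction_on with
  | zero => simp
  | tmul a u =>
    rw [embed_tmul, elim_mk_tmul]
    -- `Λ_2` becomes `-Λ_1 - ∇`, then `-Λ_1 - Λ_3 - ∇^{(1)} - ∇^{(2)}`, which acts on the values of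
    -- the outer operation as `Λ_2`.
    have key := SuperPoly.intertwine
      ((act H.superCommute).comp ((SuperPoly.linSubst (elimCoeff blk1 id)).comp
        (SuperPoly.ren fun _ : Unit => blk1)))
      ((Algebra.lsmul K K (Vnabla H (Fin 3))).comp
        ((SuperPoly.ren fun _ => (1 : Fin 3)).comp SuperPoly.involute))
      (extend merge 1 X Q.firstOuter ∘ₗ ins H Q (v 2)) ?_ ?_ a (1 ⊗ₜ[K] u)
    · refine key.trans ?_
      rw [LinearMap.comp_apply, ins_tmul, map_one, Module.End.one_apply, extend_tmul,
        SuperPoly.signBy_apply_one, one_smul, PiTensorProduct.lift.tprod, ← outerVal_apply]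
      rfl
    · intro _ z
      have hΦ : ((act H.superCommute).comp ((SuperPoly.linSubst (elimCoeff blk1 id)).comp
          (SuperPoly.ren fun _ : Unit => blk1))) (SuperPoly.lam ()) z =
          -((SuperPoly.lam blk0 : SuperPoly K N _) • z) - evenOp H.T z := by
        simp only [AlgHom.comp_apply, SuperPoly.ren_lam, SuperPoly.linSubst_lam, hec,
          Fintype.sum_sum_type, hun]
        simp [sub_eq_add_neg, show blk0 ≠ blk1 by decide]
      have hI : ∀ y, insHom H Q (SuperPoly.lam blk0) y =
          (SuperPoly.lam 0 + SuperPoly.lam 2 : SuperPoly K N (Fin 3)) • y +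
            evenOp (H.TT 2 1) y := by
        intro y
        rw [insHom_lam Q blk0 _ he]
        simp [Fin.sum_univ_three, show merge 0 = 0 from rfl, show merge 1 = 0 from rfl,
          show merge 2 = 1 from rfl, blk0, add_smul, add_assoc]
      have h2 := extend_evenOp merge Q.firstOuter hT (ins H Q (v 2) z)
      rw [hΦ, LinearMap.comp_apply, map_sub, map_neg, ins_smul, hI, ins_evenOp, map_sub, map_neg,
        map_add, extend_smul, SuperPoly.signBy_one, AlgHom.toLinearMap_apply, map_add,
        SuperPoly.involute_lam, SuperPoly.involute_lam, neg_add, add_sub_assoc,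
        ← neg_add', add_comm (extend merge 1 X Q.firstOuter (evenOp (H.TT 2 1) _)), h2, neg_neg,
        neg_add_eq_sub, ← sub_smul]
      simp [Fin.sum_univ_three]
    · intro _ i z
      have hΦ : ((act H.superCommute).comp ((SuperPoly.linSubst (elimCoeff blk1 id)).comp
          (SuperPoly.ren fun _ : Unit => blk1))) (SuperPoly.th () i) z =
          -((SuperPoly.th blk0 i : SuperPoly K N _) • z) - oddOp (H.S i) z := by
        simp only [AlgHom.comp_apply, SuperPoly.ren_th, SuperPoly.linSubst_th, hec,
          Fintype.sum_sum_type, hun]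
        simp [sub_eq_add_neg, show blk0 ≠ blk1 by decide]
      have hI : ∀ y, insHom H Q (SuperPoly.th blk0 i) y =
          (SuperPoly.th 0 i + SuperPoly.th 2 i : SuperPoly K N (Fin 3)) • y +
            oddOp (H.SS 2 1 i) y := by
        intro y
        rw [insHom_th Q blk0 i _ he]
        simp [Fin.sum_univ_three, show merge 0 = 0 from rfl, show merge 1 = 0 from rfl,
          show merge 2 = 1 from rfl, blk0, add_smul, add_assoc]
      have h2 := extend_oddOp merge hX Q.firstOuter 0 i (ins H Q (v 2) z)
      have h3 := extend_oddOp merge hX Q.firstOuter 1 i (ins H Q (v 2) z)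
      rw [hΦ, LinearMap.comp_apply, map_sub, map_neg, ins_smul, hI, ins_oddOp, map_sub, map_neg,
        map_add, extend_smul, SuperPoly.signBy_one, AlgHom.toLinearMap_apply, map_add,
        SuperPoly.involute_th, SuperPoly.involute_th, h2, h3, hfin, hfin1, ← add_smul, ← neg_smul,
        ← sub_smul]
      change _ = SuperPoly.ren (fun _ => (1 : Fin 3)) (SuperPoly.involute (SuperPoly.th () i) :
          SuperPoly K N Unit) •
        extend merge 1 X Q.firstOuter (ins H Q (v 2) z)
      rw [SuperPoly.involute_th, map_neg, SuperPoly.ren_th]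
      congr 1
      abel
  | add x y hx hy => simp only [map_add, hx, hy]

end Op

/-! ### Quivers with two and three vertices -/

namespace NQuiver

/-- The quiver with two vertices and one edge, from the second to the first vertex. -/
def rev : NQuiver (Fin 2) := ⟨{(1, 0)}, by simp⟩

/-- The quiver with an edge `e` added. -/
def cons {ι : Type} (e : ι × ι) (he : e.1 ≠ e.2) (Q : NQuiver ι) : NQuiver ι where
  edges := e ::ₘ Q.edges
  no_loop d hd := by
    rcases Multiset.mem_cons.1 hd with rfl | hd
    · exact he
    · exact Q.no_loop d hd

theorem isWalk_two {e f : Fin 2 × Fin 2} (he : e.1 ≠ e.2) (hf : f.1 ≠ f.2) :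
    IsWalk id [e, f] e.1 e.1 := by
  simp only [IsWalk, id]
  revert e f
  decide

theorem not_isAcyclic_of_card {Q : NQuiver (Fin 2)} (h : 2 ≤ Q.edges.card) : ¬ Q.IsAcyclic := by
  obtain ⟨e, he⟩ := Multiset.card_pos_iff_exists_mem.1 (show 0 < Q.edges.card by omega)
  obtain ⟨s, hs⟩ := Multiset.exists_cons_of_mem he
  have hs1 : 0 < s.card := by
    rw [hs, Multiset.card_cons] at h
    omega
  obtain ⟨f, hf⟩ := Multiset.card_pos_iff_exists_mem.1 hs1
  obtain ⟨t, ht⟩ := Multiset.exists_cons_of_mem hf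
  intro hQ
  have := hQ [e, f] e.1 (by
    rw [hs, ht, ← Multiset.cons_coe, ← Multiset.cons_coe]
    exact Multiset.cons_le_cons _ (Multiset.cons_le_cons _ (Multiset.zero_le _)))
    (isWalk_two (Q.no_loop e he) (Q.no_loop f (hs ▸ Multiset.mem_cons_of_mem hf)))
  simp at this

theorem eq_of_card_le_one {Q : NQuiver (Fin 2)} (h : Q.edges.card ≤ 1) :
    Q = discrete ∨ Q = arrow ∨ Q = rev := by
  rcases Nat.le_one_iff_eq_zero_or_eq_one.1 h with h | h
  · exact Or.inl (NQuiver.ext (Multiset.card_eq_zero.1 h))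
  · obtain ⟨e, he⟩ := Multiset.card_eq_one.1 h
    have h1 := Q.no_loop e (by simp [he])
    have h2 : e = (0, 1) ∨ e = (1, 0) := by
      clear he
      revert e
      decide
    rcases h2 with rfl | rfl
    · exact Or.inr (Or.inl (NQuiver.ext he))
    · exact Or.inr (Or.inr (NQuiver.ext he))

theorem isAcyclic_of_card {ι : Type} {Q : NQuiver ι} (h : Q.edges.card ≤ 1) : Q.IsAcyclic := by
  intro p x hp hw
  have hl : p.length ≤ 1 := (Multiset.card_le_card hp).trans h
  match p, hl, hp, hw with
  | [], _, _, _ => rfl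
  | [e], _, hp, hw =>
    have he := Q.no_loop e (Multiset.mem_of_le hp (by simp))
    simp only [IsWalk, id] at hw
    rcases hw with ⟨h1, h2⟩ | ⟨h1, h2⟩
    · exact absurd (h1.trans h2.symm) he
    · exact absurd (h2.trans h1.symm) he

theorem connected_of_mem {ι : Type} {Q : NQuiver ι} {e : ι × ι} (h : e ∈ Q.edges) :
    Q.Connected e.1 e.2 ∧ Q.Connected e.2 e.1 :=
  ⟨⟨[e], by simpa using h, Or.inl ⟨rfl, rfl⟩⟩, ⟨[e], by simpa using h, Or.inr ⟨rfl, rfl⟩⟩⟩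

theorem connected_refl {ι : Type} (Q : NQuiver ι) (x : ι) : Q.Connected x x :=
  ⟨[], by simp, rfl⟩

theorem isWalk_map {ι κ : Type} {b : ι → κ} {p : List (ι × ι)} {x y : κ} (h : IsWalk b p x y) :
    IsWalk id (p.map (Prod.map b b)) x y := by
  induction p generalizing x with
  | nil => exact h
  | cons e p ih =>
    rcases h with ⟨h1, h2⟩ | ⟨h1, h2⟩
    · exact Or.inl ⟨h1, ih h2⟩
    · exact Or.inr ⟨h1, ih h2⟩

@[simp] theorem firstOuter_cons (e : Fin 3 × Fin 3) (he : e.1 ≠ e.2) (Q : NQuiver (Fin 3)) :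
    (Q.cons e he).firstOuter.edges = (if merge e.1 ≠ merge e.2 then {Prod.map merge merge e} else 0)
      + Q.firstOuter.edges := by
  simp only [firstOuter, outer, cons]
  split_ifs with h
  · rw [Multiset.filter_cons_of_pos (p := fun e : Fin 3 × Fin 3 => merge e.1 ≠ merge e.2) _ h,
      Multiset.map_cons, Multiset.singleton_add]
  · rw [Multiset.filter_cons_of_neg (p := fun e : Fin 3 × Fin 3 => merge e.1 ≠ merge e.2) _ h,
      zero_add]

/-- An edge of the quiver `{1, 2, 3}` as an edge inside the block `{1, 2}`, if it is one. -/
def innerEdge (e : Fin 3 × Fin 3) : Multiset (Fin 2 × Fin 2) :=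
  if e = (0, 1) then {(0, 1)} else if e = (1, 0) then {(1, 0)} else 0

@[simp] theorem firstInner_cons (e : Fin 3 × Fin 3) (he : e.1 ≠ e.2) (Q : NQuiver (Fin 3)) :
    (Q.cons e he).firstInner.edges = innerEdge e + Q.firstInner.edges := by
  simp only [firstInner, inner, cons, rename, Multiset.filterMap_cons, Multiset.map_add]
  congr 1
  revert e
  decide

/-- The quiver without edges. -/
def empty (ι : Type) : NQuiver ι := ⟨0, by simp⟩

theorem induction_cons {ι : Type} {C : NQuiver ι → Prop} (h0 : C (empty ι))
    (hc : ∀ e he Q, C Q → C (cons e he Q)) (Q : NQuiver ι) : C Q := by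
  obtain ⟨s, hs⟩ := Q
  induction s using Multiset.induction_on with
  | empty => exact h0
  | cons e s ih =>
    exact hc e (hs e (Multiset.mem_cons_self e s))
      ⟨s, fun d hd => hs d (Multiset.mem_cons_of_mem hd)⟩
      (ih _)

theorem card_firstInner_add_card_firstOuter (Q : NQuiver (Fin 3)) :
    Q.firstInner.edges.card + Q.firstOuter.edges.card = Q.edges.card := by
  induction Q using induction_cons with
  | h0 => rfl
  | hc e he Q ih =>
    rw [firstInner_cons, firstOuter_cons, Multiset.card_add, Multiset.card_add, add_add_add_comm,
      ih,
      add_comm, cons, Multiset.card_cons]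
    congr 1
    clear ih
    revert e
    decide

theorem exists_not_incident {Q : NQuiver (Fin 3)} (hQ : ¬ 2 ≤ Q.firstOuter.edges.card) :
    ∃ k l : Fin 2, k ≠ l ∧ ∀ d ∈ Q.edges,
      merge d.1 ≠ merge d.2 → d.1 ≠ k.castSucc ∧ d.2 ≠ k.castSucc := by
  by_contra hne
  push Not at hne
  obtain ⟨d, hd, hm, h⟩ := hne 0 1 (by decide)
  obtain ⟨d', hd', hm', h'⟩ := hne 1 0 (by decide)
  refine hQ ?_
  have hdd : d ≠ d' := by
    rintro rfl
    clear hd hd'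
    revert hm h h'
    revert d
    decide
  rw [firstOuter, outer, Multiset.card_map]
  have h1 : d ∈ Q.edges.filter (fun e => merge e.1 ≠ merge e.2) :=
    Multiset.mem_filter.2 ⟨hd, hm⟩
  have h2 : d' ∈ Q.edges.filter (fun e => merge e.1 ≠ merge e.2) :=
    Multiset.mem_filter.2 ⟨hd', hm'⟩
  obtain ⟨t, ht⟩ := Multiset.exists_cons_of_mem h1
  rw [ht] at h2 ⊢
  rcases Multiset.mem_cons.1 h2 with h2 | h2
  · exact absurd h2.symm hdd
  · rw [Multiset.card_cons]
    have := Multiset.card_pos_iff_exists_mem.2 ⟨_, h2⟩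
    omega

theorem rename_cons {ι κ : Type} (s : ι ≃ κ) (e : ι × ι) (he : e.1 ≠ e.2) (Q : NQuiver ι) :
    (Q.cons e he).rename s = (Q.rename s).cons (Prod.map s s e) (s.injective.ne he) :=
  NQuiver.ext (Multiset.map_cons _ _ _)

theorem rename_rename {ι κ J : Type} (s : ι ≃ κ) (t : κ ≃ J) (Q : NQuiver ι) :
    (Q.rename s).rename t = Q.rename (s.trans t) :=
  NQuiver.ext (Multiset.map_map _ _ _)

theorem firstOuter_rename_swap (Q : NQuiver (Fin 3)) :
    (Q.rename (Equiv.swap 0 1)).firstOuter = Q.firstOuter := by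
  induction Q using induction_cons with
  | h0 => rfl
  | hc e he Q ih =>
    refine NQuiver.ext ?_
    rw [rename_cons, firstOuter_cons, firstOuter_cons, ih]
    congr 1
    clear ih
    revert e
    decide

theorem firstInner_rename_swap (Q : NQuiver (Fin 3)) :
    (Q.rename (Equiv.swap 0 1)).firstInner = Q.firstInner.rename (Equiv.swap 0 1) := by
  induction Q using induction_cons with
  | h0 => rfl
  | hc e he Q ih =>
    refine NQuiver.ext ?_
    rw [rename_cons, firstInner_cons, ih]
    change _ = ((Q.cons e he).firstInner.edges).map _
    rw [firstInner_cons, Multiset.map_add]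
    congr 1
    clear ih
    revert e
    decide

end NQuiver

namespace Op

theorem circOne_eq_zero_of_inner [CharZero K] {X : Op H (Fin 2)} (hX : IsPcl 1 X)
    {Q : NQuiver (Fin 3)} (h : 2 ≤ Q.firstInner.edges.card) :
    circOne (n := 1) (m := 1) 1 1 X X Q = 0 := by
  ext v
  rw [circOne_eq_ins, hX.not_acyclic _ (NQuiver.not_isAcyclic_of_card h)]
  simp

/-- Two edges between the blocks form a cycle after contraction of the blocks. -/
theorem circOne_eq_zero_of_outer [CharZero K] {X : Op H (Fin 2)} (hX : IsPcl 1 X)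
    {Q : NQuiver (Fin 3)} (h : 2 ≤ Q.firstOuter.edges.card) :
    circOne (n := 1) (m := 1) 1 1 X X Q = 0 := by
  have h0 : extend merge 1 X Q.firstOuter = 0 := by
    refine TensorProduct.ext' fun a w => ?_
    have h1 : PiTensorProduct.lift (X Q.firstOuter) w = 0 := by
      rw [hX.not_acyclic _ (NQuiver.not_isAcyclic_of_card h)]
      induction w using PiTensorProduct.induction_on with
      | smul_tprod r v => simp
      | add x y hx hy => rw [map_add, hx, hy, add_zero]
    rw [extend_tmul, h1, map_zero, smul_zero, LinearMap.zero_apply]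
  ext v
  rw [circOne_eq_ins, h0]
  simp

theorem outerVal_S {X : Op H (Fin 2)} (hX : IsPcl 1 X) (Q : NQuiver (Fin 2)) (c : V) (i : Fin N)
    (u : V) : outerVal X Q c (H.S i u) =
      (SuperPoly.th 0 i + SuperPoly.th 1 i : SuperPoly K N (Fin 3)) • outerVal X Q c u := by
  have h := hX.sesq_S Q 0 i ![u, c]
  have hv : (fun m => H.Scomp 0 i m (![u, c] m)) = ![H.S i u, c] := by
    ext m
    fin_cases m <;> rfl
  rw [hv, ksign_one, neg_one_smul, neg_neg] at h
  rw [outerVal_apply, outerVal_apply, h, blockSubst_smul, SuperPoly.linSubst_th,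
    Fin.sum_univ_three, show merge 0 = 0 from rfl, show merge 1 = 0 from rfl,
    show merge 2 = 1 from rfl]
  simp

theorem sesq_T_of_empty {X : Op H (Fin 2)} (hX : IsPcl 1 X) {Q : NQuiver (Fin 2)}
    (hQ : Q.edges = 0) (k : Fin 2) (v : Fin 2 → V) :
    X Q (fun m => H.Tcomp k m (v m)) = -((SuperPoly.lam k : SuperPoly K N (Fin 2)) • X Q v) := by
  have h := hX.sesq_T Q k {k} (fun l => ?_) v
  · simpa using h
  · rw [Finset.mem_singleton]
    constructor
    · rintro rfl
      exact Q.connected_refl _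
    · rintro ⟨p, hp, hw⟩
      cases p with
      | nil => exact hw.symm
      | cons e p => simpa [hQ] using hp e (by simp)

theorem sesq_T_of_mem {X : Op H (Fin 2)} (hX : IsPcl 1 X) {Q : NQuiver (Fin 2)}
    {e : Fin 2 × Fin 2} (he : e ∈ Q.edges) (v : Fin 2 → V) :
    ∑ l, X Q (fun m => H.Tcomp l m (v m)) =
      -((∑ l, SuperPoly.lam l : SuperPoly K N (Fin 2)) • X Q v) := by
  refine hX.sesq_T Q 0 Finset.univ (fun l => ?_) v
  have h := Q.connected_of_mem he
  have hl := Q.no_loop e he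
  have : l = 0 ∨ (l = e.1 ∧ 0 = e.2) ∨ (l = e.2 ∧ 0 = e.1) := by
    clear h he
    revert e l
    decide
  rcases this with rfl | ⟨rfl, h0⟩ | ⟨rfl, h0⟩
  · simp [Q.connected_refl]
  · rw [h0]; simp [h.2]
  · rw [h0]; simp [h.1]

theorem outerVal_T {X : Op H (Fin 2)} (hX : IsPcl 1 X) {Q : NQuiver (Fin 2)} (hQ : Q.edges = 0)
    (c : V) (u : V) : outerVal X Q c (H.T u) =
      -((SuperPoly.lam 0 + SuperPoly.lam 1 : SuperPoly K N (Fin 3)) • outerVal X Q c u) := by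
  have h := sesq_T_of_empty hX hQ 0 ![u, c]
  have hv : (fun m => H.Tcomp 0 m (![u, c] m)) = ![H.T u, c] := by
    ext m
    fin_cases m <;> rfl
  rw [hv] at h
  rw [outerVal_apply, outerVal_apply, h, map_neg, blockSubst_smul, SuperPoly.linSubst_lam,
    Fin.sum_univ_three, show merge 0 = 0 from rfl, show merge 1 = 0 from rfl,
    show merge 2 = 1 from rfl]
  simp

/-- If no edge leaves the first block, then it does not matter which of its two variables is
eliminated. -/
theorem twist_outerVal_eq {X : Op H (Fin 2)} (hX : IsPcl 1 X) {Q : NQuiver (Fin 2)}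
    (hQ : Q.edges = 0) (c : V) (x : Vnabla H (Fin 2)) :
    twist (SuperPoly.ren fun _ => (0 : Fin 3)) 1 (outerVal X Q c) (elim H 1 (fun _ => ()) x) =
      twist (SuperPoly.ren fun _ => (1 : Fin 3)) 1 (outerVal X Q c) (elim H 0 (fun _ => ()) x) := by
  let D : Vnabla H (Fin 2) →ₗ[K] Vnabla H (Fin 3) :=
    descAct H ((Algebra.lsmul K K (Vnabla H (Fin 3))).comp
      ((SuperPoly.ren (Fin.castSucc : Fin 2 → Fin 3)).comp SuperPoly.involute)) (outerVal X Q c)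
      (fun v => by
        rw [outerVal_T hX hQ, add_smul, neg_add_rev]
        simp [Fin.sum_univ_two])
      (fun i v => by
        rw [outerVal_S hX, add_comm (SuperPoly.th 0 i), add_smul]
        simp [Fin.sum_univ_two])
  have hD : ∀ (k : Fin 2) (F : PolyV K N Unit V), D (embed H (fun _ => k) F) =
      twist (SuperPoly.ren fun _ => k.castSucc) 1 (outerVal X Q c) F := by
    intro k F
    induction F using TensorProduct.induction_on with
    | zero => simp
    | tmul a u =>
      rw [twist_tmul, embed_tmul]
      refine Eq.trans (b := SuperPoly.ren Fin.castSucc (SuperPoly.involute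
        (SuperPoly.ren (fun _ => k) a)) • outerVal X Q c u) rfl ?_
      rw [SuperPoly.involute_ren, SuperPoly.signBy_one, AlgHom.toLinearMap_apply,
        ← AlgHom.comp_apply (SuperPoly.ren Fin.castSucc)]
      congr 1
      refine DFunLike.congr_fun (SuperPoly.hom_ext (fun _ => ?_) (fun _ i => ?_)) _ <;> simp
    | add x y hx hy => simp only [map_add, hx, hy]
  have h0 := hD 0 (elim H 1 (fun _ => ()) x)
  have h1 := hD 1 (elim H 0 (fun _ => ()) x)
  rw [embed_elim (by decide)] at h0 h1
  exact h0.symm.trans h1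

/-- The composition of a binary operation with itself: if no edge between the blocks ends in the
vertex `k` of the first block, the other variable of the inner operation is eliminated, and that of
`k` is not shifted. -/
theorem circOne_apply [CharZero K] {X : Op H (Fin 2)} (hX : IsPcl 1 X) (Q : NQuiver (Fin 3))
    {k l : Fin 2} (hkl : k ≠ l) (hk : ∀ e ∈ Q.edges, merge e.1 ≠ merge e.2 →
      e.1 ≠ k.castSucc ∧ e.2 ≠ k.castSucc) (v : Fin 3 → V) :
    circOne (n := 1) (m := 1) 1 1 X X Q v =
      twist (SuperPoly.ren fun _ => k.castSucc) 1 (outerVal X Q.firstOuter (v 2))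
        (elim H l (fun _ => ()) (X Q.firstInner ![v 0, v 1])) := by
  have hext : ∀ m : Fin 3, (∀ e ∈ Q.edges, merge e.1 ≠ merge e.2 → e.1 ≠ m ∧ e.2 ≠ m) →
      ∀ i, ¬ Q.ExtConnected merge i m := by
    rintro m hm i ⟨p, hp, _, e, he, h⟩
    have := Multiset.mem_filter.1 (Multiset.mem_of_le hp (Multiset.mem_coe.2 he))
    have := hm e this.1 this.2
    tauto
  -- If no outer edge meets the first vertex, `Λ_1` is not shifted and the other variable of the
  -- block can be eliminated. If no outer edge meets the second vertex either, there are no outer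
  -- edges at all, and it does not matter which of the two variables is eliminated.
  by_cases h0 : ∀ e ∈ Q.edges, merge e.1 ≠ merge e.2 → e.1 ≠ 0 ∧ e.2 ≠ 0
  · rw [circOne_of_fst X Q v (hext 0 h0) _ (embed_elim (k := 0) (l := 1) (by decide) _).symm]
    have hk2 : k = 0 ∧ l = 1 ∨ k = 1 ∧ l = 0 := by clear hk; revert k l; decide
    rcases hk2 with ⟨rfl, rfl⟩ | ⟨rfl, rfl⟩
    · rfl
    · refine twist_outerVal_eq hX ?_ _ _
      have : Q.edges.filter (fun e => merge e.1 ≠ merge e.2) = 0 := by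
        refine Multiset.filter_eq_nil.2 fun e he h => ?_
        have h1 := h0 e he h
        have h2 := hk e he h
        have h3 := Q.no_loop e he
        revert h1 h2 h3
        clear he h
        revert e
        decide
      exact (congrArg (Multiset.map (Prod.map merge merge)) this).trans (Multiset.map_zero _)
  · have hk2 : k = 1 ∧ l = 0 := by
      have : k = 0 ∧ l = 1 ∨ k = 1 ∧ l = 0 := by clear hk; revert k l; decide
      rcases this with ⟨rfl, rfl⟩ | h
      · exact absurd hk h0
      · exact h
    obtain ⟨rfl, rfl⟩ := hk2
    push Not at h0
    obtain ⟨e, he, hm, h⟩ := h0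
    have heo : e ∈ Q.edges.filter (fun e => merge e.1 ≠ merge e.2) := Multiset.mem_filter.2 ⟨he, hm⟩
    have heO : Prod.map merge merge e ∈ Q.firstOuter.edges := Multiset.mem_map_of_mem _ heo
    -- If the outer quiver has a cycle, both sides vanish.
    by_cases hac : Q.firstOuter.IsAcyclic
    · refine circOne_of_snd hX Q v (sesq_T_of_mem hX heO) ?_ ?_ _ (embed_elim (by decide) _).symm
      · rintro ⟨p, hp, hw, d, hd, _⟩
        have := hac (p.map (Prod.map merge merge)) 0 (by
          rw [← Multiset.map_coe]
          exact Multiset.map_le_map hp) (NQuiver.isWalk_map hw)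
        rw [List.map_eq_nil_iff] at this
        subst this
        simp at hd
      · refine ⟨[e], Multiset.singleton_le.2 heo, ?_, e, by simp, ?_⟩
        · have h1 := hk e he hm
          simp only [NQuiver.IsWalk]
          clear he heo heO
          revert hm h1
          revert e
          decide
        · tauto
    · have hz := hX.not_acyclic _ hac
      have hz2 : outerVal X Q.firstOuter (v 2) = 0 := by
        ext u
        rw [outerVal_apply, hz]
        simp
      have h2 : 2 ≤ Q.firstOuter.edges.card := by
        by_contra h2
        exact hac (NQuiver.isAcyclic_of_card (by omega))
      rw [circOne_eq_zero_of_outer hX h2, hz2, zero_apply]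
      generalize elim H 0 (fun _ => ()) (X Q.firstInner ![v 0, v 1]) = F
      induction F using TensorProduct.induction_on with
      | zero => simp
      | tmul a u => simp
      | add x y hx hy => rw [map_add, ← hx, ← hy, add_zero]

/-! ### Reversing an edge -/

/-- Reversing an edge changes the sign: apply the second cycle relation to the directed cycle formed
by the edge and its reverse. -/
theorem map_swap {X : Op H (Fin 2)} (hX : IsPcl 1 X) (e : Fin 2 × Fin 2) (he : e.1 ≠ e.2)
    (Q : NQuiver (Fin 2)) : X (Q.cons e.swap he.symm) = -X (Q.cons e he) := by
  have h := hX.directed_cycle ((Q.cons e he).cons e.swap he.symm) [e, e.swap]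
    ⟨by simp, ?_, e.1, ⟨rfl, rfl, rfl⟩⟩
  · have h1 : ((Q.cons e he).cons e.swap he.symm).erase e = Q.cons e.swap he.symm := by
      refine NQuiver.ext ?_
      change (e.swap ::ₘ e ::ₘ Q.edges).erase e = e.swap ::ₘ Q.edges
      rw [Multiset.cons_swap, Multiset.erase_cons_head]
    have h2 : ((Q.cons e he).cons e.swap he.symm).erase e.swap = Q.cons e he :=
      NQuiver.ext (Multiset.erase_cons_head _ _)
    rw [List.map_cons, List.map_cons, List.map_nil, List.sum_cons, List.sum_cons, List.sum_nil,
      add_zero, h1, h2] at h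
    exact eq_neg_of_add_eq_zero_left h
  · change e ::ₘ e.swap ::ₘ 0 ≤ e.swap ::ₘ e ::ₘ Q.edges
    rw [Multiset.cons_swap]
    exact Multiset.cons_le_cons _ (Multiset.cons_le_cons _ (Multiset.zero_le _))

theorem map_rev {X : Op H (Fin 2)} (hX : IsPcl 1 X) : X NQuiver.rev = -X NQuiver.arrow :=
  map_swap hX (0, 1) (by decide) NQuiver.discrete

theorem circOne_swap [CharZero K] {X : Op H (Fin 2)} (hX : IsPcl 1 X) (e : Fin 3 × Fin 3)
    (he : e.1 ≠ e.2) (Q : NQuiver (Fin 3)) :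
    circOne (n := 1) (m := 1) 1 1 X X (Q.cons e.swap he.symm) =
      -circOne (n := 1) (m := 1) 1 1 X X (Q.cons e he) := by
  by_cases hO : 2 ≤ (Q.cons e he).firstOuter.edges.card
  · rw [circOne_eq_zero_of_outer hX hO, circOne_eq_zero_of_outer hX, neg_zero]
    refine hO.trans (le_of_eq ?_)
    rw [NQuiver.firstOuter_cons, NQuiver.firstOuter_cons, Multiset.card_add, Multiset.card_add]
    congr 1
    clear hO
    revert e
    decide
  · obtain ⟨k, l, hkl, hk⟩ := NQuiver.exists_not_incident hO
    have hk' : ∀ d ∈ (Q.cons e.swap he.symm).edges,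
        merge d.1 ≠ merge d.2 → d.1 ≠ k.castSucc ∧ d.2 ≠ k.castSucc := by
      intro d hd hm
      rcases Multiset.mem_cons.1 hd with rfl | hd
      · exact (hk e (Multiset.mem_cons_self _ _) hm.symm).symm
      · exact hk d (Multiset.mem_cons_of_mem hd) hm
    ext v
    rw [circOne_apply hX _ hkl hk', neg_apply, circOne_apply hX _ hkl hk]
    by_cases hm : merge e.1 = merge e.2
    · have hi : ∃ d : Fin 2 × Fin 2, d.1 ≠ d.2 ∧ NQuiver.innerEdge e = {d} ∧
          NQuiver.innerEdge e.swap = {d.swap} := by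
        clear hO hk hk'
        revert e
        decide
      obtain ⟨d, hd, h1, h2⟩ := hi
      have hi1 : (Q.cons e he).firstInner = Q.firstInner.cons d hd := by
        refine NQuiver.ext ?_
        rw [NQuiver.firstInner_cons, h1]
        rfl
      have hi2 : (Q.cons e.swap he.symm).firstInner = Q.firstInner.cons d.swap hd.symm := by
        refine NQuiver.ext ?_
        rw [NQuiver.firstInner_cons, h2]
        rfl
      have ho : (Q.cons e.swap he.symm).firstOuter = (Q.cons e he).firstOuter := by
        refine NQuiver.ext ?_
        rw [NQuiver.firstOuter_cons, NQuiver.firstOuter_cons, if_neg (not_not.2 hm),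
          if_neg (show ¬ merge e.swap.1 ≠ merge e.swap.2 from not_not.2 hm.symm)]
      rw [hi1, hi2, ho, map_swap hX, neg_apply, map_neg, map_neg]
    · have hi : NQuiver.innerEdge e.swap = NQuiver.innerEdge e := by
        clear hO hk hk'
        revert e
        decide
      have hi1 : (Q.cons e.swap he.symm).firstInner = (Q.cons e he).firstInner := by
        refine NQuiver.ext ?_
        rw [NQuiver.firstInner_cons, NQuiver.firstInner_cons, hi]
      have ho1 : (Q.cons e he).firstOuter = Q.firstOuter.cons (Prod.map merge merge e) hm := by
        refine NQuiver.ext ?_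
        rw [NQuiver.firstOuter_cons, if_pos hm]
        rfl
      have ho2 : (Q.cons e.swap he.symm).firstOuter =
          Q.firstOuter.cons (Prod.map merge merge e).swap (Ne.symm hm) := by
        refine NQuiver.ext ?_
        rw [NQuiver.firstOuter_cons,
          if_pos (show merge e.swap.1 ≠ merge e.swap.2 from Ne.symm hm)]
        rfl
      have hneg : outerVal X (Q.cons e.swap he.symm).firstOuter (v 2) =
          (-1 : ℤ) • outerVal X (Q.cons e he).firstOuter (v 2) := by
        ext u
        rw [outerVal_apply, ho1, ho2, map_swap hX, LinearMap.smul_apply, outerVal_apply,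
          neg_apply, map_neg, neg_one_smul]
      rw [hi1, hneg, twist_smul_map, neg_one_smul]

end Op

/-! ### The action of permutations -/

theorem HWSupermodule.proj_add_proj (H : HWSupermodule K N V) (v : V) :
    ∑ q, H.proj q v = v := by
  have : ∑ q, H.proj q = LinearMap.id := by
    refine H.ext_homogeneous fun q v hv => ?_
    rw [LinearMap.sum_apply]
    simp [H.proj_of_mem _ q v hv]
  simpa using LinearMap.congr_fun this v

theorem HWSupermodule.proj_mem (H : HWSupermodule K N V) (p : ZMod 2) (v : V) :
    H.proj p v ∈ H.parity p := Subtype.property _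

theorem ext_multilinear (H : HWSupermodule K N V) {ι : Type} [Fintype ι] [DecidableEq ι]
    {W : Type*} [AddCommGroup W] [Module K W] {f g : MultilinearMap K (fun _ : ι => V) W}
    (h : ∀ (q : ι → ZMod 2) (v : ι → V), (∀ k, v k ∈ H.parity (q k)) → f v = g v) : f = g := by
  ext v
  have hv : v = fun k => ∑ q, H.proj q (v k) := funext fun k => (H.proj_add_proj (v k)).symm
  rw [hv, MultilinearMap.map_sum, MultilinearMap.map_sum]
  exact Finset.sum_congr rfl fun q _ => h q _ fun k => H.proj_mem _ _

namespace Op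

theorem perm_apply {ι : Type} [Fintype ι] [LinearOrder ι] (X : Op H ι) (s : Equiv.Perm ι)
    (Q : NQuiver ι) (q : ι → ZMod 2) (v : ι → V) (hv : ∀ k, v k ∈ H.parity (q k)) :
    X.perm s Q v = koszulSign s q •
      Vnabla.blockSubst H s (X (Q.rename s) (fun k => v (s.symm k))) := by
  rw [perm, sum_apply, Finset.sum_eq_single q]
  · have h : (fun k => H.proj (q k) (v k)) = v := funext fun k => by
      rw [H.proj_of_mem _ _ _ (hv k), if_pos rfl]
    rw [smul_apply, MultilinearMap.compLinearMap_apply, h]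
    rfl
  · intro q' _ hne
    obtain ⟨k, hk⟩ := Function.ne_iff.1 hne
    rw [smul_apply, MultilinearMap.compLinearMap_apply]
    rw [MultilinearMap.map_coord_zero _ k, smul_zero]
    rw [H.proj_of_mem _ _ _ (hv k), if_neg hk]
  · simp

theorem koszulSign_mul (s t : Equiv.Perm (Fin 3)) (q : Fin 3 → ZMod 2) :
    koszulSign (s * t) q = koszulSign t q * koszulSign s (fun k => q (t.symm k)) := by
  revert s t q
  decide +kernel

theorem perm_perm (X : Op H (Fin 3)) (s t : Equiv.Perm (Fin 3)) :
    (X.perm s).perm t = X.perm (s * t) := by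
  funext Q
  refine ext_multilinear H fun q v hv => ?_
  rw [perm_apply _ _ _ q v hv, perm_apply _ _ _ (fun k => q (t.symm k)) _ fun k => hv _,
    perm_apply _ _ _ q v hv, koszulSign_mul, mul_smul, map_zsmul, blockSubst_comp,
    NQuiver.rename_rename]
  rfl

theorem koszulSign_swap (q : Fin 2 → ZMod 2) :
    koszulSign (Equiv.swap 0 1) q = ksign (q 0 * q 1) := by
  revert q
  decide

theorem apply_swap {X : Op H (Fin 2)} (hX : ∀ s, X.perm s = X) (Q : NQuiver (Fin 2))
    {p q : ZMod 2} {a b : V} (ha : a ∈ H.parity p) (hb : b ∈ H.parity q) :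
    X Q ![a, b] = ksign (p * q) •
      Vnabla.blockSubst H (Equiv.swap 0 1) (X (Q.rename (Equiv.swap 0 1)) ![b, a]) := by
  conv_lhs => rw [← hX (Equiv.swap 0 1)]
  rw [perm_apply _ _ _ ![p, q] ![a, b] (by
    intro k
    fin_cases k
    · exact ha
    · exact hb), koszulSign_swap]
  congr 3
  ext k
  fin_cases k <;> rfl

theorem elim_blockSubst_swap {k l : Fin 2} (hkl : k ≠ l) (x : Vnabla H (Fin 2)) :
    elim H l (fun _ => ()) (Vnabla.blockSubst H (Equiv.swap 0 1) x) = elim H k (fun _ => ()) x := by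
  conv_lhs => rw [← embed_elim hkl.symm x]
  rw [blockSubst_embed (H := H) _ (fun _ => l) (fun _ => k), elim_embed_of_ne hkl]
  intro _ j
  revert k l j
  decide

theorem circOne_perm_swap [CharZero K] {X : Op H (Fin 2)} (hX : IsPcl 1 X)
    (hs : ∀ s, X.perm s = X) :
    (circOne (n := 1) (m := 1) 1 1 X X).perm (Equiv.swap 0 1) =
      circOne (n := 1) (m := 1) 1 1 X X := by
  funext Q
  refine ext_multilinear H fun q v hv => ?_
  rw [perm_apply _ _ _ q v hv]
  by_cases hO : 2 ≤ Q.firstOuter.edges.card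
  · rw [circOne_eq_zero_of_outer hX hO, circOne_eq_zero_of_outer hX
      (by rwa [NQuiver.firstOuter_rename_swap])]
    simp
  · obtain ⟨k, l, hkl, hk⟩ := NQuiver.exists_not_incident hO
    rw [circOne_apply hX _ hkl hk, circOne_apply hX _ hkl.symm]
    · rw [NQuiver.firstOuter_rename_swap, NQuiver.firstInner_rename_swap,
        blockSubst_twist (H := H) _ (fun _ => l.castSucc) (fun _ => k.castSucc)
          (by intro _ j; clear hk; revert k l j; decide),
        apply_swap hs Q.firstInner (hv 0) (hv 1), map_zsmul, map_zsmul,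
        elim_blockSubst_swap hkl]
      have h3 : koszulSign (Equiv.swap (0 : Fin 3) 1) q = ksign (q 0 * q 1) := by
        clear hv
        revert q
        decide
      have h4 : Vnabla.blockSubst H (Equiv.swap 0 1) ∘ₗ outerVal X Q.firstOuter
          (v ((Equiv.swap 0 1 : Equiv.Perm (Fin 3)).symm 2)) = outerVal X Q.firstOuter (v 2) := by
        refine LinearMap.ext fun u => ?_
        rw [LinearMap.comp_apply, outerVal_apply, outerVal_apply, blockSubst_comp,
          show merge ∘ (Equiv.swap 0 1 : Equiv.Perm (Fin 3)) = merge from funext (by decide)]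
        rfl
      rw [h3, h4]
      rfl
    · intro d hd hm
      obtain ⟨e, he, rfl⟩ := Multiset.mem_map.1 hd
      have h1 := hk e he
      clear he hd hk
      revert h1 hm
      revert e k l
      decide

theorem perm_one (X : Op H (Fin 3)) : X.perm 1 = X := by
  funext Q
  refine ext_multilinear H fun q v hv => ?_
  have h1 : koszulSign (1 : Equiv.Perm (Fin 3)) q = 1 := by
    clear hv
    revert q
    decide
  have h2 : Q.rename (1 : Equiv.Perm (Fin 3)) = Q := NQuiver.ext (Multiset.map_id' _)
  rw [perm_apply _ _ _ q v hv, h1, h2, one_smul]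
  exact blockSubst_id _

theorem perm_add (X Y : Op H (Fin 3)) (s : Equiv.Perm (Fin 3)) :
    (X + Y).perm s = X.perm s + Y.perm s := by
  funext Q
  refine ext_multilinear H fun q v hv => ?_
  rw [Pi.add_apply, add_apply, perm_apply _ _ _ q v hv, perm_apply _ _ _ q v hv,
    perm_apply _ _ _ q v hv, Pi.add_apply, add_apply, map_add, smul_add]

theorem isShuffle_iff (s : Equiv.Perm (Fin 3)) :
    IsShuffle (n := 1) (m := 1) s ↔ s = 1 ∨ s = Equiv.swap 1 2 ∨ s = finRotate 3 := by
  unfold IsShuffle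
  revert s
  decide

theorem square_eq (X : Op H (Fin 2)) :
    square (n := 1) (m := 1) 1 1 X X = circOne (n := 1) (m := 1) 1 1 X X +
      (circOne (n := 1) (m := 1) 1 1 X X).perm (Equiv.swap 1 2) +
      (circOne (n := 1) (m := 1) 1 1 X X).perm (finRotate 3)⁻¹ := by
  classical
  have h : (Finset.univ.filter fun s : Equiv.Perm (Fin 3) => IsShuffle (n := 1) (m := 1) s) =
      {1, Equiv.swap 1 2, finRotate 3} := by
    ext s
    simp [isShuffle_iff]
  unfold square
  refine (Finset.sum_congr (by convert h) fun _ _ => rfl).trans ?_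
  rw [Finset.sum_insert (by decide), Finset.sum_insert (by decide), Finset.sum_singleton, inv_one,
    perm_one, Equiv.swap_inv]
  generalize circOne (n := 1) (m := 1) 1 1 X X = C
  exact (add_assoc C (C.perm _) (C.perm _)).symm

/-- The square of a symmetric operation is symmetric: up to the factor `2` it is the sum over all
permutations, since `X ∘_1 X` is invariant under the transposition of the first two arguments. -/
theorem square_perm [CharZero K] {X : Op H (Fin 2)} (hX : IsPcl 1 X) (hs : ∀ s, X.perm s = X)
    (t : Equiv.Perm (Fin 3)) :
    (square (n := 1) (m := 1) 1 1 X X).perm t = square (n := 1) (m := 1) 1 1 X X := by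
  rw [square_eq]
  have hC := circOne_perm_swap hX hs
  generalize circOne (n := 1) (m := 1) 1 1 X X = C at *
  have hC' : ∀ s, C.perm (Equiv.swap 0 1 * s) = C.perm s := fun s => by
    rw [← perm_perm, hC]
  -- Twice the square is the sum over all permutations.
  have hall : ∀ t, (C + C.perm (Equiv.swap 1 2) + C.perm (finRotate 3)⁻¹).perm t +
      (C + C.perm (Equiv.swap 1 2) + C.perm (finRotate 3)⁻¹).perm t = ∑ s, C.perm s := by
    intro t
    rw [← Equiv.sum_comp (Equiv.mulRight t)]
    have hu : (Finset.univ : Finset (Equiv.Perm (Fin 3))) = {1, Equiv.swap 0 1, Equiv.swap 1 2,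
        Equiv.swap 0 1 * Equiv.swap 1 2, (finRotate 3)⁻¹, Equiv.swap 0 1 * (finRotate 3)⁻¹} := by
      decide
    rw [hu]
    repeat rw [Finset.sum_insert (by decide)]
    rw [Finset.sum_singleton]
    simp only [Equiv.coe_mulRight, mul_assoc, hC', one_mul]
    rw [perm_add, perm_add, perm_perm, perm_perm]
    abel
  have h1 := (hall t).trans (hall 1).symm
  rw [perm_one] at h1
  have h2 : ∀ x y : Op H (Fin 3), x + x = y + y → x = y := fun x y h =>
    smul_right_injective _ (two_ne_zero (α := K)) (by
      simpa only [two_smul] using h)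
  exact h2 _ _ h1

end Op

namespace NQuiver

/-- The quiver with three vertices and one edge, from the first to the second vertex. -/
def edge₁₂ : NQuiver (Fin 3) := (empty (Fin 3)).cons (0, 1) (by decide)

/-- The quiver `1 → 2 → 3`. -/
def path₁₂₃ : NQuiver (Fin 3) := edge₁₂.cons (1, 2) (by decide)

end NQuiver

namespace Op

/-! ### The square of a symmetric binary operation -/

/-- The values `X^Q_{Λ, -Λ-∇}(a ⊗ b)` of a binary operation. -/
def val (X : Op H (Fin 2)) (Q : NQuiver (Fin 2)) : LamBracket K N V :=
  (bilin (X Q)).compr₂ (elim H 1 fun _ => ())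

theorem val_apply (X : Op H (Fin 2)) (Q : NQuiver (Fin 2)) (a b : V) :
    val X Q a b = elim H 1 (fun _ => ()) (X Q ![a, b]) := by
  rw [val, LinearMap.compr₂_apply, bilin_apply]

theorem embed_val (X : Op H (Fin 2)) (Q : NQuiver (Fin 2)) (a b : V) :
    embed H (fun _ => (0 : Fin 2)) (val X Q a b) = X Q ![a, b] := by
  rw [val_apply, embed_elim (by decide)]

theorem val_mem_parity [CharZero K] {X : Op H (Fin 2)} (hX : IsPcl 1 X) (Q : NQuiver (Fin 2))
    {p q : ZMod 2} {a b : V} (ha : a ∈ H.parity p) (hb : b ∈ H.parity q) :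
    val X Q a b ∈ PolyV.parity H Unit (p + q + 1) := by
  rw [val_apply]
  refine elim_mem_parity _ _ ?_
  have := hX.parity Q ![p, q] ![a, b] (by
    intro k
    fin_cases k
    · exact ha
    · exact hb)
  rwa [Fin.sum_univ_two] at this

theorem blockSubst_swap_embed (x : PolyV K N Unit V) :
    Vnabla.blockSubst H (Equiv.swap (0 : Fin 2) 1) (embed H (fun _ => (0 : Fin 2)) x) =
      embed H (fun _ => (1 : Fin 2)) x :=
  blockSubst_embed (H := H) _ (fun _ => (0 : Fin 2)) (fun _ => (1 : Fin 2))
    (by intro _ k; revert k; decide) x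

theorem apply_discrete {X : Op H (Fin 2)} (hs : ∀ s, X.perm s = X) {p q : ZMod 2} {a b : V}
    (ha : a ∈ H.parity p) (hb : b ∈ H.parity q) : X NQuiver.discrete ![a, b] =
      ksign (p * q) • embed H (fun _ => (1 : Fin 2)) (val X NQuiver.discrete b a) := by
  rw [apply_swap hs _ ha hb, ← blockSubst_swap_embed, embed_val]
  rfl

theorem apply_rev {X : Op H (Fin 2)} (hs : ∀ s, X.perm s = X) {p q : ZMod 2} {a b : V}
    (ha : a ∈ H.parity p) (hb : b ∈ H.parity q) : X NQuiver.rev ![a, b] =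
      ksign (p * q) • embed H (fun _ => (1 : Fin 2)) (val X NQuiver.arrow b a) := by
  rw [apply_swap hs _ ha hb, ← blockSubst_swap_embed, embed_val]
  rfl

theorem apply_arrow {X : Op H (Fin 2)} (hX : IsPcl 1 X) (hs : ∀ s, X.perm s = X) {p q : ZMod 2}
    {a b : V} (ha : a ∈ H.parity p) (hb : b ∈ H.parity q) : X NQuiver.arrow ![a, b] =
      -(ksign (p * q) • embed H (fun _ => (1 : Fin 2)) (val X NQuiver.arrow b a)) := by
  rw [← apply_rev hs ha hb, map_rev hX, neg_apply, neg_neg]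

theorem ksign_smul_smul_add {M : Type*} [AddCommGroup M] (p q : ZMod 2) (x : M) :
    ksign p • ksign q • x = ksign (p + q) • x := by
  rw [smul_smul, ← ksign_add]

/-- The symmetry of the outer operation moves the argument `c` to the first place. -/
theorem twist_outerVal {X : Op H (Fin 2)} {R : NQuiver (Fin 2)} {c : V} {r : ZMod 2}
    (Z : V →ₗ[K] PolyV K N Unit V)
    (hZ : ∀ q u, u ∈ H.parity q → X R ![u, c] =
      ksign (q * r) • embed H (fun _ => (1 : Fin 2)) (Z u))
    (d m : Fin 3) (s : Fin 3 → Fin 3) (hm : ∀ j, merge (s j) = 1 ↔ j = m) {P : ZMod 2}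
    {F : PolyV K N Unit V} (hF : F ∈ PolyV.parity H Unit P) :
    twist (SuperPoly.ren fun _ => d) 1 (Vnabla.blockSubst H s ∘ₗ outerVal X R c) F =
      ksign (r * P) • twist (SuperPoly.ren fun _ => d) (1 + r) (embed H (fun _ => m) ∘ₗ Z) F := by
  rw [← twist_comp_signBy H _ 1 r _ hF]
  congr 2
  refine H.ext_homogeneous fun q u hu => ?_
  rw [LinearMap.comp_apply, outerVal_apply, hZ q u hu, map_zsmul, map_zsmul, blockSubst_comp,
    blockSubst_embed (H := H) (merge ∘ s) (fun _ => (1 : Fin 2)) (fun _ => m) (fun _ j => hm j),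
    LinearMap.comp_apply, H.signBy_of_mem r q u hu, map_zsmul, mul_comm]
  rfl

/-- The composition `X ∘_1 X`, followed by a renaming of the variables. -/
theorem blockSubst_circOne [CharZero K] {X : Op H (Fin 2)} (hX : IsPcl 1 X) (Q : NQuiver (Fin 3))
    {k l : Fin 2} (hkl : k ≠ l) (hk : ∀ e ∈ Q.edges, merge e.1 ≠ merge e.2 →
      e.1 ≠ k.castSucc ∧ e.2 ≠ k.castSucc) {I O : NQuiver (Fin 2)} (hI : Q.firstInner = I)
    (hO : Q.firstOuter = O) (s : Fin 3 → Fin 3) (d : Fin 3)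
    (hd : ∀ j, s j = k.castSucc ↔ j = d) (x y z : V) :
    Vnabla.blockSubst H s (circOne (n := 1) (m := 1) 1 1 X X Q ![x, y, z]) =
      twist (SuperPoly.ren fun _ => d) 1 (Vnabla.blockSubst H s ∘ₗ outerVal X O z)
        (elim H l (fun _ => ()) (X I ![x, y])) := by
  rw [circOne_apply hX Q hkl hk,
    blockSubst_twist (H := H) _ (fun _ => k.castSucc) (fun _ => d) (fun _ j => hd j), hI, hO]
  rfl

theorem add_apply_apply (X Y : Op H (Fin 3)) (Q : NQuiver (Fin 3)) (v : Fin 3 → V) :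
    (X + Y) Q v = X Q v + Y Q v := rfl

theorem square_apply (X : Op H (Fin 2)) (Q : NQuiver (Fin 3)) {p q r : ZMod 2} {a b c : V}
    (ha : a ∈ H.parity p) (hb : b ∈ H.parity q) (hc : c ∈ H.parity r) :
    square (n := 1) (m := 1) 1 1 X X Q ![a, b, c] =
      Vnabla.blockSubst H id (circOne (n := 1) (m := 1) 1 1 X X Q ![a, b, c]) +
      ksign (q * r) • Vnabla.blockSubst H (Equiv.swap (1 : Fin 3) 2)
        (circOne (n := 1) (m := 1) 1 1 X X (Q.rename (Equiv.swap 1 2)) ![a, c, b]) +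
      ksign (p * (q + r)) • Vnabla.blockSubst H ((finRotate 3)⁻¹ : Equiv.Perm (Fin 3))
        (circOne (n := 1) (m := 1) 1 1 X X (Q.rename (finRotate 3)⁻¹) ![b, c, a]) := by
  have hv : ∀ k, (![a, b, c] : Fin 3 → V) k ∈ H.parity (![p, q, r] k) := by
    intro k
    fin_cases k
    · exact ha
    · exact hb
    · exact hc
  have h1 : koszulSign (Equiv.swap 1 2) ![p, q, r] = ksign (q * r) := by
    clear ha hb hc hv
    revert p q r
    decide
  have h2 : koszulSign (finRotate 3)⁻¹ ![p, q, r] = ksign (p * (q + r)) := by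
    clear ha hb hc hv
    revert p q r
    decide
  have e1 : (fun k => (![a, b, c] : Fin 3 → V) ((Equiv.swap 1 2 : Equiv.Perm (Fin 3)).symm k)) =
      ![a, c, b] := by
    ext k
    fin_cases k <;> rfl
  have e2 : (fun k => (![a, b, c] : Fin 3 → V)
      (((finRotate 3)⁻¹ : Equiv.Perm (Fin 3)).symm k)) = ![b, c, a] := by
    ext k
    fin_cases k <;> rfl
  have h3 := perm_apply (circOne (n := 1) (m := 1) 1 1 X X) (Equiv.swap 1 2) Q _ _ hv
  have h4 := perm_apply (circOne (n := 1) (m := 1) 1 1 X X) (finRotate 3)⁻¹ Q _ _ hv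
  rw [h1, e1] at h3
  rw [h2, e2] at h4
  rw [square_eq, add_apply_apply, add_apply_apply, blockSubst_id, h3, h4]

/-- On the quiver without edges the three shuffles give the three terms of the Jacobi identity. -/
theorem square_empty [CharZero K] {X : Op H (Fin 2)} (hX : IsPcl 1 X) (hs : ∀ s, X.perm s = X)
    {p q r : ZMod 2} {a b c : V} (ha : a ∈ H.parity p) (hb : b ∈ H.parity q)
    (hc : c ∈ H.parity r) :
    square (n := 1) (m := 1) 1 1 X X (NQuiver.empty (Fin 3)) ![a, b, c] =
      twist (SuperPoly.ren fun _ => (0 : Fin 3)) 1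
        (Vnabla.blockSubst H merge ∘ₗ embed H (fun _ => (0 : Fin 2)) ∘ₗ
          (val X NQuiver.discrete).flip c) (val X NQuiver.discrete a b) +
      ksign (q * (p + 1)) • twist (SuperPoly.ren fun _ => (0 : Fin 3)) (1 + q)
        (embed H (fun _ => 1) ∘ₗ val X NQuiver.discrete b) (val X NQuiver.discrete a c) +
      ksign p • twist (SuperPoly.ren fun _ => (1 : Fin 3)) (1 + p)
        (embed H (fun _ => 0) ∘ₗ val X NQuiver.discrete a) (val X NQuiver.discrete b c) := by
  rw [square_apply X _ ha hb hc,
    blockSubst_circOne hX _ (k := 0) (l := 1) (by decide) (by decide)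
      (I := NQuiver.discrete) (O := NQuiver.discrete) rfl rfl _ 0 (by decide),
    blockSubst_circOne hX _ (k := 0) (l := 1) (by decide) (by decide)
      (I := NQuiver.discrete) (O := NQuiver.discrete) rfl rfl _ 0 (by decide),
    blockSubst_circOne hX _ (k := 0) (l := 1) (by decide) (by decide)
      (I := NQuiver.discrete) (O := NQuiver.discrete) rfl rfl _ 1 (by decide),
    ← val_apply, ← val_apply, ← val_apply]
  rw [twist_outerVal (val X NQuiver.discrete b) (fun _ u hu => apply_discrete hs hu hb) 0 1 _
      (by decide) (val_mem_parity hX _ ha hc),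
    twist_outerVal (val X NQuiver.discrete a) (fun _ u hu => apply_discrete hs hu ha) 1 0 _
      (by decide) (val_mem_parity hX _ hb hc), ksign_smul_smul_add, ksign_smul_smul_add]
  congr 1
  congr 1
  · congr 2
    refine LinearMap.ext fun u => ?_
    simp only [LinearMap.comp_apply, outerVal_apply, LinearMap.flip_apply, embed_val, blockSubst_id]
  · congr 2
    clear ha hb hc
    revert p q r
    decide
  · congr 2
    clear ha hb hc
    revert p q r
    decide

/-- On the quiver with the edge `1 → 2` the three shuffles give the three terms of the Leibniz
rule. -/
theorem square_edge [CharZero K] {X : Op H (Fin 2)} (hX : IsPcl 1 X) (hs : ∀ s, X.perm s = X)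
    {p q r : ZMod 2} {a b c : V} (ha : a ∈ H.parity p) (hb : b ∈ H.parity q)
    (hc : c ∈ H.parity r) :
    square (n := 1) (m := 1) 1 1 X X NQuiver.edge₁₂ ![a, b, c] =
      ksign (r * (p + q + 1)) • twist (SuperPoly.ren fun _ => (0 : Fin 3)) (1 + r)
        (embed H (fun _ => 2) ∘ₗ val X NQuiver.discrete c) (val X NQuiver.arrow a b) +
      ksign (r * (p + q)) • twist (SuperPoly.ren fun _ => (2 : Fin 3)) 1
        (Vnabla.blockSubst H (merge ∘ (Equiv.swap 1 2 : Equiv.Perm (Fin 3))) ∘ₗ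
          embed H (fun _ => (0 : Fin 2)) ∘ₗ (val X NQuiver.arrow).flip b)
        (val X NQuiver.discrete c a) +
      ksign (p + q * r) • twist (SuperPoly.ren fun _ => (2 : Fin 3)) (1 + p)
        (embed H (fun _ => 0) ∘ₗ val X NQuiver.arrow a) (val X NQuiver.discrete c b) := by
  rw [square_apply X _ ha hb hc,
    blockSubst_circOne hX _ (k := 0) (l := 1) (by decide) (by decide)
      (I := NQuiver.arrow) (O := NQuiver.discrete) rfl rfl _ 0 (by decide),
    blockSubst_circOne hX _ (k := 1) (l := 0) (by decide) (by decide)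
      (I := NQuiver.discrete) (O := NQuiver.arrow) rfl rfl _ 2 (by decide),
    blockSubst_circOne hX _ (k := 1) (l := 0) (by decide) (by decide)
      (I := NQuiver.discrete) (O := NQuiver.rev) rfl rfl _ 2 (by decide),
    ← val_apply, apply_discrete hs ha hc, apply_discrete hs hb hc]
  simp only [map_zsmul]
  rw [elim_embed_of_ne (by decide), elim_embed_of_ne (by decide),
    twist_outerVal (val X NQuiver.discrete c) (fun _ u hu => apply_discrete hs hu hc) 0 2 _
      (by decide) (val_mem_parity hX _ ha hb),
    twist_outerVal (val X NQuiver.arrow a) (fun _ u hu => apply_rev hs hu ha) 2 0 _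
      (by decide) (val_mem_parity hX _ hc hb), ksign_smul_smul_add, ksign_smul_smul_add,
      ksign_smul_smul_add]
  congr 1
  congr 1
  · congr 3
    · clear ha hb hc
      revert p q r
      decide
    · refine LinearMap.ext fun u => ?_
      simp only [LinearMap.comp_apply, outerVal_apply, LinearMap.flip_apply, embed_val,
        blockSubst_comp]
  · congr 2
    clear ha hb hc
    revert p q r
    decide

/-- On the quiver `1 → 2 → 3` one of the three shuffles contributes nothing: it has the blocks
`{1, 3}` and `{2}`, and the two edges between these form a cycle. The other two give the two sides
of associativity. -/
theorem square_path [CharZero K] {X : Op H (Fin 2)} (hX : IsPcl 1 X) (hs : ∀ s, X.perm s = X)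
    {p q r : ZMod 2} {a b c : V} (ha : a ∈ H.parity p) (hb : b ∈ H.parity q)
    (hc : c ∈ H.parity r) :
    square (n := 1) (m := 1) 1 1 X X NQuiver.path₁₂₃ ![a, b, c] =
      -(ksign (r * (p + q + 1)) • twist (SuperPoly.ren fun _ => (0 : Fin 3)) (1 + r)
        (embed H (fun _ => 2) ∘ₗ val X NQuiver.arrow c) (val X NQuiver.arrow a b) +
      ksign (p + q * r) • twist (SuperPoly.ren fun _ => (2 : Fin 3)) (1 + p)
        (embed H (fun _ => 0) ∘ₗ val X NQuiver.arrow a) (val X NQuiver.arrow c b)) := by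
  have h0 : circOne (n := 1) (m := 1) 1 1 X X (NQuiver.path₁₂₃.rename (Equiv.swap 1 2)) = 0 :=
    circOne_eq_zero_of_outer hX (by decide)
  have harr : ∀ q u, u ∈ H.parity q → X NQuiver.arrow ![u, c] =
      ksign (q * r) • embed H (fun _ => (1 : Fin 2)) ((-val X NQuiver.arrow c) u) := by
    intro q u hu
    rw [apply_arrow hX hs hu hc, LinearMap.neg_apply, map_neg, smul_neg]
  have hneg : embed H (fun _ => (2 : Fin 3)) ∘ₗ (-val X NQuiver.arrow c) =
      (-1 : ℤ) • (embed H (fun _ => (2 : Fin 3)) ∘ₗ val X NQuiver.arrow c) := by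
    refine LinearMap.ext fun u => ?_
    rw [LinearMap.comp_apply, LinearMap.neg_apply, map_neg, neg_one_smul, LinearMap.neg_apply,
      LinearMap.comp_apply]
  have h1 : Vnabla.blockSubst H id
      (circOne (n := 1) (m := 1) 1 1 X X NQuiver.path₁₂₃ ![a, b, c]) =
      -(ksign (r * (p + q + 1)) • twist (SuperPoly.ren fun _ => (0 : Fin 3)) (1 + r)
        (embed H (fun _ => 2) ∘ₗ val X NQuiver.arrow c) (val X NQuiver.arrow a b)) := by
    rw [blockSubst_circOne hX _ (k := 0) (l := 1) (by decide) (by decide)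
        (I := NQuiver.arrow) (O := NQuiver.arrow) rfl rfl _ 0 (by decide), ← val_apply,
      twist_outerVal (-val X NQuiver.arrow c) harr 0 2 _ (by decide) (val_mem_parity hX _ ha hb),
      hneg, twist_smul_map, neg_one_smul, smul_neg]
  have h2 : Vnabla.blockSubst H ((finRotate 3)⁻¹ : Equiv.Perm (Fin 3))
      (circOne (n := 1) (m := 1) 1 1 X X
        (NQuiver.path₁₂₃.rename (finRotate 3)⁻¹) ![b, c, a]) =
      -(ksign (q * r) • ksign (p * (r + q + 1)) •
        twist (SuperPoly.ren fun _ => (2 : Fin 3)) (1 + p)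
        (embed H (fun _ => 0) ∘ₗ val X NQuiver.arrow a) (val X NQuiver.arrow c b)) := by
    rw [blockSubst_circOne hX _ (k := 1) (l := 0) (by decide) (by decide)
        (I := NQuiver.arrow) (O := NQuiver.rev) rfl rfl _ 2 (by decide),
      apply_arrow hX hs hb hc, map_neg, map_zsmul, elim_embed_of_ne (by decide), map_neg, map_zsmul,
      twist_outerVal (val X NQuiver.arrow a) (fun _ u hu => apply_rev hs hu ha) 2 0 _
        (by decide) (val_mem_parity hX _ hc hb)]
  rw [square_apply X _ ha hb hc, h0, h1, h2, zero_apply, map_zero, smul_zero,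
    add_zero, smul_neg, ksign_smul_smul_add, ksign_smul_smul_add, neg_add]
  congr 4
  clear ha hb hc harr h1 h2
  revert p q r
  decide

end Op

theorem SuperPoly.signBy_add {ι : Type} (p q : ZMod 2) (a : SuperPoly K N ι) :
    SuperPoly.signBy p (SuperPoly.signBy q a) = SuperPoly.signBy (q + p) a := by
  rcases zmod_two_cases p with rfl | rfl <;> rcases zmod_two_cases q with rfl | rfl
  · simp [SuperPoly.signBy_zero]
  · simp [SuperPoly.signBy_zero]
  · simp [SuperPoly.signBy_zero]
  · simp [SuperPoly.signBy_one, SuperPoly.involute_involute, show (1 + 1 : ZMod 2) = 0 from rfl,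
      SuperPoly.signBy_zero]

/-- A map which is linear over the superpolynomials up to a substitution and a sign commutes with
sign-twisted extension. -/
theorem PolyV.map_twist {ι κ κ' : Type} {W M M' : Type*} [AddCommGroup W] [Module K W]
    [AddCommGroup M] [Module K M] [Module (SuperPoly K N κ) M] [IsScalarTower K (SuperPoly K N κ) M]
    [AddCommGroup M'] [Module K M'] [Module (SuperPoly K N κ') M']
    [IsScalarTower K (SuperPoly K N κ') M']
    {ρ : SuperPoly K N ι →ₐ[K] SuperPoly K N κ} {ρ' : SuperPoly K N ι →ₐ[K] SuperPoly K N κ'}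
    {r : ZMod 2} (ω : M →ₗ[K] M') (h : ∀ a m, ω (ρ a • m) = ρ' (SuperPoly.signBy r a) • ω m)
    (p : ZMod 2) (g : W →ₗ[K] M) (x : PolyV K N ι W) :
    ω (twist ρ p g x) = twist ρ' (p + r) (ω ∘ₗ g) x := by
  induction x using TensorProduct.induction_on with
  | zero => simp
  | tmul a v => rw [twist_tmul, twist_tmul, h, SuperPoly.signBy_add, LinearMap.comp_apply]
  | add x y hx hy => simp only [map_add, hx, hy]

namespace Vnabla

/-! ### Eliminating the last of three supervariables -/

variable (H) in
/-- Elimination of the third of three supervariables. -/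
def elimLast : Vnabla H (Fin 3) →ₗ[K] PolyV K N (Fin 2) V := elim H 2 ![0, 1, 0]

theorem embed_elimLast (x : Vnabla H (Fin 3)) : embed H Fin.castSucc (elimLast H x) = x := by
  obtain ⟨x, rfl⟩ := mk_surjective x
  induction x using TensorProduct.induction_on with
  | zero => simp
  | tmul a v =>
    have key := SuperPoly.intertwine
      ((PolyV.act (κ := Fin 2) H.superCommute).comp
        (SuperPoly.linSubst (elimCoeff (2 : Fin 3) ![0, 1, 0])))
      (Algebra.lsmul K K (Vnabla H (Fin 3))) (embed H Fin.castSucc) ?_ ?_ a (1 ⊗ₜ[K] v)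
    · refine key.trans ?_
      rw [embed_tmul, map_one, Algebra.lsmul_apply, smul_mk, TensorProduct.smul_tmul', smul_eq_mul,
        mul_one]
    · have he : (Finset.univ.erase 2 : Finset (Fin 3)) = {0, 1} := by decide
      have h0 : (Finset.filter (fun x => 0 = (![0, 1, 0] : Fin 3 → Fin 2) x) {0, 1}).card = 1 := by
        decide
      have h1 : (Finset.filter (fun x => 1 = (![0, 1, 0] : Fin 3 → Fin 2) x) {0, 1}).card = 1 := by
        decide
      intro j z
      fin_cases j
      · simp [elimCoeff, embed_smul]
      · simp [elimCoeff, embed_smul]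
      · simp [elimCoeff, embed_smul, embed_evenOp, Fin.sum_univ_three, add_smul, he, h0, h1]
        abel
    · have he : (Finset.univ.erase 2 : Finset (Fin 3)) = {0, 1} := by decide
      have h0 : (Finset.filter (fun x => 0 = (![0, 1, 0] : Fin 3 → Fin 2) x) {0, 1}).card = 1 := by
        decide
      have h1 : (Finset.filter (fun x => 1 = (![0, 1, 0] : Fin 3 → Fin 2) x) {0, 1}).card = 1 := by
        decide
      intro j i z
      fin_cases j
      · simp [elimCoeff, embed_smul]
      · simp [elimCoeff, embed_smul]
      · simp [elimCoeff, embed_smul, embed_oddOp, Fin.sum_univ_three, add_smul, he, h0, h1]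
        abel
  | add x y hx hy => rw [map_add, map_add, map_add, hx, hy]

theorem elimLast_injective : Function.Injective (elimLast H) := fun x y h => by
  rw [← embed_elimLast x, h, embed_elimLast]

theorem elimLast_embed (x : PolyV K N (Fin 2) V) : elimLast H (embed H Fin.castSucc x) = x :=
  elim_embed _ _ _ (by decide) (by decide) x

theorem elimLast_ren_smul {J : Type} (k : J → Fin 2) (a : SuperPoly K N J) (x : Vnabla H (Fin 3)) :
    elimLast H (SuperPoly.ren (fun j => (k j).castSucc) a • x) =
      SuperPoly.ren k a • elimLast H x := by
  have h : SuperPoly.ren (fun j => (k j).castSucc) a =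
      SuperPoly.ren Fin.castSucc (SuperPoly.ren k a) := by
    rw [← AlgHom.comp_apply]
    exact DFunLike.congr_fun (SuperPoly.hom_ext (by simp) (by simp)) a
  conv_lhs => rw [← embed_elimLast x, h, ← embed_smul, elimLast_embed]

theorem elimLast_embed_const (k : Fin 2) (x : PolyV K N Unit V) :
    elimLast H (embed H (fun _ => k.castSucc) x) =
      PolyV.subst (fun _ j => if j ∈ ({k} : Finset (Fin 2)) then 1 else 0) x := by
  induction x using TensorProduct.induction_on with
  | zero => simp
  | tmul a v =>
    have h := elimLast_ren_smul (H := H) (fun _ : Unit => k) a (embed H Fin.castSucc (1 ⊗ₜ[K] v))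
    rw [elimLast_embed] at h
    rw [subst_tmul, SuperPoly.linSubst_eq_ren _ (fun _ => k) (by simp), embed_tmul]
    refine Eq.trans ?_ (h.trans ?_)
    · rw [embed_tmul, smul_mk, TensorProduct.smul_tmul', map_one, smul_eq_mul, mul_one]
    · rw [TensorProduct.smul_tmul', smul_eq_mul, mul_one]
  | add x y hx hy => simp only [map_add, hx, hy]

theorem elimLast_blockSubst_merge (x : PolyV K N Unit V) :
    elimLast H (blockSubst H merge (embed H (fun _ => (0 : Fin 2)) x)) =
      PolyV.subst (fun _ j => if j ∈ (Finset.univ : Finset (Fin 2)) then 1 else 0) x := by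
  induction x using TensorProduct.induction_on with
  | zero => simp
  | tmul a v =>
    rw [subst_tmul, embed_tmul, blockSubst_mk_tmul]
    have h1 : SuperPoly.linSubst (fun (i : Fin 2) (k : Fin 3) => if merge k = i then 1 else 0)
        (SuperPoly.ren (fun _ => 0) a) = SuperPoly.ren Fin.castSucc (SuperPoly.linSubst
          (fun _ j => if j ∈ (Finset.univ : Finset (Fin 2)) then 1 else 0) a :
          SuperPoly K N (Fin 2)) := by
      rw [← AlgHom.comp_apply, ← AlgHom.comp_apply]
      refine DFunLike.congr_fun (SuperPoly.hom_ext (fun _ => ?_) (fun _ i => ?_)) a <;>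
      simp [Fin.sum_univ_three, Fin.sum_univ_two, show merge 0 = 0 from rfl,
        show merge 1 = 0 from rfl, show merge 2 = 1 from rfl]
    rw [h1, ← embed_tmul, elimLast_embed]
  | add x y hx hy => simp only [map_add, hx, hy]

theorem elimLast_twist (k : Fin 2) (p : ZMod 2) (g : V →ₗ[K] Vnabla H (Fin 3))
    (x : PolyV K N Unit V) :
    elimLast H (twist (SuperPoly.ren fun _ => k.castSucc) p g x) =
      PolyV.extend p (elimLast H ∘ₗ g)
        (PolyV.subst (fun _ j => if j ∈ ({k} : Finset (Fin 2)) then 1 else 0) x) := by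
  rw [map_twist (r := 0) (ρ' := SuperPoly.ren fun _ => k) (elimLast H) fun a m =>
    elimLast_ren_smul _ _ _, add_zero]
  induction x using TensorProduct.induction_on with
  | zero => simp
  | tmul a v =>
    rw [twist_tmul, subst_tmul, SuperPoly.linSubst_eq_ren _ (fun _ => k) (by simp),
      extend_eq_twist, twist_tmul, SuperPoly.signBy_ren]
    rfl
  | add x y hx hy => simp only [map_add, hx, hy]

/-! ### Eliminating the second of three supervariables -/

/-- The coefficients of the substitution `Λ_2 ↦ -Λ_1 - Λ_3 - ∇`, where the variables `Λ_1`, `Λ_3`,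
`∇` on the right have the indices `Sum.inl ()`, `Sum.inr (Sum.inl ())`, `Sum.inr (Sum.inr ())`. -/
def midCoeff (k : Fin 3) (x : Unit ⊕ (Unit ⊕ Unit)) : ℤ :=
  match k, x with
  | 0, Sum.inl _ => 1
  | 0, Sum.inr _ => 0
  | 1, _ => -1
  | 2, Sum.inr (Sum.inl _) => 1
  | 2, _ => 0

variable (H) in
/-- The polynomials in `Λ_1`, `Λ_2`, `Λ_3` as operators on `V[Λ_3][Λ_1]`, where `Λ_2` acts as
`-Λ_1 - Λ_3 - ∇`. -/
def midAct : SuperPoly K N (Fin 3) →ₐ[K] Module.End K (PolyV K N Unit (PolyV K N Unit V)) :=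
  (act (κ := Unit) (superCommute_ops (κ := Unit) H.superCommute)).comp
    (SuperPoly.linSubst midCoeff)

theorem sum_midCoeff (x : Unit ⊕ (Unit ⊕ Unit)) :
    ∑ k, midCoeff k x = -(if x = Sum.inr (Sum.inr ()) then 1 else 0) := by
  revert x
  decide

variable (H) in
/-- Elimination of the second of three supervariables, as a map to `V[Λ_3][Λ_1]`. -/
def elimMid : Vnabla H (Fin 3) →ₗ[K] PolyV K N Unit (PolyV K N Unit V) :=
  descAct H (midAct H)
    (TensorProduct.mk K (SuperPoly K N Unit) _ 1 ∘ₗ TensorProduct.mk K (SuperPoly K N Unit) V 1)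
    (fun v => by
      rw [midAct, AlgHom.comp_apply, (neg_sum_linSubst _ _ sum_midCoeff).1]
      simp [evenOp])
    (fun i v => by
      rw [midAct, AlgHom.comp_apply, (neg_sum_linSubst _ _ sum_midCoeff).2]
      simp [oddOp])

theorem elimMid_mk_tmul (a : SuperPoly K N (Fin 3)) (v : V) :
    elimMid H (mk H (a ⊗ₜ[K] v)) = midAct H a (1 ⊗ₜ[K] (1 ⊗ₜ[K] v)) := rfl

theorem elimMid_smul (a : SuperPoly K N (Fin 3)) (x : Vnabla H (Fin 3)) :
    elimMid H (a • x) = midAct H a (elimMid H x) := by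
  obtain ⟨x, rfl⟩ := mk_surjective x
  induction x using TensorProduct.induction_on with
  | zero => simp
  | tmul c v =>
    rw [smul_mk, TensorProduct.smul_tmul', smul_eq_mul, elimMid_mk_tmul, map_mul,
      Module.End.mul_apply, ← elimMid_mk_tmul]
  | add x y hx hy => simp only [map_add, smul_add, hx, hy]

theorem midAct_lam_zero (z : PolyV K N Unit (PolyV K N Unit V)) :
    midAct H (SuperPoly.lam 0) z = (SuperPoly.lam () : SuperPoly K N Unit) • z := by
  simp [midAct, midCoeff]

theorem midAct_th_zero (i : Fin N) (z : PolyV K N Unit (PolyV K N Unit V)) :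
    midAct H (SuperPoly.th 0 i) z = (SuperPoly.th () i : SuperPoly K N Unit) • z := by
  simp [midAct, midCoeff]

theorem midAct_lam_two :
    midAct H (SuperPoly.lam 2) = evenOp (mulOp (SuperPoly.lam ())) := by
  simp [midAct, midCoeff]

theorem midAct_th_two (i : Fin N) :
    midAct H (SuperPoly.th 2 i) = oddOp (mulOp (SuperPoly.th () i)) := by
  simp [midAct, midCoeff]

theorem midAct_lam_one (z : PolyV K N Unit (PolyV K N Unit V)) : midAct H (SuperPoly.lam 1) z =
    -((SuperPoly.lam () : SuperPoly K N Unit) • z) - evenOp (mulOp (SuperPoly.lam ())) z -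
      evenOp (evenOp H.T) z := by
  simp [midAct, midCoeff, sub_eq_add_neg]
  abel

theorem midAct_th_one (i : Fin N) (z : PolyV K N Unit (PolyV K N Unit V)) :
    midAct H (SuperPoly.th 1 i) z =
    -((SuperPoly.th () i : SuperPoly K N Unit) • z) - oddOp (mulOp (SuperPoly.th () i)) z -
      oddOp (oddOp (H.S i)) z := by
  simp [midAct, midCoeff, sub_eq_add_neg]
  abel

theorem midAct_ren_zero (a : SuperPoly K N Unit) (z : PolyV K N Unit (PolyV K N Unit V)) :
    midAct H (SuperPoly.ren (fun _ => 0) a) z = a • z :=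
  SuperPoly.intertwine ((midAct H).comp (SuperPoly.ren fun _ => 0))
    (Algebra.lsmul K K (PolyV K N Unit (PolyV K N Unit V))) LinearMap.id
    (fun _ z => by simp [midAct_lam_zero]) (fun _ i z => by simp [midAct_th_zero]) a z

theorem elimMid_embed_zero (x : PolyV K N Unit V) : elimMid H (embed H (fun _ => (0 : Fin 3)) x) =
    TensorProduct.map LinearMap.id (TensorProduct.mk K (SuperPoly K N Unit) V 1) x := by
  induction x using TensorProduct.induction_on with
  | zero => simp
  | tmul a v =>
    rw [embed_tmul, elimMid_mk_tmul, midAct_ren_zero, TensorProduct.smul_tmul', smul_eq_mul,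
      mul_one]
    rfl
  | add x y hx hy => simp only [map_add, hx, hy]

theorem midAct_ren_two (a : SuperPoly K N Unit) (x : PolyV K N Unit V) :
    midAct H (SuperPoly.ren (fun _ => 2) a) (1 ⊗ₜ[K] x) = 1 ⊗ₜ[K] (a • x) := by
  refine (SuperPoly.intertwine (Algebra.lsmul K K (PolyV K N Unit V))
    ((midAct H).comp (SuperPoly.ren fun _ => 2))
    (TensorProduct.mk K (SuperPoly K N Unit) _ 1) (fun _ z => ?_) (fun _ i z => ?_) a x).symm
  · simp [midAct_lam_two]
  · simp [midAct_th_two]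

theorem elimMid_embed_two (x : PolyV K N Unit V) : elimMid H (embed H (fun _ => (2 : Fin 3)) x) =
    1 ⊗ₜ[K] x := by
  induction x using TensorProduct.induction_on with
  | zero => simp
  | tmul a v =>
    rw [embed_tmul, elimMid_mk_tmul, midAct_ren_two, TensorProduct.smul_tmul', smul_eq_mul, mul_one]
  | add x y hx hy => simp only [map_add, hx, hy, TensorProduct.tmul_add]

variable (H) in
/-- The inverse of the elimination of the second of three supervariables. -/
def uneliminate : PolyV K N Unit (PolyV K N Unit V) →ₗ[K] Vnabla H (Fin 3) :=
  twist (SuperPoly.ren fun _ => (0 : Fin 3)) 0 (embed H fun _ => 2)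

theorem uneliminate_smul (a : SuperPoly K N Unit) (z : PolyV K N Unit (PolyV K N Unit V)) :
    uneliminate H (a • z) = SuperPoly.ren (fun _ => (0 : Fin 3)) a • uneliminate H z := by
  rw [uneliminate, twist_smul, SuperPoly.signBy_zero]
  rfl

theorem uneliminate_evenOp (f : Module.End K (PolyV K N Unit V)) (a : SuperPoly K N (Fin 3))
    (h : ∀ x, embed H (fun _ => (2 : Fin 3)) (f x) = a • embed H (fun _ => 2) x)
    (ha : ∀ b : SuperPoly K N Unit, SuperPoly.ren (fun _ => (0 : Fin 3)) b * a =
      a * SuperPoly.ren (fun _ => 0) b)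
    (z : PolyV K N Unit (PolyV K N Unit V)) :
    uneliminate H (evenOp f z) = a • uneliminate H z := by
  induction z using TensorProduct.induction_on with
  | zero => simp
  | tmul b x =>
    rw [evenOp_tmul, uneliminate, twist_tmul, twist_tmul, h, smul_smul, smul_smul,
      SuperPoly.signBy_zero]
    congr 1
    exact ha b
  | add x y hx hy => simp only [map_add, smul_add, hx, hy]

theorem uneliminate_oddOp (f : Module.End K (PolyV K N Unit V)) (a : SuperPoly K N (Fin 3))
    (h : ∀ x, embed H (fun _ => (2 : Fin 3)) (f x) = a • embed H (fun _ => 2) x)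
    (ha : ∀ b : SuperPoly K N Unit, SuperPoly.ren (fun _ => (0 : Fin 3)) (SuperPoly.involute b) *
      a =
      a * SuperPoly.ren (fun _ => 0) b)
    (z : PolyV K N Unit (PolyV K N Unit V)) :
    uneliminate H (oddOp f z) = a • uneliminate H z := by
  induction z using TensorProduct.induction_on with
  | zero => simp
  | tmul b x =>
    rw [oddOp_tmul, uneliminate, twist_tmul, twist_tmul, h, smul_smul, smul_smul,
      SuperPoly.signBy_zero]
    congr 1
    exact ha b
  | add x y hx hy => simp only [map_add, smul_add, hx, hy]

theorem uneliminate_elimMid (x : Vnabla H (Fin 3)) : uneliminate H (elimMid H x) = x := by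
  have hL : ∀ (k : Fin 3) (b : SuperPoly K N Unit), SuperPoly.ren (fun _ => (0 : Fin 3)) b *
      SuperPoly.lam k = SuperPoly.lam k * SuperPoly.ren (fun _ => 0) b :=
    fun k b => SuperPoly.lam_comm _ _
  have hT : ∀ (k : Fin 3) (i : Fin N) (b : SuperPoly K N Unit),
      SuperPoly.ren (fun _ => (0 : Fin 3)) (SuperPoly.involute b) * SuperPoly.th k i =
        SuperPoly.th k i * SuperPoly.ren (fun _ => 0) b := fun k i b => by
    rw [SuperPoly.th_comm, ← SuperPoly.involute_ren, SuperPoly.involute_involute]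
  have h1 := uneliminate_evenOp (H := H) (mulOp (SuperPoly.lam ())) (SuperPoly.lam 2)
    (fun x => by simp [embed_smul]) (hL 2)
  have h2 := uneliminate_evenOp (H := H) (evenOp H.T) (-∑ k, SuperPoly.lam k)
    (fun x => by rw [embed_evenOp]; exact (neg_smul _ _).symm) (fun b => by
      rw [mul_neg, neg_mul, Finset.mul_sum, Finset.sum_mul]
      simp only [hL])
  have h3 := fun i => uneliminate_oddOp (H := H) (mulOp (SuperPoly.th () i)) (SuperPoly.th 2 i)
    (fun x => by simp [embed_smul]) (hT 2 i)
  have h4 := fun i => uneliminate_oddOp (H := H) (oddOp (H.S i)) (-∑ k, SuperPoly.th k i)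
    (fun x => by rw [embed_oddOp]; exact (neg_smul _ _).symm) (fun b => by
      rw [mul_neg, neg_mul, Finset.mul_sum, Finset.sum_mul]
      simp only [hT])
  obtain ⟨x, rfl⟩ := mk_surjective x
  induction x using TensorProduct.induction_on with
  | zero => simp
  | tmul a v =>
    rw [elimMid_mk_tmul]
    refine (SuperPoly.intertwine (midAct H) (Algebra.lsmul K K (Vnabla H (Fin 3))) (uneliminate H)
      (fun k z => ?_) (fun k i z => ?_) a _).trans ?_
    · fin_cases k
      · simp [midAct_lam_zero, uneliminate_smul]
      · simp only [Fin.mk_one, midAct_lam_one, map_sub, map_neg, uneliminate_smul, h1, h2]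
        simp [Fin.sum_univ_three, add_smul]
        abel
      · simp [midAct_lam_two, h1]
    · fin_cases k
      · simp [midAct_th_zero, uneliminate_smul]
      · simp only [Fin.mk_one, midAct_th_one, map_sub, map_neg, uneliminate_smul, h3, h4]
        simp [Fin.sum_univ_three, add_smul]
        abel
      · simp [midAct_th_two, h3]
    · rw [uneliminate, twist_tmul, SuperPoly.signBy_zero, embed_tmul]
      simp [smul_mk, TensorProduct.smul_tmul']
  | add x y hx hy => rw [map_add, map_add, map_add, hx, hy]

theorem elimMid_uneliminate (z : PolyV K N Unit (PolyV K N Unit V)) :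
    elimMid H (uneliminate H z) = z := by
  induction z using TensorProduct.induction_on with
  | zero => simp
  | tmul a x =>
    rw [uneliminate, twist_tmul, elimMid_smul, elimMid_embed_two, SuperPoly.signBy_zero]
    refine (midAct_ren_zero a _).trans ?_
    rw [TensorProduct.smul_tmul', smul_eq_mul, mul_one]
  | add x y hx hy => simp only [map_add, hx, hy]

theorem dlamSub_smul {ι : Type} [Fintype ι] [DecidableEq ι] (k l : ι) (a : SuperPoly K N ι)
    (x : Vnabla H ι) : dlamSub H k l (a • x) =
      (SuperPoly.dlam k a - SuperPoly.dlam l a) • x + a • dlamSub H k l x := by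
  obtain ⟨x, rfl⟩ := mk_surjective x
  induction x using TensorProduct.induction_on with
  | zero => simp
  | tmul b v =>
    rw [dlamSub_mk, smul_mk, smul_mk, smul_mk, dlamSub_mk, ← map_add]
    congr 1
    simp only [dlamSubPoly, TensorProduct.smul_tmul', TensorProduct.map_tmul,
      LinearMap.sub_apply, smul_eq_mul, SuperPoly.dlam_mul, LinearMap.id_apply]
    rw [← TensorProduct.add_tmul]
    congr 1
    noncomm_ring
  | add x y hx hy =>
    simp only [smul_add, map_add, hx, hy]
    abel

theorem dlamSub_uneliminate (z : PolyV K N Unit (PolyV K N Unit V)) :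
    dlamSub H 0 1 (uneliminate H z) = uneliminate H (dlamOp z) := by
  induction z using TensorProduct.induction_on with
  | zero => simp
  | tmul a x =>
    have h2 : ∀ x : PolyV K N Unit V, dlamSub H (0 : Fin 3) 1 (embed H (fun _ => 2) x) = 0 := by
      intro x
      induction x using TensorProduct.induction_on with
      | zero => simp
      | tmul b v =>
        rw [embed_tmul, dlamSub_mk, dlamSubPoly, TensorProduct.map_tmul, LinearMap.sub_apply,
          dlam_ren_of_ne (by decide), dlam_ren_of_ne (by decide)]
        simp
      | add x y hx hy => simp only [map_add, hx, hy, add_zero]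
    rw [dlamOp_tmul, uneliminate, twist_tmul, twist_tmul, dlamSub_smul, h2, SuperPoly.signBy_zero,
      smul_zero, add_zero, LinearMap.id_apply, dlam_ren_self,
      dlam_ren_of_ne (by decide), sub_zero]
    rfl
  | add x y hx hy => simp only [map_add, hx, hy]

theorem dlamOp_elimMid {x : Vnabla H (Fin 3)} (h : dlamSub H 0 1 x = 0) :
    dlamOp (elimMid H x) = 0 := by
  rw [← uneliminate_elimMid x, dlamSub_uneliminate] at h
  have := congrArg (elimMid H) h
  rwa [elimMid_uneliminate, map_zero] at this

variable (H) in
/-- The map `Res_{Λ_1}(λ_1⁻¹ ·)`, after elimination of the second of three supervariables. -/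
def resMid : Vnabla H (Fin 3) →ₗ[K] PolyV K N Unit V := res ∘ₗ elimMid H

theorem resMid_ren_two_smul [CharZero K] (a : SuperPoly K N Unit) (x : Vnabla H (Fin 3)) :
    resMid H (SuperPoly.ren (fun _ => (2 : Fin 3)) a • x) = SuperPoly.signBy N a • resMid H x := by
  rw [resMid, LinearMap.comp_apply, elimMid_smul, LinearMap.comp_apply]
  generalize elimMid H x = z
  rcases zmod_two_cases (N : ZMod 2) with h | h
  · have := SuperPoly.intertwine ((midAct H).comp (SuperPoly.ren fun _ => 2))
      (Algebra.lsmul K K (PolyV K N Unit V)) res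
      (fun _ z => by simp [midAct_lam_two, res_evenOp])
      (fun _ i z => by simp [midAct_th_two, res_oddOp, h]) a z
    rw [h, SuperPoly.signBy_zero]
    exact this
  · have := SuperPoly.intertwine ((midAct H).comp (SuperPoly.ren fun _ => 2))
      ((Algebra.lsmul K K (PolyV K N Unit V)).comp SuperPoly.involute) res
      (fun _ z => by simp [midAct_lam_two, res_evenOp])
      (fun _ i z => by simp [midAct_th_two, res_oddOp, h]) a z
    rw [h, SuperPoly.signBy_one]
    exact this

theorem twist_one_tmul {κ : Type} (p : ZMod 2) (g : V →ₗ[K] V) (x : PolyV K N κ V) :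
    twist (AlgHom.id K _) p (TensorProduct.mk K (SuperPoly K N κ) V 1 ∘ₗ g) x =
      TensorProduct.map (SuperPoly.signBy p) g x := by
  induction x using TensorProduct.induction_on with
  | zero => simp
  | tmul a v =>
    rw [twist_tmul, LinearMap.comp_apply, TensorProduct.mk_apply, TensorProduct.smul_tmul',
      smul_eq_mul, mul_one]
    rfl
  | add x y hx hy => simp only [map_add, hx, hy]

theorem res_map_mk (x : PolyV K N Unit V) :
    res (TensorProduct.map LinearMap.id (TensorProduct.mk K (SuperPoly K N Unit) V 1) x) =
      1 ⊗ₜ[K] res x := by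
  induction x using TensorProduct.induction_on with
  | zero => simp
  | tmul a v => simp
  | add x y hx hy => simp only [map_add, hx, hy, TensorProduct.tmul_add]

theorem resMid_twist_two [CharZero K] (s : ZMod 2) (h : V →ₗ[K] PolyV K N Unit V)
    (F : PolyV K N Unit V) :
    resMid H (twist (SuperPoly.ren fun _ => (2 : Fin 3)) s (embed H (fun _ => 0) ∘ₗ h) F) =
      TensorProduct.map (SuperPoly.signBy (s + N)) (res ∘ₗ h) F := by
  rw [map_twist (ρ' := AlgHom.id K _) (resMid H) fun a m => resMid_ren_two_smul a m,
    ← twist_one_tmul]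
  congr 1
  congr 1
  refine LinearMap.ext fun u => ?_
  simp only [LinearMap.comp_apply, resMid, elimMid_embed_zero, res_map_mk, TensorProduct.mk_apply]

theorem resMid_blockSubst [CharZero K] {x : PolyV K N Unit V} (hx : dlamOp x = 0) :
    resMid H (blockSubst H (merge ∘ (Equiv.swap 1 2 : Equiv.Perm (Fin 3)))
      (embed H (fun _ => (0 : Fin 2)) x)) = 1 ⊗ₜ[K] res x := by
  have hS : (SuperPoly.linSubst fun (a : Fin 2) (k : Fin 3) =>
      if (merge ∘ (Equiv.swap 1 2 : Equiv.Perm (Fin 3))) k = a then 1 else 0 :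
        SuperPoly K N (Fin 2) →ₐ[K] SuperPoly K N (Fin 3)).comp (SuperPoly.ren fun _ : Unit => 0) =
      SuperPoly.linSubst (fun _ k => if k = 1 then 0 else 1) := by
    have hm : ∀ k, merge ((Equiv.swap 1 2 : Equiv.Perm (Fin 3)) k) = 0 ↔ k ≠ 1 := by decide
    refine SuperPoly.hom_ext (fun _ => ?_) (fun _ i => ?_) <;> simp [hm]
  have key := res_translate (F := TensorProduct.map LinearMap.id
      (TensorProduct.mk K (SuperPoly K N Unit) V 1) x)
    ((midAct H).comp (SuperPoly.linSubst fun (_ : Unit) (k : Fin 3) => if k = 1 then 0 else 1)) 1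
    (fun i => mulOp (SuperPoly.th () i)) (fun i => by
      refine LinearMap.ext fun z => ?_
      simp [Fin.sum_univ_three, midAct_th_zero, midAct_th_two]) ?_
  · rw [one_pow, one_smul, res_map_mk] at key
    rw [← key, resMid, LinearMap.comp_apply]
    congr 1
    clear key hx
    induction x using TensorProduct.induction_on with
    | zero => simp
    | tmul a v =>
      rw [embed_tmul, blockSubst_mk_tmul, ← AlgHom.comp_apply (SuperPoly.linSubst _), hS]
      rfl
    | add x y hx hy => simp only [map_add, hx, hy]
  · rw [← map_zero (TensorProduct.map LinearMap.id (TensorProduct.mk K (SuperPoly K N Unit) V 1)),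
      ← hx]
    clear hx
    induction x using TensorProduct.induction_on with
    | zero => simp
    | tmul a v => simp
    | add x y hx hy => simp only [map_add, hx, hy]

theorem resMid_twist_two_shift [CharZero K] (s : ZMod 2) (h : V →ₗ[K] PolyV K N Unit V)
    (hd : ∀ u, dlamOp (h u) = 0) (F : PolyV K N Unit V) :
    resMid H (twist (SuperPoly.ren fun _ => (2 : Fin 3)) s
      (blockSubst H (merge ∘ (Equiv.swap 1 2 : Equiv.Perm (Fin 3))) ∘ₗ
          embed H (fun _ => (0 : Fin 2)) ∘ₗ h) F) =
      TensorProduct.map (SuperPoly.signBy (s + N)) (res ∘ₗ h) F := by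
  rw [map_twist (ρ' := AlgHom.id K _) (resMid H) fun a m => resMid_ren_two_smul a m,
    ← twist_one_tmul]
  congr 1
  congr 1
  refine LinearMap.ext fun u => ?_
  rw [LinearMap.comp_apply, LinearMap.comp_apply, LinearMap.comp_apply, resMid_blockSubst (hd u)]
  rfl

theorem resMid_twist_zero [CharZero K] (s : ZMod 2) (h : V →ₗ[K] PolyV K N Unit V)
    (F : PolyV K N Unit V) :
    resMid H (twist (SuperPoly.ren fun _ => (0 : Fin 3)) s (embed H (fun _ => 2) ∘ₗ h) F) =
      ksign (s * N) • h (res F) := by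
  induction F using TensorProduct.induction_on with
  | zero => simp
  | tmul a v =>
    rw [twist_tmul, resMid, LinearMap.comp_apply, elimMid_smul, midAct_ren_zero,
      LinearMap.comp_apply, elimMid_embed_two, TensorProduct.smul_tmul', smul_eq_mul, mul_one,
      res_tmul, res_tmul, SuperPoly.resCoeff_signBy, map_smul, smul_assoc]
  | add x y hx hy => simp only [map_add, smul_add, hx, hy]

end Vnabla

namespace Op

/-- The Jacobiator of the bracket `X^{• •}_{Λ, -Λ-∇}`. -/
theorem elimLast_square_empty [CharZero K] {X : Op H (Fin 2)} (hX : IsPcl 1 X)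
    (hs : ∀ s, X.perm s = X)
    {p q r : ZMod 2} {a b c : V} (ha : a ∈ H.parity p) (hb : b ∈ H.parity q)
    (hc : c ∈ H.parity r) :
    elimLast H (square (n := 1) (m := 1) 1 1 X X (NQuiver.empty (Fin 3)) ![a, b, c]) =
      PolyV.extend 1 (((val X NQuiver.discrete).eval Finset.univ).flip c)
        ((val X NQuiver.discrete).eval {(0 : Fin 2)} a b) +
      ksign (q * (p + 1)) • PolyV.extend (1 + q)
        ((val X NQuiver.discrete).eval {1} b) ((val X NQuiver.discrete).eval {(0 : Fin 2)} a c) +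
      ksign p • PolyV.extend (1 + p)
        ((val X NQuiver.discrete).eval {0} a) ((val X NQuiver.discrete).eval
          {(1 : Fin 2)} b c) := by
  rw [square_empty hX hs ha hb hc, map_add, map_add, map_zsmul, map_zsmul]
  have h0 := elimLast_twist (H := H) 0
  have h1 := elimLast_twist (H := H) 1
  simp only [Fin.castSucc_zero, Fin.castSucc_one] at h0 h1
  rw [h0, h0, h1]
  have e : ∀ (k : Fin 2) (x : V), elimLast H ∘ₗ embed H (fun _ => k.castSucc) ∘ₗ
      val X NQuiver.discrete x = (val X NQuiver.discrete).eval {k} x := fun k x =>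
    LinearMap.ext fun u => elimLast_embed_const k _
  congr 4
  · exact LinearMap.ext fun u => elimLast_blockSubst_merge _
  · exact congrArg _ (e 1 b)
  · exact e 0 a

end Op

/-! ### Derivatives and odd variables -/

theorem SuperPoly.dlam_involute {ι : Type} [DecidableEq ι] (k : ι) (a : SuperPoly K N ι) :
    SuperPoly.dlam k (SuperPoly.involute a) = SuperPoly.involute (SuperPoly.dlam k a) := by
  induction a using SuperPoly.induction_on with
  | hr r => simp [Algebra.algebraMap_eq_smul_one, SuperPoly.dlam_one]
  | hl i =>
    rw [SuperPoly.involute_lam, SuperPoly.dlam_lam]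
    split_ifs <;> simp
  | ht i j => simp [SuperPoly.dlam_th]
  | hmul a b ha hb => simp [SuperPoly.dlam_mul, ha, hb]
  | hadd a b ha hb => simp [ha, hb]

theorem SuperPoly.dlam_signBy {ι : Type} [DecidableEq ι] (k : ι) (p : ZMod 2)
    (a : SuperPoly K N ι) :
    SuperPoly.dlam k (SuperPoly.signBy p a) = SuperPoly.signBy p (SuperPoly.dlam k a) := by
  rcases zmod_two_cases p with rfl | rfl
  · simp [SuperPoly.signBy_zero]
  · simp [SuperPoly.signBy_one, SuperPoly.dlam_involute]

theorem PolyV.dlamOp_map_signBy (p : ZMod 2) (h : V →ₗ[K] V) (x : PolyV K N Unit V) :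
    dlamOp (TensorProduct.map (SuperPoly.signBy p) h x) =
      TensorProduct.map (SuperPoly.signBy p) h (dlamOp x) := by
  induction x using TensorProduct.induction_on with
  | zero => simp
  | tmul a v => simp [SuperPoly.dlam_signBy]
  | add x y hx hy => simp only [map_add, hx, hy]

theorem PolyV.map_signBy_th_smul (p : ZMod 2) (h : V →ₗ[K] V) (i : Fin N)
    (x : PolyV K N Unit V) :
    TensorProduct.map (SuperPoly.signBy p) h ((SuperPoly.th () i : SuperPoly K N Unit) • x) =
      ksign p • ((SuperPoly.th () i : SuperPoly K N Unit) •
        TensorProduct.map (SuperPoly.signBy p) h x) := by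
  induction x using TensorProduct.induction_on with
  | zero => simp
  | tmul a v =>
    simp [TensorProduct.smul_tmul', SuperPoly.signBy_mul, SuperPoly.signBy_th, mul_assoc]
  | add x y hx hy => simp only [map_add, smul_add, hx, hy]

theorem PolyV.res_map_signBy [CharZero K] (p : ZMod 2) (h : V →ₗ[K] V) (x : PolyV K N Unit V) :
    res (TensorProduct.map (SuperPoly.signBy p) h x) = ksign (p * N) • h (res x) := by
  induction x using TensorProduct.induction_on with
  | zero => simp
  | tmul a v =>
    rw [TensorProduct.map_tmul, res_tmul, res_tmul, SuperPoly.resCoeff_signBy, map_smul, smul_assoc]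
  | add x y hx hy => simp only [map_add, smul_add, hx, hy]

/-- A family of `λ`-free elements of `W[Λ]`, on which the odd variables act through the operators
`S^i` on the parameter of the family, is determined by the residues. -/
theorem eq_zero_of_res_family [CharZero K] {W : Type*} [AddCommGroup W] [Module K W]
    (F : V → PolyV K N Unit W)
    (hd : ∀ p v, v ∈ H.parity p → dlamOp (F v) = 0)
    (hF : ∀ i p v, v ∈ H.parity p → ∃ ε : ℤ,
      (SuperPoly.th () i : SuperPoly K N Unit) • F v = ε • F (H.S i v))
    (hres : ∀ p v, v ∈ H.parity p → res (F v) = 0) {p : ZMod 2} {v : V} (hv : v ∈ H.parity p) :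
    F v = 0 := by
  refine eq_zero_of_res (hd p v hv) fun l => ?_
  induction l generalizing p v with
  | nil =>
    have h1 : (SuperPoly.thWord [] : SuperPoly K N Unit) = 1 := rfl
    rw [h1, one_smul, hres p v hv]
  | cons i l ih =>
    obtain ⟨ε, hε⟩ := hF i p v hv
    have h2 : ∃ δ : ℤ, (SuperPoly.thWord (i :: l) : SuperPoly K N Unit) =
        δ • (SuperPoly.thWord l * SuperPoly.th () i) := by
      rw [SuperPoly.thWord_cons, SuperPoly.th_comm, SuperPoly.involute_thWord]
      refine ⟨ksign l.length, ?_⟩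
      rw [mul_smul_comm, smul_smul, ksign_mul_self, one_smul]
    obtain ⟨δ, hδ⟩ := h2
    have h3 : ∀ (a : SuperPoly K N Unit) (x : PolyV K N Unit W), (δ • a) • x = δ • (a • x) :=
      fun a x => map_zsmul (LinearMap.toSpanSingleton (SuperPoly K N Unit) _ x) δ a
    rw [hδ, h3, mul_smul, hε, smul_comm _ ε, map_zsmul, map_zsmul,
      ih (H.S_mem i p v hv), smul_zero, smul_zero]

namespace Vnabla

theorem dlamSub_blockSubst {ι κ : Type} [Fintype ι] [Fintype κ] [DecidableEq ι] [DecidableEq κ]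
    (b : κ → ι) (k l : κ) (x : Vnabla H ι) :
    dlamSub H k l (blockSubst H b x) = blockSubst H b (dlamSub H (b k) (b l) x) := by
  have h : ∀ (k : κ) (a : SuperPoly K N ι),
      SuperPoly.dlam k (SuperPoly.linSubst (fun a k => if b k = a then 1 else 0) a) =
        SuperPoly.linSubst (fun a k => if b k = a then 1 else 0) (SuperPoly.dlam (b k) a) := by
    intro k a
    induction a using SuperPoly.induction_on with
    | hr r => simp [Algebra.algebraMap_eq_smul_one, SuperPoly.dlam_one]
    | hl i =>
      rw [SuperPoly.linSubst_lam, map_sum, SuperPoly.dlam_lam]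
      simp only [map_zsmul, SuperPoly.dlam_lam]
      rw [Finset.sum_eq_single k (fun x _ hx => by rw [if_neg hx, smul_zero]) (by simp)]
      rcases eq_or_ne (b k) i with h | h
      · simp [h]
      · simp [h, h.symm]
    | ht i j => simp [SuperPoly.dlam_th, apply_ite]
    | hmul a b ha hb => simp only [map_mul, SuperPoly.dlam_mul, ha, hb, map_add]
    | hadd a b ha hb => simp only [map_add, ha, hb]
  obtain ⟨x, rfl⟩ := mk_surjective x
  induction x using TensorProduct.induction_on with
  | zero => simp
  | tmul a v =>
    rw [blockSubst_mk_tmul, dlamSub_mk, dlamSub_mk, dlamSubPoly, dlamSubPoly,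
      TensorProduct.map_tmul, TensorProduct.map_tmul, blockSubst_mk_tmul, LinearMap.sub_apply,
      LinearMap.sub_apply, h, h, map_sub]
  | add x y hx hy => simp only [map_add, hx, hy]

theorem dlamSub_embed_const {ι : Type} [Fintype ι] [DecidableEq ι] {k l m : ι} (hk : m ≠ k)
    (hl : m ≠ l) (x : PolyV K N Unit V) : dlamSub H k l (embed H (fun _ => m) x) = 0 := by
  induction x using TensorProduct.induction_on with
  | zero => simp
  | tmul b v =>
    rw [embed_tmul, dlamSub_mk, dlamSubPoly, TensorProduct.map_tmul, LinearMap.sub_apply,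
      dlam_ren_of_ne hk, dlam_ren_of_ne hl]
    simp
  | add x y hx hy => simp only [map_add, hx, hy, add_zero]

theorem dlamSub_twist_of_ne {ι : Type} [Fintype ι] [DecidableEq ι] {k l m : ι} (hk : m ≠ k)
    (hl : m ≠ l) (s : ZMod 2) (g : V →ₗ[K] Vnabla H ι) (hg : ∀ u, dlamSub H k l (g u) = 0)
    (F : PolyV K N Unit V) : dlamSub H k l (twist (SuperPoly.ren fun _ => m) s g F) = 0 := by
  induction F using TensorProduct.induction_on with
  | zero => simp
  | tmul a u =>
    rw [twist_tmul, dlamSub_smul, hg, dlam_ren_of_ne hk, dlam_ren_of_ne hl]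
    simp
  | add x y hx hy => simp only [map_add, hx, hy, add_zero]

theorem dlamSub_twist {ι : Type} [Fintype ι] [DecidableEq ι] {k l : ι} (hkl : k ≠ l)
    (s : ZMod 2) (g : V →ₗ[K] Vnabla H ι) (hg : ∀ u, dlamSub H k l (g u) = 0)
    (F : PolyV K N Unit V) : dlamSub H k l (twist (SuperPoly.ren fun _ => k) s g F) =
      twist (SuperPoly.ren fun _ => k) s g (dlamOp F) := by
  induction F using TensorProduct.induction_on with
  | zero => simp
  | tmul a u =>
    rw [twist_tmul, dlamSub_smul, hg, dlam_ren_self, dlam_ren_of_ne hkl, dlamOp_tmul, twist_tmul,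
      SuperPoly.dlam_signBy]
    simp
  | add x y hx hy => simp only [map_add, hx, hy]

end Vnabla

namespace Op

theorem dlamOp_val_arrow {X : Op H (Fin 2)} (hX : IsPcl 1 X) (a b : V) :
    dlamOp (val X NQuiver.arrow a b) = 0 := by
  rw [val_apply, ← dlamSub_eq_zero_iff (k := 0) (by decide)]
  exact hX.sesq_d _ _ _
    (NQuiver.connected_of_mem (Q := NQuiver.arrow) (e := (0, 1)) (by decide)).1 _

theorem val_S_left {X : Op H (Fin 2)} (hX : IsPcl 1 X) (Q : NQuiver (Fin 2)) (i : Fin N) (a b : V) :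
    val X Q (H.S i a) b = (SuperPoly.th () i : SuperPoly K N Unit) • val X Q a b := by
  have h := hX.sesq_S Q 0 i ![a, b]
  have hv : (fun m => H.Scomp 0 i m (![a, b] m)) = ![H.S i a, b] := by
    ext m
    fin_cases m <;> rfl
  rw [hv, ksign_one, neg_one_smul, neg_neg] at h
  rw [val_apply, val_apply, h, elim_smul_th_of_ne (by decide)]

theorem val_S_right {X : Op H (Fin 2)} (hX : IsPcl 1 X) (Q : NQuiver (Fin 2)) (i : Fin N)
    {p : ZMod 2} {a : V} (ha : a ∈ H.parity p) (b : V) :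
    val X Q a (H.S i b) = -(ksign p • ((SuperPoly.th () i : SuperPoly K N Unit) • val X Q a b +
      oddOp (H.S i) (val X Q a b))) := by
  have h := hX.sesq_S Q 1 i ![H.signBy 1 a, b]
  have hv : (fun m => H.Scomp 1 i m (![H.signBy 1 a, b] m)) = ![a, H.S i b] := by
    ext m
    fin_cases m
    · exact H.signBy_signBy 1 a
    · rfl
  rw [hv, ksign_one, neg_one_smul, neg_neg] at h
  rw [val_apply, h, elim_smul_th_self, ← val_apply, H.signBy_of_mem 1 p a ha, one_mul, map_zsmul,
    LinearMap.smul_apply, map_zsmul, smul_comm, ← smul_neg, ← smul_sub]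
  refine Eq.trans ?_ (smul_neg _ _)
  congr 1
  exact (neg_add' _ _).symm

end Op

namespace Op

/-! ### Reduction of the Maurer–Cartan equation to three quivers -/

/-- The ternary operation `X □ X` of an odd binary operation `X`. -/
def selfSquare (X : Op H (Fin 2)) : Op H (Fin 3) := square (n := 1) (m := 1) 1 1 X X

theorem eq_vecCons_three {V : Type*} (v : Fin 3 → V) : v = ![v 0, v 1, v 2] := by
  ext k
  fin_cases k <;> rfl

theorem selfSquare_apply (X : Op H (Fin 2)) (Q : NQuiver (Fin 3)) {q : Fin 3 → ZMod 2}
    {v : Fin 3 → V} (hv : ∀ k, v k ∈ H.parity (q k)) :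
    selfSquare X Q v =
      Vnabla.blockSubst H id (circOne (n := 1) (m := 1) 1 1 X X Q ![v 0, v 1, v 2]) +
      ksign (q 1 * q 2) • Vnabla.blockSubst H (Equiv.swap (1 : Fin 3) 2)
        (circOne (n := 1) (m := 1) 1 1 X X (Q.rename (Equiv.swap 1 2)) ![v 0, v 2, v 1]) +
      ksign (q 0 * (q 1 + q 2)) • Vnabla.blockSubst H ((finRotate 3)⁻¹ : Equiv.Perm (Fin 3))
        (circOne (n := 1) (m := 1) 1 1 X X (Q.rename (finRotate 3)⁻¹) ![v 1, v 2, v 0]) := by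
  conv_lhs => rw [eq_vecCons_three v]
  exact square_apply X Q (hv 0) (hv 1) (hv 2)

theorem circOne_eq_zero [CharZero K] {X : Op H (Fin 2)} (hX : IsPcl 1 X) {Q : NQuiver (Fin 3)}
    (h : 2 ≤ Q.firstInner.edges.card ∨ 2 ≤ Q.firstOuter.edges.card) (v : Fin 3 → V) :
    circOne (n := 1) (m := 1) 1 1 X X Q v = 0 := by
  have : circOne (n := 1) (m := 1) 1 1 X X Q = 0 :=
    h.elim (circOne_eq_zero_of_inner hX) (circOne_eq_zero_of_outer hX)
  rw [this]
  rfl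

/-- The square vanishes on a quiver for which, in each numbering of the vertices, two edges lie in
the block `{1, 2}` or two edges join it to the block `{3}`. -/
theorem selfSquare_eq_zero_of_forall [CharZero K] {X : Op H (Fin 2)} (hX : IsPcl 1 X)
    {Q : NQuiver (Fin 3)} (h : ∀ s : Equiv.Perm (Fin 3), 2 ≤ (Q.rename s).firstInner.edges.card ∨
      2 ≤ (Q.rename s).firstOuter.edges.card) : selfSquare X Q = 0 := by
  have h1 : Q.rename (1 : Equiv.Perm (Fin 3)) = Q := NQuiver.ext (by
    change Q.edges.map id = _
    rw [Multiset.map_id])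
  refine ext_multilinear H fun q v hv => ?_
  have h0 := h 1
  rw [h1] at h0
  rw [selfSquare_apply X Q hv, circOne_eq_zero hX h0, circOne_eq_zero hX (h _),
    circOne_eq_zero hX (h _)]
  simp

theorem selfSquare_swap [CharZero K] {X : Op H (Fin 2)} (hX : IsPcl 1 X) (e : Fin 3 × Fin 3)
    (he : e.1 ≠ e.2) (Q : NQuiver (Fin 3)) :
    selfSquare X (Q.cons e.swap he.symm) = -selfSquare X (Q.cons e he) := by
  have key : ∀ (e : Fin 3 × Fin 3) (he : e.1 ≠ e.2) (Q : NQuiver (Fin 3)) (v : Fin 3 → V),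
      circOne (n := 1) (m := 1) 1 1 X X (Q.cons e.swap he.symm) v =
        -circOne (n := 1) (m := 1) 1 1 X X (Q.cons e he) v := by
    intro e he Q v
    rw [circOne_swap hX]
    rfl
  refine ext_multilinear H fun q v hv => ?_
  rw [neg_apply, selfSquare_apply X _ hv, selfSquare_apply X _ hv]
  simp only [NQuiver.rename_cons]
  have h2 := key (Prod.map (Equiv.swap (1 : Fin 3) 2) (Equiv.swap (1 : Fin 3) 2) e)
    ((Equiv.injective _).ne he) (Q.rename (Equiv.swap (1 : Fin 3) 2)) ![v 0, v 2, v 1]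
  have h3 := key (Prod.map ((finRotate 3)⁻¹ : Equiv.Perm (Fin 3))
    ((finRotate 3)⁻¹ : Equiv.Perm (Fin 3)) e)
    ((Equiv.injective _).ne he) (Q.rename (finRotate 3)⁻¹) ![v 1, v 2, v 0]
  have hm : ∀ s : Equiv.Perm (Fin 3), Prod.map s s e.swap = (Prod.map s s e).swap := fun _ => rfl
  simp only [hm, key e he, h2, h3, map_neg, smul_neg, neg_add]

theorem selfSquare_eq_zero_of_rename [CharZero K] {X : Op H (Fin 2)} (hX : IsPcl 1 X)
    (hs : ∀ s, X.perm s = X) {Q : NQuiver (Fin 3)} (s : Equiv.Perm (Fin 3))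
    (h : selfSquare X (Q.rename s) = 0) : selfSquare X Q = 0 := by
  refine ext_multilinear H fun q v hv => ?_
  have hp : (selfSquare X).perm s = selfSquare X := square_perm hX hs s
  rw [← hp, perm_apply _ _ _ q v hv, h, zero_apply, zero_apply,
    map_zero, smul_zero]

/-- Two edges on three vertices either join the same two vertices, or become the edges of
`1 → 2 → 3` after renumbering the vertices and reversing edges. -/
theorem parallel_or_exists_path (e f : Fin 3 × Fin 3) (he : e.1 ≠ e.2) (hf : f.1 ≠ f.2) :
    (∀ s : Equiv.Perm (Fin 3), merge (s e.1) = merge (s e.2) ↔ merge (s f.1) = merge (s f.2)) ∨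
    ∃ s : Equiv.Perm (Fin 3), (Prod.map s s e = (0, 1) ∨ Prod.map s s e = (1, 0)) ∧
      (Prod.map s s f = (1, 2) ∨ Prod.map s s f = (2, 1)) := by
  obtain ⟨e, e'⟩ := e
  obtain ⟨f, f'⟩ := f
  revert e e' f f'
  decide +kernel

theorem exists_eq_zero_one (e : Fin 3 × Fin 3) (he : e.1 ≠ e.2) :
    ∃ s : Equiv.Perm (Fin 3), Prod.map s s e = (0, 1) := by
  revert e
  decide +kernel

/-- A quiver on three vertices with at least three edges, or with two edges that join the same
vertices, has too many edges in or between the blocks of any decomposition. All other quivers are,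
up to renumbering the vertices and reversing edges, among the three listed. -/
theorem selfSquare_eq_zero [CharZero K] {X : Op H (Fin 2)} (hX : IsPcl 1 X)
    (hs : ∀ s, X.perm s = X) (h₀ : selfSquare X (NQuiver.empty (Fin 3)) = 0)
    (h₁ : selfSquare X NQuiver.edge₁₂ = 0) (h₂ : selfSquare X NQuiver.path₁₂₃ = 0) :
    selfSquare X = 0 := by
  funext Q
  rcases lt_or_ge 2 Q.edges.card with h3 | h3
  · refine selfSquare_eq_zero_of_forall hX fun s => ?_
    have := NQuiver.card_firstInner_add_card_firstOuter (Q.rename s)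
    have h4 : (Q.rename s).edges.card = Q.edges.card := Multiset.card_map _ _
    omega
  interval_cases h : Q.edges.card
  · have hQ : Q = NQuiver.empty (Fin 3) := NQuiver.ext (Multiset.card_eq_zero.1 h)
    rw [hQ, h₀]
    rfl
  · obtain ⟨e, hQe⟩ := Multiset.card_eq_one.1 h
    have he : e.1 ≠ e.2 := Q.no_loop e (by simp [hQe])
    obtain ⟨s, hs'⟩ := exists_eq_zero_one e he
    refine selfSquare_eq_zero_of_rename hX hs s ?_
    have hQ : Q.rename s = NQuiver.edge₁₂ := NQuiver.ext (by
      change Q.edges.map _ = _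
      rw [hQe, Multiset.map_singleton, hs']
      rfl)
    rw [hQ, h₁]
  · obtain ⟨e, f, hQe⟩ := Multiset.card_eq_two.1 h
    have he : e.1 ≠ e.2 := Q.no_loop e (by simp [hQe])
    have hf : f.1 ≠ f.2 := Q.no_loop f (by simp [hQe])
    have hQ : Q = ((NQuiver.empty (Fin 3)).cons e he).cons f hf := NQuiver.ext (by
      rw [hQe, Multiset.pair_comm]
      rfl)
    rcases parallel_or_exists_path e f he hf with hp | ⟨s, hse, hsf⟩
    · refine selfSquare_eq_zero_of_forall hX fun s => ?_
      have h4 := NQuiver.card_firstInner_add_card_firstOuter (Q.rename s)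
      have h5 : (Q.rename s).edges.card = Q.edges.card := Multiset.card_map _ _
      have h6 : (Q.rename s).firstOuter.edges.card = 0 ∨
          (Q.rename s).firstOuter.edges.card = 2 := by
        have h7 : ((NQuiver.empty (Fin 3)).rename s).firstOuter.edges = 0 := rfl
        rw [hQ, NQuiver.rename_cons, NQuiver.rename_cons, NQuiver.firstOuter_cons,
          NQuiver.firstOuter_cons, h7]
        by_cases hm : merge (s e.1) = merge (s e.2)
        · simp [hm, (hp s).1 hm]
        · simp [hm, (hp s).not.1 hm]
      omega
    · refine selfSquare_eq_zero_of_rename hX hs s ?_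
      have h7 : (NQuiver.empty (Fin 3)).rename s = NQuiver.empty (Fin 3) := rfl
      rw [hQ, NQuiver.rename_cons, NQuiver.rename_cons, h7]
      have hc : ∀ (e e' : Fin 3 × Fin 3) (he : e.1 ≠ e.2) (Q : NQuiver (Fin 3)) (h : e' = e),
          Q.cons e' (by rwa [h]) = Q.cons e he := by
        rintro e _ he Q rfl
        rfl
      have hflip : ∀ (e : Fin 3 × Fin 3) (he : e.1 ≠ e.2),
          ((NQuiver.empty (Fin 3)).cons e he).cons (1, 2) (by decide) =
          ((NQuiver.empty (Fin 3)).cons (1, 2) (by decide)).cons e he := fun e he =>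
        NQuiver.ext (Multiset.cons_swap (1, 2) e 0)
      have h8 : selfSquare X
          (((NQuiver.empty (Fin 3)).cons (1, 0) (by decide)).cons (1, 2) (by decide)) = 0 := by
        rw [hflip]
        refine (selfSquare_swap hX (0, 1) (by decide) _).trans ?_
        rw [← hflip]
        exact neg_eq_zero.2 h₂
      have h9 : ∀ (e : Fin 3 × Fin 3) (he : e.1 ≠ e.2), (e = (0, 1) ∨ e = (1, 0)) →
          selfSquare X (((NQuiver.empty (Fin 3)).cons e he).cons (1, 2) (by decide)) = 0 := by
        rintro _ _ (rfl | rfl)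
        · exact h₂
        · exact h8
      have hes : (Prod.map s s e).1 ≠ (Prod.map s s e).2 := s.injective.ne he
      rcases hsf with hsf | hsf
      · rw [hc (1, 2) _ (by decide) _ hsf]
        exact h9 _ hes hse
      · rw [hc (2, 1) _ (by decide) _ hsf]
        refine (selfSquare_swap hX (1, 2) (by decide) _).trans ?_
        exact neg_eq_zero.2 (h9 _ hes hse)

end Op

/-! ### The square on the quivers with edges -/

theorem SuperPoly.involute_eq_signBy {ι : Type} (a : SuperPoly K N ι) :
    SuperPoly.involute a = SuperPoly.signBy 1 a := by
  rw [SuperPoly.signBy_one]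
  rfl

theorem twist_oddOp {ι κ : Type} {M : Type*} [AddCommGroup M] [Module K M]
    [Module (SuperPoly K N κ) M] [IsScalarTower K (SuperPoly K N κ) M]
    (ρ : SuperPoly K N ι →ₐ[K] SuperPoly K N κ) (t : SuperPoly K N κ)
    (ht : ∀ a, ρ (SuperPoly.involute a) * t = t * ρ a) (s : ZMod 2) (f : V →ₗ[K] V)
    (g : V →ₗ[K] M) (hg : ∀ u, g (f u) = t • g u) (x : PolyV K N ι V) :
    twist ρ s g (oddOp f x) = t • twist ρ s g x := by
  induction x using TensorProduct.induction_on with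
  | zero => simp
  | tmul a v =>
    rw [oddOp_tmul, twist_tmul, twist_tmul, hg, smul_smul, smul_smul, ← ht,
      SuperPoly.involute_eq_signBy, SuperPoly.involute_eq_signBy, SuperPoly.signBy_add,
      SuperPoly.signBy_add, add_comm]
  | add x y hx hy => simp only [map_add, smul_add, hx, hy]

theorem twist_smul_odd {ι κ : Type} {M : Type*} [AddCommGroup M] [Module K M]
    [Module (SuperPoly K N κ) M] [IsScalarTower K (SuperPoly K N κ) M]
    (ρ : SuperPoly K N ι →ₐ[K] SuperPoly K N κ) (t : SuperPoly K N κ)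
    (ht : ∀ a, ρ (SuperPoly.involute a) * t = t * ρ a) (s : ZMod 2)
    (g g' : V →ₗ[K] M) (hg : ∀ u, g' u = t • g u) (x : PolyV K N ι V) :
    twist ρ (s + 1) g' x = t • twist ρ s g x := by
  induction x using TensorProduct.induction_on with
  | zero => simp
  | tmul a v =>
    rw [twist_tmul, twist_tmul, hg, smul_smul, smul_smul, ← ht,
      SuperPoly.involute_eq_signBy, SuperPoly.signBy_add]
  | add x y hx hy => simp only [map_add, smul_add, hx, hy]

theorem SuperPoly.ren_involute_mul_th {ι κ : Type} (b : ι → κ) (k : κ) (i : Fin N)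
    (a : SuperPoly K N ι) :
    SuperPoly.ren b (SuperPoly.involute a) * SuperPoly.th k i =
      SuperPoly.th k i * SuperPoly.ren b a := by
  rw [SuperPoly.th_comm, ← SuperPoly.involute_ren, SuperPoly.involute_involute]

namespace Op

variable {X : Op H (Fin 2)} {p q r : ZMod 2} {a b c : V}

/-- The product `Res_Λ(λ⁻¹ X^{• → •}_{Λ, -Λ-∇}(a ⊗ b))`. -/
def resArrow (X : Op H (Fin 2)) : V →ₗ[K] V →ₗ[K] V := (val X NQuiver.arrow).compr₂ res

theorem resArrow_apply (X : Op H (Fin 2)) (a b : V) :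
    resArrow X a b = res (val X NQuiver.arrow a b) := rfl

theorem embed_val_S_left (hX : IsPcl 1 X) (Q : NQuiver (Fin 2)) {ι : Type} [Fintype ι]
    [DecidableEq ι] (k : ι) (i : Fin N) (a u : V) :
    (embed H (fun _ => k) ∘ₗ val X Q (H.S i a)) u =
      (SuperPoly.th k i : SuperPoly K N ι) • (embed H (fun _ => k) ∘ₗ val X Q a) u := by
  rw [LinearMap.comp_apply, LinearMap.comp_apply, val_S_left hX, embed_smul, SuperPoly.ren_th]

theorem twist_val_S_left (hX : IsPcl 1 X) (Q : NQuiver (Fin 2)) (g : V →ₗ[K] Vnabla H (Fin 3))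
    (i : Fin N) (s : ZMod 2) (a b : V) :
    twist (SuperPoly.ren fun _ => (0 : Fin 3)) s g (val X Q (H.S i a) b) =
      ksign s • ((SuperPoly.th 0 i : SuperPoly K N (Fin 3)) •
        twist (SuperPoly.ren fun _ => (0 : Fin 3)) s g (val X Q a b)) := by
  rw [val_S_left hX, twist_smul, SuperPoly.signBy_th, map_zsmul, SuperPoly.ren_th]
  exact map_zsmul (LinearMap.toSpanSingleton (SuperPoly K N (Fin 3)) _ _) _ _

theorem ksign_smul_smul_eq {R M : Type*} [Ring R] [AddCommGroup M] [Module R M] (t : R)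
    {m n l : ZMod 2} (h : m + n + 1 = l) (x : M) :
    ksign m • ksign n • t • x = -(t • ksign l • x) := by
  rw [smul_comm t, ksign_smul_smul_add, ← h, ksign_add (m + n), ksign_one, mul_neg_one, neg_smul,
    neg_neg]

theorem ksign_smul_neg_smul_eq {R M : Type*} [Ring R] [AddCommGroup M] [Module R M] (t : R)
    {m n l : ZMod 2} (h : m + n = l) (x : M) :
    ksign m • -(ksign n • t • x) = -(t • ksign l • x) := by
  rw [smul_comm t, smul_neg, ksign_smul_smul_add, ← h]

theorem ksign_smul_eq {R M : Type*} [Ring R] [AddCommGroup M] [Module R M] (t : R)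
    {m l : ZMod 2} (h : m + 1 = l) (x : M) : ksign m • t • x = -(t • ksign l • x) := by
  rw [smul_comm t, ← h, ksign_add, ksign_one, mul_neg_one, neg_smul, neg_neg]

/-- The square satisfies the third sesquilinearity condition in its first argument. -/
theorem selfSquare_edge_S [CharZero K] (hX : IsPcl 1 X) (hs : ∀ s, X.perm s = X)
    (ha : a ∈ H.parity p) (hb : b ∈ H.parity q) (hc : c ∈ H.parity r) (i : Fin N) :
    selfSquare X NQuiver.edge₁₂ ![H.S i a, b, c] =
      -((SuperPoly.th 0 i : SuperPoly K N (Fin 3)) • selfSquare X NQuiver.edge₁₂ ![a, b, c]) := by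
  have hg : ∀ u, (Vnabla.blockSubst H (merge ∘ (Equiv.swap 1 2 : Equiv.Perm (Fin 3))) ∘ₗ
      embed H (fun _ => (0 : Fin 2)) ∘ₗ (val X NQuiver.arrow).flip b) (H.S i u) =
      (SuperPoly.th 0 i + SuperPoly.th 2 i : SuperPoly K N (Fin 3)) •
        (Vnabla.blockSubst H (merge ∘ (Equiv.swap 1 2 : Equiv.Perm (Fin 3))) ∘ₗ
          embed H (fun _ => (0 : Fin 2)) ∘ₗ (val X NQuiver.arrow).flip b) u := by
    intro u
    have hm : ∀ k, merge ((Equiv.swap 1 2 : Equiv.Perm (Fin 3)) k) = 0 ↔ k ≠ 1 := by decide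
    simp only [LinearMap.comp_apply, LinearMap.flip_apply]
    rw [val_S_left hX, embed_smul, SuperPoly.ren_th, blockSubst_smul, SuperPoly.linSubst_th]
    congr 1
    simp [Fin.sum_univ_three, hm]
  have e2 : twist (SuperPoly.ren fun _ => (2 : Fin 3)) 1
      (Vnabla.blockSubst H (merge ∘ (Equiv.swap 1 2 : Equiv.Perm (Fin 3))) ∘ₗ
        embed H (fun _ => (0 : Fin 2)) ∘ₗ (val X NQuiver.arrow).flip b)
      (val X NQuiver.discrete c (H.S i a)) =
      -(ksign r • ((SuperPoly.th 0 i : SuperPoly K N (Fin 3)) •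
        twist (SuperPoly.ren fun _ => (2 : Fin 3)) 1
      (Vnabla.blockSubst H (merge ∘ (Equiv.swap 1 2 : Equiv.Perm (Fin 3))) ∘ₗ
        embed H (fun _ => (0 : Fin 2)) ∘ₗ (val X NQuiver.arrow).flip b)
      (val X NQuiver.discrete c a))) := by
    rw [val_S_right hX _ _ hc, map_neg, map_zsmul, map_add,
      twist_oddOp _ (SuperPoly.th 0 i + SuperPoly.th 2 i) (fun a => by
        rw [mul_add, add_mul, SuperPoly.ren_involute_mul_th, SuperPoly.ren_involute_mul_th])
          _ _ _ hg,
      twist_smul, SuperPoly.signBy_th, ksign_one, neg_one_smul, map_neg, SuperPoly.ren_th]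
    congr 2
    refine (add_smul _ _ _).symm.trans ?_
    congr 1
    abel
  have e3 := twist_smul_odd (SuperPoly.ren fun _ => (2 : Fin 3)) (SuperPoly.th 0 i)
    (SuperPoly.ren_involute_mul_th _ _ _) (1 + p) (embed H (fun _ => 0) ∘ₗ val X NQuiver.arrow a) _
    (embed_val_S_left hX NQuiver.arrow 0 i a) (val X NQuiver.discrete c b)
  have E := square_edge hX hs (H.S_mem i p a ha) hb hc
  refine E.trans ?_
  have E' : selfSquare X NQuiver.edge₁₂ ![a, b, c] = _ := square_edge hX hs ha hb hc
  rw [E', twist_val_S_left hX, e2,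
    show (1 + (p + 1) : ZMod 2) = 1 + p + 1 from (add_assoc _ _ _).symm, e3,
    ksign_smul_smul_eq (SuperPoly.th 0 i) (l := r * (p + q + 1)),
    ksign_smul_neg_smul_eq (SuperPoly.th 0 i) (l := r * (p + q)),
    ksign_smul_eq (SuperPoly.th 0 i) (l := p + q * r), ← neg_add, ← neg_add, ← smul_add, ← smul_add]
  all_goals
    clear ha hb hc E E' e2 e3
    revert p q r
    decide

theorem selfSquare_path_S [CharZero K] (hX : IsPcl 1 X) (hs : ∀ s, X.perm s = X)
    (ha : a ∈ H.parity p) (hb : b ∈ H.parity q) (hc : c ∈ H.parity r) (i : Fin N) :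
    selfSquare X NQuiver.path₁₂₃ ![H.S i a, b, c] =
      -((SuperPoly.th 0 i : SuperPoly K N (Fin 3)) • selfSquare X NQuiver.path₁₂₃ ![a, b, c]) := by
  have e3 := twist_smul_odd (SuperPoly.ren fun _ => (2 : Fin 3)) (SuperPoly.th 0 i)
    (SuperPoly.ren_involute_mul_th _ _ _) (1 + p) (embed H (fun _ => 0) ∘ₗ val X NQuiver.arrow a) _
    (embed_val_S_left hX NQuiver.arrow 0 i a) (val X NQuiver.arrow c b)
  have E := square_path hX hs (H.S_mem i p a ha) hb hc
  refine E.trans ?_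
  have E' : selfSquare X NQuiver.path₁₂₃ ![a, b, c] = _ := square_path hX hs ha hb hc
  rw [E', twist_val_S_left hX,
    show (1 + (p + 1) : ZMod 2) = 1 + p + 1 from (add_assoc _ _ _).symm, e3,
    ksign_smul_smul_eq (SuperPoly.th 0 i) (l := r * (p + q + 1)),
    ksign_smul_eq (SuperPoly.th 0 i) (l := p + q * r), ← neg_add, smul_neg, ← smul_add]
  all_goals
    clear ha hb hc E E' e3
    revert p q r
    decide

theorem dlamSub_arrow_twist (hX : IsPcl 1 X) (s : ZMod 2) (g : V →ₗ[K] PolyV K N Unit V) (a b : V) :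
    dlamSub H (0 : Fin 3) 1 (twist (SuperPoly.ren fun _ => (0 : Fin 3)) s
      (embed H (fun _ => 2) ∘ₗ g)
      (val X NQuiver.arrow a b)) = 0 := by
  rw [dlamSub_twist (by decide) _ _ fun u => dlamSub_embed_const (by decide) (by decide) _,
    dlamOp_val_arrow hX, map_zero]

theorem dlamSub_twist_arrow (hX : IsPcl 1 X) (s : ZMod 2) (a : V) (F : PolyV K N Unit V) :
    dlamSub H (0 : Fin 3) 1 (twist (SuperPoly.ren fun _ => (2 : Fin 3)) s
      (embed H (fun _ => 0) ∘ₗ val X NQuiver.arrow a) F) = 0 := by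
  refine dlamSub_twist_of_ne (by decide) (by decide) _ _ (fun u => ?_) _
  rw [LinearMap.comp_apply, dlamSub_embed (by decide), dlamOp_val_arrow hX, map_zero]

theorem dlamSub_selfSquare_edge [CharZero K] (hX : IsPcl 1 X) (hs : ∀ s, X.perm s = X)
    (ha : a ∈ H.parity p) (hb : b ∈ H.parity q) (hc : c ∈ H.parity r) :
    dlamSub H 0 1 (selfSquare X NQuiver.edge₁₂ ![a, b, c]) = 0 := by
  have h2 : dlamSub H (0 : Fin 3) 1 (twist (SuperPoly.ren fun _ => (2 : Fin 3)) 1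
      (Vnabla.blockSubst H (merge ∘ (Equiv.swap 1 2 : Equiv.Perm (Fin 3))) ∘ₗ
        embed H (fun _ => (0 : Fin 2)) ∘ₗ (val X NQuiver.arrow).flip b)
      (val X NQuiver.discrete c a)) = 0 := by
    refine dlamSub_twist_of_ne (by decide) (by decide) _ _ (fun u => ?_) _
    rw [LinearMap.comp_apply, LinearMap.comp_apply, dlamSub_blockSubst]
    refine Eq.trans (congrArg _ ?_) (map_zero _)
    refine (dlamSub_embed (k := (0 : Fin 2)) (l := 1) (by decide) _).trans ?_
    rw [LinearMap.flip_apply, dlamOp_val_arrow hX, map_zero]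
  have E' : selfSquare X NQuiver.edge₁₂ ![a, b, c] = _ := square_edge hX hs ha hb hc
  rw [E', map_add, map_add, map_zsmul, map_zsmul, map_zsmul, dlamSub_arrow_twist hX,
    dlamSub_twist_arrow hX, h2]
  simp

theorem dlamSub_selfSquare_path [CharZero K] (hX : IsPcl 1 X) (hs : ∀ s, X.perm s = X)
    (ha : a ∈ H.parity p) (hb : b ∈ H.parity q) (hc : c ∈ H.parity r) :
    dlamSub H 0 1 (selfSquare X NQuiver.path₁₂₃ ![a, b, c]) = 0 := by
  have E' : selfSquare X NQuiver.path₁₂₃ ![a, b, c] = _ := square_path hX hs ha hb hc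
  rw [E', map_neg, map_add, map_zsmul, map_zsmul, dlamSub_arrow_twist hX, dlamSub_twist_arrow hX]
  simp

/-- The residue on the quiver with the edge `1 → 2`: the Leibniz rule, up to signs. -/
theorem resMid_selfSquare_edge [CharZero K] (hX : IsPcl 1 X) (hs : ∀ s, X.perm s = X)
    (ha : a ∈ H.parity p) (hb : b ∈ H.parity q) (hc : c ∈ H.parity r) :
    resMid H (selfSquare X NQuiver.edge₁₂ ![a, b, c]) =
      ksign (N + (p + q + N + 1) * r) • val X NQuiver.discrete c (resArrow X a b) +
      ksign (r * (p + q)) • TensorProduct.map (SuperPoly.signBy (1 + N)) ((resArrow X).flip b)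
        (val X NQuiver.discrete c a) +
      ksign (p + q * r) • TensorProduct.map (SuperPoly.signBy (1 + p + N)) (resArrow X a)
        (val X NQuiver.discrete c b) := by
  have E' : selfSquare X NQuiver.edge₁₂ ![a, b, c] = _ := square_edge hX hs ha hb hc
  rw [E', map_add, map_add, map_zsmul, map_zsmul, map_zsmul, resMid_twist_zero, resMid_twist_two,
    resMid_twist_two_shift _ _ fun u => dlamOp_val_arrow hX u b, ksign_smul_smul_add]
  congr 3
  clear ha hb hc E'
  generalize (N : ZMod 2) = n
  revert p q r n
  decide

theorem resMid_selfSquare_path [CharZero K] (hX : IsPcl 1 X) (hs : ∀ s, X.perm s = X)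
    (ha : a ∈ H.parity p) (hb : b ∈ H.parity q) (hc : c ∈ H.parity r) :
    resMid H (selfSquare X NQuiver.path₁₂₃ ![a, b, c]) =
      -(ksign (N + (p + q + N + 1) * r) • val X NQuiver.arrow c (resArrow X a b) +
      ksign (p + q * r) • TensorProduct.map (SuperPoly.signBy (1 + p + N)) (resArrow X a)
        (val X NQuiver.arrow c b)) := by
  have E' : selfSquare X NQuiver.path₁₂₃ ![a, b, c] = _ := square_path hX hs ha hb hc
  rw [E', map_neg, map_add, map_zsmul, map_zsmul, resMid_twist_zero, resMid_twist_two,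
    ksign_smul_smul_add]
  congr 4
  clear ha hb hc E'
  generalize (N : ZMod 2) = n
  revert p q r n
  decide

/-- The residue on the quiver `1 → 2 → 3`: associativity, up to signs. -/
theorem res_resMid_selfSquare_path [CharZero K] (hX : IsPcl 1 X) (hs : ∀ s, X.perm s = X)
    (ha : a ∈ H.parity p) (hb : b ∈ H.parity q) (hc : c ∈ H.parity r) :
    res (resMid H (selfSquare X NQuiver.path₁₂₃ ![a, b, c])) =
      -(ksign (N + (p + q + N + 1) * r) • resArrow X c (resArrow X a b) +
      ksign (p + q * r + (1 + p + N) * N) • resArrow X a (resArrow X c b)) := by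
  rw [resMid_selfSquare_path hX hs ha hb hc, map_neg, map_add, map_zsmul, map_zsmul,
    res_map_signBy, ksign_smul_smul_add, resArrow_apply X c, resArrow_apply X c]

/-- An operation on the first two arguments of a quiver with an edge `1 → 2` vanishes if its
residues vanish. -/
theorem eq_zero_of_resMid_family [CharZero K] (F : V → Vnabla H (Fin 3))
    (hd : ∀ p a, a ∈ H.parity p → dlamSub H 0 1 (F a) = 0)
    (hS : ∀ i p a, a ∈ H.parity p →
      F (H.S i a) = -((SuperPoly.th 0 i : SuperPoly K N (Fin 3)) • F a))
    (hres : ∀ p a, a ∈ H.parity p → resMid H (F a) = 0) (ha : a ∈ H.parity p) : F a = 0 := by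
  have h0 : elimMid H (F a) = 0 := eq_zero_of_res_family (H := H) (fun a => elimMid H (F a))
    (fun p a ha => dlamOp_elimMid (hd p a ha))
    (fun i p a ha => ⟨-1, by
      rw [hS i p a ha, map_neg, elimMid_smul, midAct_th_zero, neg_one_smul, neg_neg]⟩) hres ha
  rw [← uneliminate_elimMid (F a), h0, map_zero]

theorem selfSquare_edge_eq_zero [CharZero K] (hX : IsPcl 1 X) (hs : ∀ s, X.perm s = X)
    (h : ∀ (p q r : ZMod 2) (a b c : V), a ∈ H.parity p → b ∈ H.parity q → c ∈ H.parity r →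
      resMid H (selfSquare X NQuiver.edge₁₂ ![a, b, c]) = 0) :
    selfSquare X NQuiver.edge₁₂ = 0 := by
  refine ext_multilinear H fun q v hv => ?_
  rw [eq_vecCons_three v, zero_apply]
  exact eq_zero_of_resMid_family (fun a => selfSquare X NQuiver.edge₁₂ ![a, v 1, v 2])
    (fun p a ha => dlamSub_selfSquare_edge hX hs ha (hv 1) (hv 2))
    (fun i p a ha => selfSquare_edge_S hX hs ha (hv 1) (hv 2) i)
    (fun p a ha => h _ _ _ _ _ _ ha (hv 1) (hv 2)) (hv 0)

theorem selfSquare_path_eq_zero [CharZero K] (hX : IsPcl 1 X) (hs : ∀ s, X.perm s = X)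
    (h : ∀ (p q r : ZMod 2) (a b c : V), a ∈ H.parity p → b ∈ H.parity q → c ∈ H.parity r →
      res (resMid H (selfSquare X NQuiver.path₁₂₃ ![a, b, c])) = 0) :
    selfSquare X NQuiver.path₁₂₃ = 0 := by
  refine ext_multilinear H fun q v hv => ?_
  rw [eq_vecCons_three v, zero_apply]
  refine eq_zero_of_resMid_family (fun a => selfSquare X NQuiver.path₁₂₃ ![a, v 1, v 2])
    (fun p a ha => dlamSub_selfSquare_path hX hs ha (hv 1) (hv 2))
    (fun i p a ha => selfSquare_path_S hX hs ha (hv 1) (hv 2) i) (fun p a ha => ?_) (hv 0)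
  refine eq_zero_of_res_family (H := H)
    (fun c => resMid H (selfSquare X NQuiver.path₁₂₃ ![a, v 1, c])) (fun r c hc => ?_)
    (fun i r c hc => ⟨ksign (p + q 1 + N + 1), ?_⟩) (fun r c hc => h _ _ _ _ _ _ ha (hv 1) hc)
      (hv 2)
  · rw [resMid_selfSquare_path hX hs ha (hv 1) hc, map_neg, map_add, map_zsmul, map_zsmul,
      dlamOp_map_signBy, dlamOp_val_arrow hX, dlamOp_val_arrow hX]
    simp
  · rw [resMid_selfSquare_path hX hs ha (hv 1) hc,
      resMid_selfSquare_path hX hs ha (hv 1) (H.S_mem i r c hc), val_S_left hX, val_S_left hX,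
      map_signBy_th_smul, smul_neg, smul_neg, smul_add, smul_add, smul_comm (SuperPoly.th () i),
      smul_comm (SuperPoly.th () i), ksign_smul_smul_add, ksign_smul_smul_add, ksign_smul_smul_add]
    congr 4
    all_goals
      clear ha hv hc
      generalize (N : ZMod 2) = n
      generalize q 1 = q'
      clear q
      revert p q' r n
      decide

end Op

/-! ### Binary operations as pairs of brackets -/

/-- The properties shared by the two brackets `X^{• •}_{Λ, -Λ-∇}` and `X^{• → •}_{Λ, -Λ-∇}` of an
odd symmetric binary operation `X`; `ε` is `1` for the first and `-1` for the second one. -/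
structure IsOddBracket (H : HWSupermodule K N V) (ε : ℤ) (Z : LamBracket K N V) : Prop where
  parity : ∀ (p q : ZMod 2) (a b : V), a ∈ H.parity p → b ∈ H.parity q →
    Z a b ∈ PolyV.parity H Unit (p + q + 1)
  S_left : ∀ (i : Fin N) (a b : V),
    Z (H.S i a) b = (SuperPoly.th () i : SuperPoly K N Unit) • Z a b
  S_right : ∀ (i : Fin N) (p : ZMod 2) (a b : V), a ∈ H.parity p → Z a (H.S i b) =
    -(ksign p • ((SuperPoly.th () i : SuperPoly K N Unit) • Z a b + oddOp (H.S i) (Z a b)))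
  skew : ∀ (p q : ZMod 2) (a b : V), a ∈ H.parity p → b ∈ H.parity q →
    Z a b = ε • ksign (p * q) • Z.evalNeg H b a

/-- The pair `(D, A)` has the properties of the pair of brackets of an odd symmetric binary
operation. -/
structure IsOddPair (H : HWSupermodule K N V) (D A : LamBracket K N V) : Prop where
  fst : IsOddBracket H 1 D
  snd : IsOddBracket H (-1) A
  T_left : ∀ a b : V, D (H.T a) b = -((SuperPoly.lam () : SuperPoly K N Unit) • D a b)
  T_right : ∀ a b : V, D a (H.T b) =
    (SuperPoly.lam () : SuperPoly K N Unit) • D a b + evenOp H.T (D a b)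
  dlam : ∀ a b : V, dlamOp (A a b) = 0
  T_add : ∀ a b : V, A (H.T a) b + A a (H.T b) = evenOp H.T (A a b)

theorem LamBracket.evalNeg_apply (Z : LamBracket K N V) (a b : V) (l : Fin 2) :
    Z.evalNeg H a b = elim H l (fun _ => ()) (embed H (fun _ => l) (Z a b)) := by
  rw [elim_embed_self]
  rfl

theorem Vnabla.dlamOp_elim_embed_self {x : PolyV K N Unit V} (hx : dlamOp x = 0) :
    dlamOp (elim H 1 (fun _ => ()) (embed H (fun _ => (1 : Fin 2)) x)) = 0 := by
  rw [← dlamSub_eq_zero_iff (k := (0 : Fin 2)) (by decide), dlamSub_symm,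
    dlamSub_embed (by decide), hx, map_zero, neg_zero]

namespace Op

theorem eq_vecCons_two {V : Type*} (v : Fin 2 → V) : v = ![v 0, v 1] := by
  ext k
  fin_cases k <;> rfl

theorem isOddPair_val [CharZero K] {X : Op H (Fin 2)} (hX : IsPcl 1 X) (hs : ∀ s, X.perm s = X) :
    IsOddPair H (val X NQuiver.discrete) (val X NQuiver.arrow) where
  fst :=
    { parity := fun p q a b ha hb => val_mem_parity hX _ ha hb
      S_left := fun i a b => val_S_left hX _ i a b
      S_right := fun i p a b ha => val_S_right hX _ i ha b
      skew := fun p q a b ha hb => by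
        rw [val_apply, apply_discrete hs ha hb, map_zsmul, ← LamBracket.evalNeg_apply, one_smul] }
  snd :=
    { parity := fun p q a b ha hb => val_mem_parity hX _ ha hb
      S_left := fun i a b => val_S_left hX _ i a b
      S_right := fun i p a b ha => val_S_right hX _ i ha b
      skew := fun p q a b ha hb => by
        rw [val_apply, apply_arrow hX hs ha hb, map_neg, map_zsmul, ← LamBracket.evalNeg_apply,
          neg_one_smul] }
  T_left a b := by
    have h := sesq_T_of_empty hX (Q := NQuiver.discrete) rfl 0 ![a, b]
    have hv : (fun m => H.Tcomp 0 m (![a, b] m)) = ![H.T a, b] := by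
      ext m
      fin_cases m <;> rfl
    rw [hv] at h
    rw [val_apply, val_apply, h, map_neg, elim_smul_lam_of_ne (by decide)]
  T_right a b := by
    have h := sesq_T_of_empty hX (Q := NQuiver.discrete) rfl 1 ![a, b]
    have hv : (fun m => H.Tcomp 1 m (![a, b] m)) = ![a, H.T b] := by
      ext m
      fin_cases m <;> rfl
    rw [hv] at h
    rw [val_apply, val_apply, h, map_neg, elim_smul_lam_self]
    abel
  dlam a b := dlamOp_val_arrow hX a b
  T_add a b := by
    have h := sesq_T_of_mem hX (Q := NQuiver.arrow) (e := (0, 1)) (by decide) ![a, b]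
    have hv0 : (fun m => H.Tcomp 0 m (![a, b] m)) = ![H.T a, b] := by
      ext m
      fin_cases m <;> rfl
    have hv1 : (fun m => H.Tcomp 1 m (![a, b] m)) = ![a, H.T b] := by
      ext m
      fin_cases m <;> rfl
    rw [Fin.sum_univ_two, hv0, hv1] at h
    rw [val_apply, val_apply, val_apply, ← map_add, h, Fin.sum_univ_two, add_smul, map_neg, map_add,
      elim_smul_lam_self, elim_smul_lam_of_ne (by decide)]
    abel

variable (H) in
/-- The map `a ⊗ b ↦ Z_{Λ_1}(a, b)`. -/
def pairing (Z : LamBracket K N V) : MultilinearMap K (fun _ : Fin 2 => V) (Vnabla H (Fin 2)) :=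
  ((MultilinearMap.ofSubsingletonₗ K K V (Vnabla H (Fin 2)) (0 : Fin 1)).toLinearMap ∘ₗ
    Z.compr₂ (embed H fun _ => 0)).uncurryLeft

theorem pairing_apply (Z : LamBracket K N V) (v : Fin 2 → V) :
    pairing H Z v = embed H (fun _ => 0) (Z (v 0) (v 1)) := rfl

open Classical in
variable (H) in
/-- The binary operation with the brackets `D` on the quiver without edges and `A` on the quiver
`• → •`. Its values on all other quivers are the ones forced by the cycle relations. -/
def ofPair (D A : LamBracket K N V) : Op H (Fin 2) := fun Q =>
  if Q = NQuiver.discrete then pairing H D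
  else if Q = NQuiver.arrow then pairing H A
  else if Q = NQuiver.rev then -pairing H A
  else 0

theorem arrow_ne_discrete : NQuiver.arrow ≠ NQuiver.discrete := fun h => by
  have := congrArg (fun Q => Q.edges.card) h
  simp [NQuiver.arrow, NQuiver.discrete] at this

theorem rev_ne_discrete : NQuiver.rev ≠ NQuiver.discrete := fun h => by
  have := congrArg (fun Q => Q.edges.card) h
  simp [NQuiver.rev, NQuiver.discrete] at this

theorem rev_ne_arrow : NQuiver.rev ≠ NQuiver.arrow := fun h => by
  have := congrArg (fun Q => Q.edges) h
  simp [NQuiver.rev, NQuiver.arrow] at this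

theorem ofPair_discrete (D A : LamBracket K N V) : ofPair H D A NQuiver.discrete = pairing H D :=
  if_pos rfl

theorem ofPair_arrow (D A : LamBracket K N V) : ofPair H D A NQuiver.arrow = pairing H A := by
  rw [ofPair, if_neg arrow_ne_discrete, if_pos rfl]

theorem ofPair_rev (D A : LamBracket K N V) : ofPair H D A NQuiver.rev = -pairing H A := by
  rw [ofPair, if_neg rev_ne_discrete, if_neg rev_ne_arrow, if_pos rfl]

theorem ofPair_of_card (D A : LamBracket K N V) {Q : NQuiver (Fin 2)} (h : 2 ≤ Q.edges.card) :
    ofPair H D A Q = 0 := by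
  rw [ofPair, if_neg, if_neg, if_neg] <;> rintro rfl <;> revert h <;> decide

@[elab_as_elim]
theorem _root_.SUSY.NQuiver.cases_fin_two {C : NQuiver (Fin 2) → Prop} (h0 : C NQuiver.discrete)
    (h1 : C NQuiver.arrow)
    (h2 : C NQuiver.rev) (h3 : ∀ Q, 2 ≤ Q.edges.card → C Q) (Q : NQuiver (Fin 2)) : C Q := by
  rcases lt_or_ge Q.edges.card 2 with h | h
  · rcases NQuiver.eq_of_card_le_one (Nat.le_of_lt_succ h) with rfl | rfl | rfl
    · exact h0
    · exact h1
    · exact h2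
  · exact h3 Q h

theorem val_ofPair_discrete (D A : LamBracket K N V) :
    val (ofPair H D A) NQuiver.discrete = D := by
  refine LinearMap.ext fun a => LinearMap.ext fun b => ?_
  rw [val_apply, ofPair_discrete, pairing_apply, elim_embed_of_ne (by decide)]
  rfl

theorem val_ofPair_arrow (D A : LamBracket K N V) : val (ofPair H D A) NQuiver.arrow = A := by
  refine LinearMap.ext fun a => LinearMap.ext fun b => ?_
  rw [val_apply, ofPair_arrow, pairing_apply, elim_embed_of_ne (by decide)]
  rfl

theorem pairing_mem_parity {ε : ℤ} {Z : LamBracket K N V} (hZ : IsOddBracket H ε Z)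
    (q : Fin 2 → ZMod 2) (v : Fin 2 → V) (hv : ∀ k, v k ∈ H.parity (q k)) :
    pairing H Z v ∈ Vnabla.parity H (∑ k, q k + 1) := by
  rw [pairing_apply, Fin.sum_univ_two]
  exact embed_mem_parity _ (hZ.parity _ _ _ _ (hv 0) (hv 1))

theorem pairing_S {ε : ℤ} {Z : LamBracket K N V} (hZ : IsOddBracket H ε Z) (k : Fin 2) (i : Fin N)
    (v : Fin 2 → V) : pairing H Z (fun m => H.Scomp k i m (v m)) =
      (SuperPoly.th k i : SuperPoly K N (Fin 2)) • pairing H Z v := by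
  rw [pairing_apply, pairing_apply]
  fin_cases k
  · change embed H _ (Z (H.S i (v 0)) (v 1)) = _
    rw [hZ.S_left, embed_smul, SuperPoly.ren_th]
    rfl
  · change embed H _ (Z (H.signBy 1 (v 0)) (H.S i (v 1))) = _
    have h : ∀ p a, a ∈ H.parity p → embed H (fun _ => (0 : Fin 2))
        (Z (H.signBy 1 a) (H.S i (v 1))) =
        (SuperPoly.th 1 i : SuperPoly K N (Fin 2)) •
          embed H (fun _ => (0 : Fin 2)) (Z a (v 1)) := by
      intro p a ha
      rw [H.signBy_of_mem 1 p a ha, one_mul, map_zsmul, LinearMap.smul_apply, hZ.S_right i p a _ ha,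
        smul_neg, smul_smul, ksign_mul_self, one_smul, map_neg, map_add, embed_smul, embed_oddOp,
        SuperPoly.ren_th, Fin.sum_univ_two, add_smul]
      abel
    obtain ⟨x, hx, y, hy, hxy⟩ := H.exists_parity_decomposition (v 0)
    rw [hxy]
    simp only [map_add, LinearMap.add_apply, smul_add, h 0 x hx, h 1 y hy]
    rfl

theorem pairing_swap {ε : ℤ} {Z : LamBracket K N V} (hZ : IsOddBracket H ε Z) (q : Fin 2 → ZMod 2)
    (v : Fin 2 → V) (hv : ∀ k, v k ∈ H.parity (q k)) :
    pairing H Z v = ε • ksign (q 0 * q 1) •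
      Vnabla.blockSubst H (Equiv.swap (0 : Fin 2) 1) (pairing H Z ![v 1, v 0]) := by
  rw [pairing_apply, pairing_apply, blockSubst_swap_embed, hZ.skew _ _ _ _ (hv 0) (hv 1), map_zsmul,
    map_zsmul, LamBracket.evalNeg_apply _ _ _ 1, embed_elim (by decide)]
  rfl

theorem connected_discrete {k l : Fin 2} (h : NQuiver.discrete.Connected k l) : k = l := by
  obtain ⟨p, hp, hw⟩ := h
  cases p with
  | nil => exact hw
  | cons e p => exact absurd (hp e (by simp)) (by simp [NQuiver.discrete])

theorem sesq_d_ofPair {D A : LamBracket K N V} (h : IsOddPair H D A) (Q : NQuiver (Fin 2))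
    (k l : Fin 2) (hkl : Q.Connected k l) (v : Fin 2 → V) :
    dlamSub H k l (ofPair H D A Q v) = 0 := by
  rcases eq_or_ne k l with rfl | hne
  · exact dlamSub_self _ _
  have key : dlamSub H k l (pairing H A v) = 0 := by
    have h01 : dlamSub H 0 1 (pairing H A v) = 0 := by
      rw [pairing_apply, dlamSub_embed (by decide), h.dlam, map_zero]
    fin_cases k <;> fin_cases l
    · exact absurd rfl hne
    · exact h01
    · refine (dlamSub_symm _ _ _).trans ?_
      exact neg_eq_zero.2 h01
    · exact absurd rfl hne
  induction Q using NQuiver.cases_fin_two with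
  | h0 => exact absurd (connected_discrete hkl) hne
  | h1 => rw [ofPair_arrow, key]
  | h2 => rw [ofPair_rev, neg_apply, map_neg, key, neg_zero]
  | h3 Q hQ => rw [ofPair_of_card _ _ hQ, zero_apply, map_zero]

theorem sesq_T_ofPair {D A : LamBracket K N V} (h : IsOddPair H D A) (Q : NQuiver (Fin 2))
    (k : Fin 2) (I : Finset (Fin 2)) (hI : ∀ l, l ∈ I ↔ Q.Connected k l) (v : Fin 2 → V) :
    ∑ l ∈ I, ofPair H D A Q (fun m => H.Tcomp l m (v m)) =
      -((∑ l ∈ I, SuperPoly.lam l : SuperPoly K N (Fin 2)) • ofPair H D A Q v) := by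
  have key : ∑ l, pairing H A (fun m => H.Tcomp l m (v m)) =
      -((∑ l, SuperPoly.lam l : SuperPoly K N (Fin 2)) • pairing H A v) := by
    rw [Fin.sum_univ_two, pairing_apply, pairing_apply, pairing_apply, ← map_add]
    change embed H _ (A (H.T (v 0)) (v 1) + A (v 0) (H.T (v 1))) = _
    rw [h.T_add, embed_evenOp]
  have huniv : ∀ {Q : NQuiver (Fin 2)} {e : Fin 2 × Fin 2}, e ∈ Q.edges →
      (∀ l, l ∈ I ↔ Q.Connected k l) → I = Finset.univ := by
    intro Q e he hI
    refine Finset.eq_univ_iff_forall.2 fun l => (hI l).2 ?_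
    have hne := Q.no_loop e he
    have h1 := (NQuiver.connected_of_mem he).1
    have h2 := (NQuiver.connected_of_mem he).2
    have hcov : ∀ k x y : Fin 2, x ≠ y → k = x ∨ k = y := by decide
    have hk := hcov k _ _ hne
    have hl := hcov l _ _ hne
    rcases hk with rfl | rfl <;> rcases hl with rfl | rfl
    · exact NQuiver.connected_refl _ _
    · exact h1
    · exact h2
    · exact NQuiver.connected_refl _ _
  induction Q using NQuiver.cases_fin_two with
  | h0 =>
    have hI' : I = {k} := by
      ext l
      rw [hI l, Finset.mem_singleton]
      exact ⟨fun h => (connected_discrete h).symm, fun h => h ▸ NQuiver.connected_refl _ _⟩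
    rw [hI', Finset.sum_singleton, Finset.sum_singleton, ofPair_discrete, pairing_apply,
      pairing_apply]
    fin_cases k
    · change embed H _ (D (H.T (v 0)) (v 1)) = _
      rw [h.T_left, map_neg, embed_smul, SuperPoly.ren_lam]
      rfl
    · change embed H _ (D (v 0) (H.T (v 1))) = _
      rw [h.T_right, map_add, embed_smul, embed_evenOp, SuperPoly.ren_lam, Fin.sum_univ_two,
        add_smul]
      abel
  | h1 => rw [huniv (e := (0, 1)) (by decide) hI, ofPair_arrow, key]
  | h2 =>
    rw [huniv (e := (1, 0)) (by decide) hI, ofPair_rev]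
    simp only [neg_apply, Finset.sum_neg_distrib, key, smul_neg]
  | h3 Q hQ =>
    rw [ofPair_of_card _ _ hQ]
    simp

theorem directed_cycle_ofPair (D A : LamBracket K N V) (Q : NQuiver (Fin 2))
    (c : List (Fin 2 × Fin 2)) (hc : Q.IsDirectedCycle c) :
    (c.map fun e => ofPair H D A (Q.erase e)).sum = 0 := by
  obtain ⟨hne, hle, x, hx⟩ := hc
  have hcard := Multiset.card_le_card hle
  rw [Multiset.coe_card] at hcard
  rcases lt_or_ge 2 Q.edges.card with h3 | h3
  · refine List.sum_eq_zero fun y hy => ?_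
    obtain ⟨e, he, rfl⟩ := List.mem_map.1 hy
    refine ofPair_of_card _ _ ?_
    have : (Q.edges.erase e).card = Q.edges.card - 1 :=
      Multiset.card_erase_of_mem (Multiset.mem_of_le hle (by simpa using he))
    change 2 ≤ (Q.edges.erase e).card
    omega
  match c, hne, hle, hx, hcard with
  | [], hne, _, _, _ => exact absurd rfl hne
  | [e], _, hle, hx, _ =>
    have he := Q.no_loop e (Multiset.mem_of_le hle (by simp))
    exact absurd (hx.1.trans hx.2.symm) he
  | [e, f], _, hle, hx, hcard =>
    have he := Q.no_loop e (Multiset.mem_of_le hle (by simp))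
    have hf := Q.no_loop f (Multiset.mem_of_le hle (by simp))
    have hQ : (({e, f} : Multiset (Fin 2 × Fin 2))) = Q.edges :=
      Multiset.eq_of_le_of_card_le hle (by simpa using h3)
    obtain ⟨h1, h2, h4⟩ := hx
    have hf' : f = e.swap := Prod.ext h2 (h4.trans h1.symm)
    have hE1 : (Q.erase e).edges = {f} := by
      change Q.edges.erase e = _
      rw [← hQ]
      simp
    have hE2 : (Q.erase f).edges = {e} := by
      change Q.edges.erase f = _
      rw [← hQ, Multiset.pair_comm]
      simp
    have hpairs : ∀ e : Fin 2 × Fin 2, e.1 ≠ e.2 → e = (0, 1) ∨ e = (1, 0) := by decide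
    have hcases := hpairs e he
    simp only [List.map_cons, List.map_nil, List.sum_cons, List.sum_nil, add_zero]
    rcases hcases with rfl | rfl
    · have e1 : Q.erase (0, 1) = NQuiver.rev := NQuiver.ext (by rw [hE1, hf']; rfl)
      have e2 : Q.erase f = NQuiver.arrow := NQuiver.ext (by rw [hE2]; rfl)
      rw [e1, e2, ofPair_rev, ofPair_arrow, neg_add_cancel]
    · have e1 : Q.erase (1, 0) = NQuiver.arrow := NQuiver.ext (by rw [hE1, hf']; rfl)
      have e2 : Q.erase f = NQuiver.rev := NQuiver.ext (by rw [hE2]; rfl)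
      rw [e1, e2, ofPair_rev, ofPair_arrow, add_neg_cancel]
  | _ :: _ :: _ :: _, _, _, _, hcard =>
    simp only [List.length_cons] at hcard
    omega

theorem isPcl_ofPair {D A : LamBracket K N V} (h : IsOddPair H D A) : IsPcl 1 (ofPair H D A) where
  parity Q q v hv := by
    induction Q using NQuiver.cases_fin_two with
    | h0 =>
      rw [ofPair_discrete]
      exact pairing_mem_parity h.fst q v hv
    | h1 =>
      rw [ofPair_arrow]
      exact pairing_mem_parity h.snd q v hv
    | h2 =>
      rw [ofPair_rev]
      exact neg_mem (pairing_mem_parity h.snd q v hv)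
    | h3 Q hQ =>
      rw [ofPair_of_card _ _ hQ]
      exact zero_mem _
  not_acyclic Q hQ := by
    rcases lt_or_ge Q.edges.card 2 with h2 | h2
    · exact absurd (NQuiver.isAcyclic_of_card (Nat.le_of_lt_succ h2)) hQ
    · exact ofPair_of_card _ _ h2
  directed_cycle := directed_cycle_ofPair D A
  sesq_d := sesq_d_ofPair h
  sesq_T := sesq_T_ofPair h
  sesq_S Q k i v := by
    rw [ksign_one, neg_one_smul, neg_neg]
    induction Q using NQuiver.cases_fin_two with
    | h0 =>
      rw [ofPair_discrete, pairing_S h.fst]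
    | h1 =>
      rw [ofPair_arrow, pairing_S h.snd]
    | h2 =>
      rw [ofPair_rev, neg_apply, neg_apply, pairing_S h.snd, smul_neg]
    | h3 Q hQ =>
      rw [ofPair_of_card _ _ hQ]
      simp

theorem perm_ofPair {D A : LamBracket K N V} (h : IsOddPair H D A) (s : Equiv.Perm (Fin 2)) :
    (ofPair H D A).perm s = ofPair H D A := by
  have hs : s = 1 ∨ s = Equiv.swap 0 1 := by
    revert s
    decide
  funext Q
  refine ext_multilinear H fun q v hv => ?_
  rw [perm_apply _ _ _ q v hv]
  rcases hs with rfl | rfl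
  · have h1 : Q.rename (1 : Equiv.Perm (Fin 2)) = Q := NQuiver.ext (by
      change Q.edges.map id = _
      rw [Multiset.map_id])
    have h2 : koszulSign (1 : Equiv.Perm (Fin 2)) q = 1 := by
      clear hv
      revert q
      decide
    rw [h1, h2, one_smul]
    exact blockSubst_id _
  · have hv' : (fun k => v ((Equiv.swap (0 : Fin 2) 1).symm k)) = ![v 1, v 0] := by
      ext k
      fin_cases k <;> rfl
    rw [koszulSign_swap, hv']
    induction Q using NQuiver.cases_fin_two with
    | h0 =>
      have e : NQuiver.discrete.rename (Equiv.swap (0 : Fin 2) 1) = NQuiver.discrete := rfl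
      rw [e, ofPair_discrete, pairing_swap h.fst q v hv, one_smul]
    | h1 =>
      have e : NQuiver.arrow.rename (Equiv.swap (0 : Fin 2) 1) = NQuiver.rev := rfl
      rw [e, ofPair_arrow, ofPair_rev, pairing_swap h.snd q v hv, neg_one_smul,
        neg_apply, map_neg, smul_neg]
    | h2 =>
      have e : NQuiver.rev.rename (Equiv.swap (0 : Fin 2) 1) = NQuiver.arrow := rfl
      rw [e, ofPair_arrow, ofPair_rev, neg_apply, pairing_swap h.snd q v hv,
        neg_one_smul, neg_neg]
    | h3 Q hQ =>
      have hQ' : 2 ≤ (Q.rename (Equiv.swap (0 : Fin 2) 1)).edges.card := by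
        change 2 ≤ (Q.edges.map _).card
        rwa [Multiset.card_map]
      rw [ofPair_of_card _ _ hQ, ofPair_of_card _ _ hQ']
      simp

/-- A binary operation is determined by its two brackets. -/
theorem ext_val {X Y : Op H (Fin 2)} (hX : IsPcl 1 X) (hY : IsPcl 1 Y)
    (h0 : val X NQuiver.discrete = val Y NQuiver.discrete)
    (h1 : val X NQuiver.arrow = val Y NQuiver.arrow) : X = Y := by
  have key : ∀ Q, val X Q = val Y Q → X Q = Y Q := fun Q h => MultilinearMap.ext fun v => by
    rw [eq_vecCons_two v, ← embed_val, ← embed_val, h]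
  funext Q
  induction Q using NQuiver.cases_fin_two with
  | h0 => exact key _ h0
  | h1 => exact key _ h1
  | h2 => rw [map_rev hX, map_rev hY, key _ h1]
  | h3 Q hQ =>
    rw [hX.not_acyclic _ (NQuiver.not_isAcyclic_of_card hQ),
      hY.not_acyclic _ (NQuiver.not_isAcyclic_of_card hQ)]

end Op

open Op

/-! ### The shift of the parity -/

theorem zmod_two_add_self (n : ZMod 2) : n + n = 0 := by
  revert n
  decide

namespace HWSupermodule

theorem mem_shift (r p : ZMod 2) (v : V) : v ∈ (H.shift r).parity p ↔ v ∈ H.parity (p + r) :=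
  Iff.rfl

theorem mem_shift_add {r p : ZMod 2} {v : V} :
    v ∈ (H.shift r).parity (p + r) ↔ v ∈ H.parity p := by
  rw [mem_shift, add_assoc, zmod_two_add_self, add_zero]

theorem exists_eq_add (r P : ZMod 2) : ∃ p, P = p + r :=
  ⟨P + r, by rw [add_assoc, zmod_two_add_self, add_zero]⟩

theorem signBy_S (H : HWSupermodule K N V) (p : ZMod 2) (i : Fin N) (v : V) :
    H.signBy p (H.S i v) = ksign p • H.S i (H.signBy p v) := by
  have : H.signBy p ∘ₗ H.S i = ksign p • (H.S i ∘ₗ H.signBy p) :=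
    H.ext_homogeneous fun q v hv => by
      rw [LinearMap.comp_apply, H.signBy_of_mem p _ _ (H.S_mem i q v hv), LinearMap.smul_apply,
        LinearMap.comp_apply, H.signBy_of_mem p q v hv, map_zsmul, ksign_smul_smul_add, mul_add,
        mul_one, add_comm]
  exact LinearMap.congr_fun this v

theorem signBy_T_apply (H : HWSupermodule K N V) (p : ZMod 2) (v : V) :
    H.signBy p (H.T v) = H.T (H.signBy p v) := LinearMap.congr_fun (H.signBy_T p) v

end HWSupermodule

theorem PolyV.mem_parity_shift {κ : Type} (r p : ZMod 2) (x : PolyV K N κ V) :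
    x ∈ PolyV.parity (H.shift r) κ p ↔ x ∈ PolyV.parity H κ (p + r) := by
  constructor <;> intro hx
  · refine parity_induction (C := fun x => x ∈ PolyV.parity H κ (p + r)) (zero_mem _)
      (fun x y hx hy => add_mem hx hy) (fun q q' h a ha v hv => ?_) hx
    exact tmul_mem_parity H ha hv (by rw [← h, add_assoc])
  · refine parity_induction (C := fun x => x ∈ PolyV.parity (H.shift r) κ p) (zero_mem _)
      (fun x y hx hy => add_mem hx hy) (fun q q' h a ha v hv => ?_) hx
    refine tmul_mem_parity (H.shift r) ha (HWSupermodule.mem_shift_add.2 hv) ?_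
    rw [← add_assoc, h, add_assoc, zmod_two_add_self, add_zero]

theorem PolyV.map_signBy_comp (H : HWSupermodule K N V) {W : Type*} [AddCommGroup W] [Module K W]
    {κ : Type} (s r : ZMod 2) (g : V →ₗ[K] W) {P : ZMod 2} {x : PolyV K N κ V}
    (hx : x ∈ PolyV.parity H κ P) :
    TensorProduct.map (SuperPoly.signBy s) (g ∘ₗ H.signBy r) x =
      ksign (r * P) • TensorProduct.map (SuperPoly.signBy (s + r)) g x := by
  refine parity_induction (C := fun x => TensorProduct.map (SuperPoly.signBy s)
    (g ∘ₗ H.signBy r) x =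
      ksign (r * P) • TensorProduct.map (SuperPoly.signBy (s + r)) g x) (by simp)
      (fun x y hx hy => by simp only [map_add, smul_add, hx, hy]) (fun q q' h a ha v hv => ?_) hx
  rw [TensorProduct.map_tmul, TensorProduct.map_tmul, LinearMap.comp_apply,
    H.signBy_of_mem r q' v hv, map_zsmul, SuperPoly.signBy_of_mem _ _ ha,
    SuperPoly.signBy_of_mem _ _ ha, ← h]
  have e : ∀ (m : ℤ) (a : SuperPoly K N κ) (w : W), (m • a) ⊗ₜ[K] w = m • a ⊗ₜ[K] w :=
    fun m a w => map_zsmul ((TensorProduct.mk K (SuperPoly K N κ) W).flip w) m a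
  have e' : ∀ (m : ℤ) (a : SuperPoly K N κ) (w : W), a ⊗ₜ[K] (m • w) = m • a ⊗ₜ[K] w :=
    fun m a w => map_zsmul (TensorProduct.mk K (SuperPoly K N κ) W a) m w
  rw [e, e, e', ksign_smul_smul_add, ksign_smul_smul_add]
  congr 2
  clear ha hv h hx
  revert s q r q'
  decide

/-! ### Brackets of the shifted module -/

theorem ksign_smul_mem_iff {M : Type*} [AddCommGroup M] [Module K M] (S : Submodule K M)
    (p : ZMod 2)
    (x : M) : ksign p • x ∈ S ↔ x ∈ S := by
  rcases zmod_two_cases p with rfl | rfl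
  · rw [ksign_zero, one_smul]
  · rw [ksign_one, neg_one_smul, neg_mem_iff]

theorem ksign_smul_eq_iff {M : Type*} [AddCommGroup M] (p : ZMod 2) (x y : M) :
    ksign p • x = y ↔ x = ksign p • y := by
  constructor
  · rintro rfl
    rw [smul_smul, ksign_mul_self, one_smul]
  · rintro rfl
    rw [smul_smul, ksign_mul_self, one_smul]

theorem ksign_smul_add_ksign_smul_eq_zero_iff {M : Type*} [AddCommGroup M] {c₁ c₂ d : ZMod 2}
    (x y : M) (h : c₁ + c₂ = d + 1) :
    ksign c₁ • x + ksign c₂ • y = 0 ↔ x = ksign d • y := by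
  rw [add_eq_zero_iff_eq_neg, ksign_smul_eq_iff, smul_neg, ksign_smul_smul_add, h, ksign_add,
    ksign_one, mul_neg_one, neg_smul, neg_neg]

theorem ksign_smul_add_eq_zero_iff {M : Type*} [AddCommGroup M] {c₁ c₂ c₃ d₁ d₂ : ZMod 2}
    (x y z : M) (h1 : c₁ + c₃ = d₁ + 1) (h2 : c₂ + c₃ = d₂ + 1) :
    ksign c₁ • x + ksign c₂ • y + ksign c₃ • z = 0 ↔ z = ksign d₁ • x + ksign d₂ • y := by
  have h1' : c₁ = d₁ + 1 + c₃ := by rw [← h1, add_assoc, zmod_two_add_self, add_zero]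
  have h2' : c₂ = d₂ + 1 + c₃ := by rw [← h2, add_assoc, zmod_two_add_self, add_zero]
  have h3 : ksign c₁ • x + ksign c₂ • y + ksign c₃ • z =
      ksign c₃ • (z - (ksign d₁ • x + ksign d₂ • y)) := by
    rw [h1', h2']
    simp only [ksign_add, ksign_one]
    module
  rw [h3, ksign_smul_eq_iff, smul_zero, sub_eq_zero]

namespace LamBracket

variable (B : LamBracket K N V) {p q r : ZMod 2} {a b c : V}

variable (H) in
/-- The bilinear map `(-1)^{p(a) (N + 1)} B(a, b)`. -/
def twisted {W : Type*} [AddCommGroup W] [Module K W] (B : V →ₗ[K] V →ₗ[K] W) : V →ₗ[K] V →ₗ[K] W :=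
  B ∘ₗ H.signBy (N + 1)

theorem twisted_twisted {W : Type*} [AddCommGroup W] [Module K W] (B : V →ₗ[K] V →ₗ[K] W) :
    twisted H (twisted H B) = B :=
  LinearMap.ext fun v => by
    rw [twisted, twisted, LinearMap.comp_apply, LinearMap.comp_apply, H.signBy_signBy]

theorem twisted_apply {W : Type*} [AddCommGroup W] [Module K W] (B : V →ₗ[K] V →ₗ[K] W)
    (ha : a ∈ H.parity p) (b : V) : twisted H B a b = ksign ((N + 1) * p) • B a b := by
  rw [twisted, LinearMap.comp_apply, H.signBy_of_mem _ _ _ ha, map_zsmul, LinearMap.smul_apply]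

theorem twisted_mem_parity_iff (ha : a ∈ H.parity p) :
    twisted H B a b ∈ PolyV.parity (H.shift (N + 1)) Unit (p + (N + 1) + (q + (N + 1)) + 1) ↔
      B a b ∈ PolyV.parity H Unit (p + q + N) := by
  rw [twisted_apply B ha, ksign_smul_mem_iff, mem_parity_shift]
  have e : p + (N + 1) + (q + (N + 1)) + 1 + (N + 1) = p + q + (N : ZMod 2) := by
    clear ha
    generalize (N : ZMod 2) = n
    revert p q n
    decide
  rw [e]

theorem twisted_S_left_iff (i : Fin N) : (∀ a b : V, twisted H B (H.S i a) b =
      (SuperPoly.th () i : SuperPoly K N Unit) • twisted H B a b) ↔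
    ∀ a b : V, B (H.S i a) b =
      -(ksign N • ((SuperPoly.th () i : SuperPoly K N Unit) • B a b)) := by
  have key : ∀ a b, (twisted H B (H.S i a) b =
      (SuperPoly.th () i : SuperPoly K N Unit) • twisted H B a b ↔
      B (H.S i (H.signBy (N + 1) a)) b =
        -(ksign N • ((SuperPoly.th () i : SuperPoly K N Unit) • B (H.signBy (N + 1) a) b))) := by
    intro a b
    rw [twisted, LinearMap.comp_apply, LinearMap.comp_apply, H.signBy_S, map_zsmul,
      LinearMap.smul_apply, ksign_smul_eq_iff, ksign_add, ksign_one, mul_neg_one, neg_smul]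
  constructor
  · intro h a b
    have := (key (H.signBy (N + 1) a) b).1 (h _ _)
    rwa [H.signBy_signBy] at this
  · exact fun h a b => (key a b).2 (h _ _)

theorem twisted_S_right_iff (i : Fin N) (ha : a ∈ H.parity p) : twisted H B a (H.S i b) =
      -(ksign (p + (N + 1)) • ((SuperPoly.th () i : SuperPoly K N Unit) • twisted H B a b +
        oddOp (H.S i) (twisted H B a b))) ↔
    B a (H.S i b) = ksign (p + N) • ((SuperPoly.th () i : SuperPoly K N Unit) • B a b +
      oddOp (H.S i) (B a b)) := by
  rw [twisted_apply B ha, twisted_apply B ha, ksign_smul_eq_iff, map_zsmul,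
    smul_comm _ (ksign _), ← smul_add]
  have key : ∀ {M : Type _} [AddCommGroup M] (m : ZMod 2) (x : M),
      ksign m • -(ksign (p + (N + 1)) • ksign m • x) = ksign (p + N) • x := by
    intro M _ m x
    rw [smul_neg, smul_comm (ksign (p + (N + 1))), smul_smul, ksign_mul_self, one_smul, ← add_assoc,
      ksign_add (p + N), ksign_one, mul_neg_one, neg_smul, neg_neg]
  rw [key]

/-- The parities of `a` and `b` in the shifted module are `p + (N + 1)` and `q + (N + 1)`. -/
theorem twisted_skew_iff (ε : ℤ) (ha : a ∈ H.parity p) (hb : b ∈ H.parity q) : twisted H B b a =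
      ε • ksign ((q + (N + 1)) * (p + (N + 1))) •
        LamBracket.evalNeg (H.shift (N + 1)) (twisted H B) a b ↔
    B b a = ε • -(ksign (p * q + N) • B.evalNeg H a b) := by
  have e : LamBracket.evalNeg (H.shift (N + 1)) (twisted H B) a b =
      ksign ((N + 1) * p) • B.evalNeg H a b := by
    change evalNabla H.superCommute (subst (fun _ _ => -1) (twisted H B a b)) = _
    rw [twisted_apply B ha, map_zsmul, map_zsmul]
    rfl
  rw [e, twisted_apply B hb, ksign_smul_eq_iff, smul_comm _ ε, ksign_smul_smul_add,
    ksign_smul_smul_add, ← neg_smul]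
  have e2 : ksign ((N + 1) * q + (q + (N + 1)) * (p + (N + 1)) + (N + 1) * p) =
      -ksign (p * q + N) := by
    clear ha hb e
    generalize (N : ZMod 2) = n
    revert p q n
    decide
  rw [e2]

theorem twisted_T_left_iff : (∀ a b : V, twisted H B (H.T a) b =
      -((SuperPoly.lam () : SuperPoly K N Unit) • twisted H B a b)) ↔
    ∀ a b : V, B (H.T a) b = -((SuperPoly.lam () : SuperPoly K N Unit) • B a b) := by
  have key : ∀ B : LamBracket K N V, (∀ a b : V, B (H.T a) b =
      -((SuperPoly.lam () : SuperPoly K N Unit) • B a b)) → ∀ a b : V, twisted H B (H.T a) b =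
      -((SuperPoly.lam () : SuperPoly K N Unit) • twisted H B a b) := fun B h a b => by
    rw [twisted, LinearMap.comp_apply, LinearMap.comp_apply, H.signBy_T_apply, h]
  refine ⟨fun h => ?_, key B⟩
  have := key _ h
  rwa [twisted_twisted] at this

theorem twisted_T_right_iff : (∀ a b : V, twisted H B a (H.T b) =
      (SuperPoly.lam () : SuperPoly K N Unit) • twisted H B a b +
        evenOp H.T (twisted H B a b)) ↔
    ∀ a b : V, B a (H.T b) =
      (SuperPoly.lam () : SuperPoly K N Unit) • B a b + evenOp H.T (B a b) := by
  have key : ∀ B : LamBracket K N V, (∀ a b : V, B a (H.T b) =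
      (SuperPoly.lam () : SuperPoly K N Unit) • B a b + evenOp H.T (B a b)) →
      ∀ a b : V, twisted H B a (H.T b) =
      (SuperPoly.lam () : SuperPoly K N Unit) • twisted H B a b +
        evenOp H.T (twisted H B a b) := fun B h a b => h _ _
  refine ⟨fun h => ?_, key B⟩
  have := key _ h
  rwa [twisted_twisted] at this

theorem _root_.SUSY.PolyV.subst_mem_parity {ι κ : Type} [Fintype κ] (e : ι → κ → ℤ)
    {x : PolyV K N ι V} (hx : x ∈ PolyV.parity H ι p) : subst e x ∈ PolyV.parity H κ p := by
  refine parity_induction (C := fun x => subst e x ∈ PolyV.parity H κ p) (by simp)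
    (fun x y hx hy => by rw [map_add]; exact add_mem hx hy) (fun q r h a ha v hv => ?_) hx
  rw [subst_tmul]
  refine tmul_mem_parity H ?_ hv h
  rw [SuperPoly.mem_parity] at ha ⊢
  rw [SuperPoly.involute_linSubst, ha, map_zsmul]

theorem eval_mem_parity {κ : Type} [Fintype κ] [DecidableEq κ] (s : Finset κ)
    (h : B a b ∈ PolyV.parity H Unit (p + q + N)) :
    B.eval s a b ∈ PolyV.parity H κ (p + q + N) := subst_mem_parity _ h

theorem twisted_eval_apply {κ : Type} [Fintype κ] [DecidableEq κ] (s : Finset κ)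
    (ha : a ∈ H.parity p) (b : V) :
    LamBracket.eval (twisted H B) s a b = ksign ((N + 1) * p) • B.eval s a b := by
  change subst _ (twisted H B a b) = _
  rw [twisted_apply B ha, map_zsmul]
  rfl

theorem twisted_eval {κ : Type} [Fintype κ] [DecidableEq κ] (s : Finset κ) (ha : a ∈ H.parity p) :
    LamBracket.eval (twisted H B) s a = ksign ((N + 1) * p) • B.eval s a :=
  LinearMap.ext fun b => twisted_eval_apply B s ha b

/-- The left-hand side is the Jacobiator of `elimLast_square_empty`, for the shifted parities. -/
theorem twisted_jacobi_iff (ha : a ∈ H.parity p) (hb : b ∈ H.parity q)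
    (h : B a b ∈ PolyV.parity H Unit (p + q + N)) :
    PolyV.extend 1 ((LamBracket.eval (twisted H B) Finset.univ).flip c)
        (LamBracket.eval (twisted H B) {(0 : Fin 2)} a b) +
      ksign ((q + (N + 1)) * (p + (N + 1) + 1)) • PolyV.extend (1 + (q + (N + 1)))
        (LamBracket.eval (twisted H B) {1} b) (LamBracket.eval (twisted H B) {(0 : Fin 2)} a c) +
      ksign (p + (N + 1)) • PolyV.extend (1 + (p + (N + 1)))
        (LamBracket.eval (twisted H B) {0} a) (LamBracket.eval (twisted H B)
          {(1 : Fin 2)} b c) = 0 ↔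
    PolyV.extend (p + N) (B.eval {0} a) (B.eval {(1 : Fin 2)} b c) =
      ksign ((p + N) * N) • PolyV.extend N ((B.eval Finset.univ).flip c) (B.eval {0} a b) +
      ksign ((p + N) * (q + N)) • PolyV.extend (q + N) (B.eval {1} b) (B.eval {0} a c) := by
  have hflip : (LamBracket.eval (twisted H B) (Finset.univ : Finset (Fin 2))).flip c =
      (B.eval Finset.univ).flip c ∘ₗ H.signBy (N + 1) := rfl
  have e1 : (1 + (N + 1) : ZMod 2) = N := by
    generalize (N : ZMod 2) = n
    revert n
    decide
  have e2 : ∀ q : ZMod 2, (1 + (q + (N + 1)) : ZMod 2) = q + N := by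
    generalize (N : ZMod 2) = n
    revert n
    decide
  rw [hflip, twisted_eval B _ ha, twisted_eval B _ hb, e2, e2]
  simp only [LinearMap.smul_apply, map_zsmul]
  simp only [extend_eq_twist, twist_smul_map]
  rw [twist_comp_signBy H _ 1 (N + 1) _ (eval_mem_parity B {(0 : Fin 2)} h), e1,
    ksign_smul_smul_add, ksign_smul_smul_add, ksign_smul_smul_add, ksign_smul_smul_add,
    ksign_smul_smul_add]
  refine ksign_smul_add_eq_zero_iff _ _ _ ?_ ?_
  all_goals
    clear ha hb h hflip e1 e2
    generalize (N : ZMod 2) = n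
    revert p q n
    decide

/-- The left-hand side is the residue in `resMid_selfSquare_edge`, for the shifted parities. -/
theorem twisted_leibniz_iff (μ : V →ₗ[K] V →ₗ[K] V) (ha : a ∈ H.parity p)
    (hc : c ∈ H.parity r) (h : B c a ∈ PolyV.parity H Unit (r + p + N)) :
    ksign (N + (p + (N + 1) + (q + (N + 1)) + N + 1) * (r + (N + 1))) •
        twisted H B c (twisted H μ a b) +
      ksign ((r + (N + 1)) * (p + (N + 1) + (q + (N + 1)))) •
        TensorProduct.map (SuperPoly.signBy (1 + N)) ((twisted H μ).flip b) (twisted H B c a) +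
      ksign (p + (N + 1) + (q + (N + 1)) * (r + (N + 1))) •
        TensorProduct.map (SuperPoly.signBy (1 + (p + (N + 1)) + N)) (twisted H μ a)
          (twisted H B c b) = 0 ↔
    B c (μ a b) = TensorProduct.map LinearMap.id (μ.flip b) (B c a) +
      ksign ((r + N) * p) • TensorProduct.map (SuperPoly.signBy p) (μ a) (B c b) := by
  have hflip : (twisted H μ).flip b = μ.flip b ∘ₗ H.signBy (N + 1) := rfl
  have e1 : (1 + N + (N + 1) : ZMod 2) = 0 := by
    generalize (N : ZMod 2) = n
    revert n
    decide
  have e2 : (1 + (p + (N + 1)) + N : ZMod 2) = p := by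
    clear ha h
    generalize (N : ZMod 2) = n
    revert p n
    decide
  have e3 : twisted H μ a = ksign ((N + 1) * p) • μ a := LinearMap.ext (twisted_apply μ ha)
  have e4 : TensorProduct.map (SuperPoly.signBy p : SuperPoly K N Unit →ₗ[K] SuperPoly K N Unit)
      (ksign ((N + 1) * p) • μ a) =
      ksign ((N + 1) * p) • TensorProduct.map (SuperPoly.signBy p) (μ a) :=
    TensorProduct.ext' fun x v => map_zsmul (TensorProduct.mk K (SuperPoly K N Unit) V _) _ _
  rw [twisted_apply B hc, twisted_apply B hc, twisted_apply B hc, hflip, e3, e2, e4,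
    LinearMap.smul_apply, map_zsmul, map_zsmul, LinearMap.smul_apply, map_zsmul,
    map_signBy_comp H (1 + N) (N + 1) _ h, e1, SuperPoly.signBy_zero]
  simp only [ksign_smul_smul_add]
  rw [add_assoc, add_comm, ksign_smul_add_eq_zero_iff (d₁ := 0) (d₂ := (r + N) * p), ksign_zero,
    one_smul]
  all_goals
    clear ha hc h hflip e1 e2 e3 e4
    generalize (N : ZMod 2) = n
    revert p q r n
    decide

/-- The left-hand side is the residue in `res_resMid_selfSquare_path`, for the shifted parities. -/
theorem twisted_assoc_iff (μ : V →ₗ[K] V →ₗ[K] V) (ha : a ∈ H.parity p) (hc : c ∈ H.parity r) :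
    -(ksign (N + (p + (N + 1) + (q + (N + 1)) + N + 1) * (r + (N + 1))) •
        twisted H μ c (twisted H μ a b) +
      ksign (p + (N + 1) + (q + (N + 1)) * (r + (N + 1)) + (1 + (p + (N + 1)) + N) * N) •
        twisted H μ a (twisted H μ c b)) = 0 ↔
    μ c (μ a b) = ksign (p * r) • μ a (μ c b) := by
  rw [neg_eq_zero, twisted_apply μ hc, twisted_apply μ ha, twisted_apply μ ha, twisted_apply μ hc,
    map_zsmul, map_zsmul]
  simp only [ksign_smul_smul_add]
  rw [ksign_smul_add_ksign_smul_eq_zero_iff]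
  clear ha hc
  generalize (N : ZMod 2) = n
  revert p q r n
  decide

end LamBracket

/-! ### The bracket of a product -/

theorem PolyV.map_id_smul {κ : Type} {W : Type*} [AddCommGroup W] [Module K W] (g : V →ₗ[K] W)
    (a : SuperPoly K N κ) (x : PolyV K N κ V) :
    TensorProduct.map LinearMap.id g (a • x) = a • TensorProduct.map LinearMap.id g x := by
  induction x using TensorProduct.induction_on with
  | zero => simp
  | tmul b v => simp [TensorProduct.smul_tmul']
  | add x y hx hy => simp only [smul_add, map_add, hx, hy]

variable (H) in
/-- The substitution `Λ ↦ Λ + ∇` as an action of `K[Λ]` on `V[Λ]`. -/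
def translate : SuperPoly K N Unit →ₐ[K] Module.End K (PolyV K N Unit V) :=
  (act (κ := Unit) H.superCommute).comp (SuperPoly.linSubst fun _ _ => 1)

theorem translate_lam : translate H (SuperPoly.lam ()) = mulOp (SuperPoly.lam ()) + evenOp H.T := by
  simp [translate]

theorem translate_th (i : Fin N) :
    translate H (SuperPoly.th () i) = mulOp (SuperPoly.th () i) + oddOp (H.S i) := by
  simp [translate]

variable (H) in
/-- The element `(θ^1 + S^1) ⋯ (θ^N + S^N) a` of `V[Λ]`. It has the residue `a`, and every
`θ^i + S^i` annihilates it. -/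
def delta : V →ₗ[K] PolyV K N Unit V :=
  translate H (SuperPoly.thWord (List.finRange N)) ∘ₗ TensorProduct.mk K (SuperPoly K N Unit) V 1

theorem delta_apply (a : V) :
    delta H a = translate H (SuperPoly.thWord (List.finRange N)) (1 ⊗ₜ[K] a) := rfl

theorem th_mul_thWord_finRange [CharZero K] (i : Fin N) : (SuperPoly.th () i : SuperPoly K N Unit) *
    SuperPoly.thWord (List.finRange N) = 0 := by
  rw [← SuperPoly.thWord_cons, SuperPoly.thWord_of_not_nodup]
  simp

theorem thWord_finRange_mul_th [CharZero K] (i : Fin N) :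
    (SuperPoly.thWord (List.finRange N) : SuperPoly K N Unit) * SuperPoly.th () i = 0 := by
  have h : (SuperPoly.th () i : SuperPoly K N Unit) = SuperPoly.thWord [i] := by
    rw [SuperPoly.thWord_cons]
    exact (mul_one _).symm
  rw [h, ← SuperPoly.thWord_append, SuperPoly.thWord_of_not_nodup]
  intro hn
  exact (List.disjoint_of_nodup_append hn) (List.mem_finRange i) (by simp)

theorem oddOp_delta [CharZero K] (i : Fin N) (a : V) :
    oddOp (H.S i) (delta H a) = -((SuperPoly.th () i : SuperPoly K N Unit) • delta H a) := by
  have h : translate H (SuperPoly.th () i) (delta H a) = 0 := by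
    rw [delta_apply, ← Module.End.mul_apply, ← map_mul, th_mul_thWord_finRange, map_zero,
      LinearMap.zero_apply]
  rw [translate_th, LinearMap.add_apply, mulOp_apply] at h
  exact eq_neg_of_add_eq_zero_right h

theorem th_smul_translate (i : Fin N) (a : SuperPoly K N Unit) (x : PolyV K N Unit V) :
    (SuperPoly.th () i : SuperPoly K N Unit) • translate H a x =
      translate H (SuperPoly.involute a) ((SuperPoly.th () i : SuperPoly K N Unit) • x) := by
  refine SuperPoly.intertwine (translate H) ((translate H).comp SuperPoly.involute)
    (mulOp (SuperPoly.th () i)) (fun () z => ?_) (fun () j z => ?_) a x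
  · simp only [AlgHom.comp_apply, SuperPoly.involute_lam, translate_lam, LinearMap.add_apply,
      mulOp_apply, smul_add, evenOp_smul, smul_smul, SuperPoly.lam_comm]
  · simp only [AlgHom.comp_apply, SuperPoly.involute_th, map_neg, translate_th,
      LinearMap.neg_apply, LinearMap.add_apply, mulOp_apply, smul_add, oddOp_smul, smul_smul,
      SuperPoly.superCommute_gen.tt () () i j, neg_add, neg_smul]
    congr 1
    have h : (-SuperPoly.th () i : SuperPoly K N Unit) • oddOp (H.S j) z =
        -((SuperPoly.th () i : SuperPoly K N Unit) • oddOp (H.S j) z) :=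
      neg_smul (SuperPoly.th () i) (oddOp (H.S j) z)
    rw [h, neg_neg]

theorem delta_S [CharZero K] (i : Fin N) (a : V) :
    delta H (H.S i a) = -(ksign N • ((SuperPoly.th () i : SuperPoly K N Unit) • delta H a)) := by
  have h1 : (1 : SuperPoly K N Unit) ⊗ₜ[K] H.S i a = translate H (SuperPoly.th () i) (1 ⊗ₜ a) -
      (SuperPoly.th () i : SuperPoly K N Unit) • (1 ⊗ₜ[K] a) := by
    simp [translate_th]
  have h2 := th_smul_translate (H := H) i (SuperPoly.involute (SuperPoly.thWord (List.finRange N)))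
    (1 ⊗ₜ[K] a)
  rw [SuperPoly.involute_involute, SuperPoly.involute_thWord, map_zsmul, LinearMap.smul_apply,
    smul_comm, List.length_finRange] at h2
  rw [delta_apply, h1, map_sub, ← h2, ← Module.End.mul_apply, ← map_mul, thWord_finRange_mul_th,
    map_zero, LinearMap.zero_apply, zero_sub]
  rfl

theorem delta_T (a : V) : delta H (H.T a) = evenOp H.T (delta H a) := by
  have hTS : ∀ i v, H.T (H.S i v) = H.S i (H.T v) := fun i v => LinearMap.congr_fun (H.T_S i) v
  have hcomm : ∀ i (z : PolyV K N Unit V),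
      evenOp H.T (oddOp (H.S i) z) = oddOp (H.S i) (evenOp H.T z) := by
    intro i z
    induction z using TensorProduct.induction_on with
    | zero => simp
    | tmul b v => simp [hTS]
    | add x y hx hy => simp only [map_add, hx, hy]
  have h1 : evenOp H.T ((1 : SuperPoly K N Unit) ⊗ₜ[K] a) = 1 ⊗ₜ[K] H.T a := rfl
  rw [delta_apply, delta_apply, ← h1]
  refine (SuperPoly.intertwine (translate H) (translate H) (evenOp H.T) (fun () z => ?_)
    (fun () j z => ?_) _ _).symm
  · simp only [translate_lam, LinearMap.add_apply, mulOp_apply, map_add, evenOp_smul]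
  · simp only [translate_th, LinearMap.add_apply, mulOp_apply, map_add, evenOp_smul, hcomm]

theorem dlamOp_delta (a : V) : dlamOp (delta H a) = 0 := by
  have hc : ∀ i (z : PolyV K N Unit V),
      dlamOp (oddOp (H.S i) z) = oddOp (H.S i) (dlamOp z) := by
    intro i z
    induction z using TensorProduct.induction_on with
    | zero => simp
    | tmul b v => simp [SuperPoly.dlam_involute]
    | add x y hx hy => simp only [map_add, hx, hy]
  rw [delta_apply]
  generalize List.finRange N = l
  induction l with
  | nil =>
    have h1 : (SuperPoly.thWord [] : SuperPoly K N Unit) = 1 := rfl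
    rw [h1, map_one, Module.End.one_apply, dlamOp_tmul, SuperPoly.dlam_one, TensorProduct.zero_tmul]
  | cons i l ih =>
    rw [SuperPoly.thWord_cons, map_mul, Module.End.mul_apply, translate_th, LinearMap.add_apply,
      mulOp_apply, map_add, dlamOp_smul, hc, ih, SuperPoly.dlam_th]
    simp

theorem delta_mem_parity [CharZero K] {p : ZMod 2} {a : V} (ha : a ∈ H.parity p) :
    delta H a ∈ PolyV.parity H Unit (p + N) := by
  rw [PolyV.mem_parity_iff, delta_apply, translate, AlgHom.comp_apply, inv_act,
    SuperPoly.involute_linSubst, SuperPoly.involute_thWord, List.length_finRange, inv_tmul, map_one,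
    H.signBy_of_mem 1 p a ha, one_mul, map_zsmul, map_zsmul, LinearMap.smul_apply,
    TensorProduct.tmul_smul, map_zsmul, ksign_smul_smul_add, add_comm]

theorem res_delta [CharZero K] (a : V) : res (delta H a) = a := by
  have h := res_translate_thWord (translate H) 1 H.S (fun i => by rw [translate_th, one_smul])
    (l := List.finRange N) (by simp) a
  rw [delta_apply, h, SuperPoly.resCoeff_thWord_finRange, one_pow, one_smul, one_smul]

/-- The properties of a product in a SUSY Poisson vertex algebra which do not involve the bracket,
except associativity. -/
structure IsCommDer (H : HWSupermodule K N V) (μ : V →ₗ[K] V →ₗ[K] V) : Prop where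
  mul_even : ∀ (p q : ZMod 2) (a b : V), a ∈ H.parity p → b ∈ H.parity q → μ a b ∈ H.parity (p + q)
  T_mul : ∀ a b : V, H.T (μ a b) = μ (H.T a) b + μ a (H.T b)
  S_mul : ∀ (i : Fin N) (p : ZMod 2) (a b : V), a ∈ H.parity p →
    H.S i (μ a b) = μ (H.S i a) b + ksign p • μ a (H.S i b)
  mul_comm : ∀ (p q : ZMod 2) (a b : V), a ∈ H.parity p → b ∈ H.parity q →
    μ b a = ksign (p * q) • μ a b

namespace LamBracket

variable (H) in
/-- The bracket `(a, b) ↦ (θ^1 + S^1) ⋯ (θ^N + S^N) a · b`, where the `S^i` act on `a` only. -/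
def ofProduct (μ : V →ₗ[K] V →ₗ[K] V) : LamBracket K N V :=
  LinearMap.mk₂ K (fun a b => TensorProduct.map LinearMap.id (μ.flip b) (delta H a))
    (fun a a' b => by simp only [map_add])
    (fun r a b => by simp only [map_smul])
    (fun a b b' => by rw [map_add, TensorProduct.map_add_right, LinearMap.add_apply])
    (fun r a b => by rw [map_smul, TensorProduct.map_smul_right, LinearMap.smul_apply])

theorem ofProduct_apply (μ : V →ₗ[K] V →ₗ[K] V) (a b : V) :
    ofProduct H μ a b = TensorProduct.map LinearMap.id (μ.flip b) (delta H a) := rfl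

variable {μ : V →ₗ[K] V →ₗ[K] V} {p q : ZMod 2} {a b : V}

theorem res_map_id {W : Type*} [AddCommGroup W] [Module K W] (g : V →ₗ[K] W)
    (x : PolyV K N Unit V) : res (TensorProduct.map LinearMap.id g x) = g (res x) := by
  induction x using TensorProduct.induction_on with
  | zero => simp
  | tmul b v => simp
  | add x y hx hy => simp only [map_add, hx, hy]

theorem res_ofProduct [CharZero K] (a b : V) : res (ofProduct H μ a b) = μ a b := by
  rw [ofProduct_apply, res_map_id, res_delta, LinearMap.flip_apply]

theorem dlamOp_ofProduct (a b : V) : dlamOp (ofProduct H μ a b) = 0 := by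
  have h : ∀ x : PolyV K N Unit V, dlamOp (TensorProduct.map LinearMap.id (μ.flip b) x) =
      TensorProduct.map LinearMap.id (μ.flip b) (dlamOp x) := by
    intro x
    induction x using TensorProduct.induction_on with
    | zero => simp
    | tmul b v => simp
    | add x y hx hy => simp only [map_add, hx, hy]
  rw [ofProduct_apply, h, dlamOp_delta, map_zero]

theorem ofProduct_mem_parity [CharZero K] (hμ : IsCommDer H μ) (ha : a ∈ H.parity p)
    (hb : b ∈ H.parity q) : ofProduct H μ a b ∈ PolyV.parity H Unit (p + q + N) := by
  rw [ofProduct_apply]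
  refine parity_induction (C := fun x => TensorProduct.map LinearMap.id (μ.flip b) x ∈
    PolyV.parity H Unit (p + q + N)) (by simp)
      (fun x y hx hy => by rw [map_add]; exact add_mem hx hy)
    (fun r s h c hc v hv => ?_) (delta_mem_parity ha)
  rw [TensorProduct.map_tmul]
  refine tmul_mem_parity H hc (hμ.mul_even s q v b hv hb) ?_
  rw [← add_assoc, h]
  abel

theorem ofProduct_S_left [CharZero K] (i : Fin N) (a b : V) : ofProduct H μ (H.S i a) b =
    -(ksign N • ((SuperPoly.th () i : SuperPoly K N Unit) • ofProduct H μ a b)) := by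
  rw [ofProduct_apply, ofProduct_apply, delta_S, map_neg, map_zsmul, map_id_smul]

theorem ofProduct_S_right [CharZero K] (hμ : IsCommDer H μ) (i : Fin N) (ha : a ∈ H.parity p)
    (b : V) : ofProduct H μ a (H.S i b) =
      ksign (p + N) • ((SuperPoly.th () i : SuperPoly K N Unit) • ofProduct H μ a b +
        oddOp (H.S i) (ofProduct H μ a b)) := by
  have key : TensorProduct.map LinearMap.id (μ.flip (H.S i b)) (delta H a) =
      ksign (p + N) • (oddOp (H.S i) (TensorProduct.map LinearMap.id (μ.flip b) (delta H a)) -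
        TensorProduct.map LinearMap.id (μ.flip b) (oddOp (H.S i) (delta H a))) := by
    refine parity_induction (C := fun x => TensorProduct.map LinearMap.id (μ.flip (H.S i b)) x =
      ksign (p + N) • (oddOp (H.S i) (TensorProduct.map LinearMap.id (μ.flip b) x) -
        TensorProduct.map LinearMap.id (μ.flip b) (oddOp (H.S i) x))) (by simp)
      (fun x y hx hy => ?_) (fun r s h c hc v hv => ?_) (delta_mem_parity ha)
    · simp only [map_add, hx, hy, smul_add, smul_sub]
      abel
    · have h1 : μ v (H.S i b) = ksign s • (H.S i (μ v b) - μ (H.S i v) b) := by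
        rw [hμ.S_mul i s v b hv, add_sub_cancel_left, smul_smul, ksign_mul_self, one_smul]
      rw [SuperPoly.mem_parity] at hc
      simp only [TensorProduct.map_tmul, oddOp_tmul, LinearMap.id_apply, LinearMap.flip_apply, hc,
        h1]
      have e : ∀ (m : ℤ) (w : V), (m • c) ⊗ₜ[K] w = m • c ⊗ₜ[K] w :=
        fun m w => map_zsmul ((TensorProduct.mk K (SuperPoly K N Unit) V).flip w) m c
      have e' : ∀ (m : ℤ) (w : V), c ⊗ₜ[K] (m • w) = m • c ⊗ₜ[K] w :=
        fun m w => map_zsmul (TensorProduct.mk K (SuperPoly K N Unit) V c) m w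
      have h2 : ∀ {M : Type _} [AddCommGroup M] (x y : M),
          ksign s • (x - y) = ksign (p + N) • (ksign r • x - ksign r • y) := by
        intro M _ x y
        rw [← smul_sub, ksign_smul_smul_add, ← h, add_comm r s, add_assoc, zmod_two_add_self,
          add_zero]
      rw [e, e, e', TensorProduct.tmul_sub]
      exact h2 _ _
  rw [ofProduct_apply, key, oddOp_delta, map_neg, map_id_smul, sub_neg_eq_add]
  exact congrArg _ (add_comm _ _)

theorem ofProduct_T (hμ : IsCommDer H μ) (a b : V) :
    ofProduct H μ (H.T a) b + ofProduct H μ a (H.T b) = evenOp H.T (ofProduct H μ a b) := by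
  rw [ofProduct_apply, ofProduct_apply, ofProduct_apply, delta_T]
  induction delta H a using TensorProduct.induction_on with
  | zero => simp
  | tmul c v => simp [hμ.T_mul, TensorProduct.tmul_add]
  | add x y hx hy =>
    simp only [map_add, ← hx, ← hy]
    abel

/-- Neither side contains `λ`, and on both sides the application of `S^i` to `b` amounts, up to the
same sign, to multiplication by `θ^i`. So it suffices to compare the residues. -/
theorem ofProduct_skew [CharZero K] (hμ : IsCommDer H μ) (ha : a ∈ H.parity p)
    (hb : b ∈ H.parity q) :
    ofProduct H μ b a = ksign (p * q + N) • (ofProduct H μ).evalNeg H a b := by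
  have hS : ∀ i v, (ofProduct H μ).evalNeg H a (H.S i v) =
      -(ksign (p + N) • ((SuperPoly.th () i : SuperPoly K N Unit) •
        (ofProduct H μ).evalNeg H a v)) := by
    intro i v
    rw [evalNeg_apply _ _ _ 1, evalNeg_apply _ _ _ 1, ofProduct_S_right hμ i ha, map_zsmul, map_add,
      embed_smul, embed_oddOp, SuperPoly.ren_th, Fin.sum_univ_two, add_smul, map_zsmul, neg_add,
      add_comm (-_) (-_), add_neg_cancel_left, map_neg, elim_smul_th_of_ne (by decide)]
    exact smul_neg _ _
  have h0 := eq_zero_of_res_family (H := H) (fun v => ofProduct H μ v a -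
      ksign N • (ofProduct H μ).evalNeg H a (H.signBy p v)) (fun q v hv => ?_)
      (fun i q v hv => ⟨-ksign N, ?_⟩) (fun q v hv => ?_) hb
  · rw [sub_eq_zero.1 h0, H.signBy_of_mem p q b hb, map_zsmul, ksign_smul_smul_add, add_comm]
  · rw [evalNeg_apply _ _ _ 1, map_sub, map_zsmul, dlamOp_ofProduct,
      dlamOp_elim_embed_self (dlamOp_ofProduct _ _), smul_zero, sub_zero]
  · rw [ofProduct_S_left, H.signBy_S, map_zsmul, hS, smul_sub, smul_comm (SuperPoly.th () i)]
    have key : ∀ {M : Type _} [AddCommGroup M] (x y : M), x - ksign N • y = (-ksign N) •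
        (-(ksign N • x) - ksign N • ksign p • -(ksign (p + N) • y)) := by
      intro M _ x y
      have h : ksign p * ksign (p + N) = ksign N := by
        rw [← ksign_add, ← add_assoc, zmod_two_add_self, zero_add]
      have h' := ksign_mul_self (N : ZMod 2)
      rw [smul_neg, smul_neg, smul_smul (ksign p), h, smul_smul (ksign N), h', one_smul, smul_sub,
        smul_neg, smul_neg, neg_smul, neg_smul, smul_smul, h', one_smul]
      abel
    exact key _ _
  · rw [evalNeg_apply _ _ _ 1, map_sub, map_zsmul, res_elim_embed_self 1 (dlamOp_ofProduct _ _),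
      res_ofProduct, res_ofProduct, smul_smul, ksign_mul_self, one_smul,
      H.signBy_of_mem p q v hv, map_zsmul, hμ.mul_comm p q a v ha hv, sub_self]

end LamBracket

open LamBracket

/-! ### The correspondence -/

/-- The properties of a `Λ`-bracket which involve neither `T` nor the Jacobi identity, with the sign
`ε` in the skew-symmetry: `ε` is `1` for the bracket of a SUSY Poisson vertex algebra and `-1` for
the bracket of its product. -/
structure IsSkewBracket (H : HWSupermodule K N V) (ε : ℤ) (B : LamBracket K N V) : Prop where
  parity : ∀ (p q : ZMod 2) (a b : V), a ∈ H.parity p → b ∈ H.parity q →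
    B a b ∈ PolyV.parity H Unit (p + q + N)
  S_left : ∀ (i : Fin N) (a b : V), B (H.S i a) b =
    -(ksign N • ((SuperPoly.th () i : SuperPoly K N Unit) • B a b))
  S_right : ∀ (i : Fin N) (p : ZMod 2) (a b : V), a ∈ H.parity p → B a (H.S i b) =
    ksign (p + N) • ((SuperPoly.th () i : SuperPoly K N Unit) • B a b + PolyV.oddOp (H.S i) (B a b))
  skew : ∀ (p q : ZMod 2) (a b : V), a ∈ H.parity p → b ∈ H.parity q →
    B b a = ε • -(ksign (p * q + N) • B.evalNeg H a b)

theorem isOddBracket_twisted_iff {ε : ℤ} {B : LamBracket K N V} :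
    IsOddBracket (H.shift (N + 1)) ε (twisted H B) ↔ IsSkewBracket H ε B := by
  constructor
  · intro h
    exact
    { parity := fun p q a b ha hb => (twisted_mem_parity_iff B ha).1
        (h.parity _ _ a b (HWSupermodule.mem_shift_add.2 ha) (HWSupermodule.mem_shift_add.2 hb))
      S_left := fun i => (twisted_S_left_iff B i).1 (h.S_left i)
      S_right := fun i p a b ha => (twisted_S_right_iff B i ha).1
        (h.S_right i _ a b (HWSupermodule.mem_shift_add.2 ha))
      skew := fun p q a b ha hb => (twisted_skew_iff B ε ha hb).1
        (h.skew _ _ b a (HWSupermodule.mem_shift_add.2 hb) (HWSupermodule.mem_shift_add.2 ha)) }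
  · intro h
    exact
    { parity := fun P Q a b ha hb => by
        obtain ⟨p, rfl⟩ := HWSupermodule.exists_eq_add (N + 1) P
        obtain ⟨q, rfl⟩ := HWSupermodule.exists_eq_add (N + 1) Q
        rw [HWSupermodule.mem_shift_add] at ha hb
        exact (twisted_mem_parity_iff B ha).2 (h.parity p q a b ha hb)
      S_left := fun i => (twisted_S_left_iff B i).2 (h.S_left i)
      S_right := fun i P a b ha => by
        obtain ⟨p, rfl⟩ := HWSupermodule.exists_eq_add (N + 1) P
        rw [HWSupermodule.mem_shift_add] at ha
        exact (twisted_S_right_iff B i ha).2 (h.S_right i p a b ha)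
      skew := fun P Q a b ha hb => by
        obtain ⟨p, rfl⟩ := HWSupermodule.exists_eq_add (N + 1) P
        obtain ⟨q, rfl⟩ := HWSupermodule.exists_eq_add (N + 1) Q
        rw [HWSupermodule.mem_shift_add] at ha hb
        exact (twisted_skew_iff B ε hb ha).2 (h.skew q p b a hb ha) }

theorem HWSupermodule.induction_homogeneous (H : HWSupermodule K N V) {C : V → Prop}
    (hom : ∀ p v, v ∈ H.parity p → C v) (add : ∀ v w, C v → C w → C (v + w)) (v : V) : C v := by
  obtain ⟨v₀, h₀, v₁, h₁, rfl⟩ := H.exists_parity_decomposition v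
  exact add _ _ (hom _ _ h₀) (hom _ _ h₁)

theorem PolyV.extend_add {κ : Type} (p : ZMod 2) (g h : V →ₗ[K] PolyV K N κ V)
    (x : PolyV K N κ V) :
    PolyV.extend p (g + h) x = PolyV.extend p g x + PolyV.extend p h x := by
  have : PolyV.extend p (g + h) = PolyV.extend p g + PolyV.extend p h :=
    TensorProduct.ext' fun a v => smul_add (SuperPoly.signBy p a) (g v) (h v)
  rw [this, LinearMap.add_apply]

namespace IsSUSYPVA

variable {B : LamBracket K N V} {μ : V →ₗ[K] V →ₗ[K] V}

theorem isCommDer (h : IsSUSYPVA H B μ) : IsCommDer H μ :=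
  ⟨h.mul_even, h.T_mul, h.S_mul, h.mul_comm⟩

theorem isSkewBracket (h : IsSUSYPVA H B μ) : IsSkewBracket H 1 B :=
  ⟨h.lieConformal.parity, h.lieConformal.S_left, h.lieConformal.S_right,
    fun p q a b ha hb => (h.lieConformal.skew p q a b ha hb).trans (one_smul _ _).symm⟩

end IsSUSYPVA

theorem isSkewBracket_ofProduct [CharZero K] {μ : V →ₗ[K] V →ₗ[K] V} (h : IsCommDer H μ) :
    IsSkewBracket H (-1) (ofProduct H μ) where
  parity _ _ _ _ ha hb := ofProduct_mem_parity h ha hb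
  S_left i a b := ofProduct_S_left i a b
  S_right i _ _ b ha := ofProduct_S_right h i ha b
  skew p q a b ha hb := by rw [ofProduct_skew h ha hb, neg_one_smul, neg_neg]

theorem isOddPair_twisted [CharZero K] {B : LamBracket K N V} {μ : V →ₗ[K] V →ₗ[K] V}
    (h : IsSUSYPVA H B μ) :
    IsOddPair (H.shift (N + 1)) (twisted H B) (twisted H (ofProduct H μ)) where
  fst := isOddBracket_twisted_iff.2 h.isSkewBracket
  snd := isOddBracket_twisted_iff.2 (isSkewBracket_ofProduct h.isCommDer)
  T_left := (twisted_T_left_iff B).2 h.lieConformal.T_left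
  T_right := (twisted_T_right_iff B).2 h.lieConformal.T_right
  dlam a b := dlamOp_ofProduct _ _
  T_add a b := by
    change ofProduct H μ (H.signBy (N + 1) (H.T a)) b + ofProduct H μ (H.signBy (N + 1) a) (H.T b) =
      evenOp H.T (ofProduct H μ (H.signBy (N + 1) a) b)
    rw [H.signBy_T_apply, ofProduct_T h.isCommDer]

/-- The residue of the second bracket is a commutative product on which `T` and the `S^i` act as
derivations. -/
theorem isCommDer_of_isOddPair [CharZero K] {D A : LamBracket K N V}
    (h : IsOddPair (H.shift (N + 1)) D (twisted H A)) : IsCommDer H (A.compr₂ res) := by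
  have hA := isOddBracket_twisted_iff.1 h.snd
  have hd : ∀ a b, dlamOp (A a b) = 0 := fun a b => by
    have := h.dlam (H.signBy (N + 1) a) b
    rwa [twisted, LinearMap.comp_apply, H.signBy_signBy] at this
  have hT : ∀ a b, A (H.T a) b + A a (H.T b) = evenOp H.T (A a b) := fun a b => by
    have := h.T_add (H.signBy (N + 1) a) b
    change A (H.signBy (N + 1) (H.T _)) b + A (H.signBy (N + 1) _) (H.T b) =
      evenOp H.T (A (H.signBy (N + 1) _) b) at this
    rwa [H.signBy_T_apply, H.signBy_signBy] at this
  refine ⟨fun p q a b ha hb => ?_, fun a b => ?_, fun i p a b ha => ?_, fun p q a b ha hb => ?_⟩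
  all_goals simp only [LinearMap.compr₂_apply]
  · have := res_mem_parity H (hA.parity p q a b ha hb)
    rwa [add_assoc, zmod_two_add_self, add_zero] at this
  · rw [← res_evenOp, ← hT, map_add]
  · have h1 := congrArg res (hA.S_left i a b)
    have h2 := congrArg res (hA.S_right i p a b ha)
    rw [map_neg, map_zsmul] at h1
    rw [map_zsmul, map_add, res_oddOp] at h2
    rw [h1, h2]
    have h3 := ksign_mul_self (N : ZMod 2)
    have h4 := ksign_mul_self p
    rw [smul_smul, ksign_add, ← mul_assoc, h4, one_mul, smul_add, smul_smul, h3, one_smul,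
      neg_add_cancel_left]
  · have h1 := hA.skew p q a b ha hb
    rw [neg_one_smul, neg_neg, evalNeg_apply _ _ _ 1] at h1
    rw [h1, map_zsmul, res_elim_embed_self 1 (hd a b), ksign_smul_smul_add, add_assoc,
      zmod_two_add_self, add_zero]

theorem bracketOf_eq_twisted (X : Op (H.shift (N + 1)) (Fin 2)) :
    bracketOf H X = twisted H (val X NQuiver.discrete) := rfl

theorem mulOf_eq_twisted (X : Op (H.shift (N + 1)) (Fin 2)) :
    mulOf H X = twisted H (resArrow X) := rfl

theorem isSUSYPVA_of_mem_oddMC [CharZero K] {X : Op (H.shift (N + 1)) (Fin 2)}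
    (hX : X ∈ oddMC (H.shift (N + 1))) : IsSUSYPVA H (bracketOf H X) (mulOf H X) := by
  obtain ⟨hX, hs, h0⟩ := hX
  have hP := isOddPair_val hX hs
  have hD : twisted H (bracketOf H X) = val X NQuiver.discrete := by
    rw [bracketOf_eq_twisted, twisted_twisted]
  have hM : twisted H (mulOf H X) = resArrow X := by
    rw [mulOf_eq_twisted, twisted_twisted]
  have hM' : IsCommDer H (mulOf H X) := isCommDer_of_isOddPair
    (A := twisted H (val X NQuiver.arrow)) (by rwa [twisted_twisted])
  have hB : IsSkewBracket H 1 (bracketOf H X) := isOddBracket_twisted_iff.1 (by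
    rw [hD]
    exact hP.fst)
  have sh : ∀ {p : ZMod 2} {v : V}, v ∈ H.parity p → v ∈ (H.shift (N + 1)).parity (p + (N + 1)) :=
    HWSupermodule.mem_shift_add.2
  have hassoc : ∀ p q r a b c, a ∈ H.parity p → b ∈ H.parity q → c ∈ H.parity r →
      mulOf H X (mulOf H X a b) c = mulOf H X a (mulOf H X b c) := by
    intro p q r a b c ha hb hc
    have h1 := res_resMid_selfSquare_path hX hs (sh ha) (sh hb) (sh hc)
    have h2 : selfSquare X = 0 := h0
    rw [h2, ← hM] at h1
    have h3 := (twisted_assoc_iff (mulOf H X) ha hc).1 (h1.symm.trans (by simp))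
    rw [hM'.mul_comm r (p + q) c _ hc (hM'.mul_even p q a b ha hb), h3, hM'.mul_comm q r b c hb hc,
      map_zsmul, ksign_smul_smul_add, ksign_smul_smul_add]
    have e : r * (p + q) + p * r + q * r = 0 := by
      clear ha hb hc h1 h3
      revert p q r
      decide
    rw [e, ksign_zero, one_smul]
  refine ⟨⟨hB.parity, ?_, ?_, hB.S_left, hB.S_right, fun p q a b ha hb => ?_,
    fun p q a b c ha hb => ?_⟩, hM'.mul_even, hM'.T_mul, hM'.S_mul, hM'.mul_comm, fun a b c => ?_,
    fun p q a b c ha hb => ?_⟩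
  · rw [← twisted_T_left_iff, hD]
    exact hP.T_left
  · rw [← twisted_T_right_iff, hD]
    exact hP.T_right
  · rw [hB.skew p q a b ha hb, one_smul]
  · induction c using H.induction_homogeneous with
    | hom r c hc =>
      refine (twisted_jacobi_iff _ ha hb (hB.parity p q a b ha hb)).1 ?_
      have h1 := elimLast_square_empty hX hs (sh ha) (sh hb) (sh hc)
      rw [hD, ← h1, h0]
      exact map_zero _
    | add c c' hc hc' =>
      rw [map_add, map_add, map_add, map_add, extend_add, map_add, hc, hc', smul_add, smul_add]
      abel
  · induction a using H.induction_homogeneous with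
    | hom p a ha =>
      induction b using H.induction_homogeneous with
      | hom q b hb =>
        induction c using H.induction_homogeneous with
        | hom r c hc => exact hassoc p q r a b c ha hb hc
        | add c c' hc hc' => simp only [map_add, hc, hc']
      | add b b' hb hb' => simp only [map_add, LinearMap.add_apply, hb, hb']
    | add a a' ha ha' => simp only [map_add, LinearMap.add_apply, ha, ha']
  · induction c using H.induction_homogeneous with
    | hom r c hc =>
      refine (twisted_leibniz_iff (q := r) _ _ hb ha (hB.parity p q a b ha hb)).1 ?_
      have h1 := resMid_selfSquare_edge hX hs (sh hb) (sh hc) (sh ha)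
      have h2 : selfSquare X = 0 := h0
      rw [hD, hM, ← h1, h2]
      exact map_zero _
    | add c c' hc hc' =>
      rw [map_add, map_add, map_add, map_add, TensorProduct.map_add_right, LinearMap.add_apply, hc,
        hc', map_add, smul_add]
      abel

/-- The bracket on the quiver `• → •` does not contain `λ`, and its products with the `θ^i` are
again values of it, so it is determined by its residues. -/
theorem injOn_bracketOf_mulOf [CharZero K] :
    Set.InjOn (fun X => (bracketOf H X, mulOf H X)) (oddMC (H.shift (N + 1))) := by
  rintro X ⟨hX, hXs, -⟩ Y ⟨hY, hYs, -⟩ h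
  obtain ⟨h1, h2⟩ := Prod.ext_iff.1 h
  have h1' : val X NQuiver.discrete = val Y NQuiver.discrete := by
    rw [← twisted_twisted (H := H) (val X NQuiver.discrete),
      ← twisted_twisted (H := H) (val Y NQuiver.discrete)]
    exact congrArg (twisted H) h1
  have h2' : resArrow X = resArrow Y := by
    rw [← twisted_twisted (H := H) (resArrow X), ← twisted_twisted (H := H) (resArrow Y)]
    exact congrArg (twisted H) h2
  refine ext_val hX hY h1' ?_
  refine HWSupermodule.ext_homogeneous (H.shift (N + 1)) (W := V →ₗ[K] PolyV K N Unit V)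
    (g := val Y NQuiver.arrow) fun p a ha => LinearMap.ext fun b => ?_
  refine sub_eq_zero.1 (eq_zero_of_res_family (H := H.shift (N + 1))
    (fun a => val X NQuiver.arrow a b - val Y NQuiver.arrow a b) (fun p a ha => ?_)
    (fun i p a ha => ⟨1, ?_⟩) (fun p a ha => ?_) ha)
  · rw [map_sub, dlamOp_val_arrow hX, dlamOp_val_arrow hY, sub_zero]
  · rw [val_S_left hX, val_S_left hY, one_smul, smul_sub]
  · have h3 : resArrow X a b = resArrow Y a b := by rw [h2']
    rw [map_sub, ← resArrow_apply, ← resArrow_apply, h3, sub_self]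

/-- The preimage of `(B, μ)` is the operation with the two brackets `B` and `ofProduct H μ`,
twisted by the sign `(-1)^{p(a)(N+1)}` of the parity shift. -/
theorem surjOn_bracketOf_mulOf [CharZero K] :
    Set.SurjOn (fun X => (bracketOf H X, mulOf H X)) (oddMC (H.shift (N + 1)))
      {P : LamBracket K N V × (V →ₗ[K] V →ₗ[K] V) | IsSUSYPVA H P.1 P.2} := by
  rintro ⟨B, μ⟩ (h : IsSUSYPVA H B μ)
  have hP := isOddPair_twisted h
  have hX := isPcl_ofPair hP
  have hs := perm_ofPair hP
  set X := ofPair (H.shift (N + 1)) (twisted H B) (twisted H (ofProduct H μ)) with hXdef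
  have hD : val X NQuiver.discrete = twisted H B := val_ofPair_discrete _ _
  have hA : val X NQuiver.arrow = twisted H (ofProduct H μ) := val_ofPair_arrow _ _
  have hM : resArrow X = twisted H μ := by
    refine LinearMap.ext fun a => LinearMap.ext fun b => ?_
    rw [resArrow_apply, hA]
    exact res_ofProduct (H := H) (μ := μ) (H.signBy (N + 1) a) b
  refine ⟨X, ⟨hX, hs, selfSquare_eq_zero hX hs ?_ (selfSquare_edge_eq_zero hX hs ?_)
    (selfSquare_path_eq_zero hX hs ?_)⟩, Prod.ext ?_ ?_⟩
  · refine ext_multilinear (H.shift (N + 1)) fun P v hv => elimLast_injective ?_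
    obtain ⟨p, hp⟩ := HWSupermodule.exists_eq_add (N + 1) (P 0)
    obtain ⟨q, hq⟩ := HWSupermodule.exists_eq_add (N + 1) (P 1)
    have ha := hv 0
    have hb := hv 1
    rw [hp] at ha
    rw [hq] at hb
    have ha' := HWSupermodule.mem_shift_add.1 ha
    have hb' := HWSupermodule.mem_shift_add.1 hb
    rw [eq_vecCons_three v]
    refine (elimLast_square_empty hX hs ha hb (hv 2)).trans ?_
    rw [hD, zero_apply, map_zero]
    exact (twisted_jacobi_iff B ha' hb' (h.lieConformal.parity p q _ _ ha' hb')).2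
      (h.lieConformal.jacobi p q _ _ _ ha' hb')
  · intro P Q R a b c ha hb hc
    obtain ⟨p, rfl⟩ := HWSupermodule.exists_eq_add (N + 1) P
    obtain ⟨q, rfl⟩ := HWSupermodule.exists_eq_add (N + 1) Q
    obtain ⟨r, rfl⟩ := HWSupermodule.exists_eq_add (N + 1) R
    rw [resMid_selfSquare_edge hX hs ha hb hc, hD, hM]
    rw [HWSupermodule.mem_shift_add] at ha hb hc
    exact (twisted_leibniz_iff B μ ha hc (h.lieConformal.parity r p c a hc ha)).2
      (h.leibniz r p c a b hc ha)
  · intro P Q R a b c ha hb hc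
    obtain ⟨p, rfl⟩ := HWSupermodule.exists_eq_add (N + 1) P
    obtain ⟨q, rfl⟩ := HWSupermodule.exists_eq_add (N + 1) Q
    obtain ⟨r, rfl⟩ := HWSupermodule.exists_eq_add (N + 1) R
    rw [res_resMid_selfSquare_path hX hs ha hb hc, hM]
    rw [HWSupermodule.mem_shift_add] at ha hb hc
    refine (twisted_assoc_iff μ ha hc).2 ?_
    rw [← h.mul_assoc, h.mul_comm p r a c ha hc, map_zsmul, LinearMap.smul_apply, h.mul_assoc]
  · change twisted H (val X NQuiver.discrete) = B
    rw [hD, twisted_twisted]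
  · change twisted H (resArrow X) = μ
    rw [hM, twisted_twisted]

end Operad

end SUSY

end

theorem theorem2 {K : Type*} [Field K] [CharZero K] (N : ℕ) {V : Type*} [AddCommGroup V] [Module K V]
    (H : SUSY.HWSupermodule K N V) :
    (∀ X ∈ SUSY.oddMC (H.shift (N + 1)),
      SUSY.IsSUSYPVA H (SUSY.bracketOf H X) (SUSY.mulOf H X)) ∧
    Set.BijOn (fun X => (SUSY.bracketOf H X, SUSY.mulOf H X))
      (SUSY.oddMC (H.shift (N + 1)))
      {P : SUSY.LamBracket K N V × (V →ₗ[K] V →ₗ[K] V) | SUSY.IsSUSYPVA H P.1 P.2} :=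
  ⟨fun _ hX => SUSY.isSUSYPVA_of_mem_oddMC hX, fun _ hX => SUSY.isSUSYPVA_of_mem_oddMC hX,
    SUSY.injOn_bracketOf_mulOf, SUSY.surjOn_bracketOf_mulOf⟩
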